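/- Let $F$ be a non-archimedean local field of characteristic $0$ with ring of integers $\mathfrak o$, maximal ideal $\mathfrak p$, uniformizer $\varpi$ and residue field of odd order $q$, with $|\varpi|=q^{-1}$. Let $\psi:F\to\mathbb C^\times$ be a non-trivial continuous unitary additive character, $c_\psi$ the largest integer $c$ with $\psi(\mathfrak p^{-c})=1$, $\boldsymbol\delta\in F$ an element of order $c_\psi$ and $\mathfrak d=\boldsymbol\delta\mathfrak o$. For $\phi$ in the space $\mathbb S(F)$ of locally constant compactly supported functions put $\hat\phi(x)=|\boldsymbol\delta|^{1/2}\int_F\phi(y)\psi(xy)\,dy$, where $\mathrm{Vol}(\mathfrak o)=1$, and let the Weil index $\alpha_\psi(a)$, $a\in F^\times$, be the constant with $$\int_F\phi(y)\psi(ay^2)\,dy=\alpha_\psi(a)|2a|^{-1/2}\int_F\hat\phi(y)\psi\left(-\tfrac{y^2}{4a}\right)dy\qquad(\phi\in\mathbb S(F)).$$ Let $\mathrm{Mp}_2(F)=\{[g,\zeta]\mid g\in \mathrm{SL}_2(F),\ \zeta\in\{\pm1\}\}$ be the metaplectic double cover, with product $[g_1,\zeta_1][g_2,\zeta_2]=[g_1g_2,\zeta_1\zeta_2\,\boldsymbol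 c(g_1,g_2)]$, where $\boldsymbol c(g_1,g_2)=\left(\frac{\boldsymbol b(g_1)}{\boldsymbol b(g_1g_2)},\frac{\boldsymbol b(g_2)}{\boldsymbol b(g_1g_2)}\right)$ is a quadratic Hilbert symbol and $\boldsymbol b(g)$, for $g$ with lower row $(c,d)$, is $c$ if $c\neq0$ and $d$ if $c=0$. Write $[g]=[g,1]$, and let $\mathbf m(a)=\left[\begin{pmatrix}a&0\\0&a^{-1}\end{pmatrix}\right]$. The Weil representation $\omega_\psi$ of $\mathrm{Mp}_2(F)$ on $\mathbb S(F)$ is the genuine representation with $$\omega_\psi\left(\left[\begin{pmatrix}1&b\\0&1\end{pmatrix}\right]\right)\phi(x)=\psi(bx^2)\phi(x),\qquad \omega_\psi(\mathbf m(a))\phi(x)=\tfrac{\alpha_\psi(1)}{\alpha_\psi(a)}|a|^{1/2}\phi(ax),$$ $$\omega_\psi\left(\left[\begin{pmatrix}0&-a^{-1}\\a&0\end{pmatrix}\right]\right)\phi(x)=\overline{\alpha_\psi(a)}\,|2a^{-1}|^{1/2}\hat\phi(-2a^{-1}x).$$ Let $\widetilde\Gamma_0(1)$ be the inverse image in $\mathrm{Mp}_2(F)$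 of $\Gamma_0(1)=\left\{\begin{pmatrix}a&b\\c&d\end{pmatrix}\in\mathrm{SL}_2(F)\,\middle|\,a,d\in\mathfrak o,\ b\in\mathfrak d^{-1},\ c\in\mathfrak d\right\}$, and let $\varepsilon$ be its genuine character with $\omega_\psi(\gamma)\phi_0=\varepsilon(\gamma)^{-1}\phi_0$, where $\phi_0$ is the characteristic function of $\mathfrak o$. Let $\widetilde{\mathcal H}=\widetilde{\mathcal H}(\widetilde\Gamma_0(1)\backslash\mathrm{Mp}_2(F)/\widetilde\Gamma_0(1);\varepsilon)$ be the space of compactly supported genuine functions $\varphi:\mathrm{Mp}_2(F)\to\mathbb C$ with $\varphi(\gamma_1g\gamma_2)=\varepsilon(\gamma_1\gamma_2)\varphi(g)$ for $\gamma_1,\gamma_2\in\widetilde\Gamma_0(1)$, with the convolution product $(\varphi_1*\varphi_2)(g)=\int\varphi_1(h)\varphi_2(h^{-1}g)\,dh$ for the Haar measure with $\mathrm{Vol}(\widetilde\Gamma_0(1))=1$. For $m\ge0$ let $\widetilde{\mathcal T}_m\in\widetilde{\mathcal H}$ be the function supported on $\widetilde\Gamma_0(1)\,\mathbf m(\varpi^m)\,\widetilde\Gamma_0(1)$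 with $$\widetilde{\mathcal T}_m(\gamma_1\mathbf m(\varpi^m)\gamma_2)=q^{-m/2}\,\varepsilon(\gamma_1)\frac{\alpha_\psi(\varpi^m)}{\alpha_\psi(1)}\varepsilon(\gamma_2)\qquad(\gamma_1,\gamma_2\in\widetilde\Gamma_0(1)).$$ Let $K'\subset\mathrm{PGL}_2(F)$ be the standard maximal compact open subgroup, the image of the matrices $\begin{pmatrix}a&b\\c&d\end{pmatrix}\in \mathrm{GL}_2(F)$ with determinant in $\mathfrak o^\times$ and $a,d\in\mathfrak o$, $b\in\mathfrak d^{-1}$, $c\in\mathfrak d$, and let $\mathcal H(K'\backslash\mathrm{PGL}_2(F)/K')$ be the space of compactly supported $K'$-bi-invariant functions $\mathrm{PGL}_2(F)\to\mathbb C$ with convolution for the Haar measure with $\mathrm{Vol}(K')=1$. Then both spaces are unital associative $\mathbb C$-algebras under convolution, and $$\widetilde{\mathcal T}_1^2=q+1+\widetilde{\mathcal T}_2,\qquad \widetilde{\mathcal T}_1*\widetilde{\mathcal T}_m=q\,\widetilde{\mathcal T}_{m-1}+\widetilde{\mathcal T}_{m+1}\quad(m\ge2).$$ The algebra $\widetilde{\mathcal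 H}$ is generated by $\widetilde{\mathcal T}_1$, and $\widetilde{\mathcal H}$ and $\mathcal H(K'\backslash\mathrm{PGL}_2(F)/K')$ are isomorphic as $\mathbb C$-algebras. -/

import Mathlib

open MeasureTheory ValuativeRel
open scoped MatrixGroups

noncomputable section

namespace KohnenHecke

/-! ## Convolution algebras of functions on a group -/

section Convolution

/-- The convolution `(φ₁ ∗ φ₂)(g) = ∫ φ₁(h) φ₂(h⁻¹ g) dμ(h)`. -/
def conv {G : Type*} [Mul G] [Inv G] [MeasurableSpace G] (μ : Measure G)
    (φ₁ φ₂ : G → ℂ) (g : G) : ℂ :=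
  ∫ h, φ₁ h * φ₂ (h⁻¹ * g) ∂μ

/-- The compactly supported functions `φ` with `φ(γ₁ g γ₂) = χ(γ₁γ₂) φ(g)` for `γ₁, γ₂ ∈ K`. -/
def heckeSpace {G : Type*} [Mul G] [TopologicalSpace G] (K : Set G) (χ : G → ℂ) :
    Submodule ℂ (G → ℂ) where
  carrier := {φ | HasCompactSupport φ ∧
    ∀ γ₁ ∈ K, ∀ γ₂ ∈ K, ∀ g, φ (γ₁ * g * γ₂) = χ (γ₁ * γ₂) * φ g}
  zero_mem' := ⟨HasCompactSupport.zero, by simp⟩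
  add_mem' := by
    rintro a b ⟨ha, ha'⟩ ⟨hb, hb'⟩
    exact ⟨ha.add hb, fun γ₁ h₁ γ₂ h₂ g => by
      simp only [Pi.add_apply, ha' γ₁ h₁ γ₂ h₂ g, hb' γ₁ h₁ γ₂ h₂ g, mul_add]⟩
  smul_mem' := by
    rintro c a ⟨ha, ha'⟩
    refine ⟨ha.comp_left (g := fun z => c * z) (mul_zero c), fun γ₁ h₁ γ₂ h₂ g => ?_⟩
    simp only [Pi.smul_apply, ha' γ₁ h₁ γ₂ h₂ g, smul_eq_mul]
    ring

/-- The space `H` of functions is closed under convolution with respect to `μ`, and convolution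
makes it an associative `ℂ`-algebra with unit `e`. -/
structure IsConvAlgebra {G : Type*} [Mul G] [Inv G] [MeasurableSpace G] (μ : Measure G)
    (H : Submodule ℂ (G → ℂ)) (e : G → ℂ) : Prop where
  one_mem : e ∈ H
  conv_mem : ∀ a ∈ H, ∀ b ∈ H, conv μ a b ∈ H
  one_conv : ∀ a ∈ H, conv μ e a = a
  conv_one : ∀ a ∈ H, conv μ a e = a
  conv_assoc : ∀ a ∈ H, ∀ b ∈ H, ∀ c ∈ H, conv μ (conv μ a b) c = conv μ a (conv μ b c)
  add_conv : ∀ a ∈ H, ∀ b ∈ H, ∀ c ∈ H, conv μ (a + b) c = conv μ a c + conv μ b c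
  conv_add : ∀ a ∈ H, ∀ b ∈ H, ∀ c ∈ H, conv μ a (b + c) = conv μ a b + conv μ a c
  smul_conv : ∀ (r : ℂ), ∀ a ∈ H, ∀ b ∈ H, conv μ (r • a) b = r • conv μ a b
  conv_smul : ∀ (r : ℂ), ∀ a ∈ H, ∀ b ∈ H, conv μ a (r • b) = r • conv μ a b

variable {G : Type*} [Mul G] [Inv G] [MeasurableSpace G] {μ : Measure G}
  {H : Submodule ℂ (G → ℂ)} {e : G → ℂ}

/-- The space `H`, regarded as the algebra whose product is convolution. -/
def IsConvAlgebra.Alg (_ : IsConvAlgebra μ H e) : Type _ := H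

instance IsConvAlgebra.instAddCommGroup (h : IsConvAlgebra μ H e) : AddCommGroup h.Alg :=
  inferInstanceAs (AddCommGroup H)

instance IsConvAlgebra.instModule (h : IsConvAlgebra μ H e) : Module ℂ h.Alg :=
  inferInstanceAs (Module ℂ H)

/-- The function underlying an element of the convolution algebra. -/
def IsConvAlgebra.toFun {h : IsConvAlgebra μ H e} (a : h.Alg) : G → ℂ := Subtype.val (p := (· ∈ H)) a

instance IsConvAlgebra.instRing (h : IsConvAlgebra μ H e) : Ring h.Alg :=
  { IsConvAlgebra.instAddCommGroup h with
    mul := fun a b => ⟨conv μ a.1 b.1, h.conv_mem _ a.2 _ b.2⟩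
    one := ⟨e, h.one_mem⟩
    one_mul := fun a => Subtype.ext (h.one_conv _ a.2)
    mul_one := fun a => Subtype.ext (h.conv_one _ a.2)
    mul_assoc := fun a b c => Subtype.ext (h.conv_assoc _ a.2 _ b.2 _ c.2)
    left_distrib := fun a b c => Subtype.ext (h.conv_add _ a.2 _ b.2 _ c.2)
    right_distrib := fun a b c => Subtype.ext (h.add_conv _ a.2 _ b.2 _ c.2)
    zero_mul := fun a => Subtype.ext (by
      have := h.smul_conv 0 0 H.zero_mem _ a.2
      rw [zero_smul, zero_smul] at this
      exact this)
    mul_zero := fun a => Subtype.ext (by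
      have := h.conv_smul 0 _ a.2 0 H.zero_mem
      rw [zero_smul, zero_smul] at this
      exact this) }

instance IsConvAlgebra.instAlgebra (h : IsConvAlgebra μ H e) : Algebra ℂ h.Alg :=
  Algebra.ofModule
    (fun r a b => Subtype.ext (h.smul_conv r _ a.2 _ b.2))
    (fun r a b => Subtype.ext (h.conv_smul r _ a.2 _ b.2))

end Convolution

/-! ## The local field, the additive character and the Weil index -/

section Field

variable (F : Type*) [Field F] [ValuativeRel F] [TopologicalSpace F] [IsNonarchimedeanLocalField F]

/-- The order `q` of the residue field. -/
def resCard : ℕ := Nat.card 𝓀[F]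

variable {F}

/-- The normalized absolute value: `|ϖ| = q⁻¹` for a uniformizer `ϖ`. -/
def absF (x : F) : ℝ := by
  classical
  exact if x = 0 then 0 else
    (resCard F : ℝ) ^
      (WithZero.log (IsNonarchimedeanLocalField.valueGroupWithZeroIsoInt F (valuation F x)))

/-- `c` is the index of `ψ`: the largest integer such that `ψ` is trivial on `𝔭^{-c}`. -/
def IsIndex (ψ : AddChar F Circle) (c : ℤ) : Prop :=
  IsGreatest {k : ℤ | ∀ x : F, absF x ≤ (resCard F : ℝ) ^ k → ψ x = 1} c

variable (F) in
/-- The ring of integers as a compact set with non-empty interior. -/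
def integerCompacts : TopologicalSpace.PositiveCompacts F where
  carrier := {x | valuation F x ≤ 1}
  isCompact' := IsNonarchimedeanLocalField.isCompact_closedBall F 1
  interior_nonempty' := by
    refine ⟨0, mem_interior_iff_mem_nhds.mpr ?_⟩
    rw [(IsValuativeTopology.hasBasis_nhds_zero' F).mem_iff]
    exact ⟨1, one_ne_zero, fun x hx => le_of_lt (Set.mem_ofPred_eq ▸ hx)⟩

variable [MeasurableSpace F] [BorelSpace F]

variable (F) in
/-- The Haar measure on `F` giving the ring of integers volume `1`. -/
def haarF : Measure F := Measure.addHaarMeasure (integerCompacts F)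

/-- Schwartz functions on `F`: locally constant with compact support. -/
def IsSchwartz (φ : F → ℂ) : Prop := IsLocallyConstant φ ∧ HasCompactSupport φ

/-- The Fourier transform `x ↦ |δ|^{1/2} ∫ φ(y) ψ(xy) dy`. -/
def fourier (ψ : AddChar F Circle) (δ : F) (φ : F → ℂ) (x : F) : ℂ :=
  (√(absF δ) : ℂ) * ∫ y, φ y * (ψ (x * y) : ℂ) ∂(haarF F)

/-- The Weil index `α_ψ(a)`: the constant with
`∫ φ(y) ψ(ay²) dy = α_ψ(a) |2a|^{-1/2} ∫ φ^(y) ψ(-y²/(4a)) dy` for all Schwartz functions `φ`. -/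
def weilIndex (ψ : AddChar F Circle) (δ a : F) : ℂ :=
  Classical.epsilon fun α : ℂ => ∀ φ : F → ℂ, IsSchwartz φ →
    ∫ y, φ y * (ψ (a * y ^ 2) : ℂ) ∂(haarF F) =
      α * ((√(absF (2 * a)))⁻¹ : ℝ) *
        ∫ y, fourier ψ δ φ y * (ψ (-(y ^ 2 / (4 * a))) : ℂ) ∂(haarF F)

end Field

/-! ## The metaplectic group -/

section Metaplectic

/-- The quadratic Hilbert symbol. -/
def hilbertSymbol {F : Type*} [Field F] (a b : F) : ℤˣ := by
  classical
  exact if ∃ x y z : F, (x ≠ 0 ∨ y ≠ 0 ∨ z ≠ 0) ∧ z ^ 2 = a * x ^ 2 + b * y ^ 2 then 1 else -1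

/-- `b(g) = c` if `c ≠ 0`, and `d` otherwise, where `(c, d)` is the lower row of `g`. -/
def bEntry {F : Type*} [Field F] (g : SL(2, F)) : F := by
  classical
  exact if g.1 1 0 ≠ 0 then g.1 1 0 else g.1 1 1

/-- The cocycle `c(g₁, g₂) = (b(g₁)/b(g₁g₂), b(g₂)/b(g₁g₂))`. -/
def cocycle {F : Type*} [Field F] (g₁ g₂ : SL(2, F)) : ℤˣ :=
  hilbertSymbol (bEntry g₁ / bEntry (g₁ * g₂)) (bEntry g₂ / bEntry (g₁ * g₂))

/-- The metaplectic group `Mp₂(F)`: pairs `[g, ζ]` with `g ∈ SL₂(F)` and `ζ ∈ {±1}`. -/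
@[ext] structure Mp2 (F : Type*) [Field F] where
  /-- the image in `SL₂(F)` -/
  g : SL(2, F)
  /-- the sign -/
  ζ : ℤˣ

namespace Mp2

variable {F : Type*} [Field F]

instance : Mul (Mp2 F) := ⟨fun x y => ⟨x.g * y.g, x.ζ * y.ζ * cocycle x.g y.g⟩⟩

instance : One (Mp2 F) := ⟨⟨1, 1⟩⟩

instance : Inv (Mp2 F) := ⟨fun x => ⟨x.g⁻¹, x.ζ * cocycle x.g x.g⁻¹⟩⟩

/-- The topology of `Mp₂(F)`. The section `h ↦ [h, 1]` is continuous on the big cell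
`{h ∈ SL₂(F) | c ≠ 0}`, and its left translates are the charts of `Mp₂(F)`: a set is open if and
only if its preimages under all of these charts are open. -/
instance [TopologicalSpace F] : TopologicalSpace (Mp2 F) :=
  ⨆ x : Mp2 F, TopologicalSpace.coinduced
    (fun h : {h : SL(2, F) // h.1 1 0 ≠ 0} => x * ⟨h.1, 1⟩) inferInstance

instance [TopologicalSpace F] : MeasurableSpace (Mp2 F) := borel _

instance [TopologicalSpace F] : BorelSpace (Mp2 F) := ⟨rfl⟩

end Mp2

/-- `m(a) = [diag(a, a⁻¹), 1]`. -/
def mElt {F : Type*} [Field F] (a : Fˣ) : Mp2 F :=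
  ⟨⟨!![(a : F), 0; 0, (a : F)⁻¹], by simp [Matrix.det_fin_two]⟩, 1⟩

end Metaplectic

/-! ## The Weil representation and the genuine Hecke algebra -/

section Genuine

variable {F : Type*} [Field F] [ValuativeRel F] [TopologicalSpace F] [IsNonarchimedeanLocalField F]
  [MeasurableSpace F] [BorelSpace F]

/-- The operator of `u♯(b) = [(1, b; 0, 1), 1]`. -/
def weilU (ψ : AddChar F Circle) (b : F) (φ : F → ℂ) (x : F) : ℂ := (ψ (b * x ^ 2) : ℂ) * φ x

/-- The operator of `m(a) = [diag(a, a⁻¹), 1]`. -/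
def weilM (ψ : AddChar F Circle) (δ a : F) (φ : F → ℂ) (x : F) : ℂ :=
  weilIndex ψ δ 1 / weilIndex ψ δ a * (√(absF a) : ℂ) * φ (a * x)

/-- The operator of `w_a = [(0, -a⁻¹; a, 0), 1]`. -/
def weilW (ψ : AddChar F Circle) (δ a : F) (φ : F → ℂ) (x : F) : ℂ :=
  (starRingEnd ℂ) (weilIndex ψ δ a) * (√(absF (2 * a⁻¹)) : ℂ) * fourier ψ δ φ (-(2 * a⁻¹ * x))

/-- The Weil representation of `Mp₂(F)`. For `g = (a, b; c, d)` one has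
`[g, ζ] = ζ · u♯(a/c) w_c u♯(d/c)` if `c ≠ 0`, and `[g, ζ] = ζ · u♯(ab) m(a)` if `c = 0`. -/
def weilRep (ψ : AddChar F Circle) (δ : F) (γ : Mp2 F) (φ : F → ℂ) : F → ℂ := by
  classical
  exact ((γ.ζ : ℤ) : ℂ) •
    if γ.g.1 1 0 ≠ 0 then
      weilU ψ (γ.g.1 0 0 / γ.g.1 1 0)
        (weilW ψ δ (γ.g.1 1 0) (weilU ψ (γ.g.1 1 1 / γ.g.1 1 0) φ))
    else weilU ψ (γ.g.1 0 0 * γ.g.1 0 1) (weilM ψ δ (γ.g.1 0 0) φ)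

variable (F) in
/-- The characteristic function of the ring of integers. -/
def phi0 : F → ℂ := Set.indicator {x | valuation F x ≤ 1} 1

/-- The inverse image in `Mp₂(F)` of
`Γ₀(1) = {(a, b; c, d) ∈ SL₂(F) | a, d ∈ 𝔬, b ∈ 𝔡⁻¹, c ∈ 𝔡}`, where `𝔡 = δ𝔬`. -/
def GammaTilde (δ : F) : Set (Mp2 F) :=
  {γ | absF (γ.g.1 0 0) ≤ 1 ∧ absF (γ.g.1 0 1) ≤ (absF δ)⁻¹ ∧
    absF (γ.g.1 1 0) ≤ absF δ ∧ absF (γ.g.1 1 1) ≤ 1}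

/-- The genuine character `ε` of the inverse image of `Γ₀(1)`, determined by
`ω_ψ(γ) φ₀ = ε(γ)⁻¹ φ₀`; as `φ₀(0) = 1`, it is read off at `0`. -/
def eps (ψ : AddChar F Circle) (δ : F) (γ : Mp2 F) : ℂ := (weilRep ψ δ γ (phi0 F) 0)⁻¹

/-- The genuine functions on `Mp₂(F)`: `φ([1, ζ] g) = ζ φ(g)`. -/
def genuineFunctions (F : Type*) [Field F] : Submodule ℂ (Mp2 F → ℂ) where
  carrier := {φ | ∀ (ζ : ℤˣ) (g : Mp2 F), φ (⟨1, ζ⟩ * g) = ((ζ : ℤ) : ℂ) * φ g}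
  zero_mem' := by simp
  add_mem' := by
    intro a b ha hb ζ g
    simp only [Pi.add_apply, ha ζ g, hb ζ g, mul_add]
  smul_mem' := by
    intro c a ha ζ g
    simp only [Pi.smul_apply, ha ζ g, smul_eq_mul]
    ring

/-- The genuine Hecke algebra of `Mp₂(F)` with respect to the inverse image of `Γ₀(1)` and `ε`, as
a space of functions. -/
def genuineHecke (ψ : AddChar F Circle) (δ : F) : Submodule ℂ (Mp2 F → ℂ) :=
  genuineFunctions F ⊓ heckeSpace (GammaTilde δ) (eps ψ δ)

/-- The unit of the genuine Hecke algebra: `ε` on the inverse image of `Γ₀(1)`, and `0`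
elsewhere. -/
def genuineUnit (ψ : AddChar F Circle) (δ : F) : Mp2 F → ℂ :=
  Set.indicator (GammaTilde δ) (eps ψ δ)

/-- The function `X` supported on `Γ̃₀(1) m(a) Γ̃₀(1)` with `X(γ₁ m(a) γ₂) = ε(γ₁) ε(m(a)) ε(γ₂)`,
where `ε(m(a)) = α_ψ(a)/α_ψ(1)`. -/
def charFun (ψ : AddChar F Circle) (δ : F) (a : Fˣ) (g : Mp2 F) : ℂ := by
  classical
  exact if h : ∃ γ : Mp2 F × Mp2 F,
      γ.1 ∈ GammaTilde δ ∧ γ.2 ∈ GammaTilde δ ∧ g = γ.1 * mElt a * γ.2 then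
    eps ψ δ h.choose.1 * (weilIndex ψ δ a / weilIndex ψ δ 1) * eps ψ δ h.choose.2
  else 0

/-- The Hecke operator `T̃_m = q^{-m/2} X_{m(ϖ^m)}`. -/
def Ttilde (ψ : AddChar F Circle) (δ : F) (ϖ : Fˣ) (m : ℕ) : Mp2 F → ℂ :=
  (((resCard F : ℝ) ^ (-(m : ℝ) / 2) : ℝ) : ℂ) • charFun ψ δ (ϖ ^ m)

end Genuine

/-! ## The spherical Hecke algebra of `PGL₂(F)` -/

section PGL

instance {F : Type*} [Field F] [TopologicalSpace F] : TopologicalSpace (PGL(2, F)) :=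
  inferInstanceAs (TopologicalSpace (GL (Fin 2) F ⧸ Subgroup.center (GL (Fin 2) F)))

instance {F : Type*} [Field F] [TopologicalSpace F] : MeasurableSpace (PGL(2, F)) := borel _

instance {F : Type*} [Field F] [TopologicalSpace F] : BorelSpace (PGL(2, F)) := ⟨rfl⟩

/-- The standard maximal compact open subgroup of `PGL₂(F)`: the image of the matrices
`(a, b; c, d)` with unit determinant and `a, d ∈ 𝔬`, `b ∈ 𝔡⁻¹`, `c ∈ 𝔡`, where `𝔡 = δ𝔬`. -/
def KPrime {F : Type*} [Field F] [ValuativeRel F] [TopologicalSpace F]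
    [IsNonarchimedeanLocalField F] (δ : F) : Set (PGL(2, F)) :=
  Matrix.ProjGenLinGroup.mk '' {g : GL (Fin 2) F |
    absF (g.1 0 0) ≤ 1 ∧ absF (g.1 0 1) ≤ (absF δ)⁻¹ ∧
    absF (g.1 1 0) ≤ absF δ ∧ absF (g.1 1 1) ≤ 1 ∧ absF g.1.det = 1}

/-- The spherical Hecke algebra of `PGL₂(F)`, as a space of functions. -/
def sphericalHecke {F : Type*} [Field F] [ValuativeRel F] [TopologicalSpace F]
    [IsNonarchimedeanLocalField F] (δ : F) : Submodule ℂ (PGL(2, F) → ℂ) :=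
  heckeSpace (KPrime δ) 1

/-- The unit of the spherical Hecke algebra: the characteristic function of `K'`. -/
def sphericalUnit {F : Type*} [Field F] [ValuativeRel F] [TopologicalSpace F]
    [IsNonarchimedeanLocalField F] (δ : F) : PGL(2, F) → ℂ :=
  Set.indicator (KPrime δ) 1

end PGL

end KohnenHecke

end

/-! Measure a matrix by the largest absolute value of its entries after conjugation by diag(δ, 1).
This size is submultiplicative and invariant under the maximal compact subgroup on both sides, and
by the Cartan decomposition a function in either Hecke algebra is determined by its values at one
point of each size. Filtered by the logarithm of the size (for `PGL(2, F)`, of size² / |det|), each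
algebra has graded pieces of dimension at most one, so an element of degree one whose products keep
a non-zero top value generates it freely (`IsConvAlgebra.aeval_bijective`). Both algebras are thus
polynomial rings in one variable, and hence isomorphic. On the `PGL(2, F)` side the top value is the
volume of a non-empty open set, and no exact product is needed.

On the metaplectic side the products are computed. The double coset of `m(ϖ)` consists of q² + q
left cosets (`exists_coset`, `coset_injective`), and the convolution is a sum over them. At `w_c`
with |c/δ| = qⁿ and n ≥ 1, exactly q² cosets contribute if m = n + 1, and they contribute equally;
one coset contributes if m = n - 1. If m = n there are q - 1 contributions, which differ by the
signs (s, ϖ) for s running over the non-zero residue classes, and a non-trivial character sums to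
zero (`heckeTerm_small`, `sum_heckeTerm_inl_zero`). So no multiple of T̃_m occurs. At n = 0 and m =
1 all q² + q cosets contribute q⁻¹, which gives q + 1.

The contributions agree because of the normalization by Weil indices. The Weil index is a normalized
Gauss integral γ (`weilIndex_eq`), and γ(x)γ(y) = (x, y)γ(xy) (`gaussFactor_mul`). Since q is odd,
Hensel's lemma gives the bimultiplicativity of the Hilbert symbol, and then every sign identity
becomes linear algebra over `ZMod 2`. In this way one gets the associativity of `Mp2 F`
(`cocycle_assoc`), the formula ε([g, ζ]) = ζ λ(g) with an explicit sign λ (`eps_eq`), and the fact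
that λ splits the cocycle over Γ₀(1) (`lam_mul`). -/

noncomputable section

namespace KohnenHecke

/-! ## The normalized absolute value -/

section AbsoluteValue

variable {F : Type*} [Field F] [ValuativeRel F] [TopologicalSpace F] [IsNonarchimedeanLocalField F]

variable (F) in
theorem one_lt_resCard : (1 : ℝ) < resCard F := by
  have : 1 < Nat.card 𝓀[F] := Finite.one_lt_card
  exact_mod_cast this

variable (F) in
theorem resCard_pos : (0 : ℝ) < resCard F := zero_lt_one.trans (one_lt_resCard F)

@[simp] theorem absF_zero : absF (0 : F) = 0 := by simp [absF]

theorem absF_of_ne_zero {x : F} (hx : x ≠ 0) : absF x = (resCard F : ℝ) ^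
    (WithZero.log (IsNonarchimedeanLocalField.valueGroupWithZeroIsoInt F (valuation F x))) := by
  simp [absF, hx]

theorem iso_valuation_ne_zero {x : F} (hx : x ≠ 0) :
    IsNonarchimedeanLocalField.valueGroupWithZeroIsoInt F (valuation F x) ≠ 0 := by
  simpa using hx

theorem absF_pos {x : F} (hx : x ≠ 0) : 0 < absF x := by
  rw [absF_of_ne_zero hx]
  exact zpow_pos (resCard_pos F) _

theorem absF_nonneg (x : F) : 0 ≤ absF x := by
  rcases eq_or_ne x 0 with rfl | hx
  · simp
  · exact (absF_pos hx).le

@[simp] theorem absF_eq_zero {x : F} : absF x = 0 ↔ x = 0 :=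
  ⟨fun h => by_contra fun hx => (absF_pos hx).ne' h, fun h => by simp [h]⟩

theorem absF_ne_zero {x : F} (hx : x ≠ 0) : absF x ≠ 0 := (absF_pos hx).ne'

theorem absF_le_absF {x y : F} : absF x ≤ absF y ↔ valuation F x ≤ valuation F y := by
  rcases eq_or_ne x 0 with rfl | hx
  · simp [absF_nonneg]
  rcases eq_or_ne y 0 with rfl | hy
  · simp only [absF_zero, map_zero, le_zero_iff, map_eq_zero, hx, iff_false, not_le]
    exact absF_pos hx
  rw [absF_of_ne_zero hx, absF_of_ne_zero hy, zpow_le_zpow_iff_right₀ (one_lt_resCard F),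
    WithZero.log_le_log (iso_valuation_ne_zero hx) (iso_valuation_ne_zero hy)]
  exact map_le_map_iff _

@[simp] theorem absF_one : absF (1 : F) = 1 := by
  rw [absF_of_ne_zero one_ne_zero]; simp

@[simp] theorem absF_mul (x y : F) : absF (x * y) = absF x * absF y := by
  rcases eq_or_ne x 0 with rfl | hx
  · simp
  rcases eq_or_ne y 0 with rfl | hy
  · simp
  rw [absF_of_ne_zero hx, absF_of_ne_zero hy, absF_of_ne_zero (mul_ne_zero hx hy), map_mul, map_mul,
    WithZero.log_mul (iso_valuation_ne_zero hx) (iso_valuation_ne_zero hy),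
    zpow_add₀ (resCard_pos F).ne']

variable (F) in
/-- The normalized absolute value as a homomorphism. -/
def absFHom : F →*₀ ℝ where
  toFun := absF
  map_zero' := absF_zero
  map_one' := absF_one
  map_mul' := absF_mul

@[simp] theorem absF_inv (x : F) : absF x⁻¹ = (absF x)⁻¹ := map_inv₀ (absFHom F) x

@[simp] theorem absF_div (x y : F) : absF (x / y) = absF x / absF y := map_div₀ (absFHom F) x y

@[simp] theorem absF_pow (x : F) (n : ℕ) : absF (x ^ n) = absF x ^ n := map_pow (absFHom F) x n

@[simp] theorem absF_zpow (x : F) (n : ℤ) : absF (x ^ n) = absF x ^ n := map_zpow₀ (absFHom F) x n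

@[simp] theorem absF_neg (x : F) : absF (-x) = absF x :=
  le_antisymm (absF_le_absF.2 (by rw [Valuation.map_neg])) (absF_le_absF.2 (by rw [Valuation.map_neg]))

theorem absF_add_le_max (x y : F) : absF (x + y) ≤ max (absF x) (absF y) := by
  rcases le_total (absF x) (absF y) with h | h
  · rw [max_eq_right h, absF_le_absF]
    exact (valuation F).map_add_le (absF_le_absF.1 h) le_rfl
  · rw [max_eq_left h, absF_le_absF]
    exact (valuation F).map_add_le le_rfl (absF_le_absF.1 h)

theorem absF_add_le {x y : F} {r : ℝ} (hx : absF x ≤ r) (hy : absF y ≤ r) : absF (x + y) ≤ r :=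
  (absF_add_le_max x y).trans (max_le hx hy)

theorem absF_sub_le {x y : F} {r : ℝ} (hx : absF x ≤ r) (hy : absF y ≤ r) : absF (x - y) ≤ r := by
  rw [sub_eq_add_neg]
  exact absF_add_le hx (by simpa using hy)

theorem absF_sub_comm (x y : F) : absF (x - y) = absF (y - x) := by
  rw [← absF_neg, neg_sub]

theorem absF_add_eq_left {x y : F} (h : absF y < absF x) : absF (x + y) = absF x := by
  refine le_antisymm (absF_add_le le_rfl h.le) ?_
  by_contra! h'
  have : absF (x + y - y) ≤ max (absF (x + y)) (absF y) := absF_sub_le (le_max_left _ _) (le_max_right _ _)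
  rw [add_sub_cancel_right] at this
  exact absurd this (not_le.2 (max_lt h' h))

theorem absF_add_eq_right {x y : F} (h : absF x < absF y) : absF (x + y) = absF y := by
  rw [add_comm, absF_add_eq_left h]

theorem absF_eq_of_sub_lt {x y : F} (h : absF (x - y) < absF y) : absF x = absF y := by
  have := absF_add_eq_left h
  rwa [add_sub_cancel] at this

theorem absF_le_one_iff {x : F} : absF x ≤ 1 ↔ valuation F x ≤ 1 := by
  rw [← absF_one (F := F), absF_le_absF, map_one]

theorem absF_lt_one_iff {x : F} : absF x < 1 ↔ valuation F x < 1 := by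
  rw [← absF_one (F := F), ← not_le, absF_le_absF, map_one, not_le]

theorem exists_absF_eq_zpow {x : F} (hx : x ≠ 0) : ∃ k : ℤ, absF x = (resCard F : ℝ) ^ k :=
  ⟨_, absF_of_ne_zero hx⟩

/-- The values are powers of q, so an open ball is the closed ball of the next smaller radius. -/
theorem absF_lt_zpow_iff {x : F} {k : ℤ} :
    absF x < (resCard F : ℝ) ^ k ↔ absF x ≤ (resCard F : ℝ) ^ (k - 1) := by
  rcases eq_or_ne x 0 with rfl | hx
  · simp only [absF_zero]
    exact ⟨fun _ => (zpow_pos (resCard_pos F) _).le, fun _ => zpow_pos (resCard_pos F) _⟩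
  · obtain ⟨j, hj⟩ := exists_absF_eq_zpow hx
    rw [hj, zpow_lt_zpow_iff_right₀ (one_lt_resCard F), zpow_le_zpow_iff_right₀ (one_lt_resCard F)]
    omega

theorem absF_lt_one_iff_le {x : F} : absF x < 1 ↔ absF x ≤ (resCard F : ℝ)⁻¹ := by
  have := absF_lt_zpow_iff (x := x) (k := 0)
  simpa using this

theorem exists_absF_le_zpow (x : F) : ∃ k : ℤ, absF x ≤ (resCard F : ℝ) ^ k := by
  rcases eq_or_ne x 0 with rfl | hx
  · exact ⟨0, by simp⟩
  · obtain ⟨k, hk⟩ := exists_absF_eq_zpow hx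
    exact ⟨k, hk.le⟩

/-! ### Topology -/

variable (F) in
/-- The closed ball of radius `q ^ n`. -/
def ball (n : ℤ) : Set F := {x | absF x ≤ (resCard F : ℝ) ^ n}

theorem mem_ball {n : ℤ} {x : F} : x ∈ ball F n ↔ absF x ≤ (resCard F : ℝ) ^ n := Iff.rfl

variable (F) in
theorem isCompact_absF_le (r : ℝ) (hr : ∃ y : F, absF y = r) : IsCompact {x : F | absF x ≤ r} := by
  obtain ⟨y, rfl⟩ := hr
  simpa only [absF_le_absF] using IsNonarchimedeanLocalField.isCompact_closedBall F (valuation F y)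

theorem mem_nhds_zero_of_absF_le {y : F} (hy : y ≠ 0) : {x : F | absF x ≤ absF y} ∈ nhds (0 : F) := by
  rw [(IsValuativeTopology.hasBasis_nhds_zero' F).mem_iff]
  refine ⟨valuation F y, by simpa using hy, fun x hx => ?_⟩
  exact absF_le_absF.2 (le_of_lt (by simpa using hx))

theorem isLocallyConstant_of_add {X : Type*} (f : F → X) (y : F) (hy : y ≠ 0)
    (h : ∀ x t, absF t ≤ absF y → f (x + t) = f x) : IsLocallyConstant f := by
  rw [IsLocallyConstant.iff_eventually_eq]
  intro x
  have := mem_nhds_zero_of_absF_le hy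
  have h2 : Filter.Tendsto (fun z => z - x) (nhds x) (nhds 0) := by
    have : Continuous fun z : F => z - x := by fun_prop
    simpa using this.tendsto x
  filter_upwards [h2 this] with z hz
  have := h x (z - x) hz
  rwa [add_sub_cancel] at this

theorem exists_ne_zero_of_mem_nhds {s : Set F} (hs : s ∈ nhds (0 : F)) :
    ∃ y : F, y ≠ 0 ∧ ∀ x, absF x ≤ absF y → x ∈ s := by
  obtain ⟨γ, hγ, h⟩ := (IsValuativeTopology.hasBasis_nhds_zero' F).mem_iff.1 hs
  obtain ⟨z, rfl⟩ := ValuativeRel.valuation_surjective γ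
  obtain ⟨r, hr0, hr⟩ := Valuation.IsNontrivial.exists_lt_one (v := valuation F)
  simp only [ne_eq, map_eq_zero] at hγ hr0
  -- The basic neighbourhoods are open balls; the factor r with |r| < 1 makes room for a closed one.
  refine ⟨z * r, mul_ne_zero hγ (by simpa using hr0), fun x hx => h ?_⟩
  rw [absF_le_absF, map_mul] at hx
  refine hx.trans_lt ?_
  have : 0 < valuation F z := by simpa [zero_lt_iff] using hγ
  calc _ < valuation F z * 1 := by gcongr
    _ = _ := mul_one _

theorem isLocallyConstant_absF_le {r : ℝ} (hr : ∃ y : F, y ≠ 0 ∧ absF y ≤ r) :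
    IsLocallyConstant fun x : F => absF x ≤ r := by
  obtain ⟨y, hy, hyr⟩ := hr
  refine isLocallyConstant_of_add _ y hy fun x t ht => propext ⟨fun h => ?_, fun h => ?_⟩
  · have := absF_sub_le h (ht.trans hyr)
    rwa [add_sub_cancel_right] at this
  · exact absF_add_le h (ht.trans hyr)

theorem isClopen_absF_le {r : ℝ} (hr : ∃ y : F, y ≠ 0 ∧ absF y ≤ r) :
    IsClopen {x : F | absF x ≤ r} := by
  have := (isLocallyConstant_absF_le hr).isClopen_fiber True
  simpa using this

theorem continuous_absF : Continuous (absF : F → ℝ) := by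
  rw [continuous_iff_continuousAt]
  intro x
  rcases eq_or_ne x 0 with rfl | hx
  · rw [ContinuousAt, absF_zero, Metric.tendsto_nhds]
    intro ε hε
    obtain ⟨r, hr0, hr⟩ := Valuation.IsNontrivial.exists_lt_one (v := valuation F)
    have hr0' : r ≠ 0 := by simpa using hr0
    obtain ⟨n, hn⟩ := exists_pow_lt_of_lt_one hε (absF_lt_one_iff.2 hr)
    filter_upwards [mem_nhds_zero_of_absF_le (pow_ne_zero n hr0')] with z hz
    rw [Real.dist_eq, sub_zero, abs_of_nonneg (absF_nonneg z)]
    exact lt_of_le_of_lt hz (by simpa using hn)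
  · have h0 : {t : F | absF t < absF x} ∈ nhds (0 : F) := by
      obtain ⟨r, hr0, hr⟩ := Valuation.IsNontrivial.exists_lt_one (v := valuation F)
      have hr0' : r ≠ 0 := by simpa using hr0
      filter_upwards [mem_nhds_zero_of_absF_le (mul_ne_zero hx hr0')] with z hz
      refine hz.trans_lt ?_
      rw [absF_mul]
      exact mul_lt_of_lt_one_right (absF_pos hx) (absF_lt_one_iff.2 hr)
    have h2 : Filter.Tendsto (fun z => z - x) (nhds x) (nhds 0) := by
      have : Continuous fun z : F => z - x := by fun_prop
      simpa using this.tendsto x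
    refine tendsto_nhds_of_eventually_eq ?_
    filter_upwards [h2 h0] with z hz using absF_eq_of_sub_lt hz

end AbsoluteValue

/-! ## The residue field -/

section Residue

variable {F : Type*} [Field F] [ValuativeRel F] [TopologicalSpace F] [IsNonarchimedeanLocalField F]

/-- The reduction of `x` modulo the maximal ideal, with value `0` if `x` is not integral. -/
def red (x : F) : 𝓀[F] := by
  classical
  exact if h : absF x ≤ 1 then IsLocalRing.residue 𝒪[F] ⟨x, absF_le_one_iff.1 h⟩ else 0

theorem red_of_le {x : F} (h : absF x ≤ 1) :
    red x = IsLocalRing.residue 𝒪[F] ⟨x, absF_le_one_iff.1 h⟩ := by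
  simp [red, h]

theorem red_add {x y : F} (hx : absF x ≤ 1) (hy : absF y ≤ 1) : red (x + y) = red x + red y := by
  rw [red_of_le hx, red_of_le hy, red_of_le (absF_add_le hx hy), ← map_add]
  rfl

theorem absF_mul_le_one {x y : F} (hx : absF x ≤ 1) (hy : absF y ≤ 1) : absF (x * y) ≤ 1 := by
  rw [absF_mul]; exact mul_le_one₀ hx (absF_nonneg y) hy

theorem red_mul {x y : F} (hx : absF x ≤ 1) (hy : absF y ≤ 1) : red (x * y) = red x * red y := by
  rw [red_of_le hx, red_of_le hy, red_of_le (absF_mul_le_one hx hy), ← map_mul]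
  rfl

theorem isUnit_integer_iff {x : 𝒪[F]} : IsUnit x ↔ absF (x : F) = 1 := by
  constructor
  · rintro ⟨u, rfl⟩
    have h1 := absF_le_one_iff.2 (u : 𝒪[F]).2
    have h2 := absF_le_one_iff.2 ((u⁻¹ : 𝒪[F]ˣ) : 𝒪[F]).2
    have h3 : absF (((u : 𝒪[F]) : F) * (((u⁻¹ : 𝒪[F]ˣ) : 𝒪[F]) : F)) = 1 := by
      have : (((u * u⁻¹ : 𝒪[F]ˣ) : 𝒪[F]) : F) = 1 := by simp
      rw [← absF_one (F := F), ← this]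
      rfl
    rw [absF_mul] at h3
    refine le_antisymm h1 ?_
    rw [← h3]
    exact mul_le_of_le_one_right (absF_nonneg _) h2
  · intro h
    have h0 : (x : F) ≠ 0 := by intro h0; simp [h0] at h
    refine isUnit_iff_exists_inv.2 ⟨⟨(x : F)⁻¹, absF_le_one_iff.1 (by simp [h])⟩, ?_⟩
    ext
    simp [h0]

theorem red_eq_zero_iff {x : F} (hx : absF x ≤ 1) : red x = 0 ↔ absF x < 1 := by
  rw [red_of_le hx, IsLocalRing.residue_eq_zero_iff, IsLocalRing.mem_maximalIdeal, mem_nonunits_iff,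
    isUnit_integer_iff, lt_iff_le_and_ne]
  simp [hx]

theorem red_neg {x : F} (hx : absF x ≤ 1) : red (-x) = -red x := by
  rw [red_of_le hx, red_of_le (by simpa using hx), ← map_neg]
  rfl

theorem red_sub {x y : F} (hx : absF x ≤ 1) (hy : absF y ≤ 1) : red (x - y) = red x - red y := by
  rw [sub_eq_add_neg, red_add hx (by simpa using hy), red_neg hy, sub_eq_add_neg]

@[simp] theorem red_zero : red (0 : F) = 0 := by
  rw [red_eq_zero_iff] <;> simp

@[simp] theorem red_one : red (1 : F) = 1 := by
  rw [red_of_le (by simp)]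
  exact map_one _

theorem red_eq_red_iff {x y : F} (hx : absF x ≤ 1) (hy : absF y ≤ 1) :
    red x = red y ↔ absF (x - y) < 1 := by
  rw [← red_eq_zero_iff (absF_sub_le hx hy), red_sub hx hy, sub_eq_zero]

theorem red_pow {x : F} (hx : absF x ≤ 1) (n : ℕ) : red (x ^ n) = red x ^ n := by
  induction n with
  | zero => simp
  | succ n ih => rw [pow_succ, red_mul (by simpa using pow_le_one₀ (absF_nonneg x) hx) hx, ih, pow_succ]

theorem exists_red_eq (r : 𝓀[F]) : ∃ x : F, absF x ≤ 1 ∧ red x = r := by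
  obtain ⟨x, rfl⟩ := IsLocalRing.residue_surjective r
  exact ⟨x, absF_le_one_iff.2 x.2, red_of_le (absF_le_one_iff.2 x.2)⟩

/-- A section of the reduction map which maps `0` to `0`. -/
def sec (r : 𝓀[F]) : F := by
  classical
  -- The class of zero must be represented by zero itself: it then labels the central ball when
  -- balls are split, and the coset with trivial translation later.
  exact if r = 0 then 0 else (exists_red_eq r).choose

@[simp] theorem sec_zero : sec (0 : 𝓀[F]) = 0 := by simp [sec]

theorem absF_sec_le (r : 𝓀[F]) : absF (sec r) ≤ 1 := by
  rw [sec]; split_ifs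
  · simp
  · exact (exists_red_eq r).choose_spec.1

@[simp] theorem red_sec (r : 𝓀[F]) : red (sec r) = r := by
  rw [sec]; split_ifs with h
  · simp [h]
  · exact (exists_red_eq r).choose_spec.2

theorem absF_eq_one_iff {x : F} (hx : absF x ≤ 1) : absF x = 1 ↔ red x ≠ 0 := by
  rw [ne_eq, red_eq_zero_iff hx, not_lt]
  exact ⟨fun h => h.ge, fun h => le_antisymm hx h⟩

theorem absF_sec {r : 𝓀[F]} (hr : r ≠ 0) : absF (sec r) = 1 := by
  rw [absF_eq_one_iff (absF_sec_le r)]; simpa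

theorem absF_sub_sec {x : F} {r : 𝓀[F]} (hx : absF x ≤ 1) : absF (x - sec r) < 1 ↔ red x = r := by
  rw [← red_eq_red_iff hx (absF_sec_le r), red_sec]

theorem ringChar_residue_ne_two (hq : Odd (resCard F)) : ringChar 𝓀[F] ≠ 2 := by
  have := Fintype.ofFinite 𝓀[F]
  intro h
  have h2 := FiniteField.even_card_iff_char_two.1 h
  rw [resCard, Nat.card_eq_fintype_card, Nat.odd_iff] at hq
  omega

theorem residue_two_ne_zero (hq : Odd (resCard F)) : (2 : 𝓀[F]) ≠ 0 :=
  Ring.two_ne_zero (ringChar_residue_ne_two hq)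

theorem red_two : red (2 : F) = 2 := by
  rw [← one_add_one_eq_two, red_add (by simp) (by simp), red_one, one_add_one_eq_two]

theorem absF_two (hq : Odd (resCard F)) : absF (2 : F) = 1 := by
  have h : absF (2 : F) ≤ 1 := by
    rw [← one_add_one_eq_two]; exact absF_add_le (by simp) (by simp)
  rw [absF_eq_one_iff h, red_two]
  exact residue_two_ne_zero hq

theorem two_ne_zero_of_odd (hq : Odd (resCard F)) : (2 : F) ≠ 0 := by
  intro h
  have := absF_two hq
  simp [h] at this

/-- Instance search finds the Henselian property once F carries the uniform structure of its
additive group, which is given here only as a topology. -/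
theorem henselianRing_integer : HenselianRing 𝒪[F] 𝓂[F] := by
  let := IsTopologicalAddGroup.rightUniformSpace F
  have := isUniformAddGroup_of_addCommGroup (G := F)
  infer_instance

open Polynomial in
/-- Hensel's lemma for square roots of units. -/
theorem isSquare_of_isSquare_red (hq : Odd (resCard F)) {u : F} (hu : absF u = 1)
    (h : IsSquare (red u)) : IsSquare u := by
  obtain ⟨r, hr⟩ := h
  have hr0 : r ≠ 0 := by
    rintro rfl
    have := (absF_eq_one_iff hu.le).1 hu
    simp [hr] at this
  have := henselianRing_integer (F := F)
  let u' : 𝒪[F] := ⟨u, absF_le_one_iff.1 hu.le⟩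
  let s : 𝒪[F] := ⟨sec r, absF_le_one_iff.1 (absF_sec_le r)⟩
  have hmon : (X ^ 2 - C u' : 𝒪[F][X]).Monic := monic_X_pow_sub_C u' two_ne_zero
  -- At the lift s of r the value of X² - u lies in the maximal ideal, and the derivative 2s is a
  -- unit because q is odd and r ≠ 0.
  obtain ⟨a, ha, -⟩ := HenselianRing.is_henselian (I := 𝓂[F]) (X ^ 2 - C u') hmon s (by
    rw [← IsLocalRing.residue_eq_zero_iff]
    simp only [eval_sub, eval_pow, eval_X, eval_C, map_sub, map_pow]
    have h1 : IsLocalRing.residue 𝒪[F] s = r := by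
      rw [← red_of_le (absF_sec_le r), red_sec]
    have h2 : IsLocalRing.residue 𝒪[F] u' = r * r := by
      rw [← hr, red_of_le hu.le]
    rw [h1, h2]; ring) (by
    refine IsUnit.map _ ?_
    simp only [derivative_sub, derivative_X_pow, derivative_C, sub_zero, eval_mul, eval_C, eval_pow, eval_X]
    rw [isUnit_integer_iff]
    have : absF (s : F) = 1 := absF_sec hr0
    have h2 : absF (((2 : 𝒪[F])) : F) = 1 := absF_two hq
    simp [h2, this])
  refine ⟨a, ?_⟩
  have : a ^ 2 - u' = 0 := by simpa [IsRoot] using ha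
  have h3 := congrArg (Subtype.val) this
  simp only [AddSubgroupClass.coe_sub, SubmonoidClass.coe_pow, ZeroMemClass.coe_zero] at h3
  rw [← sq]
  exact (sub_eq_zero.1 h3).symm

theorem isSquare_iff_red (hq : Odd (resCard F)) {u : F} (hu : absF u = 1) :
    IsSquare u ↔ IsSquare (red u) := by
  refine ⟨?_, isSquare_of_isSquare_red hq hu⟩
  rintro ⟨r, rfl⟩
  have : absF r = 1 := by
    rw [absF_mul] at hu
    nlinarith [absF_nonneg r]
  exact ⟨red r, red_mul this.le this.le⟩

end Residue

/-! ## The quadratic Hilbert symbol -/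

section HilbertGeneral

variable {F : Type*} [Field F]

theorem hilbertSymbol_eq_one_iff {a b : F} : hilbertSymbol a b = 1 ↔
    ∃ x y z : F, (x ≠ 0 ∨ y ≠ 0 ∨ z ≠ 0) ∧ z ^ 2 = a * x ^ 2 + b * y ^ 2 := by
  classical
  unfold hilbertSymbol
  split_ifs with h
  · simp only [h]
  · simp only [h, iff_false]
    decide

theorem hilbertSymbol_congr {a b c d : F} (h : hilbertSymbol a b = 1 ↔ hilbertSymbol c d = 1) :
    hilbertSymbol a b = hilbertSymbol c d := by
  rcases Int.units_eq_one_or (hilbertSymbol a b) with h1 | h1 <;>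
  rcases Int.units_eq_one_or (hilbertSymbol c d) with h2 | h2 <;> simp_all

theorem hilbertSymbol_comm (a b : F) : hilbertSymbol a b = hilbertSymbol b a := by
  refine hilbertSymbol_congr ?_
  simp only [hilbertSymbol_eq_one_iff]
  constructor <;>
  · rintro ⟨x, y, z, h0, h⟩
    exact ⟨y, x, z, by tauto, by rw [h, add_comm]⟩

theorem hilbertSymbol_mul_sq (a b : F) {s : F} (hs : s ≠ 0) :
    hilbertSymbol a (b * s ^ 2) = hilbertSymbol a b := by
  refine hilbertSymbol_congr ?_
  simp only [hilbertSymbol_eq_one_iff]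
  constructor
  · rintro ⟨x, y, z, h0, h⟩
    exact ⟨x, s * y, z, by simpa [hs] using h0, by rw [h]; ring⟩
  · rintro ⟨x, y, z, h0, h⟩
    exact ⟨x, s⁻¹ * y, z, by simpa [hs] using h0, by rw [h]; field_simp⟩

theorem hilbertSymbol_sq_mul (a b : F) {s : F} (hs : s ≠ 0) :
    hilbertSymbol (a * s ^ 2) b = hilbertSymbol a b := by
  rw [hilbertSymbol_comm, hilbertSymbol_mul_sq _ _ hs, hilbertSymbol_comm]

theorem hilbertSymbol_of_isSquare (a : F) {b : F} (h : IsSquare b) : hilbertSymbol b a = 1 := by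
  obtain ⟨s, rfl⟩ := h
  rw [hilbertSymbol_eq_one_iff]
  exact ⟨1, 0, s, by simp, by ring⟩

@[simp] theorem hilbertSymbol_one_left (a : F) : hilbertSymbol 1 a = 1 :=
  hilbertSymbol_of_isSquare a ⟨1, by simp⟩

@[simp] theorem hilbertSymbol_one_right (a : F) : hilbertSymbol a 1 = 1 := by
  rw [hilbertSymbol_comm, hilbertSymbol_one_left]

theorem hilbertSymbol_of_add_eq_sq {a b s : F} (h : a + b = s ^ 2) : hilbertSymbol a b = 1 := by
  rw [hilbertSymbol_eq_one_iff]
  exact ⟨1, 1, s, by simp, by rw [← h]; ring⟩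

theorem hilbertSymbol_neg_self (a : F) : hilbertSymbol a (-a) = 1 :=
  hilbertSymbol_of_add_eq_sq (s := 0) (by simp)

/-- Multiplying z² = ax² + by² by a and solving for (ax)² exchanges the roles of x and z. This
replaces bimultiplicativity combined with (a, -a) = 1 at a stage where bimultiplicativity is not yet
known. -/
theorem hilbertSymbol_eq_neg_mul {a : F} (ha : a ≠ 0) (b : F) :
    hilbertSymbol a b = hilbertSymbol a (-(a * b)) := by
  refine hilbertSymbol_congr ?_
  simp only [hilbertSymbol_eq_one_iff]
  constructor
  · rintro ⟨x, y, z, h0, h⟩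
    exact ⟨z, y, a * x, by simp only [ne_eq, mul_eq_zero, ha, false_or]; tauto,
      by linear_combination -a * h⟩
  · rintro ⟨x, y, z, h0, h⟩
    refine ⟨z / a, y, x, by simp only [ne_eq, div_eq_zero_iff, ha, or_false]; tauto, ?_⟩
    field_simp
    linear_combination -h

end HilbertGeneral

/-! ### The Hilbert symbol in odd residue characteristic. -/

section HilbertLocal

variable {F : Type*} [Field F] [ValuativeRel F] [TopologicalSpace F] [IsNonarchimedeanLocalField F]

variable (F) in
theorem resCard_ne_zero : resCard F ≠ 0 := by
  have := resCard_pos F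
  rintro h
  simp [h] at this

theorem absF_pow_le_one {x : F} (hx : absF x ≤ 1) (n : ℕ) : absF (x ^ n) ≤ 1 := by
  rw [absF_pow]; exact pow_le_one₀ (absF_nonneg x) hx

variable (F) in
theorem exists_uniformizer : ∃ ϖ : F, absF ϖ = (resCard F : ℝ)⁻¹ := by
  obtain ⟨x, hx⟩ := ValuativeRel.valuation_surjective
    ((IsNonarchimedeanLocalField.valueGroupWithZeroIsoInt F).symm (WithZero.exp (-1)))
  have h0 : x ≠ 0 := by
    rintro rfl
    rw [map_zero] at hx
    have := congrArg (IsNonarchimedeanLocalField.valueGroupWithZeroIsoInt F) hx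
    simp [WithZero.exp_ne_zero.symm] at this
  refine ⟨x, ?_⟩
  rw [absF_of_ne_zero h0, hx]
  simp

theorem uniformizer_ne_zero {ϖ : F} (hϖ : absF ϖ = (resCard F : ℝ)⁻¹) : ϖ ≠ 0 := by
  rintro rfl
  have := resCard_pos F
  simp at hϖ
  linarith

/-- Up to squares, a non-zero element is a unit or a unit times a uniformizer. -/
theorem exists_eq_unit_mul_sq {ϖ : F} (hϖ : absF ϖ = (resCard F : ℝ)⁻¹) {x : F} (hx : x ≠ 0) :
    ∃ u s : F, absF u = 1 ∧ s ≠ 0 ∧ (x = u * s ^ 2 ∨ x = ϖ * u * s ^ 2) := by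
  have hϖ0 := uniformizer_ne_zero hϖ
  have hq := (resCard_pos F).ne'
  obtain ⟨k, hk⟩ := exists_absF_eq_zpow hx
  obtain ⟨j, rfl | rfl⟩ := Int.even_or_odd' k
  · refine ⟨x * (ϖ ^ j) ^ 2, ϖ ^ (-j), ?_, zpow_ne_zero _ hϖ0, Or.inl ?_⟩
    · rw [absF_mul, absF_pow, absF_zpow, hk, hϖ, inv_zpow, ← zpow_neg, ← zpow_natCast, ← zpow_mul,
        ← zpow_add₀ hq]
      convert zpow_zero _ using 2
      push_cast; ring
    · rw [zpow_neg]
      field_simp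
  · refine ⟨x * ϖ * (ϖ ^ j) ^ 2, ϖ ^ (-(j + 1)), ?_, zpow_ne_zero _ hϖ0, Or.inr ?_⟩
    · rw [absF_mul, absF_mul, absF_pow, absF_zpow, hk, hϖ, inv_zpow, ← zpow_neg, ← zpow_natCast,
        ← zpow_mul, ← zpow_neg_one, ← zpow_add₀ hq, ← zpow_add₀ hq]
      convert zpow_zero _ using 2
      push_cast; ring
    · rw [zpow_neg, zpow_add_one₀ hϖ0]
      field_simp

/-- The exponents of q on the two sides have different parity. -/
theorem absF_sq_ne {x y : F} (hx : x ≠ 0) (hy : y ≠ 0) :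
    absF x ^ 2 ≠ (resCard F : ℝ)⁻¹ * absF y ^ 2 := by
  obtain ⟨k, hk⟩ := exists_absF_eq_zpow hx
  obtain ⟨j, hj⟩ := exists_absF_eq_zpow hy
  rw [hk, hj, ← zpow_natCast, ← zpow_natCast, ← zpow_mul, ← zpow_mul, ← zpow_neg_one,
    ← zpow_add₀ (resCard_pos F).ne']
  intro h
  have := zpow_right_injective₀ (resCard_pos F) (one_lt_resCard F).ne' h
  push_cast at this
  omega

/-- By counting values, ua² + vb² = 1 is solvable over a finite field of odd order. At lifts of a
and b the left side is congruent to 1, hence a square by Hensel's lemma. -/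
theorem hilbertSymbol_units (hq : Odd (resCard F)) {u v : F} (hu : absF u = 1) (hv : absF v = 1) :
    hilbertSymbol u v = 1 := by
  have := Fintype.ofFinite 𝓀[F]
  open Polynomial in
  obtain ⟨a, b, hab⟩ := FiniteField.exists_root_sum_quadratic
    (f := C (red u) * X ^ 2) (g := C (red v) * X ^ 2 - C 1)
    (degree_C_mul_X_pow 2 ((absF_eq_one_iff hu.le).1 hu))
    (by
      rw [degree_sub_eq_left_of_degree_lt]
      · exact degree_C_mul_X_pow 2 ((absF_eq_one_iff hv.le).1 hv)
      · rw [degree_C_mul_X_pow 2 ((absF_eq_one_iff hv.le).1 hv)]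
        exact degree_C_le.trans_lt (by norm_num))
    (by rw [resCard, Nat.card_eq_fintype_card, Nat.odd_iff] at hq; exact hq)
  simp only [Polynomial.eval_sub, Polynomial.eval_mul, Polynomial.eval_C, Polynomial.eval_pow,
    Polynomial.eval_X] at hab
  have ha := absF_sec_le a
  have hb := absF_sec_le b
  have ha2 : absF (sec a ^ 2) ≤ 1 := absF_pow_le_one ha 2
  have hb2 : absF (sec b ^ 2) ≤ 1 := absF_pow_le_one hb 2
  have h1 := absF_mul_le_one hu.le ha2
  have h2 := absF_mul_le_one hv.le hb2
  have ht : absF (u * sec a ^ 2 + v * sec b ^ 2) ≤ 1 := absF_add_le h1 h2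
  have hr : red (u * sec a ^ 2 + v * sec b ^ 2) = 1 := by
    rw [red_add h1 h2, red_mul hu.le ha2, red_mul hv.le hb2, red_pow ha, red_pow hb, red_sec, red_sec]
    linear_combination hab
  have ht1 : absF (u * sec a ^ 2 + v * sec b ^ 2) = 1 := by
    rw [absF_eq_one_iff ht, hr]; exact one_ne_zero
  obtain ⟨z, hz⟩ := isSquare_of_isSquare_red hq ht1 (by rw [hr]; exact ⟨1, by simp⟩)
  rw [hilbertSymbol_eq_one_iff]
  refine ⟨sec a, sec b, z, ?_, by rw [hz]; ring⟩
  right; right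
  rintro rfl
  simp [hz] at ht1

/-- In z² - ux² = ϖy² with y ≠ 0 the right side has odd valuation. If |z| ≠ |x|, the left side has
even valuation. So |z| = |x|, cancellation must occur, and u ≡ (z/x)² modulo the maximal ideal;
Hensel's lemma applies. -/
theorem hilbertSymbol_unit_uniformizer (hq : Odd (resCard F)) {u ϖ : F} (hu : absF u = 1)
    (hϖ : absF ϖ = (resCard F : ℝ)⁻¹) : hilbertSymbol u ϖ = 1 ↔ IsSquare u := by
  refine ⟨fun h => ?_, fun h => hilbertSymbol_of_isSquare _ h⟩
  obtain ⟨x, y, z, h0, h⟩ := hilbertSymbol_eq_one_iff.1 h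
  have hϖ0 := uniformizer_ne_zero hϖ
  have hu0 : u ≠ 0 := by rintro rfl; simp at hu
  by_cases hy : y = 0
  · have hx : x ≠ 0 := by
      rintro rfl
      simp [hy] at h h0
      exact h0 h
    exact ⟨z / x, by field_simp; rw [h, hy]; ring⟩
  have h1 : z ^ 2 + -(u * x ^ 2) = ϖ * y ^ 2 := by rw [h]; ring
  have h2 : absF (z ^ 2 + -(u * x ^ 2)) = (resCard F : ℝ)⁻¹ * absF y ^ 2 := by
    rw [h1]; simp [hϖ]
  have hux : absF (-(u * x ^ 2)) = absF x ^ 2 := by simp [hu]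
  have hy2 : 0 < (resCard F : ℝ)⁻¹ * absF y ^ 2 := by
    have := absF_pos hy
    have := resCard_pos F
    positivity
  rcases lt_trichotomy (absF z) (absF x) with hlt | heq | hlt
  · rw [absF_add_eq_right (by rw [hux, absF_pow]; exact pow_lt_pow_left₀ hlt (absF_nonneg _) two_ne_zero),
      hux] at h2
    have hx : x ≠ 0 := by rintro rfl; simp [hy, resCard_ne_zero] at h2
    exact absurd h2 (absF_sq_ne hx hy)
  · have hx : x ≠ 0 := by
      rintro rfl
      rw [absF_zero, absF_eq_zero] at heq
      simp [heq, hy, resCard_ne_zero] at h2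
    have hle : absF (z ^ 2 + -(u * x ^ 2)) ≤ absF x ^ 2 := absF_add_le (by simp [heq]) hux.le
    have hlt : absF (z ^ 2 + -(u * x ^ 2)) < absF x ^ 2 := lt_of_le_of_ne hle
      (by rw [h2]; exact (absF_sq_ne hx hy).symm)
    have hzx : absF (z / x) ≤ 1 := by rw [absF_div, heq, div_self (absF_ne_zero hx)]
    have hlt2 : absF ((z / x) ^ 2 - u) < 1 := by
      have : (z / x) ^ 2 - u = (z ^ 2 + -(u * x ^ 2)) / x ^ 2 := by field_simp; ring
      rw [this, absF_div, absF_pow, div_lt_one (by have := absF_pos hx; positivity)]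
      exact hlt
    rw [← red_eq_red_iff (absF_pow_le_one hzx 2) hu.le, red_pow hzx] at hlt2
    exact isSquare_of_isSquare_red hq hu ⟨red (z / x), by rw [← hlt2, sq]⟩
  · rw [absF_add_eq_left (by rw [hux, absF_pow]; exact pow_lt_pow_left₀ hlt (absF_nonneg _) two_ne_zero),
      absF_pow] at h2
    have hz : z ≠ 0 := by rintro rfl; simp [hy, resCard_ne_zero] at h2
    exact absurd h2 (absF_sq_ne hz hy)

theorem hilbertSymbol_unit_uniformizer_eq_quadraticChar (hq : Odd (resCard F)) [Fintype 𝓀[F]]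
    [DecidableEq 𝓀[F]] {u ϖ : F} (hu : absF u = 1) (hϖ : absF ϖ = (resCard F : ℝ)⁻¹) :
    ((hilbertSymbol u ϖ : ℤˣ) : ℤ) = quadraticChar 𝓀[F] (red u) := by
  have h0 := (absF_eq_one_iff hu.le).1 hu
  have h := hilbertSymbol_unit_uniformizer hq hu hϖ
  rw [isSquare_iff_red hq hu] at h
  by_cases hs : IsSquare (red u)
  · rw [h.2 hs, (quadraticChar_one_iff_isSquare h0).2 hs]; rfl
  · rw [quadraticChar_neg_one_iff_not_isSquare.2 hs]
    rcases Int.units_eq_one_or (hilbertSymbol u ϖ) with h1 | h1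
    · exact absurd (h.1 h1) hs
    · rw [h1]; rfl

theorem hilbertSymbol_unit_mul_uniformizer (hq : Odd (resCard F)) {u v ϖ : F} (hu : absF u = 1)
    (hv : absF v = 1) (hϖ : absF ϖ = (resCard F : ℝ)⁻¹) :
    hilbertSymbol (u * v) ϖ = hilbertSymbol u ϖ * hilbertSymbol v ϖ := by
  classical
  have := Fintype.ofFinite 𝓀[F]
  apply Units.ext
  rw [Units.val_mul, hilbertSymbol_unit_uniformizer_eq_quadraticChar hq hu hϖ,
    hilbertSymbol_unit_uniformizer_eq_quadraticChar hq hv hϖ,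
    hilbertSymbol_unit_uniformizer_eq_quadraticChar hq (by simp [hu, hv]) hϖ, red_mul hu.le hv.le, map_mul]

theorem hilbertSymbol_unit_uniformizer_mul (hq : Odd (resCard F)) {u v ϖ : F} (hu : absF u = 1)
    (hv : absF v = 1) (hϖ : absF ϖ = (resCard F : ℝ)⁻¹) :
    hilbertSymbol u (ϖ * v) = hilbertSymbol u ϖ :=
  hilbertSymbol_congr (by
    rw [hilbertSymbol_unit_uniformizer hq hu hϖ,
      hilbertSymbol_unit_uniformizer hq hu (by simp [hv, hϖ])])

theorem hilbertSymbol_uniformizers (hq : Odd (resCard F)) {u v ϖ : F} (hu : absF u = 1)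
    (hv : absF v = 1) (hϖ : absF ϖ = (resCard F : ℝ)⁻¹) :
    hilbertSymbol (ϖ * u) (ϖ * v) = hilbertSymbol (-u * v) ϖ := by
  have hϖ0 := uniformizer_ne_zero hϖ
  have hu0 : u ≠ 0 := by rintro rfl; simp at hu
  rw [hilbertSymbol_eq_neg_mul (mul_ne_zero hϖ0 hu0),
    show -(ϖ * u * (ϖ * v)) = -u * v * ϖ ^ 2 by ring, hilbertSymbol_mul_sq _ _ hϖ0, hilbertSymbol_comm,
    hilbertSymbol_unit_uniformizer_mul hq (by simp [hu, hv]) hu hϖ]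

/-- The Hilbert symbol is multiplicative in each variable. -/
theorem hilbertSymbol_mul_right (hq : Odd (resCard F)) {a b c : F} (ha : a ≠ 0) (hb : b ≠ 0)
    (hc : c ≠ 0) : hilbertSymbol a (b * c) = hilbertSymbol a b * hilbertSymbol a c := by
  obtain ⟨ϖ, hϖ⟩ := exists_uniformizer F
  have hϖ0 := uniformizer_ne_zero hϖ
  obtain ⟨u, s, hu, hs, h1⟩ := exists_eq_unit_mul_sq hϖ ha
  obtain ⟨v, t, hv, ht, h2⟩ := exists_eq_unit_mul_sq hϖ hb
  obtain ⟨w, r, hw, hr, h3⟩ := exists_eq_unit_mul_sq hϖ hc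
  have hvw : absF (v * w) = 1 := by simp [hv, hw]
  have hneg : ∀ x : F, absF x = 1 → absF (-u * x) = 1 := fun x hx => by simp [hu, hx]
  have comm := hilbertSymbol_comm (F := F)
  have hu0 : u ≠ 0 := by rintro rfl; simp at hu
  -- Up to squares each argument is a unit or a uniformizer times a unit. In all eight cases the
  -- claim reduces to u ↦ (u, ϖ) on units, which is multiplicative since it is the quadratic
  -- character of the residue field.
  rcases h1 with rfl | rfl <;> rcases h2 with rfl | rfl <;> rcases h3 with rfl | rfl <;>
    simp only [hilbertSymbol_sq_mul _ _ hs, hilbertSymbol_mul_sq _ _ ht, hilbertSymbol_mul_sq _ _ hr]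
  · rw [show v * t ^ 2 * (w * r ^ 2) = v * w * (t * r) ^ 2 by ring,
      hilbertSymbol_mul_sq _ _ (mul_ne_zero ht hr), hilbertSymbol_units hq hu hvw,
      hilbertSymbol_units hq hu hv, hilbertSymbol_units hq hu hw, mul_one]
  · rw [show v * t ^ 2 * (ϖ * w * r ^ 2) = ϖ * (v * w) * (t * r) ^ 2 by ring,
      hilbertSymbol_mul_sq _ _ (mul_ne_zero ht hr), hilbertSymbol_unit_uniformizer_mul hq hu hvw hϖ,
      hilbertSymbol_units hq hu hv, hilbertSymbol_unit_uniformizer_mul hq hu hw hϖ, one_mul]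
  · rw [show ϖ * v * t ^ 2 * (w * r ^ 2) = ϖ * (v * w) * (t * r) ^ 2 by ring,
      hilbertSymbol_mul_sq _ _ (mul_ne_zero ht hr), hilbertSymbol_unit_uniformizer_mul hq hu hvw hϖ,
      hilbertSymbol_units hq hu hw, hilbertSymbol_unit_uniformizer_mul hq hu hv hϖ, mul_one]
  · rw [show ϖ * v * t ^ 2 * (ϖ * w * r ^ 2) = v * w * (ϖ * t * r) ^ 2 by ring,
      hilbertSymbol_mul_sq _ _ (mul_ne_zero (mul_ne_zero hϖ0 ht) hr), hilbertSymbol_units hq hu hvw,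
      hilbertSymbol_unit_uniformizer_mul hq hu hv hϖ, hilbertSymbol_unit_uniformizer_mul hq hu hw hϖ,
      Int.units_mul_self]
  · rw [show v * t ^ 2 * (w * r ^ 2) = v * w * (t * r) ^ 2 by ring,
      hilbertSymbol_mul_sq _ _ (mul_ne_zero ht hr), comm _ (v * w), comm _ v, comm _ w,
      hilbertSymbol_unit_uniformizer_mul hq hvw hu hϖ, hilbertSymbol_unit_uniformizer_mul hq hv hu hϖ,
      hilbertSymbol_unit_uniformizer_mul hq hw hu hϖ, hilbertSymbol_unit_mul_uniformizer hq hv hw hϖ]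
  · rw [show v * t ^ 2 * (ϖ * w * r ^ 2) = ϖ * (v * w) * (t * r) ^ 2 by ring,
      hilbertSymbol_mul_sq _ _ (mul_ne_zero ht hr), hilbertSymbol_uniformizers hq hu hvw hϖ,
      hilbertSymbol_uniformizers hq hu hw hϖ, comm _ v,
      hilbertSymbol_unit_uniformizer_mul hq hv hu hϖ, show -u * (v * w) = v * (-u * w) by ring,
      hilbertSymbol_unit_mul_uniformizer hq hv (hneg w hw) hϖ]
  · rw [show ϖ * v * t ^ 2 * (w * r ^ 2) = ϖ * (v * w) * (t * r) ^ 2 by ring,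
      hilbertSymbol_mul_sq _ _ (mul_ne_zero ht hr), hilbertSymbol_uniformizers hq hu hvw hϖ,
      hilbertSymbol_uniformizers hq hu hv hϖ, comm _ w,
      hilbertSymbol_unit_uniformizer_mul hq hw hu hϖ, show -u * (v * w) = (-u * v) * w by ring,
      hilbertSymbol_unit_mul_uniformizer hq (hneg v hv) hw hϖ]
  · rw [show ϖ * v * t ^ 2 * (ϖ * w * r ^ 2) = v * w * (ϖ * t * r) ^ 2 by ring,
      hilbertSymbol_mul_sq _ _ (mul_ne_zero (mul_ne_zero hϖ0 ht) hr),
      hilbertSymbol_uniformizers hq hu hv hϖ, hilbertSymbol_uniformizers hq hu hw hϖ,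
      ← hilbertSymbol_unit_mul_uniformizer hq (hneg v hv) (hneg w hw) hϖ,
      show -u * v * (-u * w) = (v * w) * u ^ 2 by ring, hilbertSymbol_sq_mul _ _ hu0, comm,
      hilbertSymbol_unit_uniformizer_mul hq hvw hu hϖ]

theorem hilbertSymbol_mul_left (hq : Odd (resCard F)) {a b c : F} (ha : a ≠ 0) (hb : b ≠ 0)
    (hc : c ≠ 0) : hilbertSymbol (a * b) c = hilbertSymbol a c * hilbertSymbol b c := by
  rw [hilbertSymbol_comm, hilbertSymbol_mul_right hq hc ha hb, hilbertSymbol_comm a,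
    hilbertSymbol_comm b]

end HilbertLocal

/-! ## The Hilbert symbol written additively -/

/-- The isomorphism of `{±1}` with `ZMod 2`. -/
def signBit (u : ℤˣ) : ZMod 2 := if u = 1 then 0 else 1

theorem signBit_mul (u v : ℤˣ) : signBit (u * v) = signBit u + signBit v := by
  revert u v; unfold signBit; decide

theorem signBit_injective : Function.Injective signBit := by
  intro u v; revert u v; unfold signBit; decide

@[simp] theorem signBit_one : signBit 1 = 0 := by simp [signBit]

theorem signBit_eq_zero_iff {u : ℤˣ} : signBit u = 0 ↔ u = 1 := by
  rw [← signBit_one, signBit_injective.eq_iff]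

/-- The Hilbert symbol on `Fˣ`, with values in `ZMod 2`. -/
def hs {F : Type*} [Field F] (a b : Fˣ) : ZMod 2 := signBit (hilbertSymbol (a : F) b)

/-- The character `a ↦ (-1, a)`. -/
def hsNeg {F : Type*} [Field F] (a : Fˣ) : ZMod 2 := hs (-1) a

section HilbertBitGeneral

variable {F : Type*} [Field F]

theorem hs_comm (a b : Fˣ) : hs a b = hs b a := by
  rw [hs, hilbertSymbol_comm, hs]

theorem hs_one_left (a : Fˣ) : hs 1 a = 0 := by simp [hs]

theorem hs_one_right (a : Fˣ) : hs a 1 = 0 := by simp [hs]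

theorem hsNeg_one : hsNeg (1 : Fˣ) = 0 := hs_one_right _

end HilbertBitGeneral

section HilbertBit

variable {F : Type*} [Field F] [ValuativeRel F] [TopologicalSpace F] [IsNonarchimedeanLocalField F]
  [hq : Fact (Odd (resCard F))]

theorem hs_mul_left (a b c : Fˣ) : hs (a * b) c = hs a c + hs b c := by
  rw [hs, Units.val_mul, hilbertSymbol_mul_left hq.out a.ne_zero b.ne_zero c.ne_zero, signBit_mul, hs, hs]

theorem hs_mul_right (a b c : Fˣ) : hs a (b * c) = hs a b + hs a c := by
  rw [hs_comm, hs_mul_left, hs_comm b, hs_comm c]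

theorem hs_inv_left (a b : Fˣ) : hs a⁻¹ b = hs a b := by
  have h := hs_mul_left a a⁻¹ b
  rw [mul_inv_cancel, hs_one_left] at h
  grind

theorem hs_inv_right (a b : Fˣ) : hs a b⁻¹ = hs a b := by
  rw [hs_comm, hs_inv_left, hs_comm]

theorem hs_div_left (a b c : Fˣ) : hs (a / b) c = hs a c + hs b c := by
  rw [div_eq_mul_inv, hs_mul_left, hs_inv_left]

theorem hs_div_right (a b c : Fˣ) : hs a (b / c) = hs a b + hs a c := by
  rw [div_eq_mul_inv, hs_mul_right, hs_inv_right]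

theorem hs_pow_left (a b : Fˣ) (n : ℕ) : hs (a ^ n) b = n * hs a b := by
  induction n with
  | zero => simp [hs_one_left]
  | succ n ih => rw [pow_succ, hs_mul_left, ih]; push_cast; ring

theorem hs_pow_right (a b : Fˣ) (n : ℕ) : hs a (b ^ n) = n * hs a b := by
  rw [hs_comm, hs_pow_left, hs_comm]

theorem hs_units {u v : Fˣ} (hu : absF (u : F) = 1) (hv : absF (v : F) = 1) : hs u v = 0 := by
  rw [hs, hilbertSymbol_units hq.out hu hv, signBit_one]

theorem hs_neg_left (a b : Fˣ) : hs (-a) b = hsNeg b + hs a b := by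
  rw [← neg_one_mul, hs_mul_left, hsNeg]

theorem hs_neg_right (a b : Fˣ) : hs a (-b) = hsNeg a + hs a b := by
  rw [hs_comm, hs_neg_left, hs_comm b]

theorem hs_self (a : Fˣ) : hs a a = hsNeg a := by
  have h : hs a (-a) = 0 := by
    rw [hs, Units.val_neg, hilbertSymbol_neg_self, signBit_one]
  rw [hs_neg_right] at h
  grind

theorem hsNeg_mul (a b : Fˣ) : hsNeg (a * b) = hsNeg a + hsNeg b := hs_mul_right _ _ _

theorem hsNeg_inv (a : Fˣ) : hsNeg a⁻¹ = hsNeg a := hs_inv_right _ _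

theorem hsNeg_div (a b : Fˣ) : hsNeg (a / b) = hsNeg a + hsNeg b := hs_div_right _ _ _

theorem hsNeg_pow (a : Fˣ) (n : ℕ) : hsNeg (a ^ n) = n * hsNeg a := hs_pow_right _ _ _

theorem hsNeg_unit {u : Fˣ} (hu : absF (u : F) = 1) : hsNeg u = 0 := hs_units (by simp) hu

theorem hsNeg_neg (a : Fˣ) : hsNeg (-a) = hsNeg a := by
  rw [← neg_one_mul, hsNeg_mul, hsNeg_unit (by simp), zero_add]

end HilbertBit

/-! ## The cocycle identity -/

section Cocycle

variable {F : Type*} [Field F]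

theorem bEntry_ne_zero (g : SL(2, F)) : bEntry g ≠ 0 := by
  have h := g.2
  rw [Matrix.det_fin_two] at h
  unfold bEntry
  split_ifs with h0
  · exact h0
  · push Not at h0
    intro h1
    simp [h0, h1] at h

/-- The entry `b(g)` as a unit. -/
def bu (g : SL(2, F)) : Fˣ := Units.mk0 (bEntry g) (bEntry_ne_zero g)

@[simp] theorem val_bu (g : SL(2, F)) : (bu g : F) = bEntry g := rfl

theorem bEntry_of_ne_zero {g : SL(2, F)} (h : g.1 1 0 ≠ 0) : bEntry g = g.1 1 0 := by
  simp [bEntry, h]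

theorem bEntry_of_eq_zero {g : SL(2, F)} (h : g.1 1 0 = 0) : bEntry g = g.1 1 1 := by
  simp [bEntry, h]

theorem SL2_mul_10 (g h : SL(2, F)) : (g * h).1 1 0 = g.1 1 0 * h.1 0 0 + g.1 1 1 * h.1 1 0 := by
  simp [Matrix.mul_apply, Fin.sum_univ_two]

theorem SL2_mul_11 (g h : SL(2, F)) : (g * h).1 1 1 = g.1 1 0 * h.1 0 1 + g.1 1 1 * h.1 1 1 := by
  simp [Matrix.mul_apply, Fin.sum_univ_two]

theorem SL2_mul_00 (g h : SL(2, F)) : (g * h).1 0 0 = g.1 0 0 * h.1 0 0 + g.1 0 1 * h.1 1 0 := by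
  simp [Matrix.mul_apply, Fin.sum_univ_two]

theorem SL2_mul_01 (g h : SL(2, F)) : (g * h).1 0 1 = g.1 0 0 * h.1 0 1 + g.1 0 1 * h.1 1 1 := by
  simp [Matrix.mul_apply, Fin.sum_univ_two]

theorem SL2_det (g : SL(2, F)) : g.1 0 0 * g.1 1 1 - g.1 0 1 * g.1 1 0 = 1 := by
  have h := g.2
  rwa [Matrix.det_fin_two] at h

theorem SL2_inv_10 (g : SL(2, F)) : (g⁻¹).1 1 0 = -g.1 1 0 := by
  simp [Matrix.SpecialLinearGroup.coe_inv, Matrix.adjugate_fin_two]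

theorem SL2_inv_11 (g : SL(2, F)) : (g⁻¹).1 1 1 = g.1 0 0 := by
  simp [Matrix.SpecialLinearGroup.coe_inv, Matrix.adjugate_fin_two]

theorem SL2_inv_00 (g : SL(2, F)) : (g⁻¹).1 0 0 = g.1 1 1 := by
  simp [Matrix.SpecialLinearGroup.coe_inv, Matrix.adjugate_fin_two]

theorem SL2_inv_01 (g : SL(2, F)) : (g⁻¹).1 0 1 = -g.1 0 1 := by
  simp [Matrix.SpecialLinearGroup.coe_inv, Matrix.adjugate_fin_two]

theorem bu_mul_of_left {g : SL(2, F)} (hg : g.1 1 0 = 0) (h : SL(2, F)) : bu (g * h) = bu g * bu h := by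
  ext
  have hd : g.1 1 1 ≠ 0 := by
    rw [← bEntry_of_eq_zero hg]; exact bEntry_ne_zero g
  simp only [val_bu, Units.val_mul, bEntry_of_eq_zero hg]
  by_cases h0 : h.1 1 0 = 0
  · rw [bEntry_of_eq_zero h0, bEntry_of_eq_zero (by simp [SL2_mul_10, hg, h0]), SL2_mul_11, hg, zero_mul,
      zero_add]
  · rw [bEntry_of_ne_zero h0, bEntry_of_ne_zero (by simp [SL2_mul_10, hg, h0, hd]), SL2_mul_10, hg,
      zero_mul, zero_add]

/-- For h = (a, b; 0, d), a non-zero entry c of g becomes ca = cd·a², since ad = 1. The square is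
invisible to the Hilbert symbol. -/
theorem bu_mul_of_right {h : SL(2, F)} (hh : h.1 1 0 = 0) (g : SL(2, F)) :
    ∃ s : Fˣ, bu (g * h) = bu g * bu h * s ^ 2 := by
  have hdet := SL2_det h
  rw [hh, mul_zero, sub_zero] at hdet
  have ha : h.1 0 0 ≠ 0 := left_ne_zero_of_mul_eq_one hdet
  have hd : h.1 1 1 ≠ 0 := right_ne_zero_of_mul_eq_one hdet
  by_cases hg : g.1 1 0 = 0
  · exact ⟨1, by rw [bu_mul_of_left hg]; simp⟩
  · refine ⟨Units.mk0 _ ha, ?_⟩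
    ext
    have h1 : (g * h).1 1 0 ≠ 0 := by simp [SL2_mul_10, hh, hg, ha]
    simp only [val_bu, Units.val_mul, Units.val_pow_eq_pow_val, Units.val_mk0, bEntry_of_ne_zero h1,
      bEntry_of_ne_zero hg, bEntry_of_eq_zero hh, SL2_mul_10, hh]
    linear_combination (-(g.1 1 0) * h.1 0 0) * hdet

theorem bu_inv {g : SL(2, F)} (hg : g.1 1 0 ≠ 0) : bu g⁻¹ = -bu g := by
  ext
  have h1 : (g⁻¹).1 1 0 ≠ 0 := by simpa [SL2_inv_10] using hg
  simp only [val_bu, Units.val_neg, bEntry_of_ne_zero h1, bEntry_of_ne_zero hg, SL2_inv_10]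

theorem cocycle_one_left (g : SL(2, F)) : cocycle 1 g = 1 := by
  simp [cocycle, bEntry_ne_zero g]

theorem cocycle_one_right (g : SL(2, F)) : cocycle g 1 = 1 := by
  simp [cocycle, bEntry_ne_zero g]

namespace Mp2

@[simp] theorem mul_g (x y : Mp2 F) : (x * y).g = x.g * y.g := rfl
@[simp] theorem mul_ζ (x y : Mp2 F) : (x * y).ζ = x.ζ * y.ζ * cocycle x.g y.g := rfl
@[simp] theorem one_g : (1 : Mp2 F).g = 1 := rfl
@[simp] theorem one_ζ : (1 : Mp2 F).ζ = 1 := rfl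
@[simp] theorem inv_g (x : Mp2 F) : (x⁻¹).g = x.g⁻¹ := rfl
@[simp] theorem inv_ζ (x : Mp2 F) : (x⁻¹).ζ = x.ζ * cocycle x.g x.g⁻¹ := rfl

end Mp2

variable [ValuativeRel F] [TopologicalSpace F] [IsNonarchimedeanLocalField F]
  [hq : Fact (Odd (resCard F))]

/-- Expand (x/z, y/z) bilinearly and use (z, z) = (-1, z). -/
theorem signBit_cocycle (g h : SL(2, F)) : signBit (cocycle g h) =
    hs (bu g) (bu h) + hs (-(bu g * bu h)) (bu (g * h)) := by
  have : signBit (cocycle g h) = hs (bu g / bu (g * h)) (bu h / bu (g * h)) := by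
    simp [hs, cocycle]
  rw [this]
  simp only [hs_div_left, hs_div_right, hs_neg_left, hs_mul_left, hs_self]
  rw [hs_comm (bu (g * h)) (bu h)]
  grind

/-- If one of the lower left entries of g₁, g₂, g₃, g₁g₂, g₂g₃, g₁g₂g₃ vanishes, the corresponding
factor is triangular, some of the entries b are monomials in the others up to sign and squares, and
bilinearity suffices. In the generic case the missing relation comes from the Plücker identity c₁c₃
+ c₁₂₃c₂ = c₁₂c₂₃. -/
theorem cocycle_assoc (g₁ g₂ g₃ : SL(2, F)) :
    cocycle g₁ g₂ * cocycle (g₁ * g₂) g₃ = cocycle g₁ (g₂ * g₃) * cocycle g₂ g₃ := by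
  apply signBit_injective
  simp only [signBit_mul, signBit_cocycle, mul_assoc g₁ g₂ g₃]
  by_cases h1 : g₁.1 1 0 = 0
  · rw [bu_mul_of_left h1, bu_mul_of_left h1]
    simp only [hs_neg_left, hs_mul_left, hs_mul_right, hs_self, hsNeg_mul, hsNeg_pow]
    grind [hs_comm]
  by_cases h3 : g₃.1 1 0 = 0
  · obtain ⟨s, hs1⟩ := bu_mul_of_right h3 g₂
    obtain ⟨t, ht1⟩ := bu_mul_of_right h3 (g₁ * g₂)
    rw [mul_assoc] at ht1
    rw [hs1, ht1]
    simp only [hs_neg_left, hs_mul_left, hs_mul_right, hs_self, hsNeg_mul, hsNeg_pow, hs_pow_left, hs_pow_right]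
    grind [hs_comm]
  by_cases h2 : g₂.1 1 0 = 0
  · obtain ⟨s, hs1⟩ := bu_mul_of_right h2 g₁
    rw [hs1, bu_mul_of_left h2]
    simp only [hs_neg_left, hs_mul_left, hs_mul_right, hs_self, hsNeg_mul, hsNeg_pow, hs_pow_left, hs_pow_right]
    grind [hs_comm]
  by_cases h12 : (g₁ * g₂).1 1 0 = 0
  · have e1 := bu_mul_of_left h12 g₃
    obtain ⟨s, e2⟩ := bu_mul_of_right h12 g₁⁻¹
    rw [inv_mul_cancel_left, bu_inv h1] at e2
    rw [mul_assoc] at e1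
    rw [e1, e2]
    simp only [hs_neg_left, hs_neg_right, hs_mul_left, hs_mul_right, hs_self, hsNeg_mul, hsNeg_neg, hsNeg_pow, hs_pow_left, hs_pow_right]
    grind [hs_comm]
  by_cases h23 : (g₂ * g₃).1 1 0 = 0
  · obtain ⟨s, e1⟩ := bu_mul_of_right h23 g₁
    obtain ⟨t, e2⟩ := bu_mul_of_right h23 g₂⁻¹
    rw [inv_mul_cancel_left, bu_inv h2] at e2
    rw [e1, e2]
    simp only [hs_neg_left, hs_neg_right, hs_mul_left, hs_mul_right, hs_self, hsNeg_mul, hsNeg_neg, hsNeg_pow, hs_pow_left, hs_pow_right]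
    grind [hs_comm]
  by_cases h123 : (g₁ * (g₂ * g₃)).1 1 0 = 0
  · have e1 := bu_mul_of_left h123 (g₂ * g₃)⁻¹
    rw [mul_inv_cancel_right, bu_inv h23] at e1
    have h123' : (g₁ * g₂ * g₃).1 1 0 = 0 := by rwa [mul_assoc]
    obtain ⟨s, e2⟩ := bu_mul_of_right h123' (g₁ * g₂)⁻¹
    rw [inv_mul_cancel_left, bu_inv h12, mul_assoc g₁ g₂ g₃] at e2
    rw [e1, e2]
    simp only [hs_neg_left, hs_neg_right, hs_mul_left, hs_mul_right, hs_self, hsNeg_mul, hsNeg_neg, hsNeg_pow, hs_pow_left, hs_pow_right]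
    grind [hs_comm]
  -- Multiplied by c₁₂c₂₃, the Plücker identity says that the two arguments add up to the square of
  -- c₁₂c₂₃, so their symbol is trivial. Its bilinear expansion is the cocycle identity.
  have key : hs ((bu g₁ * bu g₃) * (bu (g₁ * g₂) * bu (g₂ * g₃)))
      ((bu (g₁ * (g₂ * g₃)) * bu g₂) * (bu (g₁ * g₂) * bu (g₂ * g₃))) = 0 := by
    rw [hs, signBit_eq_zero_iff]
    apply hilbertSymbol_of_add_eq_sq (s := bEntry (g₁ * g₂) * bEntry (g₂ * g₃))
    simp only [Units.val_mul, val_bu, bEntry_of_ne_zero h1, bEntry_of_ne_zero h2, bEntry_of_ne_zero h3,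
      bEntry_of_ne_zero h12, bEntry_of_ne_zero h23, bEntry_of_ne_zero h123]
    have := SL2_det g₂
    have plu : g₁.1 1 0 * g₃.1 1 0 + (g₁ * (g₂ * g₃)).1 1 0 * g₂.1 1 0 =
        (g₁ * g₂).1 1 0 * (g₂ * g₃).1 1 0 := by
      simp only [SL2_mul_10, SL2_mul_00]
      linear_combination (-g₁.1 1 0 * g₃.1 1 0) * this
    linear_combination ((g₁ * g₂).1 1 0 * (g₂ * g₃).1 1 0) * plu
  simp only [hs_neg_left, hs_neg_right, hs_mul_left, hs_mul_right, hs_self, hsNeg_mul, hsNeg_neg, hsNeg_pow] at key ⊢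
  grind [hs_comm]

namespace Mp2

instance : Group (Mp2 F) where
  mul_assoc x y z := by
    ext1
    · exact mul_assoc _ _ _
    · have := cocycle_assoc x.g y.g z.g
      simp only [mul_ζ, mul_g]
      calc x.ζ * y.ζ * cocycle x.g y.g * z.ζ * cocycle (x.g * y.g) z.g
          = x.ζ * y.ζ * z.ζ * (cocycle x.g y.g * cocycle (x.g * y.g) z.g) := by ac_rfl
        _ = _ := by rw [this]; ac_rfl
  one_mul x := by
    ext1
    · exact one_mul _
    · simp [cocycle_one_left]
  mul_one x := by
    ext1
    · exact mul_one _
    · simp [cocycle_one_right]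
  inv_mul_cancel x := by
    ext1
    · exact inv_mul_cancel _
    · have : cocycle x.g⁻¹ x.g = cocycle x.g x.g⁻¹ := by
        rw [cocycle, cocycle, hilbertSymbol_comm, inv_mul_cancel, mul_inv_cancel]
      simp only [mul_ζ, inv_ζ, inv_g, one_ζ, this]
      rw [mul_assoc, mul_assoc, mul_comm x.ζ (cocycle _ _), ← mul_assoc (cocycle _ _), Int.units_mul_self,
        one_mul, Int.units_mul_self]

end Mp2

end Cocycle

/-! ## Hecke algebras of compact open subgroups -/

section AbstractHecke

/-- A compact open subgroup `K` of volume `1` with a character `χ`, in a group which is only assumed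
to have continuous left translations. -/
structure IsHeckePair {G : Type*} [Group G] [TopologicalSpace G] [MeasurableSpace G]
    (μ : Measure G) (K : Subgroup G) (χ : G → ℂ) : Prop where
  continuous_mul_left : ∀ x : G, Continuous fun g => x * g
  isOpen : IsOpen (K : Set G)
  isCompact : IsCompact (K : Set G)
  -- This stands in for the continuity of right translations; it serves to split a double coset into
  -- finitely many left cosets.
  isOpen_mul_right : ∀ x : G, IsOpen {g | g * x ∈ K}
  χ_one : χ 1 = 1
  χ_mul : ∀ a ∈ K, ∀ b ∈ K, χ (a * b) = χ a * χ b
  measure_eq_one : μ K = 1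

variable {G : Type*} [Group G] [TopologicalSpace G] [MeasurableSpace G] [BorelSpace G]
  {μ : Measure G} {K : Subgroup G} {χ : G → ℂ}

namespace IsHeckePair

theorem isOpen_coset (h : IsHeckePair μ K χ) (x : G) : IsOpen {g | x⁻¹ * g ∈ K} :=
  h.isOpen.preimage (h.continuous_mul_left x⁻¹)

theorem isClosed_coset (h : IsHeckePair μ K χ) (x : G) : IsClosed {g | x⁻¹ * g ∈ K} := by
  rw [← isOpen_compl_iff]
  have : {g | x⁻¹ * g ∈ K}ᶜ = ⋃ y : {y : G // x⁻¹ * y ∉ K}, {g | (y : G)⁻¹ * g ∈ K} := by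
    ext g
    simp only [Set.mem_compl_iff, Set.mem_ofPred_eq, Set.mem_iUnion, Subtype.exists, exists_prop]
    constructor
    · exact fun hg => ⟨g, hg, by simp⟩
    · rintro ⟨y, hy, hg⟩ hg'
      refine hy ?_
      have := K.mul_mem hg' (K.inv_mem hg)
      simpa [mul_assoc] using this
  rw [this]
  exact isOpen_iUnion fun y => h.isOpen_coset _

theorem isCompact_coset (h : IsHeckePair μ K χ) (x : G) : IsCompact {g | x⁻¹ * g ∈ K} := by
  convert h.isCompact.image (h.continuous_mul_left x) using 1
  ext g
  simp only [Set.mem_ofPred_eq, Set.mem_image, SetLike.mem_coe]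
  exact ⟨fun hg => ⟨_, hg, by simp⟩, by rintro ⟨k, hk, rfl⟩; simpa⟩

theorem measurePreserving_mul_left [μ.IsMulLeftInvariant] (h : IsHeckePair μ K χ) (x : G) :
    MeasurePreserving (fun g => x * g) μ μ :=
  ⟨(h.continuous_mul_left x).measurable, map_mul_left_eq_self μ x⟩

theorem integral_mul_left [μ.IsMulLeftInvariant] (h : IsHeckePair μ K χ) (x : G) (f : G → ℂ) :
    ∫ g, f (x * g) ∂μ = ∫ g, f g ∂μ := by
  let e : G ≃ₜ G :=
    { Equiv.mulLeft x with
      continuous_toFun := h.continuous_mul_left x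
      continuous_invFun := h.continuous_mul_left x⁻¹ }
  exact (h.measurePreserving_mul_left x).integral_comp e.measurableEmbedding f

theorem measure_coset [μ.IsMulLeftInvariant] (h : IsHeckePair μ K χ) (x : G) :
    μ {g | x⁻¹ * g ∈ K} = 1 := by
  rw [← h.measure_eq_one]
  exact (h.measurePreserving_mul_left x⁻¹).measure_preimage h.isOpen.measurableSet.nullMeasurableSet

theorem χ_mul_inv (h : IsHeckePair μ K χ) {k : G} (hk : k ∈ K) : χ k * χ k⁻¹ = 1 := by
  rw [← h.χ_mul k hk _ (K.inv_mem hk), mul_inv_cancel, h.χ_one]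

/-- A function which is right invariant under `K` and supported on finitely many cosets is a finite
sum of multiples of characteristic functions. -/
theorem eq_sum_indicator {ι : Type*} {s : Finset ι} {x : ι → G}
    (hx : ∀ i ∈ s, ∀ j ∈ s, (x i)⁻¹ * x j ∈ K → i = j) {f : G → ℂ}
    (hf : ∀ g, ∀ k ∈ K, f (g * k) = f g) (hs : ∀ g, f g ≠ 0 → ∃ i ∈ s, (x i)⁻¹ * g ∈ K) :
    f = fun g => ∑ i ∈ s, Set.indicator {g | (x i)⁻¹ * g ∈ K} (fun _ => f (x i)) g := by
  have key : ∀ i g, (x i)⁻¹ * g ∈ K → f g = f (x i) := fun i g hi => by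
    have := hf (x i) _ hi
    rwa [mul_inv_cancel_left] at this
  ext g
  by_cases hg : ∃ i ∈ s, (x i)⁻¹ * g ∈ K
  · obtain ⟨i, hi, hig⟩ := hg
    rw [Finset.sum_eq_single_of_mem i hi]
    · rw [Set.indicator_of_mem (show g ∈ {g | (x i)⁻¹ * g ∈ K} from hig), key i g hig]
    · intro j hj hji
      refine Set.indicator_of_notMem (fun hjg => hji ?_) _
      have := K.mul_mem hjg (K.inv_mem hig)
      exact hx j hj i hi (by simpa [mul_assoc] using this)
  · rw [Finset.sum_eq_zero]
    · by_contra h0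
      exact hg (hs g h0)
    · intro i hi
      refine Set.indicator_of_notMem (fun hig => ?_) _
      exact hg ⟨i, hi, hig⟩

theorem integrable_indicator [μ.IsMulLeftInvariant] (h : IsHeckePair μ K χ) (x : G) (c : ℂ) :
    Integrable (Set.indicator {g | x⁻¹ * g ∈ K} (fun _ => c)) μ := by
  rw [integrable_indicator_iff (h.isOpen_coset x).measurableSet]
  exact integrableOn_const (by rw [h.measure_coset]; exact ENNReal.one_ne_top)

theorem integrable [μ.IsMulLeftInvariant] (h : IsHeckePair μ K χ) {ι : Type*} {s : Finset ι} {x : ι → G}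
    (hx : ∀ i ∈ s, ∀ j ∈ s, (x i)⁻¹ * x j ∈ K → i = j) {f : G → ℂ}
    (hf : ∀ g, ∀ k ∈ K, f (g * k) = f g) (hs : ∀ g, f g ≠ 0 → ∃ i ∈ s, (x i)⁻¹ * g ∈ K) :
    Integrable f μ := by
  rw [eq_sum_indicator hx hf hs]
  exact integrable_finsetSum _ fun i _ => h.integrable_indicator _ _

/-- Every left coset of K has volume 1, so a right K-invariant function is integrated by adding one
value per coset. All explicit convolutions below are such finite sums. -/
theorem integral_eq_sum [μ.IsMulLeftInvariant] (h : IsHeckePair μ K χ) {ι : Type*} {s : Finset ι} {x : ι → G}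
    (hx : ∀ i ∈ s, ∀ j ∈ s, (x i)⁻¹ * x j ∈ K → i = j) {f : G → ℂ}
    (hf : ∀ g, ∀ k ∈ K, f (g * k) = f g) (hs : ∀ g, f g ≠ 0 → ∃ i ∈ s, (x i)⁻¹ * g ∈ K) :
    ∫ g, f g ∂μ = ∑ i ∈ s, f (x i) := by
  conv_lhs => rw [eq_sum_indicator hx hf hs]
  rw [integral_finsetSum _ fun i _ => h.integrable_indicator _ _]
  refine Finset.sum_congr rfl fun i _ => ?_
  rw [integral_indicator_const _ (h.isOpen_coset _).measurableSet, Measure.real, h.measure_coset]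
  simp

end IsHeckePair

theorem heckeSpace_mul_left {a : G → ℂ} (ha : a ∈ heckeSpace (K : Set G) χ) {k : G} (hk : k ∈ K) (g : G) :
    a (k * g) = χ k * a g := by
  have := ha.2 k hk 1 K.one_mem g
  simpa using this

theorem heckeSpace_mul_right {a : G → ℂ} (ha : a ∈ heckeSpace (K : Set G) χ) {k : G} (hk : k ∈ K) (g : G) :
    a (g * k) = χ k * a g := by
  have := ha.2 1 K.one_mem k hk g
  simpa using this

/-- The support of `f` meets only finitely many left cosets of `K`. -/
def FiniteCosetSupport (K : Subgroup G) (f : G → ℂ) : Prop :=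
  ∃ s : Finset (G ⧸ K), ∀ g, f g ≠ 0 → ∃ i ∈ s, (i.out)⁻¹ * g ∈ K

theorem out_injective (s : Finset (G ⧸ K)) :
    ∀ i ∈ s, ∀ j ∈ s, (i.out)⁻¹ * j.out ∈ K → i = j := by
  intro i _ j _ hij
  rw [← QuotientGroup.eq] at hij
  simpa using hij

theorem finiteCosetSupport_of_finset {f : G → ℂ} (t : Finset G)
    (ht : ∀ g, f g ≠ 0 → ∃ x ∈ t, x⁻¹ * g ∈ K) : FiniteCosetSupport K f := by
  classical
  refine ⟨t.image (QuotientGroup.mk : G → G ⧸ K), fun g hg => ?_⟩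
  obtain ⟨x, hx, hxg⟩ := ht g hg
  refine ⟨x, Finset.mem_image_of_mem _ hx, ?_⟩
  rw [← QuotientGroup.eq] at hxg ⊢
  simpa using hxg

namespace IsHeckePair

theorem finiteCosetSupport (h : IsHeckePair μ K χ) {f : G → ℂ} (hf : HasCompactSupport f) :
    FiniteCosetSupport K f := by
  obtain ⟨t, ht⟩ := hf.isCompact.elim_finite_subcover (fun x : G => {g | x⁻¹ * g ∈ K})
    (fun x => h.isOpen_coset x) (fun g _ => Set.mem_iUnion.2 ⟨g, by simp⟩)
  refine finiteCosetSupport_of_finset t fun g hg => ?_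
  have := ht (subset_tsupport f hg)
  simpa using this

/-- Cosets are closed as well as compact, so the topological support stays inside the finite union
without any separation axiom on G. -/
theorem hasCompactSupport (h : IsHeckePair μ K χ) {f : G → ℂ} (hf : FiniteCosetSupport K f) :
    HasCompactSupport f := by
  obtain ⟨s, hs⟩ := hf
  have hC : IsCompact (⋃ i ∈ s, {g | (i.out)⁻¹ * g ∈ K}) :=
    s.isCompact_biUnion fun i _ => h.isCompact_coset _
  have hcl : IsClosed (⋃ i ∈ s, {g | (i.out)⁻¹ * g ∈ K}) :=
    s.finite_toSet.isClosed_biUnion fun i _ => h.isClosed_coset _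
  refine hC.of_isClosed_subset (isClosed_tsupport f) (closure_minimal (fun g hg => ?_) hcl)
  simpa using hs g hg

/-- A double coset `KxK` consists of finitely many left cosets of `K`. -/
theorem exists_finset_doubleCoset (h : IsHeckePair μ K χ) (x : G) :
    ∃ t : Finset G, ∀ k₁ ∈ K, ∀ k₂ ∈ K, ∃ y ∈ t, y⁻¹ * (k₁ * x * k₂) ∈ K := by
  classical
  obtain ⟨t, ht⟩ := h.isCompact.elim_finite_subcover (fun y : G => {g | y⁻¹ * g * x ∈ K})
    (fun y => (h.isOpen_mul_right x).preimage (h.continuous_mul_left y⁻¹))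
    (fun g _ => Set.mem_iUnion.2 ⟨g * x, by simp⟩)
  refine ⟨t, fun k₁ h₁ k₂ h₂ => ?_⟩
  have := ht h₁
  simp only [Set.mem_iUnion, Set.mem_ofPred_eq, exists_prop] at this
  obtain ⟨y, hy, hyk⟩ := this
  exact ⟨y, hy, by simpa [mul_assoc] using K.mul_mem hyk h₂⟩

/-- The factors χ(k) and χ(k⁻¹) from the two functions cancel. -/
theorem conv_integrand_mul_right (h : IsHeckePair μ K χ) {a b : G → ℂ}
    (ha : a ∈ heckeSpace (K : Set G) χ) (hb : b ∈ heckeSpace (K : Set G) χ) (g : G) :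
    ∀ x, ∀ k ∈ K, a (x * k) * b ((x * k)⁻¹ * g) = a x * b (x⁻¹ * g) := by
  intro x k hk
  rw [heckeSpace_mul_right ha hk, mul_inv_rev, mul_assoc k⁻¹, heckeSpace_mul_left hb (K.inv_mem hk)]
  linear_combination (a x * b (x⁻¹ * g)) * h.χ_mul_inv hk

theorem conv_eq_sum [μ.IsMulLeftInvariant] (h : IsHeckePair μ K χ) {a b : G → ℂ}
    (ha : a ∈ heckeSpace (K : Set G) χ) (hb : b ∈ heckeSpace (K : Set G) χ)
    {ι : Type*} {s : Finset ι} {x : ι → G} (hx : ∀ i ∈ s, ∀ j ∈ s, (x i)⁻¹ * x j ∈ K → i = j)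
    (hs : ∀ g, a g ≠ 0 → ∃ i ∈ s, (x i)⁻¹ * g ∈ K) (g : G) :
    conv μ a b g = ∑ i ∈ s, a (x i) * b ((x i)⁻¹ * g) :=
  h.integral_eq_sum hx (h.conv_integrand_mul_right ha hb g) fun _ hy => hs _ (left_ne_zero_of_mul hy)

theorem conv_integrable [μ.IsMulLeftInvariant] (h : IsHeckePair μ K χ) {a b : G → ℂ}
    (ha : a ∈ heckeSpace (K : Set G) χ) (hb : b ∈ heckeSpace (K : Set G) χ) (g : G) :
    Integrable (fun x => a x * b (x⁻¹ * g)) μ := by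
  obtain ⟨s, hs⟩ := h.finiteCosetSupport ha.1
  exact h.integrable (out_injective s) (h.conv_integrand_mul_right ha hb g)
    fun _ hy => hs _ (left_ne_zero_of_mul hy)

theorem conv_mem [μ.IsMulLeftInvariant] (h : IsHeckePair μ K χ) {a b : G → ℂ}
    (ha : a ∈ heckeSpace (K : Set G) χ) (hb : b ∈ heckeSpace (K : Set G) χ) :
    conv μ a b ∈ heckeSpace (K : Set G) χ := by
  classical
  refine ⟨h.hasCompactSupport ?_, fun k₁ h₁ k₂ h₂ g => ?_⟩
  · obtain ⟨s, hs⟩ := h.finiteCosetSupport ha.1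
    obtain ⟨t, ht⟩ := h.finiteCosetSupport hb.1
    refine finiteCosetSupport_of_finset ((s ×ˢ t).image fun p => p.1.out * p.2.out) fun g hg => ?_
    rw [h.conv_eq_sum ha hb (out_injective s) hs] at hg
    obtain ⟨i, hi, hne⟩ := Finset.exists_ne_zero_of_sum_ne_zero hg
    obtain ⟨j, hj, hji⟩ := ht _ (right_ne_zero_of_mul hne)
    exact ⟨_, Finset.mem_image_of_mem _ (Finset.mk_mem_product hi hj), by simpa [mul_assoc] using hji⟩
  · rw [conv, ← h.integral_mul_left k₁]
    rw [conv, ← integral_const_mul]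
    congr 1 with x
    rw [heckeSpace_mul_left ha h₁, h.χ_mul _ h₁ _ h₂, mul_inv_rev,
      show x⁻¹ * k₁⁻¹ * (k₁ * g * k₂) = x⁻¹ * g * k₂ by group, heckeSpace_mul_right hb h₂]
    ring

/-- Only the integral over the first factor is turned into a finite sum of left translates; the
other integral is then shifted by left invariance. Neither Fubini's theorem nor unimodularity
enters. -/
theorem conv_assoc [μ.IsMulLeftInvariant] (h : IsHeckePair μ K χ) {a b c : G → ℂ}
    (ha : a ∈ heckeSpace (K : Set G) χ) (hb : b ∈ heckeSpace (K : Set G) χ)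
    (hc : c ∈ heckeSpace (K : Set G) χ) : conv μ (conv μ a b) c = conv μ a (conv μ b c) := by
  obtain ⟨s, hs⟩ := h.finiteCosetSupport ha.1
  ext g
  rw [h.conv_eq_sum ha (h.conv_mem hb hc) (out_injective s) hs, conv]
  have shift : ∀ i : G ⧸ K, (fun x => b ((i.out)⁻¹ * x) * c (x⁻¹ * g)) =
      fun x => (fun y => b y * c (y⁻¹ * ((i.out)⁻¹ * g))) ((i.out)⁻¹ * x) := by
    intro i; ext x
    simp [mul_assoc]
  have e : ∀ x, conv μ a b x * c (x⁻¹ * g) =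
      ∑ i ∈ s, a i.out * (b ((i.out)⁻¹ * x) * c (x⁻¹ * g)) := by
    intro x
    rw [h.conv_eq_sum ha hb (out_injective s) hs, Finset.sum_mul]
    exact Finset.sum_congr rfl fun _ _ => mul_assoc _ _ _
  simp only [e]
  rw [integral_finsetSum]
  · refine Finset.sum_congr rfl fun i _ => ?_
    rw [integral_const_mul, shift i,
      h.integral_mul_left (i.out)⁻¹ fun y => b y * c (y⁻¹ * ((i.out)⁻¹ * g)), conv]
  · intro i _
    refine Integrable.const_mul ?_ _
    rw [shift i]
    exact ((h.measurePreserving_mul_left _).integrable_comp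
      (h.conv_integrable hb hc _).aestronglyMeasurable).2 (h.conv_integrable hb hc _)

theorem one_mem (h : IsHeckePair μ K χ) : Set.indicator (K : Set G) χ ∈ heckeSpace (K : Set G) χ := by
  classical
  refine ⟨h.hasCompactSupport (finiteCosetSupport_of_finset {1} fun g hg => ?_), ?_⟩
  · refine ⟨1, by simp, ?_⟩
    simpa using (Set.indicator_apply_ne_zero.1 hg).1
  · intro k₁ h₁ k₂ h₂ g
    by_cases hg : g ∈ K
    · rw [Set.indicator_of_mem (K.mul_mem (K.mul_mem h₁ hg) h₂), Set.indicator_of_mem (show g ∈ (K : Set G) from hg),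
        h.χ_mul _ (K.mul_mem h₁ hg) _ h₂, h.χ_mul _ h₁ _ hg, h.χ_mul _ h₁ _ h₂]
      ring
    · rw [Set.indicator_of_notMem (show g ∉ (K : Set G) from hg), Set.indicator_of_notMem, mul_zero]
      intro h'
      refine hg ?_
      have := K.mul_mem (K.mul_mem (K.inv_mem h₁) h') (K.inv_mem h₂)
      simpa [mul_assoc] using this

/-- The functions which transform by `χ` under `K` on both sides form a unital associative algebra
under convolution. -/
theorem isConvAlgebra [μ.IsMulLeftInvariant] (h : IsHeckePair μ K χ) :
    IsConvAlgebra μ (heckeSpace (K : Set G) χ) (Set.indicator (K : Set G) χ) where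
  one_mem := h.one_mem
  conv_mem a ha b hb := h.conv_mem ha hb
  conv_assoc a ha b hb c hc := h.conv_assoc ha hb hc
  one_conv a ha := by
    ext g
    rw [h.conv_eq_sum (s := {()}) (x := fun _ => 1) h.one_mem ha (by simp)
      (fun g hg => ⟨(), by simp, by simpa using (Set.indicator_apply_ne_zero.1 hg).1⟩)]
    rw [Finset.sum_singleton, Set.indicator_of_mem K.one_mem, h.χ_one]
    simp
  conv_one a ha := by
    ext g
    obtain ⟨s, hs⟩ := h.finiteCosetSupport ha.1
    -- The integrand vanishes off the single coset gK.
    rw [conv, h.integral_eq_sum (s := {()}) (x := fun _ => g) (by simp)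
      (h.conv_integrand_mul_right ha h.one_mem g)
      (fun x hx => ⟨(), by simp, ?_⟩), Finset.sum_singleton]
    · rw [inv_mul_cancel, Set.indicator_of_mem K.one_mem, h.χ_one, mul_one]
    · have := K.inv_mem (Set.indicator_apply_ne_zero.1 (right_ne_zero_of_mul hx)).1
      simpa using this
  add_conv a ha b hb c hc := by
    ext g
    rw [Pi.add_apply, conv, conv, conv, ← integral_add (h.conv_integrable ha hc g) (h.conv_integrable hb hc g)]
    congr 1 with x
    simp [add_mul]
  conv_add a ha b hb c hc := by
    ext g
    rw [Pi.add_apply, conv, conv, conv, ← integral_add (h.conv_integrable ha hb g) (h.conv_integrable ha hc g)]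
    congr 1 with x
    simp [mul_add]
  smul_conv r a ha b hb := by
    ext g
    rw [Pi.smul_apply, conv, conv, smul_eq_mul, ← integral_const_mul]
    congr 1 with x
    simp [mul_assoc]
  conv_smul r a ha b hb := by
    ext g
    rw [Pi.smul_apply, conv, conv, smul_eq_mul, ← integral_const_mul]
    congr 1 with x
    simp [mul_left_comm]

end IsHeckePair

end AbstractHecke

/-! ## Algebras generated by one element -/

section Polynomial

open Polynomial

/-- If `ev k` are functionals which separate points, vanish on any given element for large `k`, and
are triangular on the powers of `x`, then `A` is the polynomial ring in `x`. -/
theorem aeval_bijective_of_triangular {A : Type*} [Ring A] [Algebra ℂ A] (x : A) (ev : ℕ → A →ₗ[ℂ] ℂ)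
    (hsep : ∀ a, (∀ k, ev k a = 0) → a = 0) (hfin : ∀ a, ∃ n, ∀ k, n ≤ k → ev k a = 0)
    (htri : ∀ m k, m < k → ev k (x ^ m) = 0) (hdiag : ∀ m, ev m (x ^ m) ≠ 0) :
    Function.Bijective (aeval x : ℂ[X] →ₐ[ℂ] A) := by
  constructor
  · rw [injective_iff_map_eq_zero]
    intro p hp
    by_contra hp0
    have h1 : ev p.natDegree (aeval x p) = p.leadingCoeff * ev p.natDegree (x ^ p.natDegree) := by
      rw [aeval_eq_sum_range, map_sum, Finset.sum_range_succ, Finset.sum_eq_zero, zero_add, map_smul,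
        smul_eq_mul, leadingCoeff]
      intro i hi
      rw [map_smul, htri _ _ (Finset.mem_range.1 hi), smul_zero]
    rw [hp, map_zero] at h1
    exact mul_ne_zero (leadingCoeff_ne_zero.2 hp0) (hdiag _) h1.symm
  · intro a
    obtain ⟨n, hn⟩ := hfin a
    induction n generalizing a with
    | zero => exact ⟨0, by rw [map_zero, hsep a fun k => hn k (Nat.zero_le k)]⟩
    | succ n ih =>
      -- The subtracted multiple of x ^ n kills the value of `ev n`, and triangularity leaves the
      -- higher values zero.
      obtain ⟨p, hp⟩ := ih (a - (ev n a / ev n (x ^ n)) • x ^ n) (by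
        intro k hk
        rcases hk.eq_or_lt with rfl | hk
        · simp [hdiag]
        · rw [map_sub, map_smul, hn k hk, htri n k hk, smul_zero, sub_zero])
      refine ⟨p + C (ev n a / ev n (x ^ n)) * X ^ n, ?_⟩
      rw [map_add, hp, map_mul, aeval_C, map_pow (aeval x), aeval_X, ← Algebra.smul_def, sub_add_cancel]

end Polynomial

/-! ## Integration over balls -/

section Integration

variable {F : Type*} [Field F] [ValuativeRel F] [TopologicalSpace F] [IsNonarchimedeanLocalField F]

theorem absF_uniformizer_zpow {ϖ : F} (hϖ : absF ϖ = (resCard F : ℝ)⁻¹) (n : ℤ) :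
    absF (ϖ ^ n) = (resCard F : ℝ) ^ (-n) := by
  rw [absF_zpow, hϖ, inv_zpow, zpow_neg]

theorem exists_absF_eq (n : ℤ) : ∃ y : F, y ≠ 0 ∧ absF y = (resCard F : ℝ) ^ n := by
  obtain ⟨ϖ, hϖ⟩ := exists_uniformizer F
  exact ⟨ϖ ^ (-n), zpow_ne_zero _ (uniformizer_ne_zero hϖ), by rw [absF_uniformizer_zpow hϖ, neg_neg]⟩

instance : T2Space F := ⟨fun x y hxy => separated_by_continuous (f := fun z => absF (z - x))
  (continuous_absF.comp (by fun_prop)) (by simpa [sub_eq_zero, eq_comm] using (sub_ne_zero.2 hxy.symm))⟩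

theorem isCompact_ball (n : ℤ) : IsCompact (ball F n) := by
  obtain ⟨y, -, hy⟩ := exists_absF_eq (F := F) n
  exact isCompact_absF_le F _ ⟨y, hy⟩

theorem isClopen_ball (n : ℤ) : IsClopen (ball F n) := by
  obtain ⟨y, hy0, hy⟩ := exists_absF_eq (F := F) n
  exact isClopen_absF_le ⟨y, hy0, hy.le⟩

theorem ball_subset {m n : ℤ} (h : m ≤ n) : ball F m ⊆ ball F n := fun _ hx =>
  (mem_ball.1 hx).trans (zpow_le_zpow_right₀ (one_lt_resCard F).le h)

/-- `ball n` is the disjoint union of translates of `ball (n - 1)` indexed by the residue field. -/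
theorem mem_translate_iff {ϖ : F} (hϖ : absF ϖ = (resCard F : ℝ)⁻¹) (n : ℤ) (x : F) (r : 𝓀[F]) :
    x - ϖ ^ (-n) * sec r ∈ ball F (n - 1) ↔ x ∈ ball F n ∧ red (ϖ ^ n * x) = r := by
  have hϖ0 := uniformizer_ne_zero hϖ
  have hz : ϖ ^ (-n) * ϖ ^ n = 1 := by rw [← zpow_add₀ hϖ0]; simp
  have hpos := zpow_pos (resCard_pos F) n
  have h2 : absF (ϖ ^ (-n) * sec r) ≤ (resCard F : ℝ) ^ n := by
    rw [absF_mul, absF_uniformizer_zpow hϖ, neg_neg]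
    exact mul_le_of_le_one_right hpos.le (absF_sec_le r)
  have h1 : ∀ y : F, absF y ≤ (resCard F : ℝ) ^ n ↔ absF (ϖ ^ n * y) ≤ 1 := fun y => by
    rw [absF_mul, absF_uniformizer_zpow hϖ, zpow_neg, inv_mul_le_iff₀ hpos, mul_one]
  have h3 : x - ϖ ^ (-n) * sec r ∈ ball F (n - 1) ↔ absF (ϖ ^ n * x - sec r) < 1 := by
    have : x - ϖ ^ (-n) * sec r = ϖ ^ (-n) * (ϖ ^ n * x - sec r) := by
      rw [mul_sub, ← mul_assoc, hz, one_mul]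
    rw [mem_ball, ← absF_lt_zpow_iff, this, absF_mul, absF_uniformizer_zpow hϖ, neg_neg]
    constructor
    · exact fun h => lt_of_mul_lt_mul_left (by simpa using h) hpos.le
    · exact fun h => mul_lt_of_lt_one_right hpos h
  constructor
  · intro h
    have hx : x ∈ ball F n := by
      have := absF_add_le (ball_subset (by omega) h) h2
      rwa [sub_add_cancel] at this
    exact ⟨hx, (absF_sub_sec ((h1 x).1 hx)).1 (h3.1 h)⟩
  · rintro ⟨hx, hr⟩
    exact h3.2 ((absF_sub_sec ((h1 x).1 hx)).2 hr)

variable [MeasurableSpace F] [BorelSpace F]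

instance : (haarF F).IsAddHaarMeasure := by unfold haarF; infer_instance

theorem measurableSet_ball (n : ℤ) : MeasurableSet (ball F n) := (isClopen_ball n).isOpen.measurableSet

theorem integrableOn_ball {f : F → ℂ} (hf : Continuous f) (n : ℤ) : IntegrableOn f (ball F n) (haarF F) :=
  hf.continuousOn.integrableOn_compact (isCompact_ball n)

theorem setIntegral_ball_add (f : F → ℂ) {n : ℤ} {t : F} (ht : t ∈ ball F n) :
    ∫ y in ball F n, f (y + t) ∂(haarF F) = ∫ y in ball F n, f y ∂(haarF F) := by
  rw [← integral_indicator (measurableSet_ball n), ← integral_indicator (measurableSet_ball n),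
    ← integral_add_right_eq_self (Set.indicator (ball F n) f) t]
  congr 1 with y
  by_cases hy : y ∈ ball F n
  · rw [Set.indicator_of_mem hy, Set.indicator_of_mem (show y + t ∈ ball F n from absF_add_le hy ht)]
  · rw [Set.indicator_of_notMem hy, Set.indicator_of_notMem]
    intro h
    have := absF_sub_le h ht
    rw [add_sub_cancel_right] at this
    exact hy this

theorem setIntegral_translate (f : F → ℂ) (n : ℤ) (a : F) :
    ∫ y in {x | x - a ∈ ball F n}, f y ∂(haarF F) = ∫ y in ball F n, f (a + y) ∂(haarF F) := by
  have hm : MeasurableSet {x | x - a ∈ ball F n} :=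
    ((isClopen_ball n).isOpen.preimage (by fun_prop : Continuous fun x : F => x - a)).measurableSet
  rw [← integral_indicator hm, ← integral_indicator (measurableSet_ball n), ← integral_add_left_eq_self (Set.indicator _ f) a]
  congr 1 with y
  by_cases hy : y ∈ ball F n
  · rw [Set.indicator_of_mem hy, Set.indicator_of_mem (by simpa using hy)]
  · rw [Set.indicator_of_notMem hy, Set.indicator_of_notMem (by simpa using hy)]

theorem setIntegral_ball_eq_sum {ϖ : F} (hϖ : absF ϖ = (resCard F : ℝ)⁻¹) [Fintype 𝓀[F]] {f : F → ℂ}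
    (hf : Continuous f) (n : ℤ) : ∫ y in ball F n, f y ∂(haarF F) =
      ∑ r : 𝓀[F], ∫ y in ball F (n - 1), f (ϖ ^ (-n) * sec r + y) ∂(haarF F) := by
  have hU : ball F n = ⋃ r : 𝓀[F], {x | x - ϖ ^ (-n) * sec r ∈ ball F (n - 1)} := by
    ext x
    simp only [Set.mem_iUnion, Set.mem_ofPred_eq, mem_translate_iff hϖ]
    simp
  conv_lhs => rw [hU]
  rw [integral_iUnion_fintype]
  · exact Finset.sum_congr rfl fun r _ => setIntegral_translate f (n - 1) _
  · intro r
    exact ((isClopen_ball (n - 1)).isOpen.preimage (by fun_prop)).measurableSet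
  · intro r s hrs
    refine Set.disjoint_left.2 fun x hx hx' => hrs ?_
    rw [Set.mem_ofPred_eq, mem_translate_iff hϖ] at hx hx'
    rw [← hx.2, hx'.2]
  · intro r
    refine (integrableOn_ball hf n).mono_set fun x hx => ?_
    exact ((mem_translate_iff hϖ n x r).1 hx).1

theorem integral_ball_one_zero : ∫ _ in ball F 0, (1 : ℂ) ∂(haarF F) = 1 := by
  have : (haarF F) (ball F 0) = 1 := by
    have h : ball F 0 = (integerCompacts F : Set F) := by
      ext x
      change absF x ≤ _ ↔ valuation F x ≤ 1
      rw [zpow_zero, absF_le_one_iff]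
    rw [h]
    exact Measure.addHaarMeasure_self
  simp [Measure.real, this]

/-- A ball is the disjoint union of q translates of the next smaller one; induction runs in both
directions from the ring of integers. -/
theorem integral_ball_one (n : ℤ) : ∫ _ in ball F n, (1 : ℂ) ∂(haarF F) = (resCard F : ℂ) ^ n := by
  obtain ⟨ϖ, hϖ⟩ := exists_uniformizer F
  have := Fintype.ofFinite 𝓀[F]
  have hq : (resCard F : ℂ) ≠ 0 := by exact_mod_cast resCard_ne_zero F
  have step : ∀ n : ℤ, ∫ _ in ball F n, (1 : ℂ) ∂(haarF F) =
      (resCard F : ℂ) * ∫ _ in ball F (n - 1), (1 : ℂ) ∂(haarF F) := fun n => by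
    rw [setIntegral_ball_eq_sum hϖ continuous_const n, Finset.sum_const, Finset.card_univ, resCard,
      Nat.card_eq_fintype_card, nsmul_eq_mul]
  induction n using Int.induction_on with
  | zero => simpa using integral_ball_one_zero
  | succ n ih => rw [step, add_sub_cancel_right, ih, zpow_add_one₀ hq, mul_comm]
  | pred n ih =>
    have := step (-n)
    rw [ih] at this
    rw [zpow_sub_one₀ hq, this, mul_comm, ← mul_assoc, inv_mul_cancel₀ hq, one_mul]

end Integration

/-! ## Gauss sums and Gauss integrals -/

section Gauss

variable {F : Type*} [Field F] [ValuativeRel F] [TopologicalSpace F] [IsNonarchimedeanLocalField F]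

/-- An additive character which is trivial on the integers but not on the inverse of the maximal
ideal. -/
structure IsUnramified (e : AddChar F Circle) : Prop where
  eq_one : ∀ x : F, absF x ≤ 1 → e x = 1
  exists_ne_one : ∃ x : F, absF x ≤ resCard F ∧ e x ≠ 1

namespace IsUnramified

variable {e : AddChar F Circle}

theorem coe_eq_one (he : IsUnramified e) {x : F} (hx : absF x ≤ 1) : (e x : ℂ) = 1 := by
  rw [he.eq_one x hx, Circle.coe_one]

theorem coe_add (x y : F) : (e (x + y) : ℂ) = e x * e y := by
  rw [AddChar.map_add_eq_mul, Circle.coe_mul]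

theorem eq_of_sub (he : IsUnramified e) {x y : F} (h : absF (x - y) ≤ 1) : (e x : ℂ) = e y := by
  rw [show x = (x - y) + y by ring, coe_add, he.coe_eq_one h, one_mul]

theorem continuous (he : IsUnramified e) : Continuous e :=
  (isLocallyConstant_of_add _ 1 one_ne_zero fun x t ht => by
    rw [AddChar.map_add_eq_mul, he.eq_one t (by simpa using ht), mul_one]).continuous

/-- The additive character of the residue field defined by `e` and an element of absolute value
`q`. -/
def resChar (he : IsUnramified e) {τ : F} (hτ : absF τ = resCard F) : AddChar 𝓀[F] ℂ where
  toFun r := e (τ * sec r)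
  map_zero_eq_one' := by simp
  map_add_eq_mul' r s := by
    rw [← coe_add]
    refine he.eq_of_sub ?_
    rw [← mul_add, ← mul_sub, absF_mul, hτ]
    have h1 : absF (sec (r + s) - (sec r + sec s)) < 1 := by
      rw [← red_eq_red_iff (absF_sec_le _) (absF_add_le (absF_sec_le _) (absF_sec_le _)),
        red_add (absF_sec_le _) (absF_sec_le _), red_sec, red_sec, red_sec]
    rw [absF_lt_one_iff_le] at h1
    calc _ ≤ (resCard F : ℝ) * (resCard F : ℝ)⁻¹ := by gcongr
      _ = 1 := mul_inv_cancel₀ (resCard_pos F).ne'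

theorem resChar_red (he : IsUnramified e) {τ : F} (hτ : absF τ = resCard F) {x : F} (hx : absF x ≤ 1) :
    he.resChar hτ (red x) = e (τ * x) := by
  refine he.eq_of_sub ?_
  rw [← mul_sub, absF_mul, hτ]
  have h1 : absF (sec (red x) - x) < 1 := by rw [← red_eq_red_iff (absF_sec_le _) hx, red_sec]
  rw [absF_lt_one_iff_le] at h1
  calc _ ≤ (resCard F : ℝ) * (resCard F : ℝ)⁻¹ := by gcongr
    _ = 1 := mul_inv_cancel₀ (resCard_pos F).ne'

theorem resChar_isPrimitive (he : IsUnramified e) {τ : F} (hτ : absF τ = resCard F) :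
    (he.resChar hτ).IsPrimitive := by
  refine AddChar.IsPrimitive.of_ne_one fun h => ?_
  obtain ⟨x, hx, hne⟩ := he.exists_ne_one
  have hτ0 : τ ≠ 0 := by rintro rfl; simp only [absF_zero] at hτ; exact (resCard_pos F).ne hτ
  have h1 : absF (x / τ) ≤ 1 := by
    rw [absF_div, hτ, div_le_one (resCard_pos F)]; exact hx
  have := he.resChar_red hτ h1
  rw [h, mul_div_cancel₀ _ hτ0, AddChar.one_apply] at this
  exact hne (Circle.ext (by rw [← this, Circle.coe_one]))

/-- The quadratic Gauss sum of `e` at level `τ`, where `|τ| = q`. -/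
def _root_.KohnenHecke.residueGauss [Fintype 𝓀[F]] (e : AddChar F Circle) (τ : F) : ℂ :=
  ∑ r : 𝓀[F], (e (τ * sec r ^ 2) : ℂ)

variable [Fintype 𝓀[F]] [DecidableEq 𝓀[F]]

/-- The quadratic character of the residue field with complex values. -/
def _root_.KohnenHecke.quadC (F : Type*) [Field F] [ValuativeRel F] [TopologicalSpace F]
    [IsNonarchimedeanLocalField F] [Fintype 𝓀[F]] [DecidableEq 𝓀[F]] : MulChar 𝓀[F] ℂ :=
  (quadraticChar 𝓀[F]).ringHomComp (Int.castRingHom ℂ)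

theorem _root_.KohnenHecke.quadC_ne_one (hq : Odd (resCard F)) : quadC F ≠ 1 := by
  intro h
  refine quadraticChar_ne_one (ringChar_residue_ne_two hq) ?_
  exact MulChar.injective_ringHomComp (f := Int.castRingHom ℂ) Int.cast_injective
    (h.trans (by ext; simp [MulChar.one_apply_coe]))

/-- An element x of the residue field has 1 + χ(x) square roots, and a non-trivial additive
character sums to zero, so only the sum against χ survives. -/
theorem residueGauss_eq (hq : Odd (resCard F)) (he : IsUnramified e) {τ : F} (hτ : absF τ = resCard F) :
    residueGauss e τ = gaussSum (quadC F) (he.resChar hτ) := by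
  have h1 : residueGauss e τ = ∑ r : 𝓀[F], he.resChar hτ (r ^ 2) := by
    refine Finset.sum_congr rfl fun r _ => ?_
    rw [← he.resChar_red hτ (absF_pow_le_one (absF_sec_le r) 2), red_pow (absF_sec_le r), red_sec]
  have h2 : ∑ r : 𝓀[F], he.resChar hτ (r ^ 2) =
      ∑ x : 𝓀[F], ((({r : 𝓀[F] | r ^ 2 = x} : Set 𝓀[F]).toFinset.card : ℕ) : ℂ) * he.resChar hτ x := by
    rw [← Finset.sum_fiberwise (s := Finset.univ) (g := fun r : 𝓀[F] => r ^ 2)]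
    refine Finset.sum_congr rfl fun x _ => ?_
    rw [Finset.sum_congr rfl (g := fun _ => he.resChar hτ x), Finset.sum_const, nsmul_eq_mul]
    · congr 2
      congr 1
      ext r
      simp
    · intro r hr
      rw [(Finset.mem_filter.1 hr).2]
  have h3 : ∀ x : 𝓀[F], ((({r : 𝓀[F] | r ^ 2 = x} : Set 𝓀[F]).toFinset.card : ℕ) : ℂ) = quadC F x + 1 := by
    intro x
    have := quadraticChar_card_sqrts (ringChar_residue_ne_two hq) x
    have h := congrArg (Int.cast : ℤ → ℂ) this
    push_cast at h
    rw [h]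
    rfl
  have h4 : ∑ x : 𝓀[F], he.resChar hτ x = 0 := AddChar.sum_eq_zero_of_ne_one (by
    rintro h
    have := he.resChar_isPrimitive hτ one_ne_zero
    rw [h] at this
    exact this (by ext; simp))
  rw [h1, h2, gaussSum]
  simp only [h3, add_mul, one_mul, Finset.sum_add_distrib, h4, add_zero]

theorem residueGauss_sq (hq : Odd (resCard F)) (he : IsUnramified e) {τ : F} (hτ : absF τ = resCard F) :
    residueGauss e τ ^ 2 = quadC F (-1) * resCard F := by
  rw [residueGauss_eq hq he hτ, gaussSum_sq (quadC_ne_one hq) ?_ (he.resChar_isPrimitive hτ),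
    resCard, Nat.card_eq_fintype_card]
  exact (quadraticChar_isQuadratic _).comp _

theorem residueGauss_mul_unit (hq : Odd (resCard F)) (he : IsUnramified e) {τ u : F}
    (hτ : absF τ = resCard F) (hu : absF u = 1) :
    residueGauss e (τ * u) = quadC F (red u) * residueGauss e τ := by
  have hτu : absF (τ * u) = resCard F := by simp [hτ, hu]
  have hu0 := (absF_eq_one_iff hu.le).1 hu
  have h := gaussSum_mulShift (quadC F) (he.resChar hτ) (Units.mk0 _ hu0)
  have h2 : (he.resChar hτ).mulShift (Units.mk0 _ hu0 : 𝓀[F]ˣ) = he.resChar hτu := by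
    ext r
    rw [AddChar.mulShift_apply, Units.val_mk0, ← red_sec r, ← red_mul hu.le (absF_sec_le r),
      he.resChar_red hτ (absF_mul_le_one hu.le (absF_sec_le r)), he.resChar_red hτu (absF_sec_le r),
      mul_assoc]
  rw [h2, Units.val_mk0] at h
  rw [residueGauss_eq hq he hτ, residueGauss_eq hq he hτu, ← h, ← mul_assoc, ← map_mul]
  have : quadC F (red u * red u) = 1 := by
    rw [quadC, MulChar.ringHomComp_apply, ← sq, map_pow (quadraticChar 𝓀[F]), quadraticChar_sq_one hu0]; simp
  rw [this, one_mul]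

end IsUnramified

end Gauss

/-! ## The normalized Gauss integral -/

section GaussIntegral

variable {F : Type*} [Field F] [ValuativeRel F] [TopologicalSpace F] [IsNonarchimedeanLocalField F]
  [MeasurableSpace F] [BorelSpace F]

/-- The integral of `e(βy²)` over the ball of radius `q ^ n`. -/
def gaussIntegral (e : AddChar F Circle) (β : F) (n : ℤ) : ℂ :=
  ∫ y in ball F n, (e (β * y ^ 2) : ℂ) ∂(haarF F)

theorem IsUnramified.continuous_gauss {e : AddChar F Circle} (he : IsUnramified e) (β : F) :
    Continuous fun y : F => (e (β * y ^ 2) : ℂ) :=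
  continuous_induced_dom.comp (he.continuous.comp (by fun_prop))

/-- Split the ball into translates of the next smaller one. On a translate centred at y₀ with |y₀| =
qⁿ, the shift by a suitable small t multiplies the integrand by a constant different from 1, so its
integral vanishes. Only the central ball is left. -/
theorem gaussIntegral_eq_pred (hq : Odd (resCard F)) {e : AddChar F Circle} (he : IsUnramified e)
    {β : F} {k n : ℤ} (hβ : absF β = (resCard F : ℝ) ^ k) (hkn : 2 ≤ k + 2 * n) :
    gaussIntegral e β n = gaussIntegral e β (n - 1) := by
  obtain ⟨ϖ, hϖ⟩ := exists_uniformizer F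
  have := Fintype.ofFinite 𝓀[F]
  have hq0 := (resCard_pos F).ne'
  have hq1 := (one_lt_resCard F).le
  rw [gaussIntegral, setIntegral_ball_eq_sum hϖ (he.continuous_gauss β) n,
    Finset.sum_eq_single_of_mem 0 (Finset.mem_univ _)]
  · simp [gaussIntegral]
  intro r _ hr
  set y₀ := ϖ ^ (-n) * sec r with hy₀
  have hy₀a : absF y₀ = (resCard F : ℝ) ^ n := by
    rw [hy₀, absF_mul, absF_uniformizer_zpow hϖ, neg_neg, absF_sec hr, mul_one]
  have hy₀0 : y₀ ≠ 0 := by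
    intro h; rw [h, absF_zero] at hy₀a; exact (zpow_pos (resCard_pos F) n).ne hy₀a
  have hβ0 : β ≠ 0 := by
    intro h; rw [h, absF_zero] at hβ; exact (zpow_pos (resCard_pos F) k).ne hβ
  have h20 := two_ne_zero_of_odd hq
  obtain ⟨x, hx, hxne⟩ := he.exists_ne_one
  -- Chosen so that the cross term 2βy₀t equals x, where e(x) ≠ 1. The bound 2 ≤ k + 2n puts t into
  -- the smaller ball and makes βt² integral; the term 2βyt is integral as well.
  set t := x / (2 * β * y₀) with ht
  have hta : absF t ≤ (resCard F : ℝ) ^ (1 - k - n) := by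
    rw [ht, absF_div, absF_mul, absF_mul, absF_two hq, one_mul, hβ, hy₀a, ← zpow_add₀ hq0,
      div_le_iff₀ (zpow_pos (resCard_pos F) _), ← zpow_add₀ hq0]
    simpa using hx
  have htb : t ∈ ball F (n - 1) := hta.trans (zpow_le_zpow_right₀ hq1 (by omega))
  have key : ∀ y ∈ ball F (n - 1), (e (β * (y₀ + (y + t)) ^ 2) : ℂ) = e x * e (β * (y₀ + y) ^ 2) := by
    intro y hy
    rw [← IsUnramified.coe_add]
    refine he.eq_of_sub ?_
    have hx2 : x = 2 * β * y₀ * t := by rw [ht]; field_simp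
    have : β * (y₀ + (y + t)) ^ 2 - (x + β * (y₀ + y) ^ 2) = 2 * (β * (y * t)) + β * t ^ 2 := by
      rw [hx2]; ring
    rw [this]
    refine absF_add_le ?_ ?_
    · rw [absF_mul, absF_two hq, one_mul, absF_mul, absF_mul, hβ]
      calc _ ≤ (resCard F : ℝ) ^ k * ((resCard F : ℝ) ^ (n - 1) * (resCard F : ℝ) ^ (1 - k - n)) := by
            gcongr
            · exact absF_nonneg _
            · exact hy
        _ = 1 := by rw [← zpow_add₀ hq0, ← zpow_add₀ hq0]; convert zpow_zero _ using 2; ring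
    · rw [absF_mul, absF_pow, hβ]
      calc _ ≤ (resCard F : ℝ) ^ k * ((resCard F : ℝ) ^ (1 - k - n)) ^ 2 := by
            gcongr
            exact absF_nonneg _
        _ = (resCard F : ℝ) ^ (2 - k - 2 * n) := by
            rw [← zpow_natCast, ← zpow_mul, ← zpow_add₀ hq0]; congr 1; push_cast; ring
        _ ≤ 1 := zpow_le_one_of_nonpos₀ hq1 (by omega)
  have h1 : ∫ y in ball F (n - 1), (e (β * (y₀ + y) ^ 2) : ℂ) ∂(haarF F) =
      e x * ∫ y in ball F (n - 1), (e (β * (y₀ + y) ^ 2) : ℂ) ∂(haarF F) := by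
    rw [← integral_const_mul, ← setIntegral_congr_fun (measurableSet_ball _) key]
    exact (setIntegral_ball_add (fun y => (e (β * (y₀ + y) ^ 2) : ℂ)) htb).symm
  have h2 : (1 - (e x : ℂ)) * ∫ y in ball F (n - 1), (e (β * (y₀ + y) ^ 2) : ℂ) ∂(haarF F) = 0 := by
    linear_combination h1
  rcases mul_eq_zero.1 h2 with h | h
  · exact absurd (Circle.ext (by rw [Circle.coe_one]; linear_combination -h)) hxne
  · exact h

theorem gaussIntegral_stable (hq : Odd (resCard F)) {e : AddChar F Circle} (he : IsUnramified e)
    {β : F} {k n₀ n : ℤ} (hβ : absF β = (resCard F : ℝ) ^ k) (hkn : 0 ≤ k + 2 * n₀) (hn : n₀ ≤ n) :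
    gaussIntegral e β n = gaussIntegral e β n₀ := by
  induction n, hn using Int.le_induction with
  | base => rfl
  | succ n hn ih =>
    rw [gaussIntegral_eq_pred hq he hβ (by omega), add_sub_cancel_right, ih]

/-- By stability the radius may be taken to be q^(-j), where the integrand is identically 1. -/
theorem gaussIntegral_even (hq : Odd (resCard F)) {e : AddChar F Circle} (he : IsUnramified e)
    {β : F} {j n : ℤ} (hβ : absF β = (resCard F : ℝ) ^ (2 * j)) (hn : -j ≤ n) :
    gaussIntegral e β n = (resCard F : ℂ) ^ (-j) := by
  rw [gaussIntegral_stable hq he hβ (by omega) hn, gaussIntegral, ← integral_ball_one]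
  refine setIntegral_congr_fun (measurableSet_ball _) fun y hy => he.coe_eq_one ?_
  rw [absF_mul, absF_pow, hβ]
  calc _ ≤ (resCard F : ℝ) ^ (2 * j) * ((resCard F : ℝ) ^ (-j)) ^ 2 := by
        gcongr
        · exact absF_nonneg _
        · exact hy
    _ = 1 := by
        rw [← zpow_natCast, ← zpow_mul, ← zpow_add₀ (resCard_pos F).ne']
        convert zpow_zero _ using 2
        push_cast; ring

/-- On the ball of radius q^(-j) the integrand is constant on translates of the next smaller ball,
and its values there are the terms of the residue Gauss sum. -/
theorem gaussIntegral_odd (hq : Odd (resCard F)) {e : AddChar F Circle} (he : IsUnramified e)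
    [Fintype 𝓀[F]] {ϖ : F} (hϖ : absF ϖ = (resCard F : ℝ)⁻¹)
    {β : F} {j n : ℤ} (hβ : absF β = (resCard F : ℝ) ^ (2 * j + 1)) (hn : -j ≤ n) :
    gaussIntegral e β n = (resCard F : ℂ) ^ (-j - 1) * residueGauss e (β * (ϖ ^ j) ^ 2) := by
  have hq0 := (resCard_pos F).ne'
  rw [gaussIntegral_stable hq he hβ (by omega) hn, gaussIntegral,
    setIntegral_ball_eq_sum hϖ (he.continuous_gauss β), residueGauss, Finset.mul_sum]
  refine Finset.sum_congr rfl fun r _ => ?_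
  rw [setIntegral_congr_fun (g := fun _ => (1 : ℂ) * (e (β * (ϖ ^ j) ^ 2 * sec r ^ 2) : ℂ))
    (measurableSet_ball _), integral_mul_const, integral_ball_one]
  intro y hy
  simp only [one_mul]
  refine he.eq_of_sub ?_
  have : β * (ϖ ^ (- -j) * sec r + y) ^ 2 - β * (ϖ ^ j) ^ 2 * sec r ^ 2 =
      2 * (β * (ϖ ^ j * sec r * y)) + β * y ^ 2 := by
    rw [neg_neg]; ring
  rw [this]
  have hq1 := (one_lt_resCard F).le
  refine absF_add_le ?_ ?_
  · rw [absF_mul, absF_two hq, one_mul, absF_mul, absF_mul, absF_mul, hβ, absF_uniformizer_zpow hϖ]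
    calc _ ≤ (resCard F : ℝ) ^ (2 * j + 1) * ((resCard F : ℝ) ^ (-j) * 1 * (resCard F : ℝ) ^ (-j - 1)) := by
          gcongr
          · exact absF_nonneg _
          · exact absF_sec_le r
          · exact hy
      _ = 1 := by
          rw [mul_one, ← zpow_add₀ hq0, ← zpow_add₀ hq0]; convert zpow_zero _ using 2; ring
  · rw [absF_mul, absF_pow, hβ]
    calc _ ≤ (resCard F : ℝ) ^ (2 * j + 1) * ((resCard F : ℝ) ^ (-j - 1)) ^ 2 := by
          gcongr
          · exact absF_nonneg _
          · exact hy
      _ = (resCard F : ℝ) ^ (-1 : ℤ) := by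
          rw [← zpow_natCast, ← zpow_mul, ← zpow_add₀ hq0]; congr 1; push_cast; ring
      _ ≤ 1 := zpow_le_one_of_nonpos₀ hq1 (by omega)

/-- A radius beyond which the Gauss integral is constant. -/
def gaussLevel (β : F) : ℤ := by
  classical
  -- The choice depends on β only through |β|, so β and -β get the same level; complex conjugation
  -- of the Gauss integral relies on this.
  exact if h : ∃ n : ℤ, 1 ≤ absF β * (resCard F : ℝ) ^ (2 * n) then h.choose else 0

/-- The normalized Gauss integral, a number of absolute value `1`. -/
def gaussFactor (e : AddChar F Circle) (β : F) : ℂ :=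
  (√(absF β) : ℂ) * gaussIntegral e β (gaussLevel β)

theorem one_le_level_iff {β : F} {k n : ℤ} (hβ : absF β = (resCard F : ℝ) ^ k) :
    1 ≤ absF β * (resCard F : ℝ) ^ (2 * n) ↔ 0 ≤ k + 2 * n := by
  rw [hβ, ← zpow_add₀ (resCard_pos F).ne', one_le_zpow_iff_right₀ (one_lt_resCard F)]

theorem gaussLevel_spec {β : F} {k : ℤ} (hβ : absF β = (resCard F : ℝ) ^ k) :
    0 ≤ k + 2 * gaussLevel β := by
  have h : ∃ n : ℤ, 1 ≤ absF β * (resCard F : ℝ) ^ (2 * n) := ⟨|k|, by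
    rw [one_le_level_iff hβ]
    have := neg_abs_le k
    have := abs_nonneg k
    omega⟩
  rw [← one_le_level_iff hβ, gaussLevel, dif_pos h]
  exact h.choose_spec

theorem gaussFactor_eq (hq : Odd (resCard F)) {e : AddChar F Circle} (he : IsUnramified e)
    {β : F} {k n : ℤ} (hβ : absF β = (resCard F : ℝ) ^ k) (hn : 0 ≤ k + 2 * n) :
    gaussFactor e β = (√(absF β) : ℂ) * gaussIntegral e β n := by
  have h := gaussLevel_spec hβ
  rw [gaussFactor]
  rcases le_total n (gaussLevel β) with h' | h'
  · rw [gaussIntegral_stable hq he hβ hn h']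
  · rw [gaussIntegral_stable hq he hβ h h']

theorem gaussFactor_even (hq : Odd (resCard F)) {e : AddChar F Circle} (he : IsUnramified e)
    {β : F} {j : ℤ} (hβ : absF β = (resCard F : ℝ) ^ (2 * j)) : gaussFactor e β = 1 := by
  have hq0 := resCard_pos F
  rw [gaussFactor_eq hq he hβ (n := -j) (by omega), gaussIntegral_even hq he hβ le_rfl, hβ,
    mul_comm 2 j, zpow_mul]
  have : √(((resCard F : ℝ) ^ j) ^ (2 : ℤ)) = (resCard F : ℝ) ^ j :=
    Real.sqrt_sq (zpow_pos hq0 j).le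
  rw [this]
  push_cast
  rw [← zpow_add₀ (by exact_mod_cast hq0.ne'), add_neg_cancel, zpow_zero]

theorem gaussFactor_odd (hq : Odd (resCard F)) {e : AddChar F Circle} (he : IsUnramified e)
    [Fintype 𝓀[F]] {ϖ : F} (hϖ : absF ϖ = (resCard F : ℝ)⁻¹) {β : F} {j : ℤ}
    (hβ : absF β = (resCard F : ℝ) ^ (2 * j + 1)) :
    gaussFactor e β = (√(resCard F : ℝ) : ℂ)⁻¹ * residueGauss e (β * (ϖ ^ j) ^ 2) := by
  have hq0 := resCard_pos F
  have hq0' : (resCard F : ℂ) ≠ 0 := by exact_mod_cast hq0.ne'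
  rw [gaussFactor_eq hq he hβ (n := -j) (by omega), gaussIntegral_odd hq he hϖ hβ le_rfl, hβ,
    zpow_add_one₀ hq0.ne', mul_comm 2 j, zpow_mul]
  have : √(((resCard F : ℝ) ^ j) ^ (2 : ℤ) * resCard F) = (resCard F : ℝ) ^ j * √(resCard F : ℝ) := by
    rw [Real.sqrt_mul (by positivity)]
    congr 1
    exact Real.sqrt_sq (zpow_pos hq0 j).le
  rw [this]
  have hs : (√(resCard F : ℝ) : ℂ) * √(resCard F : ℝ) = resCard F := by
    rw [← Complex.ofReal_mul, Real.mul_self_sqrt hq0.le, Complex.ofReal_natCast]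
  have hs0 : (√(resCard F : ℝ) : ℂ) ≠ 0 := by
    intro h; rw [h, zero_mul] at hs; exact hq0' hs.symm
  rw [← mul_assoc]
  congr 1
  push_cast
  rw [zpow_sub_one₀ hq0', zpow_neg]
  field_simp
  rw [sq, hs]

theorem gaussFactor_unit (hq : Odd (resCard F)) {e : AddChar F Circle} (he : IsUnramified e) {u : F}
    (hu : absF u = 1) : gaussFactor e u = 1 :=
  gaussFactor_even hq he (j := 0) (by simpa using hu)

/-- The Hilbert symbol of a unit and a uniformizer with complex values is the quadratic character. -/
theorem quadC_red (hq : Odd (resCard F)) [Fintype 𝓀[F]] [DecidableEq 𝓀[F]] {u ϖ : F} (hu : absF u = 1)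
    (hϖ : absF ϖ = (resCard F : ℝ)⁻¹) :
    quadC F (red u) = ((hilbertSymbol u ϖ : ℤ) : ℂ) := by
  rw [hilbertSymbol_unit_uniformizer_eq_quadraticChar hq hu hϖ]
  rfl

theorem intCast_units_mul_self (u : ℤˣ) : ((u : ℤ) : ℂ) * ((u : ℤ) : ℂ) = 1 := by
  rcases Int.units_eq_one_or u with rfl | rfl <;> simp

theorem exists_absF_even_or_odd {x : F} (hx : x ≠ 0) :
    ∃ j : ℤ, absF x = (resCard F : ℝ) ^ (2 * j) ∨ absF x = (resCard F : ℝ) ^ (2 * j + 1) := by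
  obtain ⟨k, hk⟩ := exists_absF_eq_zpow hx
  obtain ⟨j, rfl | rfl⟩ := Int.even_or_odd' k
  · exact ⟨j, Or.inl hk⟩
  · exact ⟨j, Or.inr hk⟩

theorem absF_odd_level {ϖ : F} (hϖ : absF ϖ = (resCard F : ℝ)⁻¹) {x : F} {j : ℤ}
    (hx : absF x = (resCard F : ℝ) ^ (2 * j + 1)) : absF (x * (ϖ ^ j) ^ 2) = resCard F := by
  have hq0 := (resCard_pos F).ne'
  rw [absF_mul, absF_pow, hx, absF_uniformizer_zpow hϖ, ← zpow_natCast, ← zpow_mul, ← zpow_add₀ hq0]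
  convert zpow_one _ using 2
  push_cast; ring

theorem gaussFactor_mul_unit_of_odd (hq : Odd (resCard F)) {e : AddChar F Circle} (he : IsUnramified e)
    {ϖ : F} (hϖ : absF ϖ = (resCard F : ℝ)⁻¹) {x u : F} {j : ℤ}
    (hx : absF x = (resCard F : ℝ) ^ (2 * j + 1)) (hu : absF u = 1) :
    gaussFactor e (x * u) = ((hilbertSymbol u ϖ : ℤ) : ℂ) * gaussFactor e x := by
  classical
  have := Fintype.ofFinite 𝓀[F]
  rw [gaussFactor_odd hq he hϖ (j := j) (by rw [absF_mul, hx, hu, mul_one]),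
    gaussFactor_odd hq he hϖ hx, show x * u * (ϖ ^ j) ^ 2 = x * (ϖ ^ j) ^ 2 * u by ring,
    he.residueGauss_mul_unit hq (absF_odd_level hϖ hx) hu, quadC_red hq hu hϖ]
  ring

/-- For even valuation both sides are 1. For odd valuation the argument of the Gauss sum changes by
the square of a unit, on which the quadratic character is trivial. -/
theorem gaussFactor_mul_sq (hq : Odd (resCard F)) {e : AddChar F Circle} (he : IsUnramified e) {x s : F}
    (hx : x ≠ 0) (hs : s ≠ 0) : gaussFactor e (x * s ^ 2) = gaussFactor e x := by
  classical
  have hq0 := (resCard_pos F).ne'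
  obtain ⟨ϖ, hϖ⟩ := exists_uniformizer F
  have hϖ0 := uniformizer_ne_zero hϖ
  have := Fintype.ofFinite 𝓀[F]
  obtain ⟨i, hi⟩ := exists_absF_eq_zpow hs
  obtain ⟨j, hj | hj⟩ := exists_absF_even_or_odd hx
  · rw [gaussFactor_even hq he hj, gaussFactor_even hq he (j := j + i)]
    rw [absF_mul, absF_pow, hj, hi, ← zpow_natCast, ← zpow_mul, ← zpow_add₀ hq0]
    congr 1; push_cast; ring
  · have hv : absF ((s * ϖ ^ i) ^ 2) = 1 := by
      rw [absF_pow, absF_mul, hi, absF_uniformizer_zpow hϖ, ← zpow_add₀ hq0]; simp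
    rw [gaussFactor_odd hq he hϖ hj, gaussFactor_odd hq he hϖ (j := j + i),
      show x * s ^ 2 * (ϖ ^ (j + i)) ^ 2 = x * (ϖ ^ j) ^ 2 * (s * ϖ ^ i) ^ 2 by
        rw [zpow_add₀ hϖ0]; ring, he.residueGauss_mul_unit hq (absF_odd_level hϖ hj) hv,
      quadC_red hq hv hϖ, hilbertSymbol_of_isSquare _ ⟨_, sq _⟩]
    · simp
    · rw [absF_mul, absF_pow, hj, hi, ← zpow_natCast, ← zpow_mul, ← zpow_add₀ hq0]
      congr 1; push_cast; ring

/-- This is the evaluation χ(-1)q of the square of the quadratic Gauss sum, divided by q. -/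
theorem gaussFactor_uniformizer_sq (hq : Odd (resCard F)) {e : AddChar F Circle} (he : IsUnramified e)
    {ϖ : F} (hϖ : absF ϖ = (resCard F : ℝ)⁻¹) :
    gaussFactor e ϖ * gaussFactor e ϖ = ((hilbertSymbol (-1) ϖ : ℤ) : ℂ) := by
  classical
  have := Fintype.ofFinite 𝓀[F]
  have hϖ' : absF ϖ = (resCard F : ℝ) ^ (2 * (-1) + 1 : ℤ) := by rw [hϖ]; norm_num
  have hs : (√(resCard F : ℝ) : ℂ) * √(resCard F : ℝ) = resCard F := by
    rw [← Complex.ofReal_mul, Real.mul_self_sqrt (resCard_pos F).le, Complex.ofReal_natCast]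
  have hq0' : (resCard F : ℂ) ≠ 0 := by exact_mod_cast resCard_ne_zero F
  rw [gaussFactor_odd hq he hϖ hϖ']
  have h := he.residueGauss_sq hq (absF_odd_level hϖ hϖ')
  have h1 : red (-1 : F) = -1 := by rw [red_neg (by simp), red_one]
  rw [← h1, quadC_red hq (by simp) hϖ] at h
  calc _ = ((√(resCard F : ℝ) : ℂ) * √(resCard F : ℝ))⁻¹ *
        residueGauss e (ϖ * (ϖ ^ (-1 : ℤ)) ^ 2) ^ 2 := by rw [mul_inv]; ring
    _ = _ := by rw [hs, h]; field_simp

/-- Both sides depend only on the classes of x and y modulo squares, which leaves units and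
uniformizers times units. The case of two uniformizers rests on the square of the Gauss sum. This is
Weil's relation, through which metaplectic signs cancel against Weil indices. -/
theorem gaussFactor_mul (hq : Odd (resCard F)) {e : AddChar F Circle} (he : IsUnramified e) {x y : F}
    (hx : x ≠ 0) (hy : y ≠ 0) :
    gaussFactor e x * gaussFactor e y = ((hilbertSymbol x y : ℤ) : ℂ) * gaussFactor e (x * y) := by
  obtain ⟨ϖ, hϖ⟩ := exists_uniformizer F
  have hϖ0 := uniformizer_ne_zero hϖ
  have hϖ' : absF ϖ = (resCard F : ℝ) ^ (2 * (-1) + 1 : ℤ) := by rw [hϖ]; norm_num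
  obtain ⟨u, s, hu, hs, h1⟩ := exists_eq_unit_mul_sq hϖ hx
  obtain ⟨v, t, hv, ht, h2⟩ := exists_eq_unit_mul_sq hϖ hy
  have hu0 : u ≠ 0 := by rintro rfl; simp at hu
  have hv0 : v ≠ 0 := by rintro rfl; simp at hv
  have huv : absF (u * v) = 1 := by simp [hu, hv]
  have red1 : ∀ a b : F, a ≠ 0 → b ≠ 0 →
      (gaussFactor e a * gaussFactor e b = ((hilbertSymbol a b : ℤ) : ℂ) * gaussFactor e (a * b)) →
      gaussFactor e (a * s ^ 2) * gaussFactor e (b * t ^ 2) =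
        ((hilbertSymbol (a * s ^ 2) (b * t ^ 2) : ℤ) : ℂ) * gaussFactor e (a * s ^ 2 * (b * t ^ 2)) := by
    intro a b ha hb hab
    rw [show a * s ^ 2 * (b * t ^ 2) = a * b * (s * t) ^ 2 by ring, gaussFactor_mul_sq hq he ha hs,
      gaussFactor_mul_sq hq he hb ht, gaussFactor_mul_sq hq he (mul_ne_zero ha hb) (mul_ne_zero hs ht),
      hilbertSymbol_sq_mul _ _ hs, hilbertSymbol_mul_sq _ _ ht, hab]
  rcases h1 with rfl | rfl <;> rcases h2 with rfl | rfl
  · refine red1 _ _ hu0 hv0 ?_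
    rw [gaussFactor_unit hq he hu, gaussFactor_unit hq he hv, gaussFactor_unit hq he huv,
      hilbertSymbol_units hq hu hv]
    simp
  · refine red1 _ _ hu0 (mul_ne_zero hϖ0 hv0) ?_
    have h3 : absF (ϖ * v) = (resCard F : ℝ) ^ (2 * (-1) + 1 : ℤ) := by rw [absF_mul, hv, mul_one, hϖ']
    rw [gaussFactor_unit hq he hu, mul_comm u (ϖ * v), gaussFactor_mul_unit_of_odd hq he hϖ h3 hu,
      hilbertSymbol_unit_uniformizer_mul hq hu hv hϖ, ← mul_assoc, intCast_units_mul_self]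
  · refine red1 _ _ (mul_ne_zero hϖ0 hu0) hv0 ?_
    have h3 : absF (ϖ * u) = (resCard F : ℝ) ^ (2 * (-1) + 1 : ℤ) := by rw [absF_mul, hu, mul_one, hϖ']
    rw [gaussFactor_unit hq he hv, gaussFactor_mul_unit_of_odd hq he hϖ h3 hv, hilbertSymbol_comm,
      hilbertSymbol_unit_uniformizer_mul hq hv hu hϖ, ← mul_assoc, intCast_units_mul_self]
    simp
  · refine red1 _ _ (mul_ne_zero hϖ0 hu0) (mul_ne_zero hϖ0 hv0) ?_
    rw [gaussFactor_mul_unit_of_odd hq he hϖ hϖ' hu, gaussFactor_mul_unit_of_odd hq he hϖ hϖ' hv,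
      show ϖ * u * (ϖ * v) = u * v * ϖ ^ 2 by ring,
      gaussFactor_mul_sq hq he (mul_ne_zero hu0 hv0) hϖ0, gaussFactor_unit hq he huv, mul_one,
      hilbertSymbol_uniformizers hq hu hv hϖ, show -u * v = (-1) * (u * v) by ring,
      hilbertSymbol_unit_mul_uniformizer hq (by simp) huv hϖ,
      hilbertSymbol_unit_mul_uniformizer hq hu hv hϖ]
    push_cast
    linear_combination (((hilbertSymbol u ϖ : ℤ) : ℂ) * ((hilbertSymbol v ϖ : ℤ) : ℂ)) *
      gaussFactor_uniformizer_sq hq he hϖ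

end GaussIntegral

/-! ## The Weil index -/

section Schwartz

variable {F : Type*} [Field F] [ValuativeRel F] [TopologicalSpace F] [IsNonarchimedeanLocalField F]

/-- Finitely many balls on which φ is constant cover the support. By the ultrametric inequality the
smallest of their radii is a period of φ everywhere. -/
theorem IsSchwartz.exists_invariant {φ : F → ℂ} (hφ : IsSchwartz φ) :
    ∃ t₀ : F, t₀ ≠ 0 ∧ ∀ x t, absF t ≤ absF t₀ → φ (x + t) = φ x := by
  have hloc : ∀ x : F, ∃ y : F, y ≠ 0 ∧ ∀ t, absF t ≤ absF y → φ (x + t) = φ x := by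
    intro x
    have h1 := (IsLocallyConstant.iff_eventually_eq φ).1 hφ.1 x
    have h2 : Filter.Tendsto (fun t => x + t) (nhds 0) (nhds x) := by
      have : Continuous fun t : F => x + t := by fun_prop
      simpa using this.tendsto 0
    exact exists_ne_zero_of_mem_nhds (h2 h1)
  choose y hy0 hy using hloc
  obtain ⟨s, hs⟩ := hφ.2.isCompact.elim_nhds_subcover (fun x => {z | absF (z - x) ≤ absF (y x)})
    (fun x _ => by
      have h2 : Filter.Tendsto (fun z => z - x) (nhds x) (nhds 0) := by
        have : Continuous fun z : F => z - x := by fun_prop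
        simpa using this.tendsto x
      exact h2 (mem_nhds_zero_of_absF_le (hy0 x)))
  have hmin : ∃ t₀ : F, t₀ ≠ 0 ∧ ∀ x ∈ s, absF t₀ ≤ absF (y x) := by
    rcases s.eq_empty_or_nonempty with rfl | hne
    · exact ⟨1, one_ne_zero, by simp⟩
    · obtain ⟨x, hx, h⟩ := s.exists_min_image (fun x => absF (y x)) hne
      exact ⟨y x, hy0 x, h⟩
  obtain ⟨t₀, ht0, ht⟩ := hmin
  refine ⟨t₀, ht0, ?_⟩
  have key : ∀ x ∈ tsupport φ, ∀ t, absF t ≤ absF t₀ → φ (x + t) = φ x := by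
    intro x hx t htt
    have := hs.2 hx
    simp only [Set.mem_iUnion, Set.mem_ofPred_eq, exists_prop] at this
    obtain ⟨x₁, hx₁, hxx⟩ := this
    have e1 := hy x₁ (x - x₁ + t) (absF_add_le hxx (htt.trans (ht x₁ hx₁)))
    have e2 := hy x₁ (x - x₁) hxx
    rw [show x₁ + (x - x₁ + t) = x + t by ring] at e1
    rw [show x₁ + (x - x₁) = x by ring] at e2
    rw [e1, e2]
  intro x t htt
  by_cases hx : x ∈ tsupport φ
  · exact key x hx t htt
  · by_cases hxt : x + t ∈ tsupport φ
    · have := key (x + t) hxt (-t) (by simpa using htt)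
      rw [add_neg_cancel_right] at this
      exact this.symm
    · rw [image_eq_zero_of_notMem_tsupport hx, image_eq_zero_of_notMem_tsupport hxt]

theorem exists_ball_of_isCompact {s : Set F} (hs : IsCompact s) : ∃ n : ℤ, s ⊆ ball F n := by
  obtain ⟨M, hM⟩ := hs.exists_bound_of_continuousOn (f := absF) continuous_absF.continuousOn
  obtain ⟨n, hn⟩ := pow_unbounded_of_one_lt M (one_lt_resCard F)
  refine ⟨n, fun x hx => ?_⟩
  rw [mem_ball, zpow_natCast]
  exact ((le_abs_self _).trans (hM x hx)).trans hn.le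

end Schwartz

/-! ### Computation of the Weil index. -/

section WeilIndex

variable {F : Type*} [Field F] [ValuativeRel F] [TopologicalSpace F] [IsNonarchimedeanLocalField F]
  {ψ : AddChar F Circle} {δ : F}

theorem eq_mulShift (hδ : δ ≠ 0) (x : F) : ψ x = ψ.mulShift δ⁻¹ (δ * x) := by
  rw [AddChar.mulShift_apply, inv_mul_cancel_left₀ hδ]

theorem continuous_of_isUnramified (hδ : δ ≠ 0) (he : IsUnramified (ψ.mulShift δ⁻¹)) : Continuous ψ := by
  have : (ψ : F → Circle) = fun x => ψ.mulShift δ⁻¹ (δ * x) := funext (eq_mulShift hδ)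
  rw [this]
  exact he.continuous.comp (by fun_prop)

theorem continuous_coe_of_isUnramified (hδ : δ ≠ 0) (he : IsUnramified (ψ.mulShift δ⁻¹)) :
    Continuous fun x => (ψ x : ℂ) :=
  continuous_induced_dom.comp (continuous_of_isUnramified hδ he)

variable [MeasurableSpace F] [BorelSpace F]

/-- Translating by a period t of φ multiplies the integral by ψ(yt). For large y there is a period
with ψ(yt) ≠ 1, so the integral vanishes. -/
theorem exists_fourier_eq_zero (hδ : δ ≠ 0) (he : IsUnramified (ψ.mulShift δ⁻¹)) {φ : F → ℂ}
    (hφ : IsSchwartz φ) : ∃ n : ℤ, ∀ y, y ∉ ball F n → fourier ψ δ φ y = 0 := by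
  obtain ⟨t₀, ht0, ht⟩ := hφ.exists_invariant
  obtain ⟨x, hx, hxne⟩ := he.exists_ne_one
  rw [AddChar.mulShift_apply] at hxne
  obtain ⟨n, hn⟩ := exists_absF_le_zpow (δ⁻¹ * x / t₀)
  refine ⟨n, fun y hy => ?_⟩
  have hy0 : y ≠ 0 := by
    rintro rfl
    exact hy (by rw [mem_ball, absF_zero]; exact (zpow_pos (resCard_pos F) n).le)
  set t := δ⁻¹ * x / y with htd
  have htle : absF t ≤ absF t₀ := by
    rw [htd, absF_div, div_le_iff₀ (absF_pos hy0), mul_comm (absF t₀), ← div_le_iff₀ (absF_pos ht0), ← absF_div]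
    exact hn.trans (not_le.1 hy).le
  have h1 : ∫ z, φ z * (ψ (y * z) : ℂ) ∂(haarF F) = ψ (δ⁻¹ * x) * ∫ z, φ z * (ψ (y * z) : ℂ) ∂(haarF F) := by
    rw [← integral_const_mul, ← integral_add_right_eq_self _ t]
    congr 1 with z
    rw [ht z t htle, mul_add, IsUnramified.coe_add, show y * t = δ⁻¹ * x by rw [htd]; field_simp]
    ring
  have h2 : (1 - (ψ (δ⁻¹ * x) : ℂ)) * ∫ z, φ z * (ψ (y * z) : ℂ) ∂(haarF F) = 0 := by
    linear_combination h1
  rw [fourier]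
  rcases mul_eq_zero.1 h2 with h | h
  · exact absurd (Circle.ext (by rw [Circle.coe_one]; linear_combination -h)) hxne
  · rw [h, mul_zero]

theorem gaussFactor_mul_neg (hq : Odd (resCard F)) {e : AddChar F Circle} (he : IsUnramified e) {x : F}
    (hx : x ≠ 0) : gaussFactor e x * gaussFactor e (-x) = 1 := by
  rw [gaussFactor_mul hq he hx (neg_ne_zero.2 hx), hilbertSymbol_neg_self,
    show x * -x = -1 * x ^ 2 by ring, gaussFactor_mul_sq hq he (by simp) hx, gaussFactor_unit hq he (by simp)]
  simp

/-- Interchange the integrations and complete the square: yz - y²/(4a) = az² - (y - 2az)²/(4a). The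
inner integral becomes the Gauss integral of -δ/(4a), which agrees with -aδ up to a square. -/
theorem integral_fourier_mul (hq : Odd (resCard F)) (hδ : δ ≠ 0) (he : IsUnramified (ψ.mulShift δ⁻¹))
    {φ : F → ℂ} (hφ : IsSchwartz φ) {a : F} (ha : a ≠ 0) :
    ∫ y, fourier ψ δ φ y * (ψ (-(y ^ 2 / (4 * a))) : ℂ) ∂(haarF F) =
      (√(absF a) : ℂ) * gaussFactor (ψ.mulShift δ⁻¹) (-(a * δ)) *
        ∫ y, φ y * (ψ (a * y ^ 2) : ℂ) ∂(haarF F) := by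
  have h2 := two_ne_zero_of_odd hq
  have h4 : (4 : F) ≠ 0 := by rw [show (4 : F) = 2 ^ 2 by norm_num]; exact pow_ne_zero 2 h2
  set β := -(δ / (4 * a)) with hβ
  have hβ0 : β ≠ 0 := neg_ne_zero.2 (div_ne_zero hδ (mul_ne_zero h4 ha))
  obtain ⟨k, hk⟩ := exists_absF_eq_zpow hβ0
  obtain ⟨n₁, hn₁⟩ := exists_fourier_eq_zero hδ he hφ
  obtain ⟨n₂, hn₂⟩ := exists_ball_of_isCompact (hφ.2.isCompact.image
    (by fun_prop : Continuous fun z : F => 2 * a * z))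
  -- The radius qⁿ is large enough for three purposes: the Gauss integral of β has become stable,
  -- the Fourier transform vanishes outside the ball, and the shifts by 2az with z in the support of
  -- φ preserve the ball.
  set n := max |k| (max n₁ n₂) with hn
  have hkn : 0 ≤ k + 2 * n := by
    have h1 : |k| ≤ n := le_max_left _ _
    have h2 := neg_abs_le k
    have h3 := abs_nonneg k
    omega
  have hnn₁ : n₁ ≤ n := (le_max_left _ _).trans (le_max_right _ _)
  have hnn₂ : n₂ ≤ n := (le_max_right _ _).trans (le_max_right _ _)
  have hψ := continuous_coe_of_isUnramified hδ he
  have hφc : Continuous φ := hφ.1.continuous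
  -- The double integral.
  let f : F → F → ℂ := fun y z => (ball F n).indicator (1 : F → ℂ) y *
    (φ z * ((ψ (y * z) : ℂ) * (ψ (-(y ^ 2 / (4 * a))) : ℂ)))
  have hind : Continuous ((ball F n).indicator (1 : F → ℂ)) :=
    (isClopen_ball n).continuous_indicator continuous_const
  have hfc : Continuous (Function.uncurry f) := by
    refine (hind.comp continuous_fst).mul ((hφc.comp continuous_snd).mul ((hψ.comp ?_).mul (hψ.comp ?_)))
    · fun_prop
    · fun_prop
  have hfs : HasCompactSupport (Function.uncurry f) := by
    refine HasCompactSupport.intro ((isCompact_ball n).prod hφ.2.isCompact) fun p hp => ?_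
    rw [Set.mem_prod, not_and_or] at hp
    change _ * (_ * _) = 0
    rcases hp with hp | hp
    · rw [Set.indicator_of_notMem hp, zero_mul]
    · rw [image_eq_zero_of_notMem_tsupport hp, zero_mul, mul_zero]
  have hL : ∫ y, fourier ψ δ φ y * (ψ (-(y ^ 2 / (4 * a))) : ℂ) ∂(haarF F) =
      (√(absF δ) : ℂ) * ∫ y, ∫ z, f y z ∂(haarF F) ∂(haarF F) := by
    rw [← integral_const_mul]
    congr 1 with y
    simp only [f]
    rw [integral_const_mul]
    by_cases hy : y ∈ ball F n
    · rw [Set.indicator_of_mem hy, Pi.one_apply, one_mul, fourier, mul_assoc, ← integral_mul_const]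
      simp only [mul_assoc]
    · rw [Set.indicator_of_notMem hy, hn₁ y fun h => hy (ball_subset hnn₁ h)]
      simp
  have hinner : ∀ z, ∫ y, f y z ∂(haarF F) = gaussIntegral (ψ.mulShift δ⁻¹) β n * (φ z * (ψ (a * z ^ 2) : ℂ)) := by
    intro z
    by_cases hz : φ z = 0
    · simp [f, hz]
    have hz2 : 2 * a * z ∈ ball F n :=
      ball_subset hnn₂ (hn₂ (Set.mem_image_of_mem _ (subset_tsupport φ hz)))
    have e1 : ∫ y, f y z ∂(haarF F) =
        φ z * ∫ y in ball F n, (ψ (y * z + -(y ^ 2 / (4 * a))) : ℂ) ∂(haarF F) := by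
      rw [← integral_indicator (measurableSet_ball n), ← integral_const_mul]
      congr 1 with y
      by_cases hy : y ∈ ball F n
      · simp [f, Set.indicator_of_mem hy, IsUnramified.coe_add]
      · simp [f, Set.indicator_of_notMem hy]
    rw [e1, ← setIntegral_ball_add _ hz2, gaussIntegral]
    rw [mul_left_comm, ← integral_mul_const]
    congr 1
    refine setIntegral_congr_fun (measurableSet_ball n) fun y _ => ?_
    rw [AddChar.mulShift_apply, ← IsUnramified.coe_add]
    congr 2
    rw [hβ]
    field_simp
    ring
  rw [hL, integral_integral_swap_of_hasCompactSupport hfc hfs]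
  simp only [hinner]
  rw [integral_const_mul, ← mul_assoc]
  congr 1
  have hg := gaussFactor_eq hq he hk hkn
  have e2 : gaussFactor (ψ.mulShift δ⁻¹) (-(a * δ)) = gaussFactor (ψ.mulShift δ⁻¹) β := by
    rw [show -(a * δ) = β * (2 * a) ^ 2 by rw [hβ]; field_simp; norm_num,
      gaussFactor_mul_sq hq he hβ0 (mul_ne_zero h2 ha)]
  have e3 : absF β = absF δ / absF a := by
    rw [hβ, absF_neg, absF_div, absF_mul, show (4 : F) = 2 ^ 2 by norm_num, absF_pow, absF_two hq]
    simp
  rw [e2, hg, e3, Real.sqrt_div (absF_nonneg δ), ← mul_assoc]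
  congr 1
  have ha' : (√(absF a) : ℂ) ≠ 0 := by
    exact_mod_cast (Real.sqrt_pos.2 (absF_pos ha)).ne'
  push_cast
  field_simp

theorem isSchwartz_indicator_ball (n : ℤ) : IsSchwartz ((ball F n).indicator (1 : F → ℂ)) := by
  refine ⟨?_, HasCompactSupport.intro (isCompact_ball n) fun x hx => Set.indicator_of_notMem hx _⟩
  obtain ⟨y, hy0, hy⟩ := exists_absF_eq (F := F) n
  refine isLocallyConstant_of_add _ y hy0 fun x t ht => ?_
  have ht' : t ∈ ball F n := by rw [mem_ball, ← hy]; exact ht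
  by_cases hx : x ∈ ball F n
  · rw [Set.indicator_of_mem hx, Set.indicator_of_mem (show x + t ∈ ball F n from absF_add_le hx ht')]
    rfl
  · rw [Set.indicator_of_notMem hx, Set.indicator_of_notMem]
    intro h
    have := absF_sub_le h ht'
    rw [add_sub_cancel_right] at this
    exact hx this

/-- The Weil index is the normalized Gauss integral. -/
theorem weilIndex_eq (hq : Odd (resCard F)) (hδ : δ ≠ 0) (he : IsUnramified (ψ.mulShift δ⁻¹)) {a : F}
    (ha : a ≠ 0) : weilIndex ψ δ a = gaussFactor (ψ.mulShift δ⁻¹) (a * δ) := by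
  have haδ := mul_ne_zero ha hδ
  have hs : (√(absF a) : ℂ) ≠ 0 := by exact_mod_cast (Real.sqrt_pos.2 (absF_pos ha)).ne'
  have hprod := gaussFactor_mul_neg hq he haδ
  have habs : absF (2 * a) = absF a := by rw [absF_mul, absF_two hq, one_mul]
  have key : ∀ α : ℂ, ∀ φ : F → ℂ, IsSchwartz φ → α * ((√(absF (2 * a)))⁻¹ : ℝ) *
        ∫ y, fourier ψ δ φ y * (ψ (-(y ^ 2 / (4 * a))) : ℂ) ∂(haarF F) =
      α * gaussFactor (ψ.mulShift δ⁻¹) (-(a * δ)) * ∫ y, φ y * (ψ (a * y ^ 2) : ℂ) ∂(haarF F) := by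
    intro α φ hφ
    rw [integral_fourier_mul hq hδ he hφ ha, habs]
    push_cast
    field_simp
  have hex : ∃ α : ℂ, ∀ φ : F → ℂ, IsSchwartz φ →
    ∫ y, φ y * (ψ (a * y ^ 2) : ℂ) ∂(haarF F) =
      α * ((√(absF (2 * a)))⁻¹ : ℝ) *
        ∫ y, fourier ψ δ φ y * (ψ (-(y ^ 2 / (4 * a))) : ℂ) ∂(haarF F) :=
    ⟨gaussFactor (ψ.mulShift δ⁻¹) (a * δ), fun φ hφ => by rw [key _ φ hφ, hprod, one_mul]⟩
  have hspec := Classical.epsilon_spec hex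
  obtain ⟨k, hk⟩ := exists_absF_eq_zpow haδ
  -- Uniqueness: ψ(ay²) = 1 on the ball of radius q^(-|k|), so this test function has a non-zero
  -- integral and determines the constant selected by `Classical.epsilon`.
  have h1 := hspec _ (isSchwartz_indicator_ball (-|k|))
  rw [key _ _ (isSchwartz_indicator_ball (-|k|))] at h1
  have hI : ∫ y, (ball F (-|k|)).indicator (1 : F → ℂ) y * (ψ (a * y ^ 2) : ℂ) ∂(haarF F) ≠ 0 := by
    have : (fun y => (ball F (-|k|)).indicator (1 : F → ℂ) y * (ψ (a * y ^ 2) : ℂ)) =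
        (ball F (-|k|)).indicator fun _ => (1 : ℂ) := by
      ext y
      by_cases hy : y ∈ ball F (-|k|)
      · rw [Set.indicator_of_mem hy, Set.indicator_of_mem hy, Pi.one_apply, one_mul, eq_mulShift hδ]
        refine he.coe_eq_one ?_
        rw [show δ * (a * y ^ 2) = a * δ * y ^ 2 by ring, absF_mul, absF_pow, hk]
        calc _ ≤ (resCard F : ℝ) ^ k * ((resCard F : ℝ) ^ (-|k|)) ^ 2 := by
              gcongr
              · exact absF_nonneg _
              · exact hy
          _ = (resCard F : ℝ) ^ (k - 2 * |k|) := by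
              rw [← zpow_natCast, ← zpow_mul, ← zpow_add₀ (resCard_pos F).ne']
              congr 1; push_cast; ring
          _ ≤ 1 := zpow_le_one_of_nonpos₀ (one_lt_resCard F).le (by
              have := le_abs_self k
              have := abs_nonneg k
              omega)
      · rw [Set.indicator_of_notMem hy, Set.indicator_of_notMem hy, zero_mul]
    rw [this, integral_indicator (measurableSet_ball _), integral_ball_one]
    exact zpow_ne_zero _ (by exact_mod_cast resCard_ne_zero F)
  have h2 : weilIndex ψ δ a * gaussFactor (ψ.mulShift δ⁻¹) (-(a * δ)) = 1 := by
    refine mul_right_cancel₀ hI ?_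
    rw [one_mul]
    exact h1.symm
  calc weilIndex ψ δ a = weilIndex ψ δ a * (gaussFactor (ψ.mulShift δ⁻¹) (a * δ) *
        gaussFactor (ψ.mulShift δ⁻¹) (-(a * δ))) := by rw [hprod, mul_one]
    _ = (weilIndex ψ δ a * gaussFactor (ψ.mulShift δ⁻¹) (-(a * δ))) *
        gaussFactor (ψ.mulShift δ⁻¹) (a * δ) := by ring
    _ = _ := by rw [h2, one_mul]

/-- Rescaling by δ moves the conductor of ψ to the ring of integers; the maximality of c supplies a
point where the rescaled character is not 1. From here on only this rescaled character matters. -/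
theorem isUnramified_of_isIndex {c : ℤ} (hc : IsIndex ψ c) (hδ : absF δ = (resCard F : ℝ) ^ (-c)) :
    IsUnramified (ψ.mulShift δ⁻¹) := by
  have hq0 := resCard_pos F
  have hδ0 : δ ≠ 0 := by
    rintro rfl; rw [absF_zero] at hδ; exact (zpow_pos hq0 _).ne hδ
  refine ⟨fun x hx => ?_, ?_⟩
  · rw [AddChar.mulShift_apply]
    refine hc.1 _ ?_
    rw [absF_mul, absF_inv, hδ, zpow_neg, inv_inv]
    exact mul_le_of_le_one_right (zpow_pos hq0 c).le hx
  · have : c + 1 ∉ {k : ℤ | ∀ x : F, absF x ≤ (resCard F : ℝ) ^ k → ψ x = 1} := fun h => by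
      have := hc.2 h
      omega
    simp only [Set.mem_ofPred_eq, not_forall] at this
    obtain ⟨x, hx, hne⟩ := this
    refine ⟨δ * x, ?_, by rwa [AddChar.mulShift_apply, inv_mul_cancel_left₀ hδ0]⟩
    rw [absF_mul, hδ]
    calc _ ≤ (resCard F : ℝ) ^ (-c) * (resCard F : ℝ) ^ (c + 1) := by gcongr
      _ = resCard F := by rw [← zpow_add₀ hq0.ne']; simp

end WeilIndex

/-! ## The sign character of the maximal compact subgroup -/

section SignCharacter

variable {F : Type*} [Field F] [ValuativeRel F] [TopologicalSpace F] [IsNonarchimedeanLocalField F]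

/-- The conditions defining `Γ₀(1)`. -/
structure IsGamma (δ : F) (g : SL(2, F)) : Prop where
  a_le : absF (g.1 0 0) ≤ 1
  b_le : absF (g.1 0 1) ≤ (absF δ)⁻¹
  c_le : absF (g.1 1 0) ≤ absF δ
  d_le : absF (g.1 1 1) ≤ 1

theorem mem_GammaTilde {δ : F} {γ : Mp2 F} : γ ∈ GammaTilde δ ↔ IsGamma δ γ.g :=
  ⟨fun h => ⟨h.1, h.2.1, h.2.2.1, h.2.2.2⟩, fun h => ⟨h.1, h.2, h.3, h.4⟩⟩

theorem absF_mul_lt_one {x y : F} (hx : absF x < 1) (hy : absF y ≤ 1) : absF (x * y) < 1 := by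
  rw [absF_mul]
  exact (mul_le_of_le_one_right (absF_nonneg x) hy).trans_lt hx

theorem absF_mul_le {x y : F} {r s : ℝ} (hx : absF x ≤ r) (hy : absF y ≤ s) : absF (x * y) ≤ r * s := by
  rw [absF_mul]
  exact mul_le_mul hx hy (absF_nonneg y) ((absF_nonneg x).trans hx)

theorem absF_add_lt {x y : F} {r : ℝ} (hx : absF x < r) (hy : absF y < r) : absF (x + y) < r :=
  (absF_add_le_max x y).trans_lt (max_lt hx hy)

namespace IsGamma

variable {δ : Fˣ} {g h : SL(2, F)}

theorem c_div_le (hg : IsGamma (δ : F) g) : absF (g.1 1 0 / δ) ≤ 1 := by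
  rw [absF_div, div_le_one (absF_pos δ.ne_zero)]; exact hg.c_le

theorem b_mul_le (hg : IsGamma (δ : F) g) : absF (g.1 0 1 * δ) ≤ 1 := by
  rw [absF_mul, ← le_div_iff₀ (absF_pos δ.ne_zero), one_div]; exact hg.b_le

theorem of_le (h1 : absF (g.1 0 0) ≤ 1) (h2 : absF (g.1 0 1 * δ) ≤ 1) (h3 : absF (g.1 1 0 / δ) ≤ 1)
    (h4 : absF (g.1 1 1) ≤ 1) : IsGamma (δ : F) g := by
  refine ⟨h1, ?_, ?_, h4⟩
  · rwa [absF_mul, ← le_div_iff₀ (absF_pos δ.ne_zero), one_div] at h2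
  · rwa [absF_div, div_le_one (absF_pos δ.ne_zero)] at h3

theorem mul (hg : IsGamma (δ : F) g) (hh : IsGamma (δ : F) h) : IsGamma (δ : F) (g * h) := by
  have hδ := δ.ne_zero
  refine of_le ?_ ?_ ?_ ?_
  · rw [SL2_mul_00, show g.1 0 1 * h.1 1 0 = (g.1 0 1 * δ) * (h.1 1 0 / δ) by field_simp]
    exact absF_add_le (absF_mul_le_one hg.a_le hh.a_le) (absF_mul_le_one hg.b_mul_le hh.c_div_le)
  · rw [SL2_mul_01, show (g.1 0 0 * h.1 0 1 + g.1 0 1 * h.1 1 1) * δ =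
      g.1 0 0 * (h.1 0 1 * δ) + (g.1 0 1 * δ) * h.1 1 1 by ring]
    exact absF_add_le (absF_mul_le_one hg.a_le hh.b_mul_le) (absF_mul_le_one hg.b_mul_le hh.d_le)
  · rw [SL2_mul_10, show (g.1 1 0 * h.1 0 0 + g.1 1 1 * h.1 1 0) / δ =
      (g.1 1 0 / δ) * h.1 0 0 + g.1 1 1 * (h.1 1 0 / δ) by field_simp]
    exact absF_add_le (absF_mul_le_one hg.c_div_le hh.a_le) (absF_mul_le_one hg.d_le hh.c_div_le)
  · rw [SL2_mul_11, show g.1 1 0 * h.1 0 1 = (g.1 1 0 / δ) * (h.1 0 1 * δ) by field_simp]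
    exact absF_add_le (absF_mul_le_one hg.c_div_le hh.b_mul_le) (absF_mul_le_one hg.d_le hh.d_le)

theorem one : IsGamma (δ : F) 1 := by
  refine ⟨?_, ?_, ?_, ?_⟩ <;> simp [absF_nonneg]

theorem inv (hg : IsGamma (δ : F) g) : IsGamma (δ : F) g⁻¹ := by
  refine ⟨?_, ?_, ?_, ?_⟩
  · rw [SL2_inv_00]; exact hg.d_le
  · rw [SL2_inv_01, absF_neg]; exact hg.b_le
  · rw [SL2_inv_10, absF_neg]; exact hg.c_le
  · rw [SL2_inv_11]; exact hg.a_le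

theorem c_div_lt (hg : IsGamma (δ : F) g) (hc : absF (g.1 1 0) ≠ absF (δ : F)) : absF (g.1 1 0 / δ) < 1 := by
  rw [absF_div, div_lt_one (absF_pos δ.ne_zero)]
  exact lt_of_le_of_ne hg.c_le hc

/-- The determinant gives ad - 1 = (c/δ)(bδ), in which c/δ is not a unit. -/
theorem ad_sub_one_lt (hg : IsGamma (δ : F) g) (hc : absF (g.1 1 0) ≠ absF (δ : F)) :
    absF (g.1 0 0 * g.1 1 1 - 1) < 1 := by
  have : g.1 0 0 * g.1 1 1 - 1 = (g.1 1 0 / δ) * (g.1 0 1 * δ) := by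
    have := δ.ne_zero
    field_simp
    linear_combination SL2_det g
  rw [this]
  exact absF_mul_lt_one (hg.c_div_lt hc) hg.b_mul_le

theorem ad_abs (hg : IsGamma (δ : F) g) (hc : absF (g.1 1 0) ≠ absF (δ : F)) :
    absF (g.1 0 0) * absF (g.1 1 1) = 1 := by
  rw [← absF_mul]
  have := absF_eq_of_sub_lt (x := g.1 0 0 * g.1 1 1) (y := 1) (by simpa using hg.ad_sub_one_lt hc)
  simpa using this

theorem d_abs (hg : IsGamma (δ : F) g) (hc : absF (g.1 1 0) ≠ absF (δ : F)) : absF (g.1 1 1) = 1 := by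
  have h := hg.ad_abs hc
  refine le_antisymm hg.d_le ?_
  rw [← h]
  exact mul_le_of_le_one_left (absF_nonneg _) hg.a_le

theorem a_abs (hg : IsGamma (δ : F) g) (hc : absF (g.1 1 0) ≠ absF (δ : F)) : absF (g.1 0 0) = 1 := by
  have h := hg.ad_abs hc
  rwa [hg.d_abs hc, mul_one] at h

end IsGamma

theorem ne_zero_of_absF_eq_one {x : F} (h : absF x = 1) : x ≠ 0 := by
  rintro rfl; simp at h

/-- The sign `λ(g)` with `ε([g, ζ]) = ζ λ(g)`. -/
def lam (δ : F) (g : SL(2, F)) : ℤˣ := by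
  classical
  exact if absF (g.1 1 0) = absF δ then 1 else hilbertSymbol (bEntry g * δ) (g.1 1 1)

variable [hq : Fact (Odd (resCard F))]

theorem hs_eq_zero_of_isSquare_red {u : Fˣ} (hu : absF (u : F) = 1) (h : IsSquare (red (u : F))) (x : Fˣ) :
    hs x u = 0 := by
  rw [hs_comm, hs, hilbertSymbol_of_isSquare _ (isSquare_of_isSquare_red hq.out hu h), signBit_one]

/-- The product uv is congruent to a square, hence a square. Inside a symbol a unit may therefore be
replaced by any congruent one. -/
theorem hs_eq_of_sub_lt {u v : Fˣ} (hu : absF (u : F) = 1) (h : absF ((u : F) - v) < 1) (x : Fˣ) :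
    hs x u = hs x v := by
  have hv : absF (v : F) = 1 := by
    rw [← hu]
    exact absF_eq_of_sub_lt (by rw [absF_sub_comm, hu]; exact h)
  have h1 : hs x (u * v) = 0 := by
    refine hs_eq_zero_of_isSquare_red (by simp [hu, hv]) ?_ x
    rw [Units.val_mul, red_mul hu.le hv.le, (red_eq_red_iff hu.le hv.le).2 h]
    exact ⟨_, rfl⟩
  rw [hs_mul_right] at h1
  grind

/-! ### The sign λ splits the cocycle over Γ₀(1). -/

section

variable {δ : Fˣ} {g h : SL(2, F)}

theorem signBit_lam_of_eq (hc : absF (g.1 1 0) = absF (δ : F)) : signBit (lam (δ : F) g) = 0 := by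
  rw [lam, if_pos hc, signBit_one]

theorem signBit_lam_of_ne (hc : absF (g.1 1 0) ≠ absF (δ : F)) {d : Fˣ} (hd : (d : F) = g.1 1 1) :
    signBit (lam (δ : F) g) = hs (bu g * δ) d := by
  rw [lam, if_neg hc, hs, hd]; rfl

theorem bu_div_of_eq (hc : absF (g.1 1 0) = absF (δ : F)) : ((bu g / δ : Fˣ) : F) = g.1 1 0 / δ := by
  have : g.1 1 0 ≠ 0 := by
    intro h; rw [h, absF_zero] at hc; exact (absF_pos δ.ne_zero).ne hc
  rw [Units.val_div_eq_div_val, val_bu, bEntry_of_ne_zero this]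

theorem absF_bu_div (hc : absF (g.1 1 0) = absF (δ : F)) : absF ((bu g / δ : Fˣ) : F) = 1 := by
  rw [bu_div_of_eq hc, absF_div, hc, div_self (absF_pos δ.ne_zero).ne']

theorem c_div_mul (g h : SL(2, F)) (δ : Fˣ) : (g * h).1 1 0 / (δ : F) =
    (g.1 1 0 / δ) * h.1 0 0 + g.1 1 1 * (h.1 1 0 / δ) := by
  have := δ.ne_zero
  rw [SL2_mul_10]; field_simp

theorem d_mul (g h : SL(2, F)) (δ : Fˣ) : (g * h).1 1 1 =
    (g.1 1 0 / δ) * (h.1 0 1 * δ) + g.1 1 1 * h.1 1 1 := by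
  have := δ.ne_zero
  rw [SL2_mul_11]; field_simp

/-- Let x and y be the units c/δ belonging to g and h. If c/δ is a unit for gh too, the symbols
between these three units vanish. Otherwise the lower right entry D of gh is a unit and satisfies
-xyD ≡ x², which evaluates the symbol defining λ(gh). -/
theorem lam_mul_of_eq_eq (hg : IsGamma (δ : F) g) (hh : IsGamma (δ : F) h) (h1 : absF (g.1 1 0) = absF (δ : F))
    (h2 : absF (h.1 1 0) = absF (δ : F)) :
    signBit (lam (δ : F) (g * h)) = signBit (lam (δ : F) g) + signBit (lam (δ : F) h) + signBit (cocycle g h) := by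
  have h12 := hs_units (absF_bu_div h1) (absF_bu_div h2)
  rw [signBit_lam_of_eq h1, signBit_lam_of_eq h2, signBit_cocycle]
  by_cases h3 : absF ((g * h).1 1 0) = absF (δ : F)
  · have h13 := hs_units (absF_bu_div h1) (absF_bu_div h3)
    have h23 := hs_units (absF_bu_div h2) (absF_bu_div h3)
    have hn := hsNeg_unit (absF_bu_div h3)
    rw [signBit_lam_of_eq h3]
    simp only [hs_neg_left, hs_neg_right, hs_mul_left, hs_mul_right, hs_div_left, hs_div_right, hs_self,
      hsNeg_mul, hsNeg_div] at *
    grind [hs_comm]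
  · have hd := (hg.mul hh).d_abs h3
    rw [signBit_lam_of_ne h3 (d := Units.mk0 _ (ne_zero_of_absF_eq_one hd)) rfl]
    set D : Fˣ := Units.mk0 _ (ne_zero_of_absF_eq_one hd) with hD
    have key : hs (bu (g * h) * δ) (-(bu g / δ * (bu h / δ) * D)) = hs (bu (g * h) * δ) ((bu g / δ) ^ 2) := by
      refine hs_eq_of_sub_lt ?_ ?_ _
      · rw [Units.val_neg, Units.val_mul, Units.val_mul, absF_neg, absF_mul, absF_mul, absF_bu_div h1,
          absF_bu_div h2]
        simpa [hD] using hd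
      · have e : ((-(bu g / δ * (bu h / δ) * D) : Fˣ) : F) - (((bu g / δ) ^ 2 : Fˣ) : F) =
            ((g * h).1 1 0 / δ) * -((g.1 1 0 / δ) * h.1 1 1) := by
          rw [Units.val_neg, Units.val_mul, Units.val_mul, Units.val_pow_eq_pow_val, bu_div_of_eq h1,
            bu_div_of_eq h2, hD, Units.val_mk0, d_mul g h δ, c_div_mul]
          have := δ.ne_zero
          field_simp
          linear_combination (g.1 1 0 ^ 2) * SL2_det h
        rw [e]
        exact absF_mul_lt_one ((hg.mul hh).c_div_lt h3)
          (by rw [absF_neg]; exact absF_mul_le_one hg.c_div_le hh.d_le)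
    simp only [hs_neg_left, hs_neg_right, hs_mul_left, hs_mul_right, hs_div_left, hs_div_right, hs_self,
      hsNeg_mul, hsNeg_div, hs_pow_right] at *
    grind [hs_comm]

/-- Modulo the maximal ideal, c/δ for gh is c/δ for g times a unit a with ad ≡ 1, where a and d are
the diagonal entries of h. This determines the symbols with d. -/
theorem lam_mul_of_eq_ne (hg : IsGamma (δ : F) g) (hh : IsGamma (δ : F) h) (h1 : absF (g.1 1 0) = absF (δ : F))
    (h2 : absF (h.1 1 0) ≠ absF (δ : F)) :
    signBit (lam (δ : F) (g * h)) = signBit (lam (δ : F) g) + signBit (lam (δ : F) h) + signBit (cocycle g h) := by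
  have hd := hh.d_abs h2
  have hcl : absF (g.1 1 0 / δ) = 1 := by rw [← bu_div_of_eq h1, absF_bu_div h1]
  have h3 : absF ((g * h).1 1 0) = absF (δ : F) := by
    have : absF ((g * h).1 1 0 / δ) = 1 := by
      rw [c_div_mul, absF_add_eq_left, absF_mul, hcl, hh.a_abs h2, one_mul]
      rw [absF_mul (g.1 1 0 / _), hcl, hh.a_abs h2, one_mul, mul_comm]
      exact absF_mul_lt_one (hh.c_div_lt h2) hg.d_le
    rwa [absF_div, div_eq_one_iff_eq (absF_pos δ.ne_zero).ne'] at this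
  have h13 := hs_units (absF_bu_div h1) (absF_bu_div h3)
  have hn := hsNeg_unit (absF_bu_div h3)
  rw [signBit_lam_of_eq h1, signBit_lam_of_eq h3, signBit_cocycle,
    signBit_lam_of_ne h2 (d := Units.mk0 _ (ne_zero_of_absF_eq_one hd)) rfl]
  set D : Fˣ := Units.mk0 _ (ne_zero_of_absF_eq_one hd) with hD
  have key : hs (bu h * δ) (bu (g * h) / δ * D) = hs (bu h * δ) (bu g / δ) := by
    refine hs_eq_of_sub_lt ?_ ?_ _
    · rw [Units.val_mul, absF_mul, absF_bu_div h3, one_mul]; exact hd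
    · rw [Units.val_mul, bu_div_of_eq h3, bu_div_of_eq h1, hD, Units.val_mk0, c_div_mul]
      have : (g.1 1 0 / (δ : F) * h.1 0 0 + g.1 1 1 * (h.1 1 0 / δ)) * h.1 1 1 - g.1 1 0 / δ =
          (h.1 1 0 / δ) * (g.1 1 1 * h.1 1 1) + (h.1 0 0 * h.1 1 1 - 1) * (g.1 1 0 / δ) := by ring
      rw [this]
      exact absF_add_lt (absF_mul_lt_one (hh.c_div_lt h2) (absF_mul_le_one hg.d_le hh.d_le))
        (absF_mul_lt_one (hh.ad_sub_one_lt h2) hg.c_div_le)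
  simp only [hs_neg_left, hs_neg_right, hs_mul_left, hs_mul_right, hs_div_left, hs_div_right, hs_self,
    hsNeg_mul, hsNeg_div] at *
  grind [hs_comm]

/-- Modulo the maximal ideal, c/δ for gh is c/δ for h times the unit d of g. -/
theorem lam_mul_of_ne_eq (hg : IsGamma (δ : F) g) (hh : IsGamma (δ : F) h) (h1 : absF (g.1 1 0) ≠ absF (δ : F))
    (h2 : absF (h.1 1 0) = absF (δ : F)) :
    signBit (lam (δ : F) (g * h)) = signBit (lam (δ : F) g) + signBit (lam (δ : F) h) + signBit (cocycle g h) := by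
  have hd := hg.d_abs h1
  have hcl : absF (h.1 1 0 / δ) = 1 := by rw [← bu_div_of_eq h2, absF_bu_div h2]
  have h3 : absF ((g * h).1 1 0) = absF (δ : F) := by
    have : absF ((g * h).1 1 0 / δ) = 1 := by
      rw [c_div_mul, absF_add_eq_right, absF_mul, hcl, hd, one_mul]
      rw [absF_mul (g.1 1 1), hcl, hd, one_mul]
      exact absF_mul_lt_one (hg.c_div_lt h1) hh.a_le
    rwa [absF_div, div_eq_one_iff_eq (absF_pos δ.ne_zero).ne'] at this
  have h23 := hs_units (absF_bu_div h2) (absF_bu_div h3)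
  have hn := hsNeg_unit (absF_bu_div h3)
  rw [signBit_lam_of_eq h2, signBit_lam_of_eq h3, signBit_cocycle,
    signBit_lam_of_ne h1 (d := Units.mk0 _ (ne_zero_of_absF_eq_one hd)) rfl]
  set D : Fˣ := Units.mk0 _ (ne_zero_of_absF_eq_one hd) with hD
  have key : hs (bu g * δ) (bu (g * h) / δ) = hs (bu g * δ) (D * (bu h / δ)) := by
    refine hs_eq_of_sub_lt (absF_bu_div h3) ?_ _
    rw [Units.val_mul, bu_div_of_eq h3, bu_div_of_eq h2, hD, Units.val_mk0, c_div_mul, add_sub_cancel_right]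
    exact absF_mul_lt_one (hg.c_div_lt h1) hh.a_le
  simp only [hs_neg_left, hs_neg_right, hs_mul_left, hs_mul_right, hs_div_left, hs_div_right, hs_self,
    hsNeg_mul, hsNeg_div] at *
  grind [hs_comm]

/-- The lower right entries are units and multiplicative up to congruence. If a lower left entry
vanishes, bilinearity suffices. Otherwise the lower left entries satisfy c₁₂ = c₁a₂ + d₁c₂;
multiplied by c₁₂ this writes a square as a sum of two terms, whose symbol is therefore trivial, and
a₂ may be exchanged for d₂ because a₂d₂ ≡ 1. -/
theorem lam_mul_of_ne_ne (hg : IsGamma (δ : F) g) (hh : IsGamma (δ : F) h) (h1 : absF (g.1 1 0) ≠ absF (δ : F))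
    (h2 : absF (h.1 1 0) ≠ absF (δ : F)) :
    signBit (lam (δ : F) (g * h)) = signBit (lam (δ : F) g) + signBit (lam (δ : F) h) + signBit (cocycle g h) := by
  have hd1 := hg.d_abs h1
  have hd2 := hh.d_abs h2
  have h3 : absF ((g * h).1 1 0) ≠ absF (δ : F) := by
    have : absF ((g * h).1 1 0 / δ) < 1 := by
      rw [c_div_mul, mul_comm (g.1 1 1)]
      exact absF_add_lt (absF_mul_lt_one (hg.c_div_lt h1) hh.a_le) (absF_mul_lt_one (hh.c_div_lt h2) hg.d_le)
    rw [absF_div, div_lt_one (absF_pos δ.ne_zero)] at this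
    exact this.ne
  have hd3 := (hg.mul hh).d_abs h3
  rw [signBit_cocycle, signBit_lam_of_ne h1 (d := Units.mk0 _ (ne_zero_of_absF_eq_one hd1)) rfl,
    signBit_lam_of_ne h2 (d := Units.mk0 _ (ne_zero_of_absF_eq_one hd2)) rfl,
    signBit_lam_of_ne h3 (d := Units.mk0 _ (ne_zero_of_absF_eq_one hd3)) rfl]
  set D₁ : Fˣ := Units.mk0 _ (ne_zero_of_absF_eq_one hd1) with hD₁
  set D₂ : Fˣ := Units.mk0 _ (ne_zero_of_absF_eq_one hd2) with hD₂
  set D₃ : Fˣ := Units.mk0 _ (ne_zero_of_absF_eq_one hd3) with hD₃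
  have keyD : ∀ x, hs x D₃ = hs x D₁ + hs x D₂ := by
    intro x
    rw [← hs_mul_right]
    refine hs_eq_of_sub_lt hd3 ?_ x
    rw [hD₃, hD₁, hD₂, Units.val_mul, Units.val_mk0, Units.val_mk0, Units.val_mk0, d_mul g h δ,
      add_sub_cancel_right]
    exact absF_mul_lt_one (hg.c_div_lt h1) hh.b_mul_le
  have hD12 : hs D₁ D₂ = 0 := hs_units hd1 hd2
  have hn1 : hsNeg D₁ = 0 := hsNeg_unit hd1
  have hn2 : hsNeg D₂ = 0 := hsNeg_unit hd2
  rw [keyD]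
  by_cases z1 : g.1 1 0 = 0
  · have e1 : bu g = D₁ := by ext; rw [val_bu, bEntry_of_eq_zero z1]; rfl
    rw [bu_mul_of_left z1, e1]
    simp only [hs_neg_left, hs_neg_right, hs_mul_left, hs_mul_right, hs_self, hsNeg_mul] at *
    grind [hs_comm]
  by_cases z2 : h.1 1 0 = 0
  · have e1 : bu h = D₂ := by ext; rw [val_bu, bEntry_of_eq_zero z2]; rfl
    obtain ⟨s, e2⟩ := bu_mul_of_right z2 g
    rw [e2, e1]
    simp only [hs_neg_left, hs_neg_right, hs_mul_left, hs_mul_right, hs_self, hsNeg_mul, hs_pow_left, hs_pow_right, hsNeg_pow] at *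
    grind [hs_comm]
  by_cases z3 : (g * h).1 1 0 = 0
  · have e1 : bu (g * h) = D₃ := by ext; rw [val_bu, bEntry_of_eq_zero z3]; rfl
    have hn3 : hsNeg D₃ = 0 := hsNeg_unit hd3
    have h13 : hs D₃ D₁ = 0 := hs_units hd3 hd1
    have h23 : hs D₃ D₂ = 0 := hs_units hd3 hd2
    have k1 := keyD δ
    have k2 := keyD (bu g)
    obtain ⟨s, e2⟩ := bu_mul_of_right z3 g⁻¹
    rw [inv_mul_cancel_left, bu_inv z1, e1] at e2
    rw [e2, e1]
    simp only [hs_neg_left, hs_neg_right, hs_mul_left, hs_mul_right, hs_self, hsNeg_mul, hs_pow_left, hs_pow_right, hsNeg_pow, hsNeg_neg] at *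
    grind [hs_comm]
  set A₂ : Fˣ := Units.mk0 _ (ne_zero_of_absF_eq_one (hh.a_abs h2)) with hA₂
  have keyA : ∀ x, hs x A₂ = hs x D₂ := by
    intro x
    have : hs x (A₂ * D₂) = hs x 1 := by
      refine hs_eq_of_sub_lt ?_ ?_ x
      · rw [Units.val_mul, absF_mul]; exact hh.ad_abs h2
      · exact hh.ad_sub_one_lt h2
    rw [hs_mul_right, hs_one_right] at this
    grind
  have key : hs (bu g * A₂ * bu (g * h)) (D₁ * bu h * bu (g * h)) = 0 := by
    rw [hs, signBit_eq_zero_iff]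
    apply hilbertSymbol_of_add_eq_sq (s := (g * h).1 1 0)
    simp only [Units.val_mul, val_bu, bEntry_of_ne_zero z1, bEntry_of_ne_zero z2, bEntry_of_ne_zero z3,
      hD₁, hA₂, Units.val_mk0]
    rw [SL2_mul_10]
    ring
  have k1 := keyA D₁
  have k2 := keyA (bu h)
  have k3 := keyA (bu (g * h))
  simp only [hs_neg_left, hs_neg_right, hs_mul_left, hs_mul_right, hs_self, hsNeg_mul] at *
  grind [hs_comm]

/-- The defining relation of the section of the metaplectic cover over `Γ₀(1)`. -/
theorem lam_mul (hg : IsGamma (δ : F) g) (hh : IsGamma (δ : F) h) :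
    lam (δ : F) (g * h) = lam (δ : F) g * lam (δ : F) h * cocycle g h := by
  apply signBit_injective
  rw [signBit_mul, signBit_mul]
  by_cases h1 : absF (g.1 1 0) = absF (δ : F) <;> by_cases h2 : absF (h.1 1 0) = absF (δ : F)
  · exact lam_mul_of_eq_eq hg hh h1 h2
  · exact lam_mul_of_eq_ne hg hh h1 h2
  · exact lam_mul_of_ne_eq hg hh h1 h2
  · exact lam_mul_of_ne_ne hg hh h1 h2

end

end SignCharacter

/-! ## The character `ε` -/

section Eps

variable {F : Type*} [Field F] [ValuativeRel F] [TopologicalSpace F] [IsNonarchimedeanLocalField F]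
  [MeasurableSpace F] [BorelSpace F]

theorem conj_gaussFactor (e : AddChar F Circle) (x : F) :
    (starRingEnd ℂ) (gaussFactor e x) = gaussFactor e (-x) := by
  have h1 : gaussLevel (-x) = gaussLevel x := by
    classical
    exact congrArg (fun r : ℝ => if h : ∃ n : ℤ, 1 ≤ r * (resCard F : ℝ) ^ (2 * n) then h.choose else 0)
      (absF_neg x)
  rw [gaussFactor, gaussFactor, h1, absF_neg, map_mul, Complex.conj_ofReal, gaussIntegral, gaussIntegral,
    ← integral_conj]
  congr 2 with y
  rw [neg_mul, AddChar.map_neg_eq_inv, Circle.coe_inv_eq_conj]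

theorem phi0_eq_indicator : phi0 F = (ball F 0).indicator 1 := by
  rw [phi0]
  congr 1
  ext x
  change valuation F x ≤ 1 ↔ absF x ≤ _
  rw [zpow_zero, absF_le_one_iff]

theorem phi0_zero : phi0 F 0 = 1 := by
  rw [phi0_eq_indicator, Set.indicator_of_mem]
  · rfl
  · simp [mem_ball]

variable {ψ : AddChar F Circle} {δ : F}

theorem fourier_weilU_phi0_zero (hδ : δ ≠ 0) (t : F) : fourier ψ δ (weilU ψ t (phi0 F)) 0 =
    (√(absF δ) : ℂ) * gaussIntegral (ψ.mulShift δ⁻¹) (t * δ) 0 := by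
  rw [fourier, gaussIntegral, ← integral_indicator (measurableSet_ball 0)]
  congr 2 with y
  rw [weilU, phi0_eq_indicator]
  by_cases hy : y ∈ ball F 0
  · rw [Set.indicator_of_mem hy, Set.indicator_of_mem hy, eq_mulShift hδ (t * y ^ 2)]
    simp only [Pi.one_apply, mul_one, zero_mul, AddChar.map_zero_eq_one, Circle.coe_one, AddChar.mulShift_apply]
    congr 2
    ring
  · rw [Set.indicator_of_notMem hy, Set.indicator_of_notMem hy]
    simp

theorem weilRep_phi0_of_ne (hq : Odd (resCard F)) (hδ : δ ≠ 0) (he : IsUnramified (ψ.mulShift δ⁻¹))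
    {γ : Mp2 F} (hc : γ.g.1 1 0 ≠ 0) : weilRep ψ δ γ (phi0 F) 0 = ((γ.ζ : ℤ) : ℂ) *
      (gaussFactor (ψ.mulShift δ⁻¹) (-(γ.g.1 1 0 * δ)) * (√(absF (δ / γ.g.1 1 0)) : ℂ) *
        gaussIntegral (ψ.mulShift δ⁻¹) (γ.g.1 1 1 / γ.g.1 1 0 * δ) 0) := by
  have h0 : (-(2 * (γ.g.1 1 0)⁻¹ * 0) : F) = 0 := by ring
  rw [weilRep, if_pos hc, Pi.smul_apply, smul_eq_mul]
  congr 1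
  rw [weilU, weilW, h0, fourier_weilU_phi0_zero hδ, weilIndex_eq hq hδ he hc, conj_gaussFactor,
    absF_mul, absF_two hq, one_mul, absF_div, div_eq_mul_inv (absF δ), Real.sqrt_mul (absF_nonneg _), absF_inv]
  simp
  ring

theorem gaussFactor_ne_zero (hq : Odd (resCard F)) {e : AddChar F Circle} (he : IsUnramified e) {x : F}
    (hx : x ≠ 0) : gaussFactor e x ≠ 0 :=
  left_ne_zero_of_mul_eq_one (gaussFactor_mul_neg hq he hx)

theorem weilIndex_div (hq : Odd (resCard F)) (hδ : δ ≠ 0) (he : IsUnramified (ψ.mulShift δ⁻¹)) {a : F}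
    (ha : a ≠ 0) : weilIndex ψ δ a / weilIndex ψ δ 1 =
      ((hilbertSymbol a δ : ℤ) : ℂ) * gaussFactor (ψ.mulShift δ⁻¹) a := by
  rw [weilIndex_eq hq hδ he ha, weilIndex_eq hq hδ he one_ne_zero, one_mul,
    div_eq_iff (gaussFactor_ne_zero hq he hδ), mul_assoc, gaussFactor_mul hq he ha hδ, ← mul_assoc,
    intCast_units_mul_self, one_mul]

theorem intCast_units_inv (u : ℤˣ) : (((u : ℤ) : ℂ))⁻¹ = ((u : ℤ) : ℂ) :=
  inv_eq_of_mul_eq_one_left (intCast_units_mul_self u)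

theorem weilRep_phi0_of_eq (hq : Odd (resCard F)) (hδ : δ ≠ 0) (he : IsUnramified (ψ.mulShift δ⁻¹))
    {γ : Mp2 F} (hc : γ.g.1 1 0 = 0) (ha : absF (γ.g.1 0 0) = 1) : weilRep ψ δ γ (phi0 F) 0 =
      ((γ.ζ : ℤ) : ℂ) * ((hilbertSymbol (γ.g.1 0 0) δ : ℤ) : ℂ) := by
  have ha0 := ne_zero_of_absF_eq_one ha
  have h1 := weilIndex_div hq hδ he ha0
  rw [gaussFactor_unit hq he ha, mul_one] at h1
  rw [weilRep, if_neg (by simpa using hc), Pi.smul_apply, smul_eq_mul, weilU, weilM, mul_zero, phi0_zero, ha,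
    ← inv_div, h1, intCast_units_inv]
  simp

/-- The character `ε` is the product of the sign with `λ`. -/
theorem eps_eq [hq : Fact (Odd (resCard F))] {δ : Fˣ} (he : IsUnramified (ψ.mulShift (δ : F)⁻¹)) {γ : Mp2 F}
    (hγ : IsGamma (δ : F) γ.g) : eps ψ (δ : F) γ = ((γ.ζ : ℤ) : ℂ) * ((lam (δ : F) γ.g : ℤ) : ℂ) := by
  have hδ := δ.ne_zero
  suffices h : weilRep ψ (δ : F) γ (phi0 F) 0 = ((γ.ζ : ℤ) : ℂ) * ((lam (δ : F) γ.g : ℤ) : ℂ) by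
    rw [eps, h, mul_inv, intCast_units_inv, intCast_units_inv]
  -- If |c| = |δ|, the Weil index belongs to an element of even valuation and the integrand is 1 on
  -- the integers. If c = 0, the quotient of Weil indices is the symbol (a, δ). In the remaining
  -- case the value is γ(-cδ)γ(cδd) = (cδ, d), by Weil's relation and γ(x)γ(-x) = 1.
  by_cases h1 : absF (γ.g.1 1 0) = absF (δ : F)
  · have hc : γ.g.1 1 0 ≠ 0 := by
      intro h; rw [h, absF_zero] at h1; exact (absF_pos hδ).ne h1
    obtain ⟨j, hj⟩ := exists_absF_eq_zpow hδ
    rw [weilRep_phi0_of_ne hq.out hδ he hc, lam, if_pos h1, gaussFactor_even hq.out he (j := j), absF_div, h1,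
      div_self (absF_pos hδ).ne', gaussIntegral, setIntegral_congr_fun (g := fun _ => (1 : ℂ)) (measurableSet_ball 0),
      integral_ball_one]
    · simp
    · intro y hy
      refine he.coe_eq_one ?_
      rw [absF_mul, absF_mul, absF_div, h1, div_mul_cancel₀ _ (absF_pos hδ).ne']
      rw [mem_ball, zpow_zero] at hy
      rw [← absF_mul]
      exact absF_mul_le_one hγ.d_le (absF_pow_le_one hy 2)
    · rw [absF_neg, absF_mul, h1, hj, ← zpow_add₀ (resCard_pos F).ne', two_mul]
  have hd := hγ.d_abs h1
  have hd0 := ne_zero_of_absF_eq_one hd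
  by_cases hc : γ.g.1 1 0 = 0
  · have ha := hγ.a_abs h1
    rw [weilRep_phi0_of_eq hq.out hδ he hc ha, lam, if_neg h1, bEntry_of_eq_zero hc]
    have hdet := SL2_det γ.g
    rw [hc, mul_zero, sub_zero] at hdet
    have had : γ.g.1 0 0 = γ.g.1 1 1 * (γ.g.1 0 0) ^ 2 := by linear_combination (-γ.g.1 0 0) * hdet
    have : hilbertSymbol (γ.g.1 1 1 * δ) (γ.g.1 1 1) = hilbertSymbol (γ.g.1 0 0) (δ : F) := by
      rw [hilbertSymbol_mul_left hq.out hd0 hδ hd0, hilbertSymbol_units hq.out hd hd, one_mul, had,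
        hilbertSymbol_sq_mul _ _ (ne_zero_of_absF_eq_one ha), hilbertSymbol_comm]
    rw [this]
  · have hlt := hγ.c_div_lt h1
    have hcδ := mul_ne_zero hc hδ
    obtain ⟨k, hk⟩ := exists_absF_eq_zpow (div_ne_zero hc hδ)
    have hk0 : k ≤ 0 := by
      rw [hk] at hlt
      exact ((zpow_lt_one_iff_right₀ (one_lt_resCard F)).1 hlt).le
    have hβ : absF (γ.g.1 1 1 / γ.g.1 1 0 * (δ : F)) = (resCard F : ℝ) ^ (-k) := by
      rw [zpow_neg, ← hk, ← absF_inv, inv_div, absF_mul, absF_div, hd, absF_div]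
      ring
    have hg := gaussFactor_eq hq.out he hβ (n := 0) (by omega)
    have hs : absF (γ.g.1 1 1 / γ.g.1 1 0 * (δ : F)) = absF ((δ : F) / γ.g.1 1 0) := by
      rw [absF_mul, absF_div, hd, absF_div]; ring
    rw [hs] at hg
    rw [weilRep_phi0_of_ne hq.out hδ he hc, lam, if_neg h1, bEntry_of_ne_zero hc, mul_assoc (gaussFactor _ _), ← hg,
      show γ.g.1 1 1 / γ.g.1 1 0 * (δ : F) = (γ.g.1 1 0 * δ * γ.g.1 1 1) * ((γ.g.1 1 0)⁻¹) ^ 2 by field_simp,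
      gaussFactor_mul_sq hq.out he (mul_ne_zero hcδ hd0) (inv_ne_zero hc)]
    have h2 := gaussFactor_mul hq.out he hcδ hd0
    rw [gaussFactor_unit hq.out he hd, mul_one] at h2
    have h3 := gaussFactor_mul_neg hq.out he hcδ
    have h4 := intCast_units_mul_self (hilbertSymbol (γ.g.1 1 0 * (δ : F)) (γ.g.1 1 1))
    rw [h2] at h3
    congr 1
    linear_combination ((hilbertSymbol (γ.g.1 1 0 * (δ : F)) (γ.g.1 1 1) : ℤ) : ℂ) * h3 -
      gaussFactor (ψ.mulShift (δ : F)⁻¹) (γ.g.1 1 0 * δ * γ.g.1 1 1) *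
        gaussFactor (ψ.mulShift (δ : F)⁻¹) (-(γ.g.1 1 0 * δ)) * h4

end Eps

/-! ## The topology of the metaplectic group -/

section Topology

variable {F : Type*} [Field F] [ValuativeRel F] [TopologicalSpace F] [IsNonarchimedeanLocalField F]

theorem Mp2.continuous_chart [hq : Fact (Odd (resCard F))] (x : Mp2 F) :
    Continuous fun h : {h : SL(2, F) // h.1 1 0 ≠ 0} => x * (⟨h.1, 1⟩ : Mp2 F) :=
  continuous_iff_coinduced_le.2 (le_iSup (fun x : Mp2 F => TopologicalSpace.coinduced
    (fun h : {h : SL(2, F) // h.1 1 0 ≠ 0} => x * (⟨h.1, 1⟩ : Mp2 F)) inferInstance) x)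

theorem Mp2.continuous_of_chart {Y : Type*} [TopologicalSpace Y] {f : Mp2 F → Y}
    (hf : ∀ x : Mp2 F, Continuous fun h : {h : SL(2, F) // h.1 1 0 ≠ 0} => f (x * (⟨h.1, 1⟩ : Mp2 F))) :
    Continuous f :=
  continuous_iSup_dom.2 fun x => continuous_coinduced_dom.2 (hf x)

theorem Mp2.continuous_g : Continuous (Mp2.g : Mp2 F → SL(2, F)) :=
  Mp2.continuous_of_chart fun x => continuous_const.mul continuous_subtype_val

/-- A left translate of a chart is again a chart. Right translations would involve the local
behaviour of the cocycle, and `IsHeckePair` does not ask for their continuity. -/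
theorem Mp2.continuous_mul_left [hq : Fact (Odd (resCard F))] (y : Mp2 F) : Continuous fun g : Mp2 F => y * g := by
  refine Mp2.continuous_of_chart fun x => ?_
  simp only [← mul_assoc]
  exact Mp2.continuous_chart (y * x)

theorem SL2_continuous_entry (i j : Fin 2) : Continuous fun g : SL(2, F) => g.1 i j :=
  (continuous_subtype_val (p := fun M : Matrix (Fin 2) (Fin 2) F => M.det = 1)).matrix_elem i j

theorem isOpen_absF_le {X : Type*} [TopologicalSpace X] {f : X → F} (hf : Continuous f) {y : F} (hy : y ≠ 0) :
    IsOpen {x | absF (f x) ≤ absF y} :=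
  (isClopen_absF_le ⟨y, hy, le_rfl⟩).isOpen.preimage hf

theorem isOpen_isGamma (δ : Fˣ) : IsOpen {g : SL(2, F) | IsGamma (δ : F) g} := by
  have h1 := isOpen_absF_le (SL2_continuous_entry (F := F) 0 0) one_ne_zero
  have h2 := isOpen_absF_le (SL2_continuous_entry (F := F) 0 1) (inv_ne_zero δ.ne_zero)
  have h3 := isOpen_absF_le (SL2_continuous_entry (F := F) 1 0) δ.ne_zero
  have h4 := isOpen_absF_le (SL2_continuous_entry (F := F) 1 1) one_ne_zero
  convert ((h1.inter h2).inter h3).inter h4 using 1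
  ext g
  simp only [absF_one, absF_inv, Set.mem_inter_iff, Set.mem_ofPred_eq]
  exact ⟨fun h => ⟨⟨⟨h.1, h.2⟩, h.3⟩, h.4⟩, fun h => ⟨h.1.1.1, h.1.1.2, h.1.2, h.2⟩⟩

/-- Bounds for the entries of a matrix. -/
theorem isCompact_matrix_entries (r : Fin 2 → Fin 2 → F) :
    IsCompact {M : Matrix (Fin 2) (Fin 2) F | ∀ i j, absF (M i j) ≤ absF (r i j)} := by
  have : IsCompact (Set.pi Set.univ fun i => Set.pi Set.univ fun j => {x : F | absF x ≤ absF (r i j)}) :=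
    isCompact_univ_pi fun i => isCompact_univ_pi fun j => isCompact_absF_le F _ ⟨_, rfl⟩
  have hset : {M : Matrix (Fin 2) (Fin 2) F | ∀ i j, absF (M i j) ≤ absF (r i j)} =
      (Set.pi Set.univ fun i => Set.pi Set.univ fun j => {x : F | absF x ≤ absF (r i j)}) :=
    Set.ext fun M => ⟨fun h i _ j _ => h i j, fun h i j => h i trivial j trivial⟩
  rw [hset]
  exact this

theorem isClosed_absF_eq {X : Type*} [TopologicalSpace X] {f : X → F} (hf : Continuous f) (r : ℝ) :
    IsClosed {x | absF (f x) = r} :=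
  isClosed_eq (continuous_absF.comp hf) continuous_const

/-- The condition |c| = |δ| is closed and keeps c away from zero, so this part of Γ₀(1) is closed in
a product of compact balls and still lies in the domain of the charts. -/
theorem isCompact_isGamma_bigCell (δ : Fˣ) : IsCompact {h : {h : SL(2, F) // h.1 1 0 ≠ 0} |
    IsGamma (δ : F) h.1 ∧ absF (h.1.1 1 0) = absF (δ : F)} := by
  rw [Subtype.isCompact_iff]
  refine Matrix.SpecialLinearGroup.isClosedEmbedding_val.isEmbedding.isCompact_iff.2 ?_
  have h1 := isCompact_matrix_entries (F := F) ![![1, (δ : F)⁻¹], ![δ, 1]]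
  have h2 : IsClosed {M : Matrix (Fin 2) (Fin 2) F | M.det = 1} := isClosed_eq (by fun_prop) continuous_const
  have h3 := isClosed_absF_eq (F := F) (continuous_id.matrix_elem (R := F) (m := Fin 2) (n := Fin 2) 1 0) (absF (δ : F))
  convert (h1.inter_right h2).inter_right h3 using 1
  ext M
  simp only [Set.mem_image, Set.mem_inter_iff, Set.mem_ofPred_eq, Fin.forall_fin_two]
  constructor
  · rintro ⟨h, ⟨⟨h, h0⟩, ⟨hγ, hc⟩, rfl⟩, rfl⟩
    exact ⟨⟨⟨⟨by simpa using hγ.a_le, by simpa using hγ.b_le⟩, by simpa using hγ.c_le, by simpa using hγ.d_le⟩, h.2⟩, hc⟩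
  · rintro ⟨⟨⟨⟨ha, hb⟩, hc, hd⟩, hdet⟩, hce⟩
    refine ⟨⟨M, hdet⟩, ⟨⟨⟨M, hdet⟩, ?_⟩, ⟨⟨?_, ?_, ?_, ?_⟩, hce⟩, rfl⟩, rfl⟩
    · intro h
      simp only [id_eq] at hce
      change M 1 0 = 0 at h
      rw [h, absF_zero] at hce
      exact (absF_pos δ.ne_zero).ne hce
    · simpa using ha
    · simpa using hb
    · simpa using hc
    · simpa using hd

end Topology

/-! ### The inverse image of Γ₀(1) as a compact open subgroup with character ε. -/

section HeckePair

variable {F : Type*} [Field F] [ValuativeRel F] [TopologicalSpace F] [IsNonarchimedeanLocalField F]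
  [hq : Fact (Odd (resCard F))]

/-- The inverse image of `Γ₀(1)` as a subgroup. -/
def gammaGroup (δ : Fˣ) : Subgroup (Mp2 F) where
  carrier := GammaTilde (δ : F)
  mul_mem' ha hb := mem_GammaTilde.2 ((mem_GammaTilde.1 ha).mul (mem_GammaTilde.1 hb))
  one_mem' := mem_GammaTilde.2 IsGamma.one
  inv_mem' ha := mem_GammaTilde.2 (mem_GammaTilde.1 ha).inv

theorem mem_gammaGroup {δ : Fˣ} {γ : Mp2 F} : γ ∈ gammaGroup δ ↔ IsGamma (δ : F) γ.g := mem_GammaTilde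

/-- The matrix `(0, -a⁻¹; a, 0)`. -/
def wMat (a : Fˣ) : SL(2, F) :=
  ⟨!![0, -(a : F)⁻¹; (a : F), 0], by simp [Matrix.det_fin_two]⟩

/-- Four translates of the compact piece with |c| = |δ| cover the group, by the two lifts of 1 and
of w_δ. Indeed, if |c| < |δ|, the entry a is a unit, and multiplication by w_δ⁻¹ moves it to a lower
left entry of absolute value |δ|. -/
theorem isCompact_gammaGroup (δ : Fˣ) : IsCompact (gammaGroup δ : Set (Mp2 F)) := by
  have hchart : ∀ x : Mp2 F, IsCompact ((fun h : {h : SL(2, F) // h.1 1 0 ≠ 0} => x * (⟨h.1, 1⟩ : Mp2 F)) ''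
      {h | IsGamma (δ : F) h.1 ∧ absF (h.1.1 1 0) = absF (δ : F)}) := fun x =>
    (isCompact_isGamma_bigCell δ).image (Mp2.continuous_chart x)
  have hw : IsGamma (δ : F) (wMat δ) := by
    refine ⟨?_, ?_, ?_, ?_⟩ <;> simp [wMat, absF_nonneg]
  let X : ℤˣ × Bool → Mp2 F := fun p => if p.2 then ⟨1, p.1⟩ else ⟨wMat δ, 1⟩ * ⟨1, p.1⟩
  have hX : ∀ p, X p ∈ gammaGroup δ := by
    rintro ⟨ζ, b⟩
    rcases b with _ | _
    · exact mul_mem (mem_gammaGroup.2 hw) (mem_gammaGroup.2 IsGamma.one)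
    · exact mem_gammaGroup.2 IsGamma.one
  convert isCompact_iUnion fun p => hchart (X p) using 1
  ext γ
  simp only [SetLike.mem_coe, Set.mem_iUnion, Set.mem_image, Set.mem_ofPred_eq]
  have main : ∀ γ : Mp2 F, γ ∈ gammaGroup δ → absF (γ.g.1 1 0) = absF (δ : F) →
      ∃ h : {h : SL(2, F) // h.1 1 0 ≠ 0}, (IsGamma (δ : F) h.1 ∧ absF (h.1.1 1 0) = absF (δ : F)) ∧
        (⟨1, γ.ζ⟩ : Mp2 F) * ⟨h.1, 1⟩ = γ := by
    intro γ hγ hc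
    refine ⟨⟨γ.g, ?_⟩, ⟨mem_gammaGroup.1 hγ, hc⟩, ?_⟩
    · intro h; rw [h, absF_zero] at hc; exact (absF_pos δ.ne_zero).ne hc
    · ext1 <;> simp [cocycle_one_left]
  constructor
  · intro hγ
    by_cases hc : absF (γ.g.1 1 0) = absF (δ : F)
    · obtain ⟨h, hh, e⟩ := main γ hγ hc
      exact ⟨(γ.ζ, true), h, hh, e⟩
    · have hγ' := mul_mem (inv_mem (hX (1, false))) hγ
      obtain ⟨h, hh, e⟩ := main _ hγ' (by
        have ha := (mem_gammaGroup.1 hγ).a_abs hc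
        have e : ((X (1, false))⁻¹ * γ).g = (wMat δ)⁻¹ * γ.g := by simp [X]
        rw [e, SL2_mul_10, SL2_inv_10, SL2_inv_11]
        simp [wMat, ha])
      refine ⟨(((X (1, false))⁻¹ * γ).ζ, false), h, hh, ?_⟩
      have e1 : X (((X (1, false))⁻¹ * γ).ζ, false) = X (1, false) * ⟨1, ((X (1, false))⁻¹ * γ).ζ⟩ := by
        have : (⟨1, 1⟩ : Mp2 F) = 1 := rfl
        simp only [X, Bool.false_eq_true, if_false, this, mul_one]
      rw [e1, mul_assoc, e, mul_inv_cancel_left]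
  · rintro ⟨p, h, ⟨hh, -⟩, rfl⟩
    exact mul_mem (hX p) (mem_gammaGroup.2 hh)

theorem lam_one (δ : Fˣ) : lam (δ : F) 1 = 1 := by
  have : absF (δ : F) ≠ 0 := (absF_pos δ.ne_zero).ne'
  simp [lam, this.symm, bEntry]

variable [MeasurableSpace F] [BorelSpace F]

theorem eps_mul {ψ : AddChar F Circle} {δ : Fˣ} (he : IsUnramified (ψ.mulShift (δ : F)⁻¹)) {a b : Mp2 F}
    (ha : a ∈ gammaGroup δ) (hb : b ∈ gammaGroup δ) :
    eps ψ (δ : F) (a * b) = eps ψ (δ : F) a * eps ψ (δ : F) b := by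
  rw [mem_gammaGroup] at ha hb
  rw [eps_eq he ha, eps_eq he hb, eps_eq he (ha.mul hb), Mp2.mul_g, Mp2.mul_ζ, lam_mul ha hb]
  have := intCast_units_mul_self (cocycle a.g b.g)
  push_cast
  linear_combination (((a.ζ : ℤ) : ℂ) * ((b.ζ : ℤ) : ℂ) * ((lam (δ : F) a.g : ℤ) : ℂ) * ((lam (δ : F) b.g : ℤ) : ℂ)) * this

theorem eps_mul_self {ψ : AddChar F Circle} {δ : Fˣ} (he : IsUnramified (ψ.mulShift (δ : F)⁻¹)) {a : Mp2 F}
    (ha : a ∈ gammaGroup δ) : eps ψ (δ : F) a * eps ψ (δ : F) a = 1 := by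
  rw [eps_eq he (mem_gammaGroup.1 ha)]
  have h1 := intCast_units_mul_self a.ζ
  have h2 := intCast_units_mul_self (lam (δ : F) a.g)
  linear_combination ((lam (δ : F) a.g : ℤ) : ℂ) * ((lam (δ : F) a.g : ℤ) : ℂ) * h1 + h2

theorem eps_one {ψ : AddChar F Circle} {δ : Fˣ} (he : IsUnramified (ψ.mulShift (δ : F)⁻¹)) :
    eps ψ (δ : F) 1 = 1 := by
  rw [eps_eq he IsGamma.one, Mp2.one_ζ, Mp2.one_g, lam_one]; simp

theorem eps_inv {ψ : AddChar F Circle} {δ : Fˣ} (he : IsUnramified (ψ.mulShift (δ : F)⁻¹)) {a : Mp2 F}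
    (ha : a ∈ gammaGroup δ) : eps ψ (δ : F) a⁻¹ = eps ψ (δ : F) a := by
  have h := eps_mul he ha (inv_mem ha)
  rw [mul_inv_cancel, eps_one he] at h
  linear_combination (-eps ψ (δ : F) a) * h - eps ψ (δ : F) a⁻¹ * eps_mul_self he ha

theorem isHeckePair_gammaGroup {ψ : AddChar F Circle} {δ : Fˣ} (he : IsUnramified (ψ.mulShift (δ : F)⁻¹))
    {μ : Measure (Mp2 F)} (hμ : μ (GammaTilde (δ : F)) = 1) :
    IsHeckePair μ (gammaGroup δ) (eps ψ (δ : F)) where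
  continuous_mul_left := Mp2.continuous_mul_left
  isOpen := by
    have : (gammaGroup δ : Set (Mp2 F)) = Mp2.g ⁻¹' {g | IsGamma (δ : F) g} := by
      ext γ; exact mem_gammaGroup
    rw [this]
    exact (isOpen_isGamma δ).preimage Mp2.continuous_g
  isCompact := isCompact_gammaGroup δ
  isOpen_mul_right x := by
    have : {g | g * x ∈ gammaGroup δ} = (fun γ : Mp2 F => γ.g * x.g) ⁻¹' {g | IsGamma (δ : F) g} := by
      ext γ; exact mem_gammaGroup
    rw [this]
    exact (isOpen_isGamma δ).preimage (Mp2.continuous_g.mul continuous_const)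
  χ_one := eps_one he
  χ_mul _ ha _ hb := eps_mul he ha hb
  measure_eq_one := hμ

end HeckePair

/-! ## The size of a matrix -/

section Size

variable {F : Type*} [Field F] [ValuativeRel F] [TopologicalSpace F] [IsNonarchimedeanLocalField F]

/-- The largest absolute value of an entry of the conjugate of a matrix by `diag(δ, 1)`. -/
def matSize (δ : F) (M : Matrix (Fin 2) (Fin 2) F) : ℝ :=
  max (max (absF (M 0 0)) (absF (M 0 1 * δ))) (max (absF (M 1 0 / δ)) (absF (M 1 1)))

theorem matSize_le_iff {δ : F} {M : Matrix (Fin 2) (Fin 2) F} {r : ℝ} : matSize δ M ≤ r ↔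
    (absF (M 0 0) ≤ r ∧ absF (M 0 1 * δ) ≤ r) ∧ absF (M 1 0 / δ) ≤ r ∧ absF (M 1 1) ≤ r := by
  simp only [matSize, max_le_iff]

theorem matSize_bounds (δ : F) (M : Matrix (Fin 2) (Fin 2) F) :
    (absF (M 0 0) ≤ matSize δ M ∧ absF (M 0 1 * δ) ≤ matSize δ M) ∧
      absF (M 1 0 / δ) ≤ matSize δ M ∧ absF (M 1 1) ≤ matSize δ M :=
  matSize_le_iff.1 le_rfl

/-- After conjugation by diag(δ, 1) this is the submultiplicativity of the maximum norm under the
ultrametric inequality. -/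
theorem matSize_mul_le {δ : F} (hδ : δ ≠ 0) (M N : Matrix (Fin 2) (Fin 2) F) :
    matSize δ (M * N) ≤ matSize δ M * matSize δ N := by
  obtain ⟨⟨a1, b1⟩, c1, d1⟩ := matSize_bounds δ M
  obtain ⟨⟨a2, b2⟩, c2, d2⟩ := matSize_bounds δ N
  rw [matSize_le_iff]
  simp only [Matrix.mul_apply, Fin.sum_univ_two]
  refine ⟨⟨?_, ?_⟩, ?_, ?_⟩
  · rw [show M 0 1 * N 1 0 = (M 0 1 * δ) * (N 1 0 / δ) by field_simp]
    exact absF_add_le (absF_mul_le a1 a2) (absF_mul_le b1 c2)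
  · rw [show (M 0 0 * N 0 1 + M 0 1 * N 1 1) * δ = M 0 0 * (N 0 1 * δ) + (M 0 1 * δ) * N 1 1 by ring]
    exact absF_add_le (absF_mul_le a1 b2) (absF_mul_le b1 d2)
  · rw [show (M 1 0 * N 0 0 + M 1 1 * N 1 0) / δ = (M 1 0 / δ) * N 0 0 + M 1 1 * (N 1 0 / δ) by field_simp]
    exact absF_add_le (absF_mul_le c1 a2) (absF_mul_le d1 c2)
  · rw [show M 1 0 * N 0 1 = (M 1 0 / δ) * (N 0 1 * δ) by field_simp]
    exact absF_add_le (absF_mul_le c1 b2) (absF_mul_le d1 d2)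

theorem continuous_matSize (δ : F) : Continuous (matSize δ) := by
  have h : ∀ i j, Continuous fun M : Matrix (Fin 2) (Fin 2) F => M i j := fun i j =>
    continuous_id.matrix_elem i j
  have h2 : Continuous fun M : Matrix (Fin 2) (Fin 2) F => M 0 1 * δ := (h 0 1).mul continuous_const
  have h3 : Continuous fun M : Matrix (Fin 2) (Fin 2) F => M 1 0 / δ := by
    simp only [div_eq_mul_inv]; exact (h 1 0).mul continuous_const
  exact ((continuous_absF.comp (h 0 0)).max (continuous_absF.comp h2)).max
    ((continuous_absF.comp h3).max (continuous_absF.comp (h 1 1)))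

theorem exists_matSize_eq_absF (δ : F) (M : Matrix (Fin 2) (Fin 2) F) : ∃ x : F, matSize δ M = absF x := by
  unfold matSize
  rcases max_choice (max (absF (M 0 0)) (absF (M 0 1 * δ))) (max (absF (M 1 0 / δ)) (absF (M 1 1))) with h | h <;>
    rw [h]
  · rcases max_choice (absF (M 0 0)) (absF (M 0 1 * δ)) with h | h <;> exact ⟨_, h⟩
  · rcases max_choice (absF (M 1 0 / δ)) (absF (M 1 1)) with h | h <;> exact ⟨_, h⟩

theorem absF_det_le {δ : F} (hδ : δ ≠ 0) (M : Matrix (Fin 2) (Fin 2) F) :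
    absF M.det ≤ matSize δ M * max (absF (M 1 0 / δ)) (absF (M 1 1)) := by
  obtain ⟨⟨a1, b1⟩, c1, d1⟩ := matSize_bounds δ M
  rw [Matrix.det_fin_two, show M 0 1 * M 1 0 = (M 0 1 * δ) * (M 1 0 / δ) by field_simp]
  exact absF_sub_le (absF_mul_le a1 (le_max_right _ _)) (absF_mul_le b1 (le_max_left _ _))

theorem matSize_nonneg (δ : F) (M : Matrix (Fin 2) (Fin 2) F) : 0 ≤ matSize δ M :=
  (absF_nonneg _).trans (matSize_bounds δ M).1.1

theorem absF_det_le_sq {δ : F} (hδ : δ ≠ 0) (M : Matrix (Fin 2) (Fin 2) F) : absF M.det ≤ matSize δ M ^ 2 := by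
  refine (absF_det_le hδ M).trans ?_
  rw [sq]
  have := matSize_bounds δ M
  exact mul_le_mul_of_nonneg_left (max_le this.2.1 this.2.2) (matSize_nonneg δ M)

theorem isGamma_iff_matSize {δ : Fˣ} {g : SL(2, F)} : IsGamma (δ : F) g ↔ matSize (δ : F) g.1 ≤ 1 := by
  rw [matSize_le_iff]
  exact ⟨fun h => ⟨⟨h.a_le, h.b_mul_le⟩, h.c_div_le, h.d_le⟩,
    fun h => IsGamma.of_le h.1.1 h.1.2 h.2.1 h.2.2⟩

variable {δ : Fˣ}

theorem one_le_matSize (g : SL(2, F)) : 1 ≤ matSize (δ : F) g.1 := by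
  have h := absF_det_le_sq δ.ne_zero g.1
  rw [g.2, absF_one] at h
  exact (one_le_sq_iff₀ (matSize_nonneg _ _)).1 h

theorem exists_matSize_eq_pow (g : SL(2, F)) : ∃ n : ℕ, matSize (δ : F) g.1 = (resCard F : ℝ) ^ n := by
  obtain ⟨x, hx⟩ := exists_matSize_eq_absF (δ : F) g.1
  have h1 := one_le_matSize (δ := δ) g
  have hx0 : x ≠ 0 := by
    rintro rfl; rw [hx, absF_zero] at h1; linarith
  obtain ⟨k, hk⟩ := exists_absF_eq_zpow hx0
  rw [hx, hk, one_le_zpow_iff_right₀ (one_lt_resCard F)] at h1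
  obtain ⟨n, rfl⟩ := Int.eq_ofNat_of_zero_le h1
  exact ⟨n, by rw [hx, hk]; exact zpow_natCast _ n⟩

theorem matSize_mul_of_isGamma_left {k : SL(2, F)} (hk : IsGamma (δ : F) k) (g : SL(2, F)) :
    matSize (δ : F) (k * g).1 = matSize (δ : F) g.1 := by
  have key : ∀ {k : SL(2, F)}, IsGamma (δ : F) k → ∀ g : SL(2, F), matSize (δ : F) (k * g).1 ≤ matSize (δ : F) g.1 :=
    fun {k} hk g => (matSize_mul_le δ.ne_zero k.1 g.1).trans
      (mul_le_of_le_one_left (matSize_nonneg _ _) (isGamma_iff_matSize.1 hk))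
  refine le_antisymm (key hk g) ?_
  have := key hk.inv (k * g)
  rwa [inv_mul_cancel_left] at this

theorem matSize_mul_of_isGamma_right {k : SL(2, F)} (hk : IsGamma (δ : F) k) (g : SL(2, F)) :
    matSize (δ : F) (g * k).1 = matSize (δ : F) g.1 := by
  have key : ∀ {k : SL(2, F)}, IsGamma (δ : F) k → ∀ g : SL(2, F), matSize (δ : F) (g * k).1 ≤ matSize (δ : F) g.1 :=
    fun {k} hk g => (matSize_mul_le δ.ne_zero g.1 k.1).trans
      (mul_le_of_le_one_right (matSize_nonneg _ _) (isGamma_iff_matSize.1 hk))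
  refine le_antisymm (key hk g) ?_
  have := key hk.inv (g * k)
  rwa [mul_inv_cancel_right] at this

end Size

/-! ## Elements of the metaplectic group -/

section Elements

variable {F : Type*} [Field F]

/-- The matrix `(1, b; 0, 1)`. -/
def uMat (b : F) : SL(2, F) := ⟨!![1, b; 0, 1], by simp [Matrix.det_fin_two]⟩

/-- The element `[(1, b; 0, 1), 1]`. -/
def uElt (b : F) : Mp2 F := ⟨uMat b, 1⟩

/-- The element `[(0, -a⁻¹; a, 0), 1]`. -/
def wElt (a : Fˣ) : Mp2 F := ⟨wMat a, 1⟩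

/-- The central element `[1, ζ]`. -/
def zElt (F : Type*) [Field F] (ζ : ℤˣ) : Mp2 F := ⟨1, ζ⟩

/-- The matrix `diag(a, a⁻¹)`. -/
def dMat (a : Fˣ) : SL(2, F) := (mElt a).g

@[simp] theorem uElt_g (b : F) : (uElt b).g = uMat b := rfl
@[simp] theorem uElt_ζ (b : F) : (uElt b).ζ = 1 := rfl
@[simp] theorem wElt_g (a : Fˣ) : (wElt a).g = wMat a := rfl
@[simp] theorem wElt_ζ (a : Fˣ) : (wElt a).ζ = 1 := rfl
@[simp] theorem mElt_g (a : Fˣ) : (mElt a).g = dMat a := rfl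
@[simp] theorem mElt_ζ (a : Fˣ) : (mElt a).ζ = 1 := rfl
@[simp] theorem zElt_g (ζ : ℤˣ) : (zElt F ζ).g = 1 := rfl
@[simp] theorem zElt_ζ (ζ : ℤˣ) : (zElt F ζ).ζ = ζ := rfl

@[simp] theorem uMat_00 (b : F) : (uMat b).1 0 0 = 1 := rfl
@[simp] theorem uMat_01 (b : F) : (uMat b).1 0 1 = b := rfl
@[simp] theorem uMat_10 (b : F) : (uMat b).1 1 0 = 0 := rfl
@[simp] theorem uMat_11 (b : F) : (uMat b).1 1 1 = 1 := rfl
@[simp] theorem wMat_00 (a : Fˣ) : (wMat a).1 0 0 = 0 := rfl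
@[simp] theorem wMat_01 (a : Fˣ) : (wMat a).1 0 1 = -(a : F)⁻¹ := rfl
@[simp] theorem wMat_10 (a : Fˣ) : (wMat a).1 1 0 = a := rfl
@[simp] theorem wMat_11 (a : Fˣ) : (wMat a).1 1 1 = 0 := rfl
@[simp] theorem dMat_00 (a : Fˣ) : (dMat a).1 0 0 = a := rfl
@[simp] theorem dMat_01 (a : Fˣ) : (dMat a).1 0 1 = 0 := rfl
@[simp] theorem dMat_10 (a : Fˣ) : (dMat a).1 1 0 = 0 := rfl
@[simp] theorem dMat_11 (a : Fˣ) : (dMat a).1 1 1 = (a : F)⁻¹ := rfl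

theorem SL2_ext {g h : SL(2, F)} (h00 : g.1 0 0 = h.1 0 0) (h01 : g.1 0 1 = h.1 0 1)
    (h10 : g.1 1 0 = h.1 1 0) (h11 : g.1 1 1 = h.1 1 1) : g = h := by
  apply Subtype.ext
  ext i j
  fin_cases i <;> fin_cases j <;> assumption

@[simp] theorem bu_uMat (b : F) : bu (uMat b) = 1 := by
  ext; rw [val_bu, bEntry_of_eq_zero (uMat_10 b)]; rfl

@[simp] theorem bu_wMat (a : Fˣ) : bu (wMat a) = a := by
  ext; rw [val_bu, bEntry_of_ne_zero (by simp)]; rfl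

@[simp] theorem bu_dMat (a : Fˣ) : bu (dMat a) = a⁻¹ := by
  ext; rw [val_bu, bEntry_of_eq_zero (dMat_10 a)]; simp

theorem bu_of_ne_zero {g : SL(2, F)} {c : Fˣ} (h : g.1 1 0 = c) : bu g = c := by
  ext; rw [val_bu, bEntry_of_ne_zero (by simp [h]), h]

theorem cocycle_uMat_left (b : F) (g : SL(2, F)) : cocycle (uMat b) g = 1 := by
  have h : bu (uMat b * g) = bu g := by rw [bu_mul_of_left (uMat_10 b), bu_uMat, one_mul]
  rw [cocycle, ← val_bu (uMat b * g), h, val_bu, div_self (bEntry_ne_zero g), hilbertSymbol_one_right]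

theorem cocycle_uMat_right (b : F) (g : SL(2, F)) : cocycle g (uMat b) = 1 := by
  have h : bEntry (g * uMat b) = bEntry g := by
    by_cases hg : g.1 1 0 = 0
    · rw [bEntry_of_eq_zero (by simp [SL2_mul_10, hg]), bEntry_of_eq_zero hg]; simp [SL2_mul_11, hg]
    · rw [bEntry_of_ne_zero (by simp [SL2_mul_10, hg]), bEntry_of_ne_zero hg]; simp [SL2_mul_10]
  rw [cocycle, h, div_self (bEntry_ne_zero g), hilbertSymbol_one_left]

theorem uMat_inv (b : F) : (uMat b)⁻¹ = uMat (-b) := by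
  refine inv_eq_of_mul_eq_one_right (SL2_ext ?_ ?_ ?_ ?_) <;>
    simp [SL2_mul_00, SL2_mul_01, SL2_mul_10, SL2_mul_11]

variable [ValuativeRel F] [TopologicalSpace F] [IsNonarchimedeanLocalField F]
  [hq : Fact (Odd (resCard F))]

theorem uElt_inv (b : F) : (uElt b)⁻¹ = uElt (-b) := by
  ext1
  · exact uMat_inv b
  · simp [cocycle_uMat_left]

theorem zElt_mul (ζ : ℤˣ) (g : Mp2 F) : zElt F ζ * g = ⟨g.g, ζ * g.ζ⟩ := by
  ext1 <;> simp [cocycle_one_left]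

/-- The Bruhat decomposition of an element of the big cell. -/
theorem eq_mul_of_ne_zero {γ : Mp2 F} {c : Fˣ} (hc : γ.g.1 1 0 = c) :
    γ = zElt F γ.ζ * uElt (γ.g.1 0 0 / c) * wElt c * uElt (γ.g.1 1 1 / c) := by
  have hc0 := c.ne_zero
  have hdet := SL2_det γ.g
  rw [mul_assoc, mul_assoc, zElt_mul]
  ext1
  · refine SL2_ext ?_ ?_ ?_ ?_ <;> simp [SL2_mul_00, SL2_mul_01, SL2_mul_10, SL2_mul_11]
    · field_simp
      linear_combination (-1) * hdet + (-γ.g.1 0 1) * hc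
    · exact hc
    · field_simp
  · simp [cocycle_uMat_left, cocycle_uMat_right]

theorem cocycle_dMat_wMat (s c : Fˣ) : signBit (cocycle (dMat s) (wMat c)) = hs s c := by
  have : bu (dMat s * wMat c) = s⁻¹ * c := by rw [bu_mul_of_left (dMat_10 s), bu_dMat, bu_wMat]
  rw [signBit_cocycle, this, bu_dMat, bu_wMat]
  simp only [hs_neg_left, hs_mul_left, hs_mul_right, hs_inv_left, hs_inv_right, hs_self, hsNeg_mul, hsNeg_inv]
  grind [hs_comm]

theorem wMat_div (c s : Fˣ) : wMat (c / s) = dMat s * wMat c := by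
  refine SL2_ext ?_ ?_ ?_ ?_ <;> simp [SL2_mul_00, SL2_mul_01, SL2_mul_10, SL2_mul_11]
  all_goals have := c.ne_zero; have := s.ne_zero; field_simp

/-- For a unit s this shows how a Hecke function changes when c changes by a unit: by the sign (s,
c) times ε(m(s)). -/
theorem wElt_div (c s : Fˣ) : wElt (c / s) = zElt F (hilbertSymbol (s : F) c) * mElt s * wElt c := by
  rw [mul_assoc, zElt_mul]
  ext1
  · exact wMat_div c s
  · have : cocycle (dMat s) (wMat c) = hilbertSymbol (s : F) c := signBit_injective (cocycle_dMat_wMat s c)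
    simp only [wElt_ζ, Mp2.mul_ζ, mElt_ζ, mElt_g, wElt_g, one_mul, this, mul_one, Int.units_mul_self]

end Elements

/-! ## The Cartan decomposition -/

section Cartan

variable {F : Type*} [Field F] [ValuativeRel F] [TopologicalSpace F] [IsNonarchimedeanLocalField F]
  {δ : Fˣ}

theorem isGamma_uMat {b : F} : IsGamma (δ : F) (uMat b) ↔ absF (b * δ) ≤ 1 := by
  refine ⟨fun h => by simpa using h.b_mul_le, fun h => IsGamma.of_le ?_ ?_ ?_ ?_⟩ <;> simp
  simpa using h

theorem isGamma_wMat : IsGamma (δ : F) (wMat δ) := by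
  have := δ.ne_zero
  refine IsGamma.of_le ?_ ?_ ?_ ?_ <;> simp [this]

theorem isGamma_dMat {s : Fˣ} (hs : absF (s : F) = 1) : IsGamma (δ : F) (dMat s) := by
  refine IsGamma.of_le ?_ ?_ ?_ ?_ <;> simp [hs]

/-- An element of a double coset in which the lower left entry dominates. -/
theorem exists_dominant (g : SL(2, F)) : ∃ x y : SL(2, F), (x = 1 ∨ x = wMat δ) ∧ (y = 1 ∨ y = wMat δ) ∧
    absF ((x * g * y).1 1 0 / δ) = matSize (δ : F) g.1 := by
  have hδ := δ.ne_zero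
  have key : (matSize (δ : F) g.1 = absF (g.1 0 0) ∨ matSize (δ : F) g.1 = absF (g.1 0 1 * δ)) ∨
      matSize (δ : F) g.1 = absF (g.1 1 0 / δ) ∨ matSize (δ : F) g.1 = absF (g.1 1 1) := by
    unfold matSize
    rcases max_choice (max (absF (g.1 0 0)) (absF (g.1 0 1 * δ))) (max (absF (g.1 1 0 / δ)) (absF (g.1 1 1))) with h | h <;>
      rw [h]
    · exact Or.inl (max_choice _ _)
    · exact Or.inr (max_choice _ _)
  rcases key with (h | h) | h | h
  · refine ⟨wMat δ, 1, Or.inr rfl, Or.inl rfl, ?_⟩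
    rw [h, mul_one, SL2_mul_10, wMat_10, wMat_11]
    simp [hδ]
  · refine ⟨wMat δ, wMat δ, Or.inr rfl, Or.inr rfl, ?_⟩
    rw [h, SL2_mul_10, SL2_mul_10, SL2_mul_11]
    simp [hδ]
    field_simp
  · refine ⟨1, 1, Or.inl rfl, Or.inl rfl, ?_⟩
    rw [h, one_mul, mul_one]
  · refine ⟨1, wMat δ, Or.inl rfl, Or.inr rfl, ?_⟩
    rw [h, one_mul, SL2_mul_10, wMat_10, wMat_00]
    simp [hδ]

variable [hq : Fact (Odd (resCard F))] [MeasurableSpace F] [BorelSpace F] {ψ : AddChar F Circle}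

theorem eps_uElt (he : IsUnramified (ψ.mulShift (δ : F)⁻¹)) {b : F} (hb : absF (b * δ) ≤ 1) :
    eps ψ (δ : F) (uElt b) = 1 := by
  rw [eps_eq he (isGamma_uMat.2 hb), lam, if_neg]
  · simp
  · simpa using (absF_pos δ.ne_zero).ne

theorem eps_wElt (he : IsUnramified (ψ.mulShift (δ : F)⁻¹)) : eps ψ (δ : F) (wElt δ) = 1 := by
  rw [eps_eq he isGamma_wMat, lam, if_pos]
  · simp
  · rfl

theorem eps_zElt (he : IsUnramified (ψ.mulShift (δ : F)⁻¹)) (ζ : ℤˣ) :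
    eps ψ (δ : F) (zElt F ζ) = ((ζ : ℤ) : ℂ) := by
  rw [eps_eq he IsGamma.one, zElt_g, lam_one]; simp

theorem eps_mElt (he : IsUnramified (ψ.mulShift (δ : F)⁻¹)) {s : Fˣ} (hs1 : absF (s : F) = 1) :
    eps ψ (δ : F) (mElt s) = ((hilbertSymbol (s : F) δ : ℤ) : ℂ) := by
  have h : hilbertSymbol (bEntry (dMat s) * δ) ((dMat s).1 1 1) = hilbertSymbol (s : F) δ := by
    apply signBit_injective
    have h1 := hs_units (u := s) (v := s) hs1 hs1
    have e : (dMat s).1 1 1 = ((s⁻¹ : Fˣ) : F) := by simp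
    rw [e]
    change hs (bu (dMat s) * δ) s⁻¹ = hs s δ
    rw [bu_dMat]
    simp only [hs_mul_left, hs_inv_left, hs_inv_right, h1]
    rw [hs_comm, zero_add]
  rw [eps_eq he (isGamma_dMat hs1), lam, if_neg, mElt_g, h]
  · simp
  · simpa using (absF_pos δ.ne_zero).ne

theorem mem_uElt {b : F} (hb : absF (b * δ) ≤ 1) : uElt b ∈ gammaGroup δ := mem_gammaGroup.2 (isGamma_uMat.2 hb)

theorem mem_wElt : wElt δ ∈ gammaGroup δ := mem_gammaGroup.2 isGamma_wMat

theorem mem_zElt (ζ : ℤˣ) : zElt F ζ ∈ gammaGroup δ := mem_gammaGroup.2 IsGamma.one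

theorem mem_mElt {s : Fˣ} (hs : absF (s : F) = 1) : mElt s ∈ gammaGroup δ := mem_gammaGroup.2 (isGamma_dMat hs)

/-- The value of a function in the Hecke algebra at an element with dominant lower left entry. -/
theorem hecke_apply_of_dominant (he : IsUnramified (ψ.mulShift (δ : F)⁻¹)) {φ : Mp2 F → ℂ}
    (hφ : φ ∈ heckeSpace (gammaGroup δ : Set (Mp2 F)) (eps ψ (δ : F))) {γ : Mp2 F} {c : Fˣ}
    (hc : γ.g.1 1 0 = c) (h : absF ((c : F) / δ) = matSize (δ : F) γ.g.1) :
    φ γ = ((γ.ζ : ℤ) : ℂ) * φ (wElt c) := by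
  obtain ⟨⟨h1, h2⟩, h3, h4⟩ := matSize_bounds (δ : F) γ.g.1
  -- Since c dominates, both unipotent factors of the Bruhat decomposition lie in Γ₀(1), where ε is
  -- 1 on them.
  have key : ∀ x : F, absF x ≤ matSize (δ : F) γ.g.1 → absF (x / c * δ) ≤ 1 := by
    intro x hx
    rw [show x / c * δ = x / (c / δ) by field_simp, absF_div, h]
    exact div_le_one_of_le₀ hx (matSize_nonneg _ _)
  conv_lhs => rw [eq_mul_of_ne_zero hc]
  rw [heckeSpace_mul_right hφ (mem_uElt (key _ h4)), mul_assoc, heckeSpace_mul_left hφ (mem_zElt _),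
    heckeSpace_mul_left hφ (mem_uElt (key _ h1)), eps_uElt he (key _ h4), eps_uElt he (key _ h1), eps_zElt he,
    one_mul, one_mul]

theorem hecke_apply_wElt_div (he : IsUnramified (ψ.mulShift (δ : F)⁻¹)) {φ : Mp2 F → ℂ}
    (hφ : φ ∈ heckeSpace (gammaGroup δ : Set (Mp2 F)) (eps ψ (δ : F))) {c s : Fˣ} (hs : absF (s : F) = 1) :
    φ (wElt (c / s)) = ((hilbertSymbol (s : F) c : ℤ) : ℂ) * (((hilbertSymbol (s : F) δ : ℤ) : ℂ) * φ (wElt c)) := by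
  rw [wElt_div, mul_assoc, heckeSpace_mul_left hφ (mem_zElt _), heckeSpace_mul_left hφ (mem_mElt hs), eps_zElt he,
    eps_mElt he hs]

/-- Functions in the Hecke algebra are determined by their values at one element of each size. -/
theorem hecke_eq_zero (he : IsUnramified (ψ.mulShift (δ : F)⁻¹)) {φ : Mp2 F → ℂ}
    (hφ : φ ∈ heckeSpace (gammaGroup δ : Set (Mp2 F)) (eps ψ (δ : F))) {γ : Mp2 F} {c : Fˣ}
    (hc : absF ((c : F) / δ) = matSize (δ : F) γ.g.1) (h : φ (wElt c) = 0) : φ γ = 0 := by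
  obtain ⟨x, y, hx, hy, hxy⟩ := exists_dominant (δ := δ) γ.g
  have mem : ∀ z : SL(2, F), (z = 1 ∨ z = wMat δ) → (⟨z, 1⟩ : Mp2 F) ∈ gammaGroup δ := by
    rintro z (rfl | rfl)
    · exact one_mem _
    · exact mem_wElt
  have epsne : ∀ z : SL(2, F), (z = 1 ∨ z = wMat δ) → eps ψ (δ : F) (⟨z, 1⟩ : Mp2 F) ≠ 0 := by
    rintro z (rfl | rfl)
    · have : eps ψ (δ : F) (⟨1, 1⟩ : Mp2 F) = _ := eps_zElt (F := F) he 1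
      rw [this]; simp
    · have : eps ψ (δ : F) (⟨wMat δ, 1⟩ : Mp2 F) = _ := eps_wElt he
      rw [this]; simp
  suffices h0 : φ (⟨x, 1⟩ * γ * ⟨y, 1⟩) = 0 by
    rw [heckeSpace_mul_right hφ (mem y hy), heckeSpace_mul_left hφ (mem x hx)] at h0
    exact ((mul_eq_zero.1 ((mul_eq_zero.1 h0).resolve_left (epsne y hy))).resolve_left (epsne x hx))
  have hγ' : (⟨x, 1⟩ * γ * ⟨y, 1⟩ : Mp2 F).g = x * γ.g * y := rfl
  have hsz : matSize (δ : F) (⟨x, 1⟩ * γ * ⟨y, 1⟩ : Mp2 F).g.1 = matSize (δ : F) γ.g.1 := by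
    rw [Mp2.mul_g, matSize_mul_of_isGamma_right (mem_gammaGroup.1 (mem y hy)), Mp2.mul_g,
      matSize_mul_of_isGamma_left (mem_gammaGroup.1 (mem x hx))]
  have hne : (x * γ.g * y).1 1 0 ≠ 0 := by
    intro h0
    rw [h0, zero_div, absF_zero] at hxy
    linarith [one_le_matSize (δ := δ) γ.g]
  rw [hecke_apply_of_dominant he hφ (c := Units.mk0 _ hne) rfl (by rw [hsz]; exact hxy)]
  have hs : absF ((c / Units.mk0 _ hne : Fˣ) : F) = 1 := by
    have hδ := absF_pos δ.ne_zero
    have hc' := hc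
    rw [← hxy, absF_div, absF_div] at hc'
    rw [Units.val_div_eq_div_val, absF_div, Units.val_mk0, div_eq_one_iff_eq (absF_pos hne).ne']
    field_simp at hc'
    exact hc'
  have : Units.mk0 _ hne = c / (c / Units.mk0 _ hne) := by simp
  rw [this, hecke_apply_wElt_div he hφ hs, h]
  simp

end Cartan

/-! ## Signs -/

section Sign

/-- The isomorphism of `ZMod 2` with `{±1}`, as a subset of `ℂ`. -/
def sg (x : ZMod 2) : ℂ := if x = 0 then 1 else -1

@[simp] theorem sg_zero : sg 0 = 1 := if_pos rfl

theorem sg_add (x y : ZMod 2) : sg (x + y) = sg x * sg y := by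
  have h : ∀ x : ZMod 2, x = 0 ∨ x = 1 := by decide
  have h2 : (1 : ZMod 2) + 1 = 0 := by decide
  rcases h x with rfl | rfl <;> rcases h y with rfl | rfl <;> simp [sg, h2]

theorem intCast_eq_sg (u : ℤˣ) : ((u : ℤ) : ℂ) = sg (signBit u) := by
  rcases Int.units_eq_one_or u with rfl | rfl <;> simp [sg, signBit]

end Sign

/-! ### Weil's relation with additive signs. -/

section GaussSign

variable {F : Type*} [Field F] [ValuativeRel F] [TopologicalSpace F] [IsNonarchimedeanLocalField F]
  [MeasurableSpace F] [BorelSpace F]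

/-- The normalized Gauss integral on `Fˣ`. -/
def gau (e : AddChar F Circle) (x : Fˣ) : ℂ := gaussFactor e (x : F)

variable {e : AddChar F Circle} [hq : Fact (Odd (resCard F))]

theorem gau_mul (he : IsUnramified e) (x y : Fˣ) : gau e x * gau e y = sg (hs x y) * gau e (x * y) := by
  rw [gau, gau, gaussFactor_mul hq.out he x.ne_zero y.ne_zero, intCast_eq_sg]; rfl

theorem gau_mul_eq (he : IsUnramified e) (x y : Fˣ) : gau e (x * y) = sg (hs x y) * (gau e x * gau e y) := by
  rw [gau_mul he, ← mul_assoc, ← sg_add, CharTwo.add_self_eq_zero, sg_zero, one_mul]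

theorem gau_mul_sq (he : IsUnramified e) (x s : Fˣ) : gau e (x * s ^ 2) = gau e x := by
  rw [gau, gau, Units.val_mul, Units.val_pow_eq_pow_val, gaussFactor_mul_sq hq.out he x.ne_zero s.ne_zero]

theorem gau_unit (he : IsUnramified e) {u : Fˣ} (hu : absF (u : F) = 1) : gau e u = 1 :=
  gaussFactor_unit hq.out he hu

theorem gau_mul_neg (he : IsUnramified e) (x : Fˣ) : gau e x * gau e (-x) = 1 := by
  rw [gau, gau, Units.val_neg, gaussFactor_mul_neg hq.out he x.ne_zero]

theorem gau_ne_zero (he : IsUnramified e) (x : Fˣ) : gau e x ≠ 0 := left_ne_zero_of_mul_eq_one (gau_mul_neg he x)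

theorem gau_mul_self (he : IsUnramified e) (x : Fˣ) : gau e x * gau e x = sg (hsNeg x) := by
  rw [gau_mul he, show x * x = 1 * x ^ 2 by rw [sq, one_mul], gau_mul_sq he, gau_unit he (by simp), mul_one, hs_self]

end GaussSign

/-! ## The Hecke operators -/

section HeckeOperator

variable {F : Type*} [Field F] [ValuativeRel F] [TopologicalSpace F] [IsNonarchimedeanLocalField F]
  [hq : Fact (Odd (resCard F))] [MeasurableSpace F] [BorelSpace F] {ψ : AddChar F Circle} {δ : Fˣ}

/-- This makes functions on the double coset of m(a) well defined. Conjugation by m(a) multiplies c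
by a² and fixes d, so b changes by a square and the cocycles with diag(a, a⁻¹) agree; hence so do
the signs ζ. The values of λ agree too: if |c| = |δ| holds for κ only, the symbol for κ' is one of
two units. -/
theorem eps_eq_of_conj (he : IsUnramified (ψ.mulShift (δ : F)⁻¹)) {a : Fˣ} (ha : absF (a : F) ≤ 1) {κ κ' : Mp2 F}
    (hκ : κ ∈ gammaGroup δ) (hκ' : κ' ∈ gammaGroup δ) (h : κ * mElt a = mElt a * κ') :
    eps ψ (δ : F) κ = eps ψ (δ : F) κ' := by
  rw [mem_gammaGroup] at hκ hκ'
  have ha0 := a.ne_zero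
  have hg : κ.g * dMat a = dMat a * κ'.g := congrArg Mp2.g h
  have hζ : κ.ζ * 1 * cocycle κ.g (dMat a) = 1 * κ'.ζ * cocycle (dMat a) κ'.g := congrArg Mp2.ζ h
  have hc : κ'.g.1 1 0 = κ.g.1 1 0 * a ^ 2 := by
    have := congrArg (fun x : SL(2, F) => x.1 1 0) hg
    simp only [SL2_mul_10, dMat_00, dMat_10, dMat_11, mul_zero, add_zero, zero_mul, zero_add] at this
    field_simp at this
    linear_combination -this
  have hd : κ'.g.1 1 1 = κ.g.1 1 1 := by
    have := congrArg (fun x : SL(2, F) => x.1 1 1) hg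
    simp only [SL2_mul_11, dMat_01, dMat_10, dMat_11, mul_zero, zero_mul, zero_add] at this
    field_simp at this
    exact this.symm
  obtain ⟨s, hb⟩ : ∃ s : Fˣ, bu κ'.g = bu κ.g * s ^ 2 := by
    by_cases h0 : κ.g.1 1 0 = 0
    · refine ⟨1, ?_⟩
      ext
      rw [val_bu, bEntry_of_eq_zero (by rw [hc, h0, zero_mul]), hd]
      simp [bEntry_of_eq_zero h0]
    · refine ⟨a, ?_⟩
      ext
      rw [val_bu, bEntry_of_ne_zero (by rw [hc]; exact mul_ne_zero h0 (pow_ne_zero 2 ha0)), hc]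
      simp [bEntry_of_ne_zero h0]
  have hcoc : cocycle κ.g (dMat a) = cocycle (dMat a) κ'.g := by
    apply signBit_injective
    rw [signBit_cocycle, signBit_cocycle, hg, bu_mul_of_left (dMat_10 a), hb, bu_dMat]
    simp only [hs_neg_left, hs_mul_left, hs_mul_right, hs_inv_left, hs_inv_right, hs_self, hsNeg_mul, hsNeg_inv,
      hsNeg_pow, hs_pow_left, hs_pow_right]
    grind [hs_comm]
  have hζ' : κ.ζ = κ'.ζ := by
    rw [hcoc, mul_one, one_mul] at hζ
    exact mul_right_cancel hζ
  have hle : absF (κ'.g.1 1 0) ≤ absF (κ.g.1 1 0) := by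
    rw [hc, absF_mul, absF_pow]
    exact mul_le_of_le_one_right (absF_nonneg _) (pow_le_one₀ (absF_nonneg _) ha)
  have hlam : lam (δ : F) κ.g = lam (δ : F) κ'.g := by
    apply signBit_injective
    by_cases h2 : absF (κ'.g.1 1 0) = absF (δ : F)
    · rw [signBit_lam_of_eq h2, signBit_lam_of_eq (le_antisymm hκ.c_le (h2 ▸ hle))]
    · have hd1 := hκ'.d_abs h2
      rw [signBit_lam_of_ne h2 (d := Units.mk0 _ (ne_zero_of_absF_eq_one hd1)) rfl, hb]
      by_cases h1 : absF (κ.g.1 1 0) = absF (δ : F)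
      · have h3 := hs_units (v := Units.mk0 _ (ne_zero_of_absF_eq_one hd1)) (absF_bu_div h1) hd1
        rw [signBit_lam_of_eq h1]
        simp only [hs_mul_left, hs_div_left, hs_pow_left] at *
        grind
      · rw [signBit_lam_of_ne h1 (d := Units.mk0 _ (ne_zero_of_absF_eq_one hd1)) (by simp [hd])]
        simp only [hs_mul_left, hs_pow_left]
        grind
  rw [eps_eq he hκ, eps_eq he hκ', hζ', hlam]

/-- Two factorizations of the same element differ by elements of the subgroup conjugate under m(a),
so the choice made in `charFun` does not matter. -/
theorem charFun_apply (he : IsUnramified (ψ.mulShift (δ : F)⁻¹)) {a : Fˣ} (ha : absF (a : F) ≤ 1) {k₁ k₂ : Mp2 F}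
    (h₁ : k₁ ∈ gammaGroup δ) (h₂ : k₂ ∈ gammaGroup δ) : charFun ψ (δ : F) a (k₁ * mElt a * k₂) =
      eps ψ (δ : F) k₁ * (weilIndex ψ (δ : F) a / weilIndex ψ (δ : F) 1) * eps ψ (δ : F) k₂ := by
  have hex : ∃ γ : Mp2 F × Mp2 F, γ.1 ∈ GammaTilde (δ : F) ∧ γ.2 ∈ GammaTilde (δ : F) ∧
      k₁ * mElt a * k₂ = γ.1 * mElt a * γ.2 := ⟨(k₁, k₂), h₁, h₂, rfl⟩
  rw [charFun, dif_pos hex]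
  obtain ⟨g₁, g₂, e⟩ := hex.choose_spec
  set γ := hex.choose
  change γ.1 ∈ gammaGroup δ at g₁
  change γ.2 ∈ gammaGroup δ at g₂
  have hconj : γ.1⁻¹ * k₁ * mElt a = mElt a * (γ.2 * k₂⁻¹) := by
    calc γ.1⁻¹ * k₁ * mElt a = γ.1⁻¹ * (k₁ * mElt a * k₂) * k₂⁻¹ := by group
      _ = mElt a * (γ.2 * k₂⁻¹) := by rw [e]; group
  have key := eps_eq_of_conj he ha (mul_mem (inv_mem g₁) h₁) (mul_mem g₂ (inv_mem h₂)) hconj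
  rw [eps_mul he (inv_mem g₁) h₁, eps_mul he g₂ (inv_mem h₂), eps_inv he g₁, eps_inv he h₂] at key
  have e1 := eps_mul_self he g₁
  have e2 := eps_mul_self he h₂
  linear_combination (weilIndex ψ (δ : F) a / weilIndex ψ (δ : F) 1) * (-eps ψ (δ : F) γ.1 * eps ψ (δ : F) k₂ * key
    - eps ψ (δ : F) γ.1 * eps ψ (δ : F) γ.2 * e2 + eps ψ (δ : F) k₁ * eps ψ (δ : F) k₂ * e1)

theorem charFun_eq_zero {a : Fˣ} {g : Mp2 F}
    (h : ¬∃ γ : Mp2 F × Mp2 F, γ.1 ∈ gammaGroup δ ∧ γ.2 ∈ gammaGroup δ ∧ g = γ.1 * mElt a * γ.2) :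
    charFun ψ (δ : F) a g = 0 := by
  rw [charFun]
  exact dif_neg h

theorem charFun_mem (he : IsUnramified (ψ.mulShift (δ : F)⁻¹)) {μ : Measure (Mp2 F)}
    (h : IsHeckePair μ (gammaGroup δ) (eps ψ (δ : F))) {a : Fˣ} (ha : absF (a : F) ≤ 1) :
    charFun ψ (δ : F) a ∈ heckeSpace (gammaGroup δ : Set (Mp2 F)) (eps ψ (δ : F)) := by
  classical
  constructor
  · obtain ⟨t, ht⟩ := h.exists_finset_doubleCoset (mElt a)
    refine h.hasCompactSupport (finiteCosetSupport_of_finset t fun g hg => ?_)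
    by_contra hcon
    refine hg (charFun_eq_zero ?_)
    rintro ⟨γ, h₁, h₂, rfl⟩
    exact hcon (ht _ h₁ _ h₂)
  · intro γ₁ h₁ γ₂ h₂ g
    by_cases hg : ∃ γ : Mp2 F × Mp2 F, γ.1 ∈ gammaGroup δ ∧ γ.2 ∈ gammaGroup δ ∧ g = γ.1 * mElt a * γ.2
    · obtain ⟨γ, g₁, g₂, rfl⟩ := hg
      rw [show γ₁ * (γ.1 * mElt a * γ.2) * γ₂ = (γ₁ * γ.1) * mElt a * (γ.2 * γ₂) by group,
        charFun_apply he ha (mul_mem h₁ g₁) (mul_mem g₂ h₂), charFun_apply he ha g₁ g₂, eps_mul he h₁ g₁,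
        eps_mul he g₂ h₂, eps_mul he h₁ h₂]
      ring
    · rw [charFun_eq_zero hg, charFun_eq_zero, mul_zero]
      rintro ⟨γ, g₁, g₂, e⟩
      refine hg ⟨(γ₁⁻¹ * γ.1, γ.2 * γ₂⁻¹), mul_mem (inv_mem h₁) g₁, mul_mem g₂ (inv_mem h₂), ?_⟩
      calc g = γ₁⁻¹ * (γ₁ * g * γ₂) * γ₂⁻¹ := by group
        _ = _ := by rw [e]; group

theorem matSize_dMat {a : Fˣ} (ha : absF (a : F) ≤ 1) : matSize (δ : F) (dMat a).1 = (absF (a : F))⁻¹ := by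
  have h1 : absF (a : F) ≤ (absF (a : F))⁻¹ := ha.trans ((one_le_inv₀ (absF_pos a.ne_zero)).2 ha)
  have h2 : (0 : ℝ) ≤ (absF (a : F))⁻¹ := inv_nonneg.2 (absF_nonneg _)
  rw [matSize]
  simp only [dMat_00, dMat_01, dMat_10, dMat_11, zero_mul, zero_div, absF_zero, absF_inv]
  rw [max_eq_left (absF_nonneg _), max_eq_right h2, max_eq_right h1]

variable {ϖ : Fˣ}

theorem absF_uniformizer_pow (hϖ : absF (ϖ : F) = (resCard F : ℝ)⁻¹) (m : ℕ) :
    absF ((ϖ ^ m : Fˣ) : F) = ((resCard F : ℝ) ^ m)⁻¹ := by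
  rw [Units.val_pow_eq_pow_val, absF_pow, hϖ, inv_pow]

theorem absF_uniformizer_pow_le (hϖ : absF (ϖ : F) = (resCard F : ℝ)⁻¹) (m : ℕ) :
    absF ((ϖ ^ m : Fˣ) : F) ≤ 1 := by
  rw [absF_uniformizer_pow hϖ]
  exact inv_le_one_of_one_le₀ (one_le_pow₀ (one_lt_resCard F).le)

variable (F) in
/-- The complex number `q ^ (-1/2)`. -/
def rq : ℂ := ((√(resCard F : ℝ) : ℝ) : ℂ)⁻¹

variable (F) in
theorem rq_sq : resCard F * (rq F * rq F) = 1 := by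
  have hs : (√(resCard F : ℝ) : ℂ) * √(resCard F : ℝ) = resCard F := by
    rw [← Complex.ofReal_mul, Real.mul_self_sqrt (resCard_pos F).le, Complex.ofReal_natCast]
  rw [rq, ← mul_inv, hs]
  exact mul_inv_cancel₀ (by exact_mod_cast resCard_ne_zero F)

theorem resCard_rpow (m : ℕ) : ((((resCard F : ℝ) ^ (-(m : ℝ) / 2) : ℝ)) : ℂ) = rq F ^ m := by
  rw [rq, ← Complex.ofReal_inv, ← Complex.ofReal_pow]
  congr 1
  rw [Real.sqrt_eq_rpow, ← Real.rpow_neg (resCard_pos F).le, ← Real.rpow_natCast, ← Real.rpow_mul (resCard_pos F).le]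
  congr 1
  ring

theorem Ttilde_mem (he : IsUnramified (ψ.mulShift (δ : F)⁻¹)) (hϖ : absF (ϖ : F) = (resCard F : ℝ)⁻¹)
    {μ : Measure (Mp2 F)} (h : IsHeckePair μ (gammaGroup δ) (eps ψ (δ : F))) (m : ℕ) :
    Ttilde ψ (δ : F) ϖ m ∈ heckeSpace (gammaGroup δ : Set (Mp2 F)) (eps ψ (δ : F)) :=
  Submodule.smul_mem _ _ (charFun_mem he h (absF_uniformizer_pow_le hϖ m))

theorem Ttilde_eq_zero (hϖ : absF (ϖ : F) = (resCard F : ℝ)⁻¹) {m : ℕ} {γ : Mp2 F}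
    (h : matSize (δ : F) γ.g.1 ≠ (resCard F : ℝ) ^ m) : Ttilde ψ (δ : F) ϖ m γ = 0 := by
  rw [Ttilde, Pi.smul_apply, charFun_eq_zero, smul_zero]
  rintro ⟨k, h₁, h₂, rfl⟩
  refine h ?_
  rw [Mp2.mul_g, Mp2.mul_g, matSize_mul_of_isGamma_right (mem_gammaGroup.1 h₂),
    matSize_mul_of_isGamma_left (mem_gammaGroup.1 h₁), mElt_g, matSize_dMat (absF_uniformizer_pow_le hϖ m),
    absF_uniformizer_pow hϖ, inv_inv]

theorem Ttilde_apply_mul (he : IsUnramified (ψ.mulShift (δ : F)⁻¹)) (hϖ : absF (ϖ : F) = (resCard F : ℝ)⁻¹)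
    (m : ℕ) {k₁ k₂ : Mp2 F} (h₁ : k₁ ∈ gammaGroup δ) (h₂ : k₂ ∈ gammaGroup δ) :
    Ttilde ψ (δ : F) ϖ m (k₁ * mElt (ϖ ^ m) * k₂) = rq F ^ m *
      (eps ψ (δ : F) k₁ * (sg (hs (ϖ ^ m) δ) * gau (ψ.mulShift (δ : F)⁻¹) (ϖ ^ m)) * eps ψ (δ : F) k₂) := by
  rw [Ttilde, Pi.smul_apply, charFun_apply he (absF_uniformizer_pow_le hϖ m) h₁ h₂, smul_eq_mul, resCard_rpow,
    weilIndex_div hq.out δ.ne_zero he (Units.ne_zero _), intCast_eq_sg]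
  rfl

/-- The value of a Hecke operator at an element with dominant lower left entry. -/
theorem Ttilde_apply_c (he : IsUnramified (ψ.mulShift (δ : F)⁻¹)) (hϖ : absF (ϖ : F) = (resCard F : ℝ)⁻¹)
    {μ : Measure (Mp2 F)} (h : IsHeckePair μ (gammaGroup δ) (eps ψ (δ : F))) {m : ℕ} {γ : Mp2 F} {c : Fˣ}
    (hγ : γ.g.1 1 0 = c) (hc : absF ((c : F) / δ) = (resCard F : ℝ) ^ m)
    (hsize : matSize (δ : F) γ.g.1 = (resCard F : ℝ) ^ m) : Ttilde ψ (δ : F) ϖ m γ =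
      sg (signBit γ.ζ) * (rq F ^ m * gau (ψ.mulShift (δ : F)⁻¹) (c * δ)) := by
  have hT := Ttilde_mem he hϖ h m
  rw [hecke_apply_of_dominant he hT hγ (hc.trans hsize.symm), intCast_eq_sg]
  congr 1
  set t := ϖ ^ m with ht
  -- This is the unit with c = δ/t/s. The value at w_(δ/t) is known from w_(δ/t) = [1, (t, δ)] m(t)
  -- w_δ, and passing to w_c costs only the signs of the unit s.
  set s := δ / c / t with hs'
  have hs1 : absF (s : F) = 1 := by
    rw [absF_div] at hc
    rw [hs', Units.val_div_eq_div_val, Units.val_div_eq_div_val, absF_div, absF_div, absF_uniformizer_pow hϖ, ← hc]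
    have := (absF_pos c.ne_zero).ne'
    have := (absF_pos δ.ne_zero).ne'
    field_simp
  have hcs : c = δ / t / s := by
    rw [hs']
    simp [div_div_eq_mul_div, mul_comm]
  have h0 := Ttilde_apply_mul he hϖ m (mem_zElt (δ := δ) (hilbertSymbol (t : F) δ)) mem_wElt
  rw [← ht, ← wElt_div, eps_zElt he, eps_wElt he, intCast_eq_sg] at h0
  have hcs' : gau (ψ.mulShift (δ : F)⁻¹) (c * δ) = sg (hs s t) * gau (ψ.mulShift (δ : F)⁻¹) t := by
    have e1 : c * δ = s * t * (c) ^ 2 := by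
      rw [hs', sq]
      calc c * δ = δ * c := mul_comm _ _
        _ = δ / c / t * t * (c * c) := by rw [div_mul_cancel, ← mul_assoc, div_mul_cancel]
    rw [e1, gau_mul_sq he, gau_mul_eq he, gau_unit he hs1, one_mul]
  rw [hcs', hcs, hecke_apply_wElt_div he hT hs1, h0, intCast_eq_sg, intCast_eq_sg]
  have e2 : sg (hs s (δ / t)) * (sg (hs s δ) * (sg (hs t δ) * sg (hs t δ))) = sg (hs s t) := by
    rw [← sg_add, ← sg_add, ← sg_add]
    congr 1
    rw [hs_div_right]
    grind
  change sg (hs s (δ / t)) * (sg (hs s δ) * _) = _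
  change _ * (_ * (_ * (sg (hs t δ) * _ * _))) = _
  linear_combination (rq F ^ m * gau (ψ.mulShift (δ : F)⁻¹) t) * e2

/-- The value of a Hecke operator at an element with dominant upper left entry. -/
theorem Ttilde_apply_a (he : IsUnramified (ψ.mulShift (δ : F)⁻¹)) (hϖ : absF (ϖ : F) = (resCard F : ℝ)⁻¹)
    {μ : Measure (Mp2 F)} (h : IsHeckePair μ (gammaGroup δ) (eps ψ (δ : F))) {m : ℕ} {γ : Mp2 F} {a : Fˣ}
    (hγ : γ.g.1 0 0 = a) (ha : absF (a : F) = (resCard F : ℝ) ^ m)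
    (hsize : matSize (δ : F) γ.g.1 = (resCard F : ℝ) ^ m) : Ttilde ψ (δ : F) ϖ m γ =
      sg (signBit γ.ζ + hs a (-(δ * bu γ.g))) *
        (rq F ^ m * gau (ψ.mulShift (δ : F)⁻¹) a) := by
  have hT := Ttilde_mem he hϖ h m
  -- Left multiplication by w_δ, where ε is 1, turns the dominant entry a into the lower left entry
  -- δa.
  have h1 := heckeSpace_mul_left hT mem_wElt γ
  rw [eps_wElt he, one_mul] at h1
  have hc : (wElt δ * γ).g.1 1 0 = ((δ * a : Fˣ) : F) := by
    rw [Mp2.mul_g, SL2_mul_10]; simp [hγ]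
  rw [← h1, Ttilde_apply_c he hϖ h hc]
  · have e1 : δ * a * δ = a * δ ^ 2 := by rw [sq, mul_comm δ a, mul_assoc]
    rw [e1, gau_mul_sq he, Mp2.mul_ζ, wElt_ζ, one_mul, signBit_mul, signBit_cocycle, wElt_g, bu_wMat]
    have e2 : bu (wMat δ * γ.g) = δ * a := bu_of_ne_zero hc
    rw [e2]
    congr 2
    simp only [hs_neg_left, hs_neg_right, hs_mul_left, hs_mul_right, hs_self, hsNeg_mul]
    grind [hs_comm]
  · rw [Units.val_mul, mul_div_cancel_left₀ _ δ.ne_zero, ha]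
  · rw [Mp2.mul_g, wElt_g, matSize_mul_of_isGamma_left isGamma_wMat, hsize]

end HeckeOperator

/-! ## Cosets in the double coset of a uniformizer -/

section Cosets

variable {F : Type*} [Field F] [ValuativeRel F] [TopologicalSpace F] [IsNonarchimedeanLocalField F]

/-- The matrix `(1, y; 0, 1) diag(t, t⁻¹)`. -/
def bMat (y : F) (t : Fˣ) : SL(2, F) := uMat y * dMat t

theorem bMat_inv (y : F) (t : Fˣ) : (bMat y t)⁻¹ = dMat t⁻¹ * uMat (-y) := by
  have : (dMat t)⁻¹ = dMat t⁻¹ := by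
    refine inv_eq_of_mul_eq_one_right (SL2_ext ?_ ?_ ?_ ?_) <;>
      simp [SL2_mul_00, SL2_mul_01, SL2_mul_10, SL2_mul_11]
  rw [bMat, mul_inv_rev, this, uMat_inv]

theorem bMat_inv_mul_00 (y : F) (t : Fˣ) (g : SL(2, F)) :
    ((bMat y t)⁻¹ * g).1 0 0 = (t : F)⁻¹ * (g.1 0 0 - y * g.1 1 0) := by
  rw [bMat_inv]; simp [SL2_mul_00, SL2_mul_01]; ring

theorem bMat_inv_mul_01 (y : F) (t : Fˣ) (g : SL(2, F)) :
    ((bMat y t)⁻¹ * g).1 0 1 = (t : F)⁻¹ * (g.1 0 1 - y * g.1 1 1) := by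
  rw [bMat_inv]; simp [SL2_mul_00, SL2_mul_01]; ring

theorem bMat_inv_mul_10 (y : F) (t : Fˣ) (g : SL(2, F)) :
    ((bMat y t)⁻¹ * g).1 1 0 = t * g.1 1 0 := by
  rw [bMat_inv]; simp [SL2_mul_10, SL2_mul_11]

theorem bMat_inv_mul_11 (y : F) (t : Fˣ) (g : SL(2, F)) :
    ((bMat y t)⁻¹ * g).1 1 1 = t * g.1 1 1 := by
  rw [bMat_inv]; simp [SL2_mul_10, SL2_mul_11]

variable {δ : Fˣ}

/-- Here t rescales the lower row and y cancels the upper left entry up to an error of size |t|; the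
bound for the upper right entry then follows from the determinant. -/
theorem isGamma_bMat_inv_mul {y : F} {t : Fˣ} {g : SL(2, F)} (hc : absF (g.1 1 0 / δ) = (absF (t : F))⁻¹)
    (hd : absF (g.1 1 1) ≤ absF (g.1 1 0 / δ)) (ha : absF (g.1 0 0 * δ / g.1 1 0 - y * δ) ≤ absF (t : F) ^ 2) :
    IsGamma (δ : F) ((bMat y t)⁻¹ * g) := by
  have hδ := δ.ne_zero
  have ht := absF_pos t.ne_zero
  have hc0 : g.1 1 0 ≠ 0 := by
    intro h0
    rw [h0, zero_div, absF_zero] at hc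
    exact (inv_pos.2 ht).ne hc
  have key : absF (g.1 0 0 - y * g.1 1 0) ≤ absF (t : F) := by
    rw [show g.1 0 0 - y * g.1 1 0 = (g.1 0 0 * δ / g.1 1 0 - y * δ) * (g.1 1 0 / δ) by field_simp, absF_mul, hc]
    calc _ ≤ absF (t : F) ^ 2 * (absF (t : F))⁻¹ := by gcongr
      _ = _ := by field_simp
  refine IsGamma.of_le ?_ ?_ ?_ ?_
  · rw [bMat_inv_mul_00, absF_mul, absF_inv, inv_mul_le_one₀ ht]
    exact key
  · rw [bMat_inv_mul_01, mul_assoc, absF_mul, absF_inv, inv_mul_le_one₀ ht,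
      show (g.1 0 1 - y * g.1 1 1) * (δ : F) =
        (g.1 0 0 - y * g.1 1 0) * (g.1 1 1 / (g.1 1 0 / δ)) - (g.1 1 0 / δ)⁻¹ by
        field_simp
        linear_combination (-1) * SL2_det g]
    refine absF_sub_le ?_ ?_
    · rw [absF_mul, absF_div]
      exact (mul_le_of_le_one_right (absF_nonneg _) (div_le_one_of_le₀ hd (absF_nonneg _))).trans key
    · rw [absF_inv, hc, inv_inv]
  · rw [bMat_inv_mul_10, mul_div_assoc, absF_mul, hc, mul_inv_cancel₀ ht.ne']
  · rw [bMat_inv_mul_11, absF_mul, ← mul_inv_cancel₀ ht.ne', ← hc]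
    gcongr

variable {ϖ : Fˣ}

/-- The translations which occur in the representatives of the cosets. -/
def cosetY (δ ϖ : Fˣ) : (𝓀[F] × 𝓀[F]) ⊕ 𝓀[F] → F
  | Sum.inl p => (sec p.1 + ϖ * sec p.2) / δ
  | Sum.inr r => sec r / ϖ / δ

open Classical in
/-- The diagonal parts of the representatives of the cosets. -/
def cosetT (ϖ : Fˣ) : (𝓀[F] × 𝓀[F]) ⊕ 𝓀[F] → Fˣ
  | Sum.inl _ => ϖ
  | Sum.inr r => if r = 0 then ϖ⁻¹ else 1

/-- When the lower row is dominated by |c/δ| = q^k, determinant 1 and size q force k to be 1, 0 or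
-1, and t must have absolute value q^(-k). The coset depends on aδ/c modulo t²𝔬. For k = 1 this
means two residue digits, for k = 0 one digit, which is not zero since otherwise g would lie in
Γ₀(1), and for k = -1 none. Altogether there are q² + (q - 1) + 1 representatives. -/
theorem exists_coset (hϖ : absF (ϖ : F) = (resCard F : ℝ)⁻¹) {g : SL(2, F)}
    (hg : matSize (δ : F) g.1 = resCard F) :
    ∃ i, IsGamma (δ : F) ((bMat (cosetY δ ϖ i) (cosetT ϖ i))⁻¹ * g) := by
  have hδ := δ.ne_zero
  have hϖ0 := ϖ.ne_zero
  have hq := resCard_pos F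
  have hq1 := one_lt_resCard F
  suffices main : ∀ g : SL(2, F), matSize (δ : F) g.1 = resCard F → absF (g.1 1 1) ≤ absF (g.1 1 0 / δ) →
      ∃ i, IsGamma (δ : F) ((bMat (cosetY δ ϖ i) (cosetT ϖ i))⁻¹ * g) by
    rcases le_total (absF (g.1 1 1)) (absF (g.1 1 0 / δ)) with h | h
    · exact main g hg h
    -- Right multiplication by w_δ exchanges the absolute values of c/δ and d without changing the
    -- left coset.
    · obtain ⟨i, hi⟩ := main (g * wMat δ) (by rw [matSize_mul_of_isGamma_right isGamma_wMat, hg]) (by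
        rw [SL2_mul_10, SL2_mul_11]
        simp only [wMat_00, wMat_01, wMat_10, wMat_11, mul_zero, zero_add, add_zero]
        rw [mul_div_cancel_right₀ _ hδ, mul_neg, absF_neg, ← div_eq_mul_inv]
        exact h)
      refine ⟨i, ?_⟩
      have := hi.mul isGamma_wMat.inv
      rwa [← mul_assoc, mul_inv_cancel_right] at this
  intro g hg hd
  obtain ⟨⟨ha, -⟩, hc, -⟩ := matSize_bounds (δ : F) g.1
  have hdet := absF_det_le hδ g.1
  rw [g.2, absF_one, hg, max_eq_left hd] at hdet
  have hcne : g.1 1 0 / (δ : F) ≠ 0 := by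
    intro h0; rw [h0, absF_zero, mul_zero] at hdet; linarith
  have hc0 : g.1 1 0 ≠ 0 := fun h0 => hcne (by rw [h0, zero_div])
  obtain ⟨k, hk⟩ := exists_absF_eq_zpow hcne
  have hk1 : k ≤ 1 := by
    rw [hg, hk] at hc
    exact (zpow_le_zpow_iff_right₀ hq1).1 (by simpa using hc)
  have hk2 : -1 ≤ k := by
    rw [hk, ← zpow_one_add₀ hq.ne', one_le_zpow_iff_right₀ hq1] at hdet
    omega
  have hs0 : absF (g.1 0 0 * δ / g.1 1 0) ≤ (resCard F : ℝ) ^ (1 - k) := by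
    rw [show g.1 0 0 * (δ : F) / g.1 1 0 = g.1 0 0 / (g.1 1 0 / δ) by field_simp, absF_div, hk, zpow_sub₀ hq.ne', zpow_one]
    rw [hg] at ha
    gcongr
  set s₀ := g.1 0 0 * δ / g.1 1 0 with hs0d
  have hk' : k = 1 ∨ k = 0 ∨ k = -1 := by omega
  rcases hk' with rfl | rfl | rfl
  · rw [sub_self, zpow_zero] at hs0
    have h1 := (absF_sub_sec hs0).2 rfl
    have h2 : absF ((s₀ - sec (red s₀)) / ϖ) ≤ 1 := by
      rw [absF_lt_one_iff_le] at h1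
      rw [absF_div, hϖ, div_le_one (inv_pos.2 hq)]; exact h1
    have h3 := (absF_sub_sec h2).2 rfl
    rw [absF_lt_one_iff_le] at h3
    refine ⟨Sum.inl (red s₀, red ((s₀ - sec (red s₀)) / ϖ)), isGamma_bMat_inv_mul ?_ hd ?_⟩
    · rw [hk, cosetT, hϖ]; simp
    · rw [← hs0d, cosetY, cosetT, div_mul_cancel₀ _ hδ, hϖ, sq]
      rw [show s₀ - (sec (red s₀) + ϖ * sec (red ((s₀ - sec (red s₀)) / ϖ))) =
        ϖ * ((s₀ - sec (red s₀)) / ϖ - sec (red ((s₀ - sec (red s₀)) / ϖ))) by field_simp; ring, absF_mul, hϖ]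
      gcongr
  · rw [sub_zero, zpow_one] at hs0
    have h1 : absF (ϖ * s₀) ≤ 1 := by
      rw [absF_mul, hϖ, inv_mul_le_one₀ hq]; exact hs0
    have h2 := (absF_sub_sec h1).2 rfl
    rw [absF_lt_one_iff_le] at h2
    have hr : red (ϖ * s₀) ≠ 0 := by
      intro h0
      rw [red_eq_zero_iff h1, absF_lt_one_iff_le, absF_mul, hϖ] at h0
      have h3 : absF s₀ ≤ 1 := by
        rwa [mul_le_iff_le_one_right (inv_pos.2 hq)] at h0
      have := isGamma_bMat_inv_mul (δ := δ) (y := 0) (t := 1) (g := g) (by rw [hk]; simp) hd (by rw [← hs0d]; simpa using h3)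
      have e : (bMat (0 : F) 1)⁻¹ = 1 := by
        rw [inv_eq_one, bMat]
        refine SL2_ext ?_ ?_ ?_ ?_ <;> simp [SL2_mul_00, SL2_mul_01, SL2_mul_10, SL2_mul_11]
      rw [e, one_mul, isGamma_iff_matSize, hg] at this
      linarith
    refine ⟨Sum.inr (red (ϖ * s₀)), isGamma_bMat_inv_mul ?_ hd ?_⟩
    · rw [hk, cosetT, if_neg hr]; simp
    · rw [← hs0d, cosetY, cosetT, if_neg hr, div_mul_cancel₀ _ hδ,
        show s₀ - sec (red (ϖ * s₀)) / ϖ = (ϖ * s₀ - sec (red (ϖ * s₀))) / ϖ by field_simp, absF_div, hϖ]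
      rw [Units.val_one, absF_one, one_pow, div_le_one (inv_pos.2 hq)]
      exact h2
  · refine ⟨Sum.inr 0, isGamma_bMat_inv_mul ?_ hd ?_⟩
    · rw [hk, cosetT, if_pos rfl, Units.val_inv_eq_inv_val, absF_inv, hϖ]; simp
    · rw [← hs0d, cosetY, cosetT, if_pos rfl, Units.val_inv_eq_inv_val, absF_inv, hϖ, sec_zero]
      simpa [zpow_ofNat] using hs0

theorem sec_injective_of_sub_lt {r r' : 𝓀[F]} (h : absF (sec r - sec r') < 1) : r = r' := by
  rw [absF_sub_sec (absF_sec_le r), red_sec] at h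
  exact h

/-- The diagonal entries of the quotient force |t| to agree, and the upper right entry forces the
translations to agree modulo t²; the residue digits can then be read off. -/
theorem coset_injective (hϖ : absF (ϖ : F) = (resCard F : ℝ)⁻¹) {i j : (𝓀[F] × 𝓀[F]) ⊕ 𝓀[F]}
    (h : IsGamma (δ : F) ((bMat (cosetY δ ϖ i) (cosetT ϖ i))⁻¹ * bMat (cosetY δ ϖ j) (cosetT ϖ j))) : i = j := by
  have hδ := δ.ne_zero
  have hϖ0 := ϖ.ne_zero
  have hq := resCard_pos F
  have hq1 := one_lt_resCard F
  set t := cosetT ϖ i with ht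
  set t' := cosetT ϖ j with ht'
  have tpos := absF_pos t.ne_zero
  have tpos' := absF_pos t'.ne_zero
  have e00 : (bMat (cosetY δ ϖ j) t').1 0 0 = t' := by simp [bMat, SL2_mul_00]
  have e01 : (bMat (cosetY δ ϖ j) t').1 0 1 = cosetY δ ϖ j * (t' : F)⁻¹ := by simp [bMat, SL2_mul_01]
  have e10 : (bMat (cosetY δ ϖ j) t').1 1 0 = 0 := by simp [bMat, SL2_mul_10]
  have e11 : (bMat (cosetY δ ϖ j) t').1 1 1 = (t' : F)⁻¹ := by simp [bMat, SL2_mul_11]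
  have h1 := h.a_le
  have h2 := h.d_le
  have h3 := h.b_mul_le
  rw [bMat_inv_mul_00, e00, e10, mul_zero, sub_zero, absF_mul, absF_inv, inv_mul_le_one₀ tpos] at h1
  rw [bMat_inv_mul_11, e11, absF_mul, absF_inv, ← div_eq_mul_inv, div_le_one tpos'] at h2
  have htt : absF (t : F) = absF (t' : F) := le_antisymm h2 h1
  rw [bMat_inv_mul_01, e01, e11] at h3
  have h4 : absF ((cosetY δ ϖ j - cosetY δ ϖ i) * δ) ≤ absF (t : F) * absF (t : F) := by
    rw [show (t : F)⁻¹ * (cosetY δ ϖ j * (t' : F)⁻¹ - cosetY δ ϖ i * (t' : F)⁻¹) * δ =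
      (cosetY δ ϖ j - cosetY δ ϖ i) * δ / (t * t') by field_simp, absF_div, absF_mul (t : F), ← htt,
      div_le_one (by positivity)] at h3
    exact h3
  have hϖinv : absF ((ϖ⁻¹ : Fˣ) : F) = resCard F := by rw [Units.val_inv_eq_inv_val, absF_inv, hϖ, inv_inv]
  have hlt : (resCard F : ℝ)⁻¹ < 1 := inv_lt_one_of_one_lt₀ hq1
  rcases i with ⟨a, b⟩ | r <;> rcases j with ⟨a', b'⟩ | r'
  · simp only [cosetT] at ht
    rw [ht, hϖ, cosetY, cosetY, ← sub_div, div_mul_cancel₀ _ hδ] at h4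
    simp only at h4
    have h5 : a' = a := by
      refine sec_injective_of_sub_lt ?_
      have : sec a' - sec a = (sec a' + ϖ * sec b' - (sec a + ϖ * sec b)) + ϖ * (sec b - sec b') := by ring
      rw [this]
      refine absF_add_lt (h4.trans_lt (mul_lt_one_of_nonneg_of_lt_one_left (inv_pos.2 hq).le hlt hlt.le)) ?_
      exact absF_mul_lt_one (by rw [hϖ]; exact hlt) (absF_sub_le (absF_sec_le _) (absF_sec_le _))
    subst h5
    have h6 : b' = b := by
      refine sec_injective_of_sub_lt ?_
      rw [show sec a' + ϖ * sec b' - (sec a' + ϖ * sec b) = ϖ * (sec b' - sec b) by ring, absF_mul, hϖ] at h4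
      exact (le_of_mul_le_mul_left h4 (inv_pos.2 hq)).trans_lt hlt
    rw [h6]
  · simp only [cosetT] at ht ht'
    rw [ht, ht', hϖ] at htt
    split_ifs at htt
    · rw [hϖinv] at htt; linarith
    · rw [Units.val_one, absF_one] at htt; linarith
  · simp only [cosetT] at ht ht'
    rw [ht, ht', hϖ] at htt
    split_ifs at htt
    · rw [hϖinv] at htt; linarith
    · rw [Units.val_one, absF_one] at htt; linarith
  · simp only [cosetT] at ht ht'
    by_cases hr : r = 0 <;> by_cases hr' : r' = 0
    · rw [hr, hr']
    · rw [ht, ht', if_pos hr, if_neg hr', hϖinv, Units.val_one, absF_one] at htt; linarith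
    · rw [ht, ht', if_neg hr, if_pos hr', hϖinv, Units.val_one, absF_one] at htt; linarith
    · rw [ht, if_neg hr, Units.val_one, absF_one, mul_one, cosetY, cosetY, ← sub_div, div_mul_cancel₀ _ hδ,
        ← sub_div, absF_div, hϖ, div_le_one (inv_pos.2 hq)] at h4
      exact congrArg Sum.inr (sec_injective_of_sub_lt (h4.trans_lt hlt)).symm

end Cosets

/-! ## The product of two Hecke operators -/

section Terms

variable {F : Type*} [Field F] [ValuativeRel F] [TopologicalSpace F] [IsNonarchimedeanLocalField F]

/-- The element `[(1, y; 0, 1), 1] m(t)`. -/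
def bElt (y : F) (t : Fˣ) : Mp2 F := uElt y * mElt t

theorem bElt_g (y : F) (t : Fˣ) : (bElt y t).g = bMat y t := rfl

variable {δ ϖ : Fˣ}

theorem bMat_inv_mul_wMat (y : F) (t c : Fˣ) :
    ((bMat y t)⁻¹ * wMat c).1 0 0 = -((t : F)⁻¹ * y * c) ∧ ((bMat y t)⁻¹ * wMat c).1 0 1 = -((t : F)⁻¹ * (c : F)⁻¹) ∧
      ((bMat y t)⁻¹ * wMat c).1 1 0 = ((t * c : Fˣ) : F) ∧ ((bMat y t)⁻¹ * wMat c).1 1 1 = 0 := by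
  rw [bMat_inv_mul_00, bMat_inv_mul_01, bMat_inv_mul_10, bMat_inv_mul_11]
  simp [mul_assoc]

theorem bu_bMat_inv_mul_wMat (y : F) (t c : Fˣ) : bu ((bMat y t)⁻¹ * wMat c) = t * c :=
  bu_of_ne_zero (bMat_inv_mul_wMat y t c).2.2.1

theorem matSize_bMat_inv_mul_wMat {y : F} {t c : Fˣ} {j n : ℤ} (ht : absF (t : F) = (resCard F : ℝ) ^ (-j))
    (hc : absF ((c : F) / δ) = (resCard F : ℝ) ^ n) : matSize (δ : F) ((bMat y t)⁻¹ * wMat c).1 =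
      max (max (absF (y * δ) * (resCard F : ℝ) ^ (j + n)) ((resCard F : ℝ) ^ (j - n))) ((resCard F : ℝ) ^ (n - j)) := by
  have hδ := δ.ne_zero
  have hq := (resCard_pos F).ne'
  obtain ⟨e1, e2, e3, e4⟩ := bMat_inv_mul_wMat y t c
  rw [matSize, e1, e2, e3, e4, absF_zero, max_eq_left (absF_nonneg _)]
  congr 2
  · rw [absF_neg, show (t : F)⁻¹ * y * c = (y * δ) * ((t : F)⁻¹ * (c / δ)) by field_simp, absF_mul, absF_mul (t : F)⁻¹,
      absF_inv, ht, hc, ← zpow_neg, neg_neg, ← zpow_add₀ hq]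
  · rw [neg_mul, absF_neg, show (t : F)⁻¹ * (c : F)⁻¹ * δ = (t : F)⁻¹ * (c / δ : F)⁻¹ by field_simp, absF_mul,
      absF_inv, absF_inv, ht, hc, ← zpow_neg, ← zpow_neg, neg_neg, ← zpow_add₀ hq, sub_eq_add_neg]
  · rw [Units.val_mul, mul_div_assoc, absF_mul, ht, hc, ← zpow_add₀ hq, neg_add_eq_sub]

variable [hq : Fact (Odd (resCard F))]

theorem signBit_bElt_inv_mul_wElt (y : F) (t c : Fˣ) :
    signBit ((bElt y t)⁻¹ * wElt c).ζ = hs t (-c) := by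
  have e : (bElt y t)⁻¹ * wElt c = (mElt t)⁻¹ * (uElt (-y) * wElt c) := by
    rw [bElt, mul_inv_rev, uElt_inv, mul_assoc]
  have h1 : (dMat t)⁻¹ = dMat t⁻¹ := by
    refine inv_eq_of_mul_eq_one_right (SL2_ext ?_ ?_ ?_ ?_) <;>
      simp [SL2_mul_00, SL2_mul_01, SL2_mul_10, SL2_mul_11]
  have h2 : bu (uMat (-y) * wMat c) = c := by rw [bu_mul_of_left (uMat_10 _), bu_uMat, bu_wMat, one_mul]
  have h3 : bu (dMat t * dMat t⁻¹) = 1 := by rw [← h1, mul_inv_cancel]; ext; simp [bEntry]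
  rw [e]
  simp only [Mp2.mul_ζ, Mp2.inv_ζ, Mp2.inv_g, Mp2.mul_g, mElt_ζ, mElt_g, uElt_ζ, uElt_g, wElt_ζ, wElt_g, one_mul,
    cocycle_uMat_left, mul_one, h1, signBit_mul, signBit_cocycle, h2, h3, bu_mul_of_left (dMat_10 t⁻¹), bu_dMat]
  simp only [hs_neg_left, hs_neg_right, hs_mul_left, hs_mul_right, hs_inv_left, hs_inv_right, hs_self, hsNeg_mul,
    hsNeg_inv, hs_one_left, hs_one_right, hsNeg_one]
  grind [hs_comm]

variable [MeasurableSpace F] [BorelSpace F] {ψ : AddChar F Circle} {μ : Measure (Mp2 F)}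

theorem Ttilde_one_bElt (he : IsUnramified (ψ.mulShift (δ : F)⁻¹)) (hϖ : absF (ϖ : F) = (resCard F : ℝ)⁻¹)
    {y : F} (hy : absF (y * δ) ≤ 1) : Ttilde ψ (δ : F) ϖ 1 (bElt y ϖ) =
      rq F * (sg (hs ϖ δ) * gau (ψ.mulShift (δ : F)⁻¹) ϖ) := by
  have := Ttilde_apply_mul he hϖ 1 (mem_uElt hy) (one_mem (gammaGroup δ))
  rw [pow_one, pow_one, eps_uElt he hy, eps_one he, mul_one, one_mul, mul_one] at this
  exact this

theorem Ttilde_one_bElt_inv (he : IsUnramified (ψ.mulShift (δ : F)⁻¹)) (hϖ : absF (ϖ : F) = (resCard F : ℝ)⁻¹)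
    (h : IsHeckePair μ (gammaGroup δ) (eps ψ (δ : F))) : Ttilde ψ (δ : F) ϖ 1 (bElt 0 ϖ⁻¹) =
      rq F * (sg (hs ϖ δ) * gau (ψ.mulShift (δ : F)⁻¹) ϖ) := by
  have hq1 := one_lt_resCard F
  have h0 : (uMat (0 : F)) = 1 := SL2_ext (by simp) (by simp) (by simp) (by simp)
  have hg : (bElt (0 : F) ϖ⁻¹).g = dMat ϖ⁻¹ := by rw [bElt_g, bMat, h0, one_mul]
  have hζ : (bElt (0 : F) ϖ⁻¹).ζ = 1 := by simp [bElt, cocycle_uMat_left]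
  rw [Ttilde_apply_a he hϖ h (a := ϖ⁻¹) (by rw [hg]; simp) (by simp [hϖ]), hζ, hg, bu_dMat, pow_one]
  · have e1 : gau (ψ.mulShift (δ : F)⁻¹) ϖ⁻¹ = gau (ψ.mulShift (δ : F)⁻¹) ϖ := by
      rw [← gau_mul_sq he ϖ⁻¹ ϖ, sq, inv_mul_cancel_left]
    rw [e1]
    have e2 : signBit 1 + hs ϖ⁻¹ (-(δ * ϖ⁻¹⁻¹)) = hs ϖ δ := by
      simp only [signBit_one, inv_inv, hs_neg_right, hs_mul_right, hs_inv_left, hs_self, hsNeg_inv]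
      grind
    rw [e2]; ring
  · rw [hg, matSize]
    simp only [dMat_00, dMat_01, dMat_10, dMat_11, zero_mul, zero_div, absF_zero, Units.val_inv_eq_inv_val, absF_inv,
      hϖ, inv_inv, pow_one]
    have h1 : (resCard F : ℝ)⁻¹ ≤ resCard F := (inv_le_one_of_one_le₀ hq1.le).trans hq1.le
    rw [max_eq_left (resCard_pos F).le, max_eq_right (inv_pos.2 (resCard_pos F)).le, max_eq_left h1]

theorem Ttilde_one_uElt (he : IsUnramified (ψ.mulShift (δ : F)⁻¹)) (hϖ : absF (ϖ : F) = (resCard F : ℝ)⁻¹)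
    (h : IsHeckePair μ (gammaGroup δ) (eps ψ (δ : F))) {s : Fˣ} (hs' : absF (s : F) = resCard F) :
    Ttilde ψ (δ : F) ϖ 1 (bElt ((s : F) / δ) 1) =
      rq F * (sg (hsNeg s) * gau (ψ.mulShift (δ : F)⁻¹) s) := by
  have hq1 := one_lt_resCard F
  have hδ := δ.ne_zero
  have hT := Ttilde_mem he hϖ h 1
  have h0 : mElt (1 : Fˣ) = 1 := by
    ext1
    · exact SL2_ext (by simp) (by simp) (by simp) (by simp)
    · rfl
  -- Right multiplication by w_δ moves the large entry s/δ to the upper left corner, where it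
  -- becomes s.
  have h1 := heckeSpace_mul_right hT mem_wElt (bElt ((s : F) / δ) 1)
  rw [eps_wElt he, one_mul] at h1
  rw [← h1, bElt, h0, mul_one]
  have hg : (uElt ((s : F) / δ) * wElt δ).g = uMat ((s : F) / δ) * wMat δ := rfl
  have hζ : (uElt ((s : F) / δ) * wElt δ).ζ = 1 := by simp [cocycle_uMat_left]
  have e00 : (uMat ((s : F) / δ) * wMat δ).1 0 0 = s := by simp [SL2_mul_00]
  rw [Ttilde_apply_a he hϖ h (a := s) (by rw [hg, e00]) (by simp [hs']), hζ, hg, bu_mul_of_left (uMat_10 _), bu_uMat,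
    bu_wMat, one_mul, pow_one]
  · have e2 : signBit 1 + hs s (-(δ * δ)) = hsNeg s := by
      simp only [signBit_one, hs_neg_right, hs_mul_right]
      grind
    rw [e2]; ring
  · rw [hg, matSize, e00]
    simp only [SL2_mul_01, SL2_mul_10, SL2_mul_11, uMat_00, uMat_01, uMat_10, uMat_11, wMat_00, wMat_01, wMat_10, wMat_11]
    simp [hδ, hs', hq1.le]

end Terms

/-! ### The terms of the product of T̃₁ and T̃_m at w_c. -/

section Product

variable {F : Type*} [Field F] [ValuativeRel F] [TopologicalSpace F] [IsNonarchimedeanLocalField F]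
  [hq : Fact (Odd (resCard F))] [MeasurableSpace F] [BorelSpace F] {ψ : AddChar F Circle} {μ : Measure (Mp2 F)}
  {δ ϖ : Fˣ}

/-- The term of the product of `T 1` and `T m` at a large element which belongs to the coset of `h`. -/
def heckeTerm (ψ : AddChar F Circle) (δ ϖ : Fˣ) (m : ℕ) (g h : Mp2 F) : ℂ :=
  Ttilde ψ (δ : F) ϖ 1 h * Ttilde ψ (δ : F) ϖ m (h⁻¹ * g)

theorem heckeTerm_eq_zero (hϖ : absF (ϖ : F) = (resCard F : ℝ)⁻¹) {m : ℕ} {N : ℤ} {g h : Mp2 F}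
    (hN : matSize (δ : F) (h.g⁻¹ * g.g).1 = (resCard F : ℝ) ^ N) (hm : (m : ℤ) ≠ N) : heckeTerm ψ δ ϖ m g h = 0 := by
  rw [heckeTerm, Ttilde_eq_zero (m := m) (γ := h⁻¹ * g) hϖ, mul_zero]
  intro h'
  refine hm (zpow_right_injective₀ (resCard_pos F) (one_lt_resCard F).ne' ?_)
  have : matSize (δ : F) (h⁻¹ * g).g.1 = (resCard F : ℝ) ^ N := hN
  rw [this] at h'
  simpa using h'.symm

theorem matSize_term_a {y : F} {t c : Fˣ} {j k n N : ℤ} (ht : absF (t : F) = (resCard F : ℝ) ^ (-j))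
    (hc : absF ((c : F) / δ) = (resCard F : ℝ) ^ n) (hy : absF (y * δ) = (resCard F : ℝ) ^ k) (hN : k + j + n = N)
    (h1 : j - n ≤ N) (h2 : n - j ≤ N) : matSize (δ : F) ((bMat y t)⁻¹ * wMat c).1 = (resCard F : ℝ) ^ N := by
  have hq1 := (one_lt_resCard F).le
  rw [matSize_bMat_inv_mul_wMat ht hc, hy, ← zpow_add₀ (resCard_pos F).ne', ← add_assoc, hN,
    max_eq_left (zpow_le_zpow_right₀ hq1 h1), max_eq_left (zpow_le_zpow_right₀ hq1 h2)]

theorem matSize_term_c {t c : Fˣ} {j n N : ℤ} (ht : absF (t : F) = (resCard F : ℝ) ^ (-j))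
    (hc : absF ((c : F) / δ) = (resCard F : ℝ) ^ n) (hN : n - j = N)
    (h1 : j ≤ n) : matSize (δ : F) ((bMat 0 t)⁻¹ * wMat c).1 = (resCard F : ℝ) ^ N := by
  have hq1 := (one_lt_resCard F).le
  rw [matSize_bMat_inv_mul_wMat ht hc, zero_mul, absF_zero, zero_mul, max_eq_right (zpow_pos (resCard_pos F) _).le, hN,
    max_eq_right (zpow_le_zpow_right₀ hq1 (by omega))]

theorem Ttilde_term_a (he : IsUnramified (ψ.mulShift (δ : F)⁻¹)) (hϖ : absF (ϖ : F) = (resCard F : ℝ)⁻¹)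
    (h : IsHeckePair μ (gammaGroup δ) (eps ψ (δ : F))) {m : ℕ} {s t c : Fˣ} {j k n : ℤ}
    (ht : absF (t : F) = (resCard F : ℝ) ^ (-j)) (hc : absF ((c : F) / δ) = (resCard F : ℝ) ^ n)
    (hs' : absF (s : F) = (resCard F : ℝ) ^ k) (hN : k + j + n = m) (h1 : j - n ≤ m) (h2 : n - j ≤ m) :
    Ttilde ψ (δ : F) ϖ m ((bElt ((s : F) / δ) t)⁻¹ * wElt c) =
      sg (hs t (-c) + hs (-(t⁻¹ * (s / δ) * c)) (-(δ * (t * c)))) *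
        (rq F ^ m * gau (ψ.mulShift (δ : F)⁻¹) (-(t⁻¹ * (s / δ) * c))) := by
  have hδ := δ.ne_zero
  have hy : absF ((s : F) / δ * δ) = (resCard F : ℝ) ^ k := by rw [div_mul_cancel₀ _ hδ, hs']
  have hg : ((bElt ((s : F) / δ) t)⁻¹ * wElt c).g = (bMat ((s : F) / δ) t)⁻¹ * wMat c := rfl
  have e00 := (bMat_inv_mul_wMat ((s : F) / δ) t c).1
  rw [Ttilde_apply_a he hϖ h (a := -(t⁻¹ * (s / δ) * c)) (by rw [hg, e00]; simp), signBit_bElt_inv_mul_wElt, hg,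
    bu_bMat_inv_mul_wMat]
  · rw [← zpow_natCast, ← hN, Units.val_neg, absF_neg, Units.val_mul, Units.val_mul, Units.val_inv_eq_inv_val,
      Units.val_div_eq_div_val, show (t : F)⁻¹ * ((s : F) / δ) * c = s * ((t : F)⁻¹ * (c / δ)) by field_simp, absF_mul,
      absF_mul (t : F)⁻¹, absF_inv, ht, hc, hs', ← zpow_neg, neg_neg, ← zpow_add₀ (resCard_pos F).ne',
      ← zpow_add₀ (resCard_pos F).ne', add_assoc]
  · rw [hg, matSize_term_a ht hc hy hN h1 h2, zpow_natCast]

theorem Ttilde_term_c (he : IsUnramified (ψ.mulShift (δ : F)⁻¹)) (hϖ : absF (ϖ : F) = (resCard F : ℝ)⁻¹)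
    (h : IsHeckePair μ (gammaGroup δ) (eps ψ (δ : F))) {m : ℕ} {t c : Fˣ} {j n : ℤ}
    (ht : absF (t : F) = (resCard F : ℝ) ^ (-j)) (hc : absF ((c : F) / δ) = (resCard F : ℝ) ^ n)
    (hN : n - j = m) (h1 : j ≤ n) :
    Ttilde ψ (δ : F) ϖ m ((bElt 0 t)⁻¹ * wElt c) =
      sg (hs t (-c)) * (rq F ^ m * gau (ψ.mulShift (δ : F)⁻¹) (t * c * δ)) := by
  have hg : ((bElt 0 t)⁻¹ * wElt c).g = (bMat 0 t)⁻¹ * wMat c := rfl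
  have e10 := (bMat_inv_mul_wMat 0 t c).2.2.1
  rw [Ttilde_apply_c he hϖ h (c := t * c) (by rw [hg, e10]), signBit_bElt_inv_mul_wElt]
  · rw [← zpow_natCast, ← hN, Units.val_mul, mul_div_assoc, absF_mul, ht, hc, ← zpow_add₀ (resCard_pos F).ne',
      neg_add_eq_sub]
  · rw [hg, matSize_term_c ht hc hN h1, zpow_natCast]

/-- The term of a coset with trivial unipotent part. -/
theorem heckeTerm_c (he : IsUnramified (ψ.mulShift (δ : F)⁻¹)) (hϖ : absF (ϖ : F) = (resCard F : ℝ)⁻¹)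
    (h : IsHeckePair μ (gammaGroup δ) (eps ψ (δ : F))) {m : ℕ} {t c : Fˣ} {j n : ℤ}
    (ht : absF (t : F) = (resCard F : ℝ) ^ (-j)) (hc : absF ((c : F) / δ) = (resCard F : ℝ) ^ n)
    (h1 : j ≤ n) (hT : Ttilde ψ (δ : F) ϖ 1 (bElt 0 t) = rq F * (sg (hs t δ) * gau (ψ.mulShift (δ : F)⁻¹) t)) :
    heckeTerm ψ δ ϖ m (wElt c) (bElt 0 t) =
      if n - j = m then rq F ^ (m + 1) * gau (ψ.mulShift (δ : F)⁻¹) (c * δ) else 0 := by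
  split_ifs with hN
  · have e1 : t * c * δ = t * (c * δ) := mul_assoc _ _ _
    rw [heckeTerm, hT, Ttilde_term_c he hϖ h ht hc hN h1, e1, gau_mul_eq he]
    have e2 : sg (hs t δ) * (sg (hs t (-c)) * (sg (hs t (c * δ)) * sg (hsNeg t))) = 1 := by
      rw [← sg_add, ← sg_add, ← sg_add, ← sg_zero]
      congr 1
      simp only [hs_neg_right, hs_mul_right]
      grind
    have e3 := gau_mul_self he t
    linear_combination (rq F ^ (m + 1) * sg (hs t δ) * sg (hs t (-c)) * sg (hs t (c * δ)) *
      gau (ψ.mulShift (δ : F)⁻¹) (c * δ)) * e3 + rq F ^ (m + 1) * gau (ψ.mulShift (δ : F)⁻¹) (c * δ) * e2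
  · exact heckeTerm_eq_zero hϖ (N := n - j) (matSize_term_c ht hc rfl h1) fun h => hN h.symm

/-- The quotient has size q^(n+1). The two Weil indices of ϖ multiply to (-1, ϖ), and this sign
cancels against the Hilbert symbols, so the unit s leaves no trace. -/
theorem heckeTerm_unit (he : IsUnramified (ψ.mulShift (δ : F)⁻¹)) (hϖ : absF (ϖ : F) = (resCard F : ℝ)⁻¹)
    (h : IsHeckePair μ (gammaGroup δ) (eps ψ (δ : F))) {m : ℕ} {s c : Fˣ} {n : ℤ}
    (hc : absF ((c : F) / δ) = (resCard F : ℝ) ^ n) (hn : 0 ≤ n) (hs' : absF (s : F) = 1) :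
    heckeTerm ψ δ ϖ m (wElt c) (bElt ((s : F) / δ) ϖ) =
      if n + 1 = m then rq F ^ (m + 1) * gau (ψ.mulShift (δ : F)⁻¹) (c * δ) else 0 := by
  have hδ := δ.ne_zero
  have hϖ' : absF (ϖ : F) = (resCard F : ℝ) ^ (-1 : ℤ) := by rw [hϖ, zpow_neg_one]
  split_ifs with hN
  · rw [heckeTerm, Ttilde_one_bElt he hϖ (by rw [div_mul_cancel₀ _ hδ]; exact hs'.le),
      Ttilde_term_a he hϖ h (k := 0) hϖ' hc (by simpa using hs') (by omega) (by omega) (by omega)]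
    have e1 : -(ϖ⁻¹ * (s / δ) * c) = ϖ * (-s * (c * δ)) * (ϖ⁻¹ * δ⁻¹) ^ 2 := by
      ext
      push_cast
      have := ϖ.ne_zero
      field_simp
    have hus : absF ((-s : Fˣ) : F) = 1 := by simpa using hs'
    have hns : hsNeg s = 0 := hsNeg_unit hs'
    have hns' : hsNeg (-s) = 0 := hsNeg_unit hus
    rw [e1, gau_mul_sq he, gau_mul_eq he, gau_mul_eq he (-s), gau_unit he hus, one_mul]
    have e2 : sg (hs ϖ δ) * (sg (hs ϖ (-c) + hs (ϖ * (-s * (c * δ)) * (ϖ⁻¹ * δ⁻¹) ^ 2) (-(δ * (ϖ * c)))) *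
        (sg (hs ϖ (-s * (c * δ))) * (sg (hs (-s) (c * δ)) * sg (hsNeg ϖ)))) = 1 := by
      rw [← sg_add, ← sg_add, ← sg_add, ← sg_add, ← sg_zero]
      congr 1
      simp only [hs_neg_left, hs_neg_right, hs_mul_left, hs_mul_right, hs_pow_left, hs_self, hsNeg_mul, hsNeg_pow] at *
      grind [hs_comm]
    have e3 := gau_mul_self he ϖ
    linear_combination (rq F ^ (m + 1) * sg (hs ϖ δ) *
      sg (hs ϖ (-c) + hs (ϖ * (-s * (c * δ)) * (ϖ⁻¹ * δ⁻¹) ^ 2) (-(δ * (ϖ * c)))) *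
      sg (hs ϖ (-s * (c * δ))) * sg (hs (-s) (c * δ)) * gau (ψ.mulShift (δ : F)⁻¹) (c * δ)) * e3 +
        rq F ^ (m + 1) * gau (ψ.mulShift (δ : F)⁻¹) (c * δ) * e2
  · refine heckeTerm_eq_zero hϖ (N := n + 1) (matSize_term_a (k := 0) hϖ' hc ?_ (by omega) (by omega) (by omega))
      fun h => hN h.symm
    rw [div_mul_cancel₀ _ hδ, hs', zpow_zero]

/-- The quotient again has size q^(n+1); here s disappears because γ(s)γ(-s) = 1. -/
theorem heckeTerm_large (he : IsUnramified (ψ.mulShift (δ : F)⁻¹)) (hϖ : absF (ϖ : F) = (resCard F : ℝ)⁻¹)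
    (h : IsHeckePair μ (gammaGroup δ) (eps ψ (δ : F))) {m : ℕ} {s c : Fˣ} {n : ℤ}
    (hc : absF ((c : F) / δ) = (resCard F : ℝ) ^ n) (hn : 0 ≤ n) (hs' : absF (s : F) = resCard F) :
    heckeTerm ψ δ ϖ m (wElt c) (bElt ((s : F) / δ) 1) =
      if n + 1 = m then rq F ^ (m + 1) * gau (ψ.mulShift (δ : F)⁻¹) (c * δ) else 0 := by
  have hδ := δ.ne_zero
  have h1 : absF ((1 : Fˣ) : F) = (resCard F : ℝ) ^ (-0 : ℤ) := by
    rw [neg_zero, zpow_zero, Units.val_one, absF_one]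
  have hs1 : absF (s : F) = (resCard F : ℝ) ^ (1 : ℤ) := by rw [hs', zpow_one]
  split_ifs with hN
  · rw [heckeTerm, Ttilde_one_uElt he hϖ h hs',
      Ttilde_term_a he hϖ h (k := 1) h1 hc hs1 (by omega) (by omega) (by omega)]
    have e1 : -((1 : Fˣ)⁻¹ * (s / δ) * c) = (-s * (c * δ)) * (δ⁻¹) ^ 2 := by
      ext
      push_cast
      field_simp
    rw [e1, gau_mul_sq he, gau_mul_eq he (-s)]
    have e2 : sg (hsNeg s) * (sg (hs 1 (-c) + hs (-s * (c * δ) * δ⁻¹ ^ 2) (-(δ * (1 * c)))) *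
        sg (hs (-s) (c * δ))) = 1 := by
      clear h1
      rw [← sg_add, ← sg_add, ← sg_zero]
      congr 1
      simp only [hs_neg_left, hs_neg_right, hs_mul_left, hs_mul_right, hs_pow_left, hs_self, hsNeg_mul, hsNeg_pow,
        hs_one_left, hs_one_right, hsNeg_one, hsNeg_neg]
      grind [hs_comm]
    have e3 := gau_mul_neg he s
    linear_combination (rq F ^ (m + 1) * sg (hsNeg s) *
      sg (hs 1 (-c) + hs (-s * (c * δ) * δ⁻¹ ^ 2) (-(δ * (1 * c)))) *
      sg (hs (-s) (c * δ)) * gau (ψ.mulShift (δ : F)⁻¹) (c * δ)) * e3 +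
        rq F ^ (m + 1) * gau (ψ.mulShift (δ : F)⁻¹) (c * δ) * e2
  · refine heckeTerm_eq_zero hϖ (N := n + 1) (matSize_term_a (k := 1) h1 hc ?_ (by omega) (by omega) (by omega))
      fun h => hN h.symm
    rw [div_mul_cancel₀ _ hδ, hs1]

/-- The quotient has size qⁿ, so these are the terms that could produce a multiple of T̃_m. The unit
s enters only through (s, ϖ), the quadratic character of its residue, and the terms cancel when s
varies. The value z itself is irrelevant. -/
theorem heckeTerm_small (he : IsUnramified (ψ.mulShift (δ : F)⁻¹)) (hϖ : absF (ϖ : F) = (resCard F : ℝ)⁻¹)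
    (h : IsHeckePair μ (gammaGroup δ) (eps ψ (δ : F))) {c : Fˣ} {n : ℤ}
    (hc : absF ((c : F) / δ) = (resCard F : ℝ) ^ n) (hn : 1 ≤ n) (m : ℕ) : ∃ z : ℂ, ∀ s : Fˣ, absF (s : F) = 1 →
    heckeTerm ψ δ ϖ m (wElt c) (bElt (((ϖ * s : Fˣ) : F) / δ) ϖ) = sg (hs s ϖ) * z := by
  have hδ := δ.ne_zero
  have hϖ' : absF (ϖ : F) = (resCard F : ℝ) ^ (-1 : ℤ) := by rw [hϖ, zpow_neg_one]
  have hs1 : ∀ s : Fˣ, absF (s : F) = 1 → absF ((ϖ * s : Fˣ) : F) = (resCard F : ℝ) ^ (-1 : ℤ) := fun s hs' => by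
    rw [Units.val_mul, absF_mul, hs', mul_one, hϖ']
  by_cases hN : n = m
  · refine ⟨rq F ^ (m + 1) * sg (hs ϖ δ + hs ϖ (-c) + hs (-(δ * c)) (-(δ * (ϖ * c)))) *
      gau (ψ.mulShift (δ : F)⁻¹) ϖ * gau (ψ.mulShift (δ : F)⁻¹) (-(c * δ)), fun s hs' => ?_⟩
    have hle : absF (((ϖ * s : Fˣ) : F) / δ * δ) ≤ 1 := by
      rw [div_mul_cancel₀ _ hδ, hs1 s hs']
      exact zpow_le_one_of_nonpos₀ (one_lt_resCard F).le (by norm_num)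
    rw [heckeTerm, Ttilde_one_bElt he hϖ hle,
      Ttilde_term_a he hϖ h (k := -1) hϖ' hc (hs1 s hs') (by omega) (by omega) (by omega)]
    have e1 : -(ϖ⁻¹ * (ϖ * s / δ) * c) = (s * -(c * δ)) * (δ⁻¹) ^ 2 := by
      ext
      push_cast
      have := ϖ.ne_zero
      field_simp
    have hns : hsNeg s = 0 := hsNeg_unit hs'
    rw [e1, gau_mul_sq he, gau_mul_eq he s, gau_unit he hs', one_mul]
    have e2 : sg (hs ϖ δ) * (sg (hs ϖ (-c) + hs (s * -(c * δ) * δ⁻¹ ^ 2) (-(δ * (ϖ * c)))) * sg (hs s (-(c * δ)))) =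
        sg (hs s ϖ) * sg (hs ϖ δ + hs ϖ (-c) + hs (-(δ * c)) (-(δ * (ϖ * c)))) := by
      rw [← sg_add, ← sg_add, ← sg_add]
      congr 1
      simp only [hs_neg_left, hs_neg_right, hs_mul_left, hs_mul_right, hs_pow_left, hs_self, hsNeg_mul, hsNeg_pow,
        hs_one_left, hs_one_right, hsNeg_one, hsNeg_neg] at *
      grind [hs_comm]
    linear_combination rq F ^ (m + 1) * gau (ψ.mulShift (δ : F)⁻¹) ϖ * gau (ψ.mulShift (δ : F)⁻¹) (-(c * δ)) * e2
  · refine ⟨0, fun s hs' => ?_⟩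
    rw [mul_zero]
    refine heckeTerm_eq_zero hϖ (N := n) (matSize_term_a (k := -1) hϖ' hc ?_ (by omega) (by omega) (by omega))
      fun h => hN h.symm
    rw [div_mul_cancel₀ _ hδ, hs1 s hs']

end Product

/-! ## The relations between the Hecke operators -/

section Relations

variable {F : Type*} [Field F] [ValuativeRel F] [TopologicalSpace F] [IsNonarchimedeanLocalField F]
  [hq : Fact (Odd (resCard F))] [MeasurableSpace F] [BorelSpace F] {ψ : AddChar F Circle} {μ : Measure (Mp2 F)}
  {δ ϖ : Fˣ}

theorem conv_Ttilde_one [μ.IsMulLeftInvariant] [Fintype 𝓀[F]] (he : IsUnramified (ψ.mulShift (δ : F)⁻¹))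
    (hϖ : absF (ϖ : F) = (resCard F : ℝ)⁻¹) (h : IsHeckePair μ (gammaGroup δ) (eps ψ (δ : F))) {φ : Mp2 F → ℂ}
    (hφ : φ ∈ heckeSpace (gammaGroup δ : Set (Mp2 F)) (eps ψ (δ : F))) (g : Mp2 F) :
    conv μ (Ttilde ψ (δ : F) ϖ 1) φ g = ∑ i, Ttilde ψ (δ : F) ϖ 1 (bElt (cosetY δ ϖ i) (cosetT ϖ i)) *
      φ ((bElt (cosetY δ ϖ i) (cosetT ϖ i))⁻¹ * g) := by
  refine h.conv_eq_sum (s := Finset.univ) (x := fun i => bElt (cosetY δ ϖ i) (cosetT ϖ i)) (Ttilde_mem he hϖ h 1) hφ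
    (fun i _ j _ hij => coset_injective (δ := δ) hϖ (mem_gammaGroup.1 hij)) (fun g hg => ?_) g
  have hsz : matSize (δ : F) g.g.1 = resCard F := by
    by_contra hne
    exact hg (Ttilde_eq_zero hϖ (by simpa using hne))
  obtain ⟨i, hi⟩ := exists_coset hϖ hsz
  exact ⟨i, Finset.mem_univ _, mem_gammaGroup.2 hi⟩

theorem bElt_coset_inl_of_ne (hϖ : absF (ϖ : F) = (resCard F : ℝ)⁻¹) {r r' : 𝓀[F]} (hr : r ≠ 0) :
    ∃ s : Fˣ, absF (s : F) = 1 ∧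
      bElt (cosetY δ ϖ (Sum.inl (r, r'))) (cosetT ϖ (Sum.inl (r, r'))) = bElt ((s : F) / δ) ϖ := by
  have h1 : absF (sec r + ϖ * sec r') = 1 := by
    rw [absF_add_eq_left, absF_sec hr]
    rw [absF_sec hr]
    exact absF_mul_lt_one (by rw [hϖ]; exact inv_lt_one_of_one_lt₀ (one_lt_resCard F)) (absF_sec_le _)
  exact ⟨Units.mk0 _ (ne_zero_of_absF_eq_one h1), h1, rfl⟩

theorem bElt_coset_inl_zero (r : 𝓀[F]) : bElt (cosetY δ ϖ (Sum.inl (0, r))) (cosetT ϖ (Sum.inl (0, r))) =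
    bElt (ϖ * sec r / δ) ϖ := by
  rw [cosetY, cosetT, sec_zero, zero_add]

theorem bElt_coset_inr_of_ne (hϖ : absF (ϖ : F) = (resCard F : ℝ)⁻¹) {r : 𝓀[F]} (hr : r ≠ 0) :
    ∃ s : Fˣ, absF (s : F) = resCard F ∧
      bElt (cosetY δ ϖ (Sum.inr r)) (cosetT ϖ (Sum.inr r)) = bElt ((s : F) / δ) 1 := by
  have h1 : absF (sec r / ϖ) = resCard F := by rw [absF_div, absF_sec hr, hϖ]; simp
  have h2 : sec r / (ϖ : F) ≠ 0 := div_ne_zero (ne_zero_of_absF_eq_one (absF_sec hr)) ϖ.ne_zero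
  refine ⟨Units.mk0 _ h2, h1, ?_⟩
  rw [cosetY, cosetT, if_neg hr]; rfl

theorem bElt_coset_inr_zero : bElt (cosetY δ ϖ (Sum.inr 0)) (cosetT ϖ (Sum.inr 0)) = bElt 0 ϖ⁻¹ := by
  rw [cosetY, cosetT, if_pos rfl, sec_zero, zero_div, zero_div]

theorem heckeTerm_inr (he : IsUnramified (ψ.mulShift (δ : F)⁻¹))
    (hϖ : absF (ϖ : F) = (resCard F : ℝ)⁻¹) (h : IsHeckePair μ (gammaGroup δ) (eps ψ (δ : F))) {m n : ℕ} {c : Fˣ}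
    (hc : absF ((c : F) / δ) = (resCard F : ℝ) ^ n) (r : 𝓀[F]) :
    heckeTerm ψ δ ϖ m (wElt c) (bElt (cosetY δ ϖ (Sum.inr r)) (cosetT ϖ (Sum.inr r))) =
      if n + 1 = m then rq F ^ (m + 1) * gau (ψ.mulShift (δ : F)⁻¹) (c * δ) else 0 := by
  rw [← zpow_natCast] at hc
  have hiff : ((n : ℤ) + 1 = m) ↔ n + 1 = m := by omega
  by_cases hr : r = 0
  · subst hr
    have h1 : absF ((ϖ⁻¹ : Fˣ) : F) = (resCard F : ℝ) ^ (-(-1) : ℤ) := by simp [hϖ]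
    have e1 : gau (ψ.mulShift (δ : F)⁻¹) ϖ⁻¹ = gau (ψ.mulShift (δ : F)⁻¹) ϖ := by
      rw [← gau_mul_sq he ϖ⁻¹ ϖ, sq, inv_mul_cancel_left]
    rw [bElt_coset_inr_zero, heckeTerm_c he hϖ h h1 hc (by omega), sub_neg_eq_add]
    · simp only [hiff]
    · rw [Ttilde_one_bElt_inv he hϖ h, e1, hs_inv_left]
  · obtain ⟨s, h1, h2⟩ := bElt_coset_inr_of_ne (δ := δ) hϖ hr
    rw [h2, heckeTerm_large he hϖ h hc (by omega) h1]
    simp only [hiff]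

theorem heckeTerm_inl_of_ne (he : IsUnramified (ψ.mulShift (δ : F)⁻¹))
    (hϖ : absF (ϖ : F) = (resCard F : ℝ)⁻¹) (h : IsHeckePair μ (gammaGroup δ) (eps ψ (δ : F))) {m n : ℕ} {c : Fˣ}
    (hc : absF ((c : F) / δ) = (resCard F : ℝ) ^ n) {r : 𝓀[F]} (hr : r ≠ 0) (r' : 𝓀[F]) :
    heckeTerm ψ δ ϖ m (wElt c) (bElt (cosetY δ ϖ (Sum.inl (r, r'))) (cosetT ϖ (Sum.inl (r, r')))) =
      if n + 1 = m then rq F ^ (m + 1) * gau (ψ.mulShift (δ : F)⁻¹) (c * δ) else 0 := by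
  rw [← zpow_natCast] at hc
  have hiff : ((n : ℤ) + 1 = m) ↔ n + 1 = m := by omega
  obtain ⟨s, h1, h2⟩ := bElt_coset_inl_of_ne (δ := δ) (r' := r') hϖ hr
  rw [h2, heckeTerm_unit he hϖ h hc (by omega) h1]
  simp only [hiff]

/-- The terms of the cosets in which the translation is divisible by the uniformizer. -/
theorem sum_heckeTerm_inl_zero [Fintype 𝓀[F]] (he : IsUnramified (ψ.mulShift (δ : F)⁻¹))
    (hϖ : absF (ϖ : F) = (resCard F : ℝ)⁻¹) (h : IsHeckePair μ (gammaGroup δ) (eps ψ (δ : F))) {m n : ℕ} {c : Fˣ}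
    (hc : absF ((c : F) / δ) = (resCard F : ℝ) ^ n) (hn : 1 ≤ n) :
    ∑ r, heckeTerm ψ δ ϖ m (wElt c) (bElt (cosetY δ ϖ (Sum.inl (0, r))) (cosetT ϖ (Sum.inl (0, r)))) =
      if n = m + 1 then rq F ^ (m + 1) * gau (ψ.mulShift (δ : F)⁻¹) (c * δ) else 0 := by
  classical
  rw [← zpow_natCast] at hc
  have hϖ' : absF (ϖ : F) = (resCard F : ℝ) ^ (-1 : ℤ) := by rw [hϖ, zpow_neg_one]
  obtain ⟨z, hz⟩ := heckeTerm_small he hϖ h hc (by omega) m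
  have hiff : ((n : ℤ) - 1 = m) ↔ n = m + 1 := by omega
  have h0 : heckeTerm ψ δ ϖ m (wElt c) (bElt 0 ϖ) =
      if n = m + 1 then rq F ^ (m + 1) * gau (ψ.mulShift (δ : F)⁻¹) (c * δ) else 0 := by
    rw [heckeTerm_c he hϖ h hϖ' hc (by omega) (Ttilde_one_bElt he hϖ (by simp))]
    simp only [hiff]
  -- The quadratic character vanishes at 0, so one formula covers all digits; its second part sums
  -- to zero and only the digit 0 remains.
  have hterm : ∀ r, heckeTerm ψ δ ϖ m (wElt c) (bElt (cosetY δ ϖ (Sum.inl (0, r))) (cosetT ϖ (Sum.inl (0, r)))) =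
      (if r = 0 then heckeTerm ψ δ ϖ m (wElt c) (bElt 0 ϖ) else 0) + quadC F r * z := by
    intro r
    rw [bElt_coset_inl_zero]
    by_cases hr : r = 0
    · subst hr
      rw [if_pos rfl, sec_zero, mul_zero, zero_div, MulChar.map_zero, zero_mul, add_zero]
    · have h1 := absF_sec hr
      have h2 := hz (Units.mk0 _ (ne_zero_of_absF_eq_one h1)) h1
      rw [if_neg hr, zero_add]
      have h3 : sg (hs (Units.mk0 _ (ne_zero_of_absF_eq_one h1)) ϖ) = quadC F r := by
        have h4 := quadC_red hq.out h1 hϖ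
        rw [red_sec, intCast_eq_sg] at h4
        exact h4.symm
      rw [h3] at h2
      exact h2
  rw [Finset.sum_congr rfl fun r _ => hterm r, Finset.sum_add_distrib, ← Finset.sum_mul,
    MulChar.sum_eq_zero_of_ne_one (quadC_ne_one hq.out), zero_mul, add_zero, Finset.sum_ite_eq' Finset.univ,
    if_pos (Finset.mem_univ _), h0]

/-- For n + 1 = m there are (q - 1)q equal contributions from cosets with unit translation and q
from the cosets with t = 1 or t = ϖ⁻¹, in all q². For n = m + 1 only the coset of m(ϖ) contributes.
-/
theorem conv_Ttilde_apply [μ.IsMulLeftInvariant] (he : IsUnramified (ψ.mulShift (δ : F)⁻¹))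
    (hϖ : absF (ϖ : F) = (resCard F : ℝ)⁻¹) (h : IsHeckePair μ (gammaGroup δ) (eps ψ (δ : F))) {m n : ℕ} {c : Fˣ}
    (hc : absF ((c : F) / δ) = (resCard F : ℝ) ^ n) (hn : 1 ≤ n) :
    conv μ (Ttilde ψ (δ : F) ϖ 1) (Ttilde ψ (δ : F) ϖ m) (wElt c) =
      ((if n + 1 = m then (resCard F : ℂ) ^ 2 else 0) + if n = m + 1 then 1 else 0) *
        (rq F ^ (m + 1) * gau (ψ.mulShift (δ : F)⁻¹) (c * δ)) := by
  classical
  have := Fintype.ofFinite 𝓀[F]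
  have hcard : (Fintype.card 𝓀[F] : ℂ) = resCard F := by rw [resCard, Nat.card_eq_fintype_card]
  rw [conv_Ttilde_one he hϖ h (Ttilde_mem he hϖ h m)]
  change ∑ i, heckeTerm ψ δ ϖ m (wElt c) (bElt (cosetY δ ϖ i) (cosetT ϖ i)) = _
  rw [Fintype.sum_sum_type, Fintype.sum_prod_type, ← Finset.add_sum_erase _ _ (Finset.mem_univ 0),
    sum_heckeTerm_inl_zero he hϖ h hc hn, Finset.sum_congr rfl fun r _ => heckeTerm_inr he hϖ h hc r]
  rw [Finset.sum_congr rfl fun r hr => Finset.sum_congr rfl fun r' _ =>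
    heckeTerm_inl_of_ne he hϖ h hc (Finset.ne_of_mem_erase hr) r']
  simp only [Finset.sum_const, Finset.card_univ, Finset.card_erase_of_mem (Finset.mem_univ _), nsmul_eq_mul, hcard]
  rw [Nat.cast_sub Fintype.card_pos, hcard]
  split_ifs <;> push_cast <;> ring

theorem matSize_wMat {n : ℕ} {c : Fˣ} (hc : absF ((c : F) / δ) = (resCard F : ℝ) ^ n) :
    matSize (δ : F) (wMat c).1 = (resCard F : ℝ) ^ n := by
  have h1 : absF (-(c : F)⁻¹ * δ) = ((resCard F : ℝ) ^ n)⁻¹ := by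
    rw [← hc, neg_mul, absF_neg, absF_mul, absF_inv, absF_div, inv_div]; ring
  have hpow : 1 ≤ (resCard F : ℝ) ^ n := one_le_pow₀ (one_lt_resCard F).le
  have h2 : ((resCard F : ℝ) ^ n)⁻¹ ≤ (resCard F : ℝ) ^ n := (inv_le_one_of_one_le₀ hpow).trans hpow
  rw [matSize, wMat_00, wMat_01, wMat_10, wMat_11, h1, hc, absF_zero, max_eq_right (inv_nonneg.2 (zero_le_one.trans hpow)),
    max_eq_left (zero_le_one.trans hpow), max_eq_right h2]

theorem Ttilde_apply_wElt (he : IsUnramified (ψ.mulShift (δ : F)⁻¹))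
    (hϖ : absF (ϖ : F) = (resCard F : ℝ)⁻¹) (h : IsHeckePair μ (gammaGroup δ) (eps ψ (δ : F))) {m n : ℕ} {c : Fˣ}
    (hc : absF ((c : F) / δ) = (resCard F : ℝ) ^ n) : Ttilde ψ (δ : F) ϖ m (wElt c) =
      if n = m then rq F ^ m * gau (ψ.mulShift (δ : F)⁻¹) (c * δ) else 0 := by
  have hsz := matSize_wMat (δ := δ) hc
  split_ifs with hmn
  · subst hmn
    rw [Ttilde_apply_c he hϖ h (c := c) rfl hc hsz, wElt_ζ, signBit_one, sg_zero, one_mul]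
  · refine Ttilde_eq_zero hϖ ?_
    rw [wElt_g, hsz]
    intro h'
    exact hmn (Nat.pow_right_injective (Nat.succ_le_of_lt (by exact_mod_cast one_lt_resCard F))
      (by exact_mod_cast h'))

/-- The value of `T h * T h⁻¹` is constant on the double coset. -/
theorem Ttilde_one_mul_inv (he : IsUnramified (ψ.mulShift (δ : F)⁻¹))
    (hϖ : absF (ϖ : F) = (resCard F : ℝ)⁻¹) (h : IsHeckePair μ (gammaGroup δ) (eps ψ (δ : F))) {x : Mp2 F}
    (hx : Ttilde ψ (δ : F) ϖ 1 x ≠ 0) : Ttilde ψ (δ : F) ϖ 1 x * Ttilde ψ (δ : F) ϖ 1 x⁻¹ =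
      Ttilde ψ (δ : F) ϖ 1 (mElt ϖ) * Ttilde ψ (δ : F) ϖ 1 (mElt ϖ)⁻¹ := by
  have hT := Ttilde_mem he hϖ h 1
  have hex : ∃ γ : Mp2 F × Mp2 F, γ.1 ∈ gammaGroup δ ∧ γ.2 ∈ gammaGroup δ ∧ x = γ.1 * mElt ϖ * γ.2 := by
    by_contra hne
    refine hx ?_
    rw [Ttilde, Pi.smul_apply, pow_one, charFun_eq_zero hne, smul_zero]
  obtain ⟨γ, h₁, h₂, rfl⟩ := hex
  have e1 := eps_mul_self he h₁
  have e2 := eps_mul_self he h₂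
  rw [heckeSpace_mul_right hT h₂, heckeSpace_mul_left hT h₁, mul_inv_rev, mul_inv_rev,
    heckeSpace_mul_left hT (inv_mem h₂), heckeSpace_mul_right hT (inv_mem h₁), eps_inv he h₁, eps_inv he h₂]
  linear_combination (Ttilde ψ (δ : F) ϖ 1 (mElt ϖ) * Ttilde ψ (δ : F) ϖ 1 (mElt ϖ)⁻¹) *
    (eps ψ (δ : F) γ.2 * eps ψ (δ : F) γ.2 * e1 + e2)

theorem sg_ne_zero (x : ZMod 2) : sg x ≠ 0 := by
  unfold sg; split_ifs <;> simp

variable (F) in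
theorem rq_ne_zero : rq F ≠ 0 := fun h => by
  have := rq_sq F
  rw [h] at this
  simp at this

theorem Ttilde_one_coset_ne_zero (he : IsUnramified (ψ.mulShift (δ : F)⁻¹))
    (hϖ : absF (ϖ : F) = (resCard F : ℝ)⁻¹) (h : IsHeckePair μ (gammaGroup δ) (eps ψ (δ : F)))
    (i : (𝓀[F] × 𝓀[F]) ⊕ 𝓀[F]) : Ttilde ψ (δ : F) ϖ 1 (bElt (cosetY δ ϖ i) (cosetT ϖ i)) ≠ 0 := by
  have hval : ∀ x y, rq F * (sg x * gau (ψ.mulShift (δ : F)⁻¹) y) ≠ 0 := fun x y =>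
    mul_ne_zero (rq_ne_zero F) (mul_ne_zero (sg_ne_zero x) (gau_ne_zero he y))
  rcases i with ⟨r, r'⟩ | r
  · rw [cosetT, Ttilde_one_bElt he hϖ]
    · exact hval _ _
    · rw [cosetY, div_mul_cancel₀ _ δ.ne_zero]
      refine absF_add_le (absF_sec_le _) (absF_mul_le_one ?_ (absF_sec_le _))
      rw [hϖ]
      exact inv_le_one_of_one_le₀ (one_lt_resCard F).le
  · by_cases hr : r = 0
    · subst hr
      rw [bElt_coset_inr_zero, Ttilde_one_bElt_inv he hϖ h]
      exact hval _ _
    · obtain ⟨s, h1, h2⟩ := bElt_coset_inr_of_ne (δ := δ) hϖ hr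
      rw [h2, Ttilde_one_uElt he hϖ h h1]
      exact hval _ _

/-- At w_δ every term is a value of h ↦ T̃₁(h)T̃₁(h⁻¹), which is constant on the double coset. One
coset, that of m(ϖ⁻¹), shows the constant to be q⁻¹, and there are q² + q cosets. -/
theorem conv_Ttilde_one_one_apply [μ.IsMulLeftInvariant] (he : IsUnramified (ψ.mulShift (δ : F)⁻¹))
    (hϖ : absF (ϖ : F) = (resCard F : ℝ)⁻¹) (h : IsHeckePair μ (gammaGroup δ) (eps ψ (δ : F))) :
    conv μ (Ttilde ψ (δ : F) ϖ 1) (Ttilde ψ (δ : F) ϖ 1) (wElt δ) = resCard F + 1 := by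
  classical
  have := Fintype.ofFinite 𝓀[F]
  have hcard : (Fintype.card 𝓀[F] : ℂ) = resCard F := by rw [resCard, Nat.card_eq_fintype_card]
  have hT := Ttilde_mem he hϖ h 1
  have hδ1 : absF ((δ : F) / δ) = (resCard F : ℝ) ^ 0 := by simp
  have hr : heckeTerm ψ δ ϖ 1 (wElt δ) (bElt (cosetY δ ϖ (Sum.inr 0)) (cosetT ϖ (Sum.inr 0))) = rq F * rq F := by
    have hg : gau (ψ.mulShift (δ : F)⁻¹) (δ * δ) = 1 := by
      rw [← one_mul (δ * δ), ← sq, gau_mul_sq he, gau_unit he (by simp)]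
    rw [heckeTerm_inr he hϖ h hδ1, if_pos rfl, hg]
    ring
  have hterm : ∀ i, heckeTerm ψ δ ϖ 1 (wElt δ) (bElt (cosetY δ ϖ i) (cosetT ϖ i)) = rq F * rq F := by
    intro i
    rw [heckeTerm, heckeSpace_mul_right hT mem_wElt, eps_wElt he, one_mul] at hr ⊢
    rw [← hr, Ttilde_one_mul_inv he hϖ h (Ttilde_one_coset_ne_zero he hϖ h _),
      Ttilde_one_mul_inv he hϖ h (Ttilde_one_coset_ne_zero he hϖ h _)]
  rw [conv_Ttilde_one he hϖ h hT]
  change ∑ i, heckeTerm ψ δ ϖ 1 (wElt δ) (bElt (cosetY δ ϖ i) (cosetT ϖ i)) = _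
  rw [Finset.sum_congr rfl fun i _ => hterm i, Finset.sum_const, Finset.card_univ, Fintype.card_sum, Fintype.card_prod,
    nsmul_eq_mul]
  push_cast
  rw [hcard]
  linear_combination (resCard F + 1 : ℂ) * rq_sq F

theorem matSize_inv (g : SL(2, F)) : matSize (δ : F) (g⁻¹).1 = matSize (δ : F) g.1 := by
  rw [matSize, matSize, SL2_inv_00, SL2_inv_01, SL2_inv_10, SL2_inv_11, neg_mul, neg_div, absF_neg, absF_neg,
    max_comm (absF (g.1 1 1)), max_comm (absF (g.1 1 0 / δ)), max_max_max_comm, max_comm (absF (g.1 1 1))]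
  simp only [max_comm, max_left_comm, max_assoc]

/-- Inversion preserves the size, so the two factors of the integrand have disjoint supports. -/
theorem conv_Ttilde_apply_wElt_self [μ.IsMulLeftInvariant] (he : IsUnramified (ψ.mulShift (δ : F)⁻¹))
    (hϖ : absF (ϖ : F) = (resCard F : ℝ)⁻¹) (h : IsHeckePair μ (gammaGroup δ) (eps ψ (δ : F))) {m : ℕ} (hm : m ≠ 1) :
    conv μ (Ttilde ψ (δ : F) ϖ 1) (Ttilde ψ (δ : F) ϖ m) (wElt δ) = 0 := by
  rw [conv]
  refine integral_eq_zero_of_ae (Filter.Eventually.of_forall fun x => ?_)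
  change _ * _ = (0 : ℂ)
  by_cases hx : matSize (δ : F) x.g.1 = (resCard F : ℝ) ^ 1
  · rw [Ttilde_eq_zero (m := m) (γ := x⁻¹ * wElt δ) hϖ, mul_zero]
    rw [Mp2.mul_g, wElt_g, matSize_mul_of_isGamma_right isGamma_wMat, Mp2.inv_g, matSize_inv, hx]
    intro h'
    exact hm (Nat.pow_right_injective (Nat.succ_le_of_lt (by exact_mod_cast one_lt_resCard F))
      (by exact_mod_cast h')).symm
  · rw [Ttilde_eq_zero hϖ hx, zero_mul]

theorem absF_div_uniformizer_pow (hϖ : absF (ϖ : F) = (resCard F : ℝ)⁻¹) (n : ℕ) :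
    absF (((δ / ϖ ^ n : Fˣ) : F) / δ) = (resCard F : ℝ) ^ n := by
  rw [Units.val_div_eq_div_val, absF_div, absF_div, absF_uniformizer_pow hϖ]
  have := (absF_pos δ.ne_zero).ne'
  field_simp

/-- Two functions in the Hecke algebra are equal if they agree at one element of each size. -/
theorem hecke_ext (he : IsUnramified (ψ.mulShift (δ : F)⁻¹)) (hϖ : absF (ϖ : F) = (resCard F : ℝ)⁻¹)
    {φ φ' : Mp2 F → ℂ} (hφ : φ ∈ heckeSpace (gammaGroup δ : Set (Mp2 F)) (eps ψ (δ : F)))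
    (hφ' : φ' ∈ heckeSpace (gammaGroup δ : Set (Mp2 F)) (eps ψ (δ : F)))
    (h : ∀ n : ℕ, φ (wElt (δ / ϖ ^ n)) = φ' (wElt (δ / ϖ ^ n))) : φ = φ' := by
  rw [← sub_eq_zero]
  ext γ
  obtain ⟨n, hn⟩ := exists_matSize_eq_pow (δ := δ) γ.g
  exact hecke_eq_zero he (Submodule.sub_mem _ hφ hφ') (c := δ / ϖ ^ n)
    (by rw [hn, absF_div_uniformizer_pow hϖ]) (by rw [Pi.sub_apply, h n, sub_self])

theorem conv_Ttilde [μ.IsMulLeftInvariant] (he : IsUnramified (ψ.mulShift (δ : F)⁻¹))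
    (hϖ : absF (ϖ : F) = (resCard F : ℝ)⁻¹) (h : IsHeckePair μ (gammaGroup δ) (eps ψ (δ : F))) {m : ℕ} (hm : 2 ≤ m) :
    conv μ (Ttilde ψ (δ : F) ϖ 1) (Ttilde ψ (δ : F) ϖ m) =
      (resCard F : ℂ) • Ttilde ψ (δ : F) ϖ (m - 1) + Ttilde ψ (δ : F) ϖ (m + 1) := by
  have hT := Ttilde_mem he hϖ h
  refine hecke_ext he hϖ (h.conv_mem (hT 1) (hT m))
    (Submodule.add_mem _ (Submodule.smul_mem _ _ (hT _)) (hT _)) fun n => ?_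
  have hc := absF_div_uniformizer_pow (δ := δ) hϖ n
  rw [Pi.add_apply, Pi.smul_apply, Ttilde_apply_wElt he hϖ h hc, Ttilde_apply_wElt he hϖ h hc]
  rcases Nat.eq_zero_or_pos n with rfl | hn
  · rw [pow_zero, div_one, conv_Ttilde_apply_wElt_self he hϖ h (by omega), if_neg (by omega), if_neg (by omega)]
    simp
  · rw [conv_Ttilde_apply he hϖ h hc hn]
    by_cases h1 : n + 1 = m
    · rw [if_pos h1, if_neg (by omega), if_pos (by omega), if_neg (by omega), smul_eq_mul]
      obtain ⟨k, rfl⟩ : ∃ k, m = k + 1 := ⟨m - 1, by omega⟩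
      rw [Nat.add_sub_cancel]
      -- Here q² · q^(-(m+1)/2) = q · q^(-(m-1)/2), which is the source of the coefficient q.
      linear_combination (resCard F * rq F ^ k * gau (ψ.mulShift (δ : F)⁻¹) (δ / ϖ ^ n * δ)) * rq_sq F
    · rw [if_neg h1, if_neg (by omega : ¬ n = m - 1)]
      split_ifs <;> simp

theorem conv_Ttilde_one_one [μ.IsMulLeftInvariant] (he : IsUnramified (ψ.mulShift (δ : F)⁻¹))
    (hϖ : absF (ϖ : F) = (resCard F : ℝ)⁻¹) (h : IsHeckePair μ (gammaGroup δ) (eps ψ (δ : F))) :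
    conv μ (Ttilde ψ (δ : F) ϖ 1) (Ttilde ψ (δ : F) ϖ 1) =
      (resCard F + 1 : ℂ) • genuineUnit ψ (δ : F) + Ttilde ψ (δ : F) ϖ 2 := by
  have hT := Ttilde_mem he hϖ h
  refine hecke_ext he hϖ (h.conv_mem (hT 1) (hT 1))
    (Submodule.add_mem _ (Submodule.smul_mem _ _ h.one_mem) (hT _)) fun n => ?_
  have hc := absF_div_uniformizer_pow (δ := δ) hϖ n
  rw [Pi.add_apply, Pi.smul_apply, Ttilde_apply_wElt he hϖ h hc, genuineUnit]
  rcases Nat.eq_zero_or_pos n with rfl | hn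
  · rw [pow_zero, div_one, conv_Ttilde_one_one_apply he hϖ h, if_neg (by omega), add_zero,
      Set.indicator_of_mem (show wElt δ ∈ GammaTilde (δ : F) from mem_wElt), eps_wElt he]
    simp
  · rw [conv_Ttilde_apply he hϖ h hc hn, Set.indicator_of_notMem, smul_zero, zero_add, if_neg (by omega), zero_add]
    · split_ifs <;> simp
    · rw [mem_GammaTilde]
      intro hγ
      have := hγ.c_div_le
      rw [wElt_g, wMat_10, hc] at this
      exact absurd (one_lt_pow₀ (one_lt_resCard F) hn.ne') (not_lt.2 this)

end Relations

/-! ### Filtered convolution algebras as polynomial rings. -/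

section ConvAlg

variable {G : Type*} [Group G] [MeasurableSpace G] {μ : Measure G} {H : Submodule ℂ (G → ℂ)} {e : G → ℂ}

/-- The element of the convolution algebra given by a function in `H`. -/
def IsConvAlgebra.of (h : IsConvAlgebra μ H e) (a : G → ℂ) (ha : a ∈ H) : h.Alg := (⟨a, ha⟩ : H)

namespace IsConvAlgebra

variable {h : IsConvAlgebra μ H e}

@[simp] theorem toFun_of (a : G → ℂ) (ha : a ∈ H) : toFun (h.of a ha) = a := rfl

theorem toFun_mem (a : h.Alg) : toFun a ∈ H := Subtype.property (p := (· ∈ H)) a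

theorem toFun_injective : Function.Injective (toFun : h.Alg → G → ℂ) := fun _ _ hab => Subtype.ext hab

theorem toFun_add (a b : h.Alg) : toFun (a + b) = toFun a + toFun b := rfl

theorem toFun_smul (c : ℂ) (a : h.Alg) : toFun (c • a) = c • toFun a := rfl

theorem toFun_mul (a b : h.Alg) : toFun (a * b) = conv μ (toFun a) (toFun b) := rfl

theorem toFun_one : toFun (1 : h.Alg) = e := rfl

theorem natCast_eq_smul (n : ℕ) : (n : h.Alg) = (n : ℂ) • 1 := by
  rw [← Algebra.algebraMap_eq_smul_one, map_natCast]

/-- Evaluation at a point, as a linear form on the convolution algebra. -/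
def evalAt (h : IsConvAlgebra μ H e) (g : G) : h.Alg →ₗ[ℂ] ℂ where
  toFun a := toFun a g
  map_add' _ _ := rfl
  map_smul' _ _ := rfl

theorem evalAt_apply (g : G) (a : h.Alg) : h.evalAt g a = toFun a g := rfl

end IsConvAlgebra

/-- The function `a` vanishes at all points of degree greater than `n`. -/
def VanishAbove (deg : G → ℕ) (n : ℕ) (a : G → ℂ) : Prop := ∀ g, n < deg g → a g = 0

theorem VanishAbove.conv {deg : G → ℕ} (hdeg : ∀ g g', deg (g * g') ≤ deg g + deg g') {m n : ℕ} {a b : G → ℂ}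
    (ha : VanishAbove deg m a) (hb : VanishAbove deg n b) : VanishAbove deg (m + n) (conv μ a b) := by
  intro g hg
  rw [KohnenHecke.conv, ← integral_zero G ℂ (μ := μ)]
  congr 1
  ext x
  have := hdeg x (x⁻¹ * g)
  rw [mul_inv_cancel_left] at this
  rcases lt_or_ge m (deg x) with h1 | h1
  · rw [ha _ h1, zero_mul]
  · rw [hb _ (by omega), mul_zero]

open IsConvAlgebra in
/-- A convolution algebra filtered by a degree function, whose elements are determined by their
values at points `w k` of degree `k`, is a polynomial algebra in any element `T` of degree `1`
multiplication by which raises the degree. -/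
theorem IsConvAlgebra.aeval_bijective (h : IsConvAlgebra μ H e) {deg : G → ℕ}
    (hdeg : ∀ g g', deg (g * g') ≤ deg g + deg g') {w : ℕ → G} (hw : ∀ k, deg (w k) = k)
    (hfin : ∀ a ∈ H, ∃ n, VanishAbove deg n a) (hsep : ∀ a ∈ H, ∀ g, a (w (deg g)) = 0 → a g = 0)
    (he : VanishAbove deg 0 e) (he' : e (w 0) ≠ 0) (T : h.Alg) (hT : VanishAbove deg 1 (toFun T))
    (hstep : ∀ m, ∃ b ∈ H, VanishAbove deg m b ∧ conv μ (toFun T) b (w (m + 1)) ≠ 0) :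
    Function.Bijective (Polynomial.aeval T : Polynomial ℂ →ₐ[ℂ] h.Alg) := by
  have hpow : ∀ m, VanishAbove deg m (toFun (T ^ m)) := by
    intro m
    induction m with
    | zero => rwa [pow_zero, toFun_one]
    | succ m ih => rw [pow_succ', toFun_mul, add_comm]; exact hT.conv hdeg ih
  -- In degree at most m an element is determined modulo lower degree by its value at w m. So b and
  -- a multiple of T ^ m agree modulo lower degree, and multiplied by T they have the same value at
  -- w (m + 1), which is non-zero for b. For m = 0 there is no lower degree and the difference
  -- vanishes outright.
  have hsucc : ∀ m, toFun (T ^ m) (w m) ≠ 0 → toFun (T ^ (m + 1)) (w (m + 1)) ≠ 0 := by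
    intro m hm
    obtain ⟨b, hb, hbm, hbT⟩ := hstep m
    set c := b (w m) / toFun (T ^ m) (w m) with hc
    have hd : toFun (T * (h.of b hb + (-c) • T ^ m)) (w (m + 1)) = 0 := by
      rw [toFun_mul]
      rcases Nat.eq_zero_or_pos m with rfl | hm0
      · have : toFun (h.of b hb + (-c) • T ^ 0) = 0 := by
          ext g
          rw [toFun_add, toFun_smul, toFun_of, Pi.zero_apply]
          rcases Nat.eq_zero_or_pos (deg g) with h0 | h0
          · refine hsep (b + (-c) • toFun (T ^ 0)) (H.add_mem hb (H.smul_mem _ (toFun_mem _))) g ?_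
            rw [h0]; simp only [Pi.add_apply, Pi.smul_apply, smul_eq_mul, hc]; field_simp; ring
          · simp only [Pi.add_apply, Pi.smul_apply, smul_eq_mul, hbm g h0, hpow 0 g h0]; ring
        rw [this]
        simp [KohnenHecke.conv]
      · have : VanishAbove deg (m - 1) (toFun (h.of b hb + (-c) • T ^ m)) := by
          intro g hg
          rw [toFun_add, toFun_smul, toFun_of]
          rcases lt_or_ge m (deg g) with h0 | h0
          · simp only [Pi.add_apply, Pi.smul_apply, smul_eq_mul, hbm g h0, hpow m g h0]; ring
          · refine hsep (b + (-c) • toFun (T ^ m)) (H.add_mem hb (H.smul_mem _ (toFun_mem _))) g ?_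
            rw [show deg g = m by omega]
            simp only [Pi.add_apply, Pi.smul_apply, smul_eq_mul, hc]; field_simp; ring
        exact hT.conv hdeg this _ (by rw [hw]; omega)
    rw [mul_add, mul_smul_comm, ← pow_succ', toFun_add, toFun_smul, toFun_mul, toFun_of, Pi.add_apply,
      Pi.smul_apply, smul_eq_mul] at hd
    intro h0
    rw [h0, mul_zero, add_zero] at hd
    exact hbT hd
  refine aeval_bijective_of_triangular T (fun k => h.evalAt (w k)) (fun a ha => ?_) (fun a => ?_)
    (fun m k hk => hpow m _ (by rwa [hw])) (fun m => ?_)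
  · refine toFun_injective ?_
    ext g
    exact hsep _ (toFun_mem a) g (ha (deg g))
  · obtain ⟨n, hn⟩ := hfin _ (toFun_mem a)
    exact ⟨n + 1, fun k hk => hn _ (by rw [hw]; omega)⟩
  · rw [evalAt_apply]
    induction m with
    | zero => rwa [pow_zero, toFun_one]
    | succ m ih => exact hsucc m ih

theorem IsHeckePair.exists_vanishAbove [TopologicalSpace G] [BorelSpace G] {K : Subgroup G} {χ : G → ℂ} (h : IsHeckePair μ K χ)
    {deg : G → ℕ} (hdeg : ∀ g g', deg (g * g') ≤ deg g + deg g') (hK : ∀ k ∈ K, deg k = 0) {a : G → ℂ}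
    (ha : HasCompactSupport a) : ∃ n, VanishAbove deg n a := by
  obtain ⟨s, hs⟩ := h.finiteCosetSupport ha
  refine ⟨s.sup fun i => deg i.out, fun g hg => ?_⟩
  by_contra hne
  obtain ⟨i, hi, hig⟩ := hs g hne
  have h1 := hdeg i.out ((i.out)⁻¹ * g)
  rw [mul_inv_cancel_left, hK _ hig] at h1
  have := Finset.le_sup (f := fun i : G ⧸ K => deg i.out) hi
  omega

end ConvAlg

/-! ### The genuine Hecke algebra is a polynomial ring in T̃₁. -/

section Genuine

variable {F : Type*} [Field F] [ValuativeRel F] [TopologicalSpace F] [IsNonarchimedeanLocalField F]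
  [MeasurableSpace F] [BorelSpace F] [CharZero F] [hq : Fact (Odd (resCard F))]
  {ψ : AddChar F Circle} {δ ϖ : Fˣ} {μ : Measure (Mp2 F)}

/-- The central element [1, ζ] lies in the subgroup and ε takes the value ζ on it, so genuineness is
automatic. -/
theorem genuineHecke_eq (he : IsUnramified (ψ.mulShift (δ : F)⁻¹)) :
    genuineHecke ψ (δ : F) = heckeSpace (gammaGroup δ : Set (Mp2 F)) (eps ψ (δ : F)) := by
  refine le_antisymm inf_le_right (le_inf (fun φ hφ ζ g => ?_) le_rfl)
  have := heckeSpace_mul_left hφ (mem_zElt (δ := δ) ζ) g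
  rw [eps_zElt he] at this
  exact this

theorem isConvAlgebra_genuineHecke [μ.IsMulLeftInvariant] (he : IsUnramified (ψ.mulShift (δ : F)⁻¹))
    (h : IsHeckePair μ (gammaGroup δ) (eps ψ (δ : F))) :
    IsConvAlgebra μ (genuineHecke ψ (δ : F)) (genuineUnit ψ (δ : F)) := by
  rw [genuineHecke_eq he]
  exact h.isConvAlgebra

variable (δ) in
theorem exists_degree : ∃ deg : Mp2 F → ℕ, (∀ g, matSize (δ : F) g.g.1 = (resCard F : ℝ) ^ deg g) ∧
    ∀ g g', deg (g * g') ≤ deg g + deg g' := by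
  choose deg hdeg using fun g : Mp2 F => exists_matSize_eq_pow (δ := δ) g.g
  refine ⟨deg, hdeg, fun g g' => ?_⟩
  have := matSize_mul_le δ.ne_zero g.g.1 g'.g.1
  rw [hdeg, hdeg, ← pow_add] at this
  have h2 : matSize (δ : F) (g.g.1 * g'.g.1) = (resCard F : ℝ) ^ deg (g * g') := hdeg (g * g')
  rw [h2] at this
  exact (pow_le_pow_iff_right₀ (one_lt_resCard F)).1 this

theorem aeval_Ttilde_bijective [μ.IsMulLeftInvariant] (he : IsUnramified (ψ.mulShift (δ : F)⁻¹))
    (hϖ : absF (ϖ : F) = (resCard F : ℝ)⁻¹) (h : IsHeckePair μ (gammaGroup δ) (eps ψ (δ : F)))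
    (hA : IsConvAlgebra μ (genuineHecke ψ (δ : F)) (genuineUnit ψ (δ : F)))
    (T : hA.Alg) (hT : IsConvAlgebra.toFun T = Ttilde ψ (δ : F) ϖ 1) :
    Function.Bijective (Polynomial.aeval T : Polynomial ℂ →ₐ[ℂ] hA.Alg) := by
  obtain ⟨deg, hdeg, hmul⟩ := exists_degree (F := F) δ
  have hinj : Function.Injective fun n : ℕ => (resCard F : ℝ) ^ n := pow_right_injective₀
    (zero_lt_one.trans (one_lt_resCard F)) (one_lt_resCard F).ne'
  have hmem : ∀ g : Mp2 F, g ∈ gammaGroup δ ↔ deg g = 0 := fun g => by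
    rw [mem_gammaGroup, isGamma_iff_matSize, hdeg]
    refine ⟨fun h1 => ?_, fun h1 => by rw [h1, pow_zero]⟩
    by_contra h0
    exact h1.not_gt (one_lt_pow₀ (one_lt_resCard F) h0)
  have hvan : ∀ m n, m ≤ n → VanishAbove deg n (Ttilde ψ (δ : F) ϖ m) := fun m n hmn g hg =>
    Ttilde_eq_zero hϖ fun h' => by
      rw [hdeg] at h'
      have := hinj h'
      omega
  have hval : ∀ m, Ttilde ψ (δ : F) ϖ m (wElt (δ / ϖ ^ m)) ≠ 0 := fun m => by
    rw [Ttilde_apply_wElt he hϖ h (absF_div_uniformizer_pow hϖ m), if_pos rfl]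
    exact mul_ne_zero (pow_ne_zero _ (rq_ne_zero F)) (gau_ne_zero he _)
  have hw : ∀ k, deg (wElt (δ / ϖ ^ k)) = k := fun k => hinj <| by
    change _ ^ _ = _ ^ _
    rw [← hdeg, wElt_g, matSize_wMat (absF_div_uniformizer_pow hϖ k)]
  have hunit : VanishAbove deg 0 (genuineUnit ψ (δ : F)) := fun g hg =>
    Set.indicator_of_notMem (fun hg' : g ∈ gammaGroup δ => by rw [hmem] at hg'; omega) _
  have hT' := genuineHecke_eq (ψ := ψ) (δ := δ) he ▸ Ttilde_mem he hϖ h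
  have hzero : ∀ m n, m < n → Ttilde ψ (δ : F) ϖ m (wElt (δ / ϖ ^ n)) = 0 := fun m n hmn =>
    hvan m m le_rfl _ (by rwa [hw])
  refine hA.aeval_bijective hmul hw (fun a ha => ?_) (fun a ha g h0 => ?_) hunit ?_ T ?_ fun m => ?_
  · exact h.exists_vanishAbove hmul (fun k hk => (hmem k).1 hk) ha.2.1
  · exact hecke_eq_zero he (genuineHecke_eq (ψ := ψ) (δ := δ) he ▸ ha) (c := δ / ϖ ^ deg g)
      (by rw [hdeg, absF_div_uniformizer_pow hϖ]) h0
  · rw [pow_zero, div_one, genuineUnit, Set.indicator_of_mem (show wElt δ ∈ GammaTilde (δ : F) from mem_wElt),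
      eps_wElt he]
    exact one_ne_zero
  · rw [hT]; exact hvan 1 1 le_rfl
  · rw [hT]
    -- The elements 1, T̃₁ and T̃_m with m ≥ 2 represent the degrees; multiplied by T̃₁ each has
    -- leading term T̃_(m+1), whose value at the point of degree m + 1 is non-zero because Weil
    -- indices are. The product formula has a different shape in each of the three cases.
    rcases m with _ | _ | m
    · refine ⟨_, hA.one_mem, hunit, ?_⟩
      rw [hA.conv_one _ (hT' 1)]
      exact hval 1
    · refine ⟨_, hT' 1, hvan 1 1 le_rfl, ?_⟩
      rw [conv_Ttilde_one_one he hϖ h, Pi.add_apply, Pi.smul_apply, hunit _ (by rw [hw]; omega), smul_zero, zero_add]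
      exact hval 2
    · refine ⟨_, hT' (m + 2), hvan _ _ le_rfl, ?_⟩
      rw [conv_Ttilde he hϖ h (by omega), Pi.add_apply, Pi.smul_apply, hzero _ _ (by omega), smul_zero, zero_add]
      exact hval (m + 3)

end Genuine

/-! ## The spherical Hecke algebra -/

section Spherical

open Matrix.ProjGenLinGroup

variable {F : Type*} [Field F] [ValuativeRel F] [TopologicalSpace F] [IsNonarchimedeanLocalField F] {δ ϖ : Fˣ}

theorem matSize_smul (δ x : F) (M : Matrix (Fin 2) (Fin 2) F) : matSize δ (x • M) = absF x * matSize δ M := by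
  simp only [matSize, Matrix.smul_apply, smul_eq_mul, mul_assoc, mul_div_assoc, absF_mul x,
    mul_max_of_nonneg _ _ (absF_nonneg x)]

theorem matSize_adjugate (δ : F) (M : Matrix (Fin 2) (Fin 2) F) : matSize δ M.adjugate = matSize δ M := by
  simp only [matSize, Matrix.adjugate_fin_two, Matrix.of_apply, Matrix.cons_val', Matrix.cons_val_zero,
    Matrix.cons_val_one, Matrix.cons_val_fin_one, neg_mul, neg_div, absF_neg]
  rw [max_comm (absF (M 1 1)), max_comm _ (absF (M 0 0)), max_max_max_comm, max_comm (absF (M 0 1 * δ)),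
    max_comm (absF (M 1 0 / δ)), max_max_max_comm]

theorem matSize_le_one_iff {M : Matrix (Fin 2) (Fin 2) F} : matSize (δ : F) M ≤ 1 ↔
    absF (M 0 0) ≤ 1 ∧ absF (M 0 1) ≤ (absF (δ : F))⁻¹ ∧ absF (M 1 0) ≤ absF (δ : F) ∧ absF (M 1 1) ≤ 1 := by
  have := absF_pos δ.ne_zero
  rw [matSize_le_iff, absF_mul, absF_div, div_le_one this, ← le_div_iff₀ this, one_div, and_assoc]

theorem matSize_pos (g : GL (Fin 2) F) : 0 < matSize (δ : F) g.1 := by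
  refine (matSize_nonneg _ _).lt_of_ne fun h => ?_
  have := absF_det_le_sq δ.ne_zero g.1
  rw [← h, sq, zero_mul] at this
  exact this.not_gt (absF_pos g.det.ne_zero)

theorem coe_mul_scalar (g : GL (Fin 2) F) (u : Fˣ) :
    (g * Matrix.GeneralLinearGroup.scalar (Fin 2) u).1 = (u : F) • g.1 := by
  rw [Units.val_mul, Matrix.GeneralLinearGroup.coe_scalar, Matrix.scalar_apply, ← Matrix.smul_one_eq_diagonal,
    mul_smul_comm, mul_one]

variable (δ) in
-- The quotient size² / |det| is invariant under scalars, a power of q, and at least 1.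
theorem exists_pglDegree (x : PGL(2, F)) : ∃ n : ℕ, ∀ g : GL (Fin 2) F, mk g = x →
    matSize (δ : F) g.1 ^ 2 = (resCard F : ℝ) ^ n * absF g.1.det := by
  obtain ⟨g, rfl⟩ := mk_surjective x
  obtain ⟨y, hy⟩ := exists_matSize_eq_absF (δ : F) g.1
  have hdet : g.1.det ≠ 0 := g.det.ne_zero
  have hy0 : y ≠ 0 := by
    rintro rfl; rw [absF_zero] at hy; exact (matSize_pos (δ := δ) g).ne' hy
  obtain ⟨k, hk⟩ := exists_absF_eq_zpow (div_ne_zero (pow_ne_zero 2 hy0) hdet)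
  have h1 : (resCard F : ℝ) ^ k = matSize (δ : F) g.1 ^ 2 / absF g.1.det := by
    rw [← hk, absF_div, absF_pow, hy]
  have h2 : 1 ≤ (resCard F : ℝ) ^ k := by
    rw [h1, one_le_div (absF_pos hdet)]
    exact absF_det_le_sq δ.ne_zero g.1
  rw [one_le_zpow_iff_right₀ (one_lt_resCard F)] at h2
  obtain ⟨n, rfl⟩ := Int.eq_ofNat_of_zero_le h2
  rw [zpow_natCast, eq_div_iff (absF_ne_zero hdet)] at h1
  refine ⟨n, fun g' hg' => ?_⟩
  obtain ⟨u, rfl⟩ := mk_eq_mk_iff.1 hg'.symm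
  rw [coe_mul_scalar, matSize_smul, Matrix.det_smul, Fintype.card_fin, absF_mul, absF_pow, mul_pow, ← h1]
  ring

variable (δ) in
/-- The natural number `n` with `max |entries of g|² = q^n |det g|`. -/
def pglDegree (x : PGL(2, F)) : ℕ := (exists_pglDegree δ x).choose

theorem matSize_sq (g : GL (Fin 2) F) : matSize (δ : F) g.1 ^ 2 =
    (resCard F : ℝ) ^ pglDegree δ (mk g) * absF g.1.det :=
  (exists_pglDegree δ (mk g)).choose_spec g rfl

theorem pglDegree_eq_iff (g : GL (Fin 2) F) (n : ℕ) : pglDegree δ (mk g) = n ↔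
    matSize (δ : F) g.1 ^ 2 = (resCard F : ℝ) ^ n * absF g.1.det := by
  rw [matSize_sq, mul_left_inj' (absF_ne_zero (x := g.1.det) g.det.ne_zero),
    (pow_right_injective₀ (zero_lt_one.trans (one_lt_resCard F)) (one_lt_resCard F).ne').eq_iff]

theorem pglDegree_mul_le (x y : PGL(2, F)) : pglDegree δ (x * y) ≤ pglDegree δ x + pglDegree δ y := by
  obtain ⟨g, rfl⟩ := mk_surjective x
  obtain ⟨h, rfl⟩ := mk_surjective y
  have h1 := pow_le_pow_left₀ (matSize_nonneg _ _) (matSize_mul_le δ.ne_zero g.1 h.1) 2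
  have h2 := matSize_sq (δ := δ) (g * h)
  rw [Units.val_mul, Matrix.det_mul, absF_mul, map_mul] at h2
  rw [h2, mul_pow, matSize_sq, matSize_sq] at h1
  have h3 := mul_pos (absF_pos (x := g.1.det) g.det.ne_zero) (absF_pos (x := h.1.det) h.det.ne_zero)
  refine (pow_le_pow_iff_right₀ (one_lt_resCard F)).1 (le_of_mul_le_mul_right ?_ h3)
  rw [pow_add]
  linarith

theorem pglDegree_inv (x : PGL(2, F)) : pglDegree δ x⁻¹ = pglDegree δ x := by
  obtain ⟨g, rfl⟩ := mk_surjective x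
  have hd := absF_ne_zero (x := g.1.det) g.det.ne_zero
  rw [← map_inv, pglDegree_eq_iff, Matrix.coe_units_inv, Matrix.inv_def, Ring.inverse_eq_inv', matSize_smul,
    matSize_adjugate, mul_pow, matSize_sq, Matrix.det_smul, Matrix.det_adjugate]
  simp
  field_simp

theorem mem_KPrime {x : PGL(2, F)} : x ∈ KPrime (δ : F) ↔ pglDegree δ x = 0 := by
  constructor
  · rintro ⟨g, ⟨ha, hb, hc, hd, hdet⟩, rfl⟩
    have h1 : matSize (δ : F) g.1 ≤ 1 := matSize_le_one_iff.2 ⟨ha, hb, hc, hd⟩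
    have h2 := absF_det_le_sq δ.ne_zero g.1
    rw [pglDegree_eq_iff, hdet, pow_zero, mul_one]
    rw [hdet] at h2
    exact le_antisymm (pow_le_one₀ (matSize_nonneg _ _) h1) h2
  · obtain ⟨g, rfl⟩ := mk_surjective x
    rw [pglDegree_eq_iff, pow_zero, one_mul]
    intro h
    -- Degree zero means |det g| = size². Dividing g by a scalar y of absolute value equal to its
    -- size gives a representative with bounded entries and unit determinant.
    obtain ⟨y, hy⟩ := exists_matSize_eq_absF (δ : F) g.1
    have hp := matSize_pos (δ := δ) g
    have hy0 : y ≠ 0 := by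
      rintro rfl; rw [absF_zero] at hy; exact hp.ne' hy
    refine ⟨g * Matrix.GeneralLinearGroup.scalar (Fin 2) (Units.mk0 y hy0)⁻¹, ?_, mk_eq_mk_iff.2 ⟨Units.mk0 y hy0, ?_⟩⟩
    · have h1 : matSize (δ : F) ((y⁻¹ : F) • g.1) = 1 := by
        rw [matSize_smul, absF_inv, ← hy, inv_mul_cancel₀ hp.ne']
      obtain ⟨ha, hb, hc, hd⟩ := matSize_le_one_iff.1 h1.le
      rw [Set.mem_ofPred_eq, coe_mul_scalar, Units.val_inv_eq_inv_val, Units.val_mk0]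
      refine ⟨ha, hb, hc, hd, ?_⟩
      rw [Matrix.det_smul, Fintype.card_fin, absF_mul, ← h, hy, absF_pow, absF_inv, ← mul_pow,
        inv_mul_cancel₀ (absF_ne_zero hy0), one_pow]
    · rw [mul_assoc, ← map_mul, inv_mul_cancel, map_one, mul_one]

variable (δ) in
/-- The standard maximal compact subgroup of `PGL₂(F)`. -/
def kPrimeGroup : Subgroup (PGL(2, F)) where
  carrier := KPrime (δ : F)
  one_mem' := by
    rw [mem_KPrime]
    have : pglDegree δ (mk (1 : GL (Fin 2) F)) = 0 := by
      rw [pglDegree_eq_iff]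
      simp [matSize]
    exact this
  mul_mem' {x y} hx hy := by
    rw [mem_KPrime] at *
    have := pglDegree_mul_le (δ := δ) x y
    omega
  inv_mem' {x} hx := by rwa [mem_KPrime, pglDegree_inv, ← mem_KPrime]

theorem mem_kPrimeGroup {x : PGL(2, F)} : x ∈ kPrimeGroup δ ↔ pglDegree δ x = 0 := mem_KPrime

theorem pglDegree_mul_left {k : PGL(2, F)} (hk : k ∈ kPrimeGroup δ) (x : PGL(2, F)) :
    pglDegree δ (k * x) = pglDegree δ x := by
  have h1 := pglDegree_mul_le (δ := δ) k x
  have h2 := pglDegree_mul_le (δ := δ) k⁻¹ (k * x)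
  rw [inv_mul_cancel_left, pglDegree_inv] at h2
  rw [mem_kPrimeGroup] at hk
  omega

theorem pglDegree_mul_right {k : PGL(2, F)} (hk : k ∈ kPrimeGroup δ) (x : PGL(2, F)) :
    pglDegree δ (x * k) = pglDegree δ x := by
  rw [← pglDegree_inv, mul_inv_rev, pglDegree_mul_left (inv_mem hk), pglDegree_inv]

/-! ### Topology -/

instance : IsTopologicalGroup (PGL(2, F)) :=
  inferInstanceAs (IsTopologicalGroup (GL (Fin 2) F ⧸ Subgroup.center (GL (Fin 2) F)))

theorem continuous_pgl_mk : Continuous (mk : GL (Fin 2) F → PGL(2, F)) := continuous_coinduced_rng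

variable (δ) in
-- The degree is an integer, so a fixed value is cut out by two strict inequalities between
-- continuous functions on GL₂(F).
theorem isOpen_pglDegree_eq (n : ℕ) : IsOpen {x : PGL(2, F) | pglDegree δ x = n} := by
  refine isOpen_coinduced.2 ?_
  have hq : (1 : ℝ) < resCard F := one_lt_resCard F
  have h1 : Continuous fun g : GL (Fin 2) F => matSize (δ : F) g.1 ^ 2 :=
    ((continuous_matSize (δ : F)).comp Units.continuous_val).pow 2
  have h2 : Continuous fun g : GL (Fin 2) F => absF g.1.det :=
    continuous_absF.comp (Units.continuous_val.matrix_det)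
  have h3 : IsOpen {g : GL (Fin 2) F | (resCard F : ℝ) ^ n * absF g.1.det < resCard F * matSize (δ : F) g.1 ^ 2} :=
    isOpen_lt (continuous_const.mul h2) (continuous_const.mul h1)
  have h4 : IsOpen {g : GL (Fin 2) F | matSize (δ : F) g.1 ^ 2 < (resCard F : ℝ) ^ (n + 1) * absF g.1.det} :=
    isOpen_lt h1 (continuous_const.mul h2)
  convert h3.inter h4 using 1
  ext g
  change pglDegree δ (mk g) = n ↔ (_ : ℝ) < _ ∧ (_ : ℝ) < _
  have hd := absF_pos (x := g.1.det) g.det.ne_zero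
  rw [matSize_sq, ← mul_assoc, mul_lt_mul_iff_left₀ hd, mul_lt_mul_iff_left₀ hd, ← pow_succ' (resCard F : ℝ),
    pow_lt_pow_iff_right₀ hq, pow_lt_pow_iff_right₀ hq]
  omega

/-- The group is the image of a compact set of matrices with |det| = 1; on that set inversion is
continuous, so the map to GL₂(F) is continuous. -/
theorem isCompact_kPrimeGroup : IsCompact (kPrimeGroup δ : Set (PGL(2, F))) := by
  let S : Set (Matrix (Fin 2) (Fin 2) F) := {M | matSize (δ : F) M ≤ 1} ∩ {M | absF M.det = 1}
  have hS : IsCompact S := by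
    have h1 := isCompact_matrix_entries (F := F) ![![1, (δ : F)⁻¹], ![δ, 1]]
    have h2 := isClosed_absF_eq (F := F) (X := Matrix (Fin 2) (Fin 2) F) (f := fun M => M.det) (by fun_prop) 1
    have h3 : IsClosed {M : Matrix (Fin 2) (Fin 2) F | matSize (δ : F) M ≤ 1} :=
      isClosed_le (continuous_matSize _) continuous_const
    refine h1.of_isClosed_subset (h3.inter h2) fun M hM => ?_
    obtain ⟨ha, hb, hc, hd⟩ := matSize_le_one_iff.1 hM.1
    simp only [Set.mem_ofPred_eq, Fin.forall_fin_two]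
    exact ⟨⟨by simpa using ha, by simpa using hb⟩, by simpa using hc, by simpa using hd⟩
  have hdet : ∀ M : S, M.1.det ≠ 0 := fun M h => by
    have := M.2.2
    rw [Set.mem_ofPred_eq, h, absF_zero] at this
    exact zero_ne_one this
  have := isCompact_iff_compactSpace.1 hS
  let f : S → GL (Fin 2) F := fun M => Matrix.GeneralLinearGroup.mkOfDetNeZero M.1 (hdet M)
  have hf : Continuous f := by
    refine Units.continuous_iff.2 ⟨continuous_subtype_val, ?_⟩
    have h1 : ∀ M : S, ((f M)⁻¹).1 = (M.1.det)⁻¹ • M.1.adjugate := fun M => by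
      rw [Matrix.coe_units_inv, Matrix.inv_def, Ring.inverse_eq_inv']; rfl
    simp only [h1]
    have h2 : Continuous fun M : S => M.1.det := by fun_prop
    exact (h2.inv₀ hdet).smul (Continuous.matrix_adjugate continuous_subtype_val)
  convert isCompact_range (continuous_pgl_mk.comp hf) using 1
  ext x
  constructor
  · rintro ⟨g, ⟨ha, hb, hc, hd, hg⟩, rfl⟩
    exact ⟨⟨g.1, matSize_le_one_iff.2 ⟨ha, hb, hc, hd⟩, hg⟩, congrArg mk (Units.ext rfl)⟩
  · rintro ⟨M, rfl⟩
    rw [SetLike.mem_coe, mem_kPrimeGroup, Function.comp_apply, pglDegree_eq_iff]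
    have h1 := absF_det_le_sq δ.ne_zero M.1
    have h2 := M.2.2
    rw [Set.mem_ofPred_eq] at h2
    change matSize (δ : F) M.1 ^ 2 = _ * absF M.1.det
    rw [h2] at h1 ⊢
    rw [pow_zero, mul_one]
    exact le_antisymm (pow_le_one₀ (matSize_nonneg _ _) M.2.1) h1

variable {ν : Measure (PGL(2, F))}

theorem isHeckePair_kPrimeGroup (hν : ν (KPrime (δ : F)) = 1) : IsHeckePair ν (kPrimeGroup δ) 1 where
  continuous_mul_left _ := continuous_const_mul _
  isOpen := by
    convert isOpen_pglDegree_eq (F := F) δ 0 using 1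
    ext x
    exact mem_kPrimeGroup
  isCompact := isCompact_kPrimeGroup
  isOpen_mul_right x := by
    convert (isOpen_pglDegree_eq (F := F) δ 0).preimage (continuous_mul_const x) using 1
    ext x
    exact mem_kPrimeGroup
  χ_one := rfl
  χ_mul _ _ _ _ := (mul_one (1 : ℂ)).symm
  measure_eq_one := hν

end Spherical

/-! ### The Cartan decomposition of `PGL₂(F)` -/

section SphericalCartan

open Matrix.ProjGenLinGroup

variable {F : Type*} [Field F]

/-- The element `(0, -aδ⁻¹; δ, 0)` of `GL₂(F)`. -/
def swapGL (δ a : Fˣ) : GL (Fin 2) F :=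
  Matrix.GeneralLinearGroup.mkOfDetNeZero !![0, -(a / δ : F); (δ : F), 0] (by simp [Matrix.det_fin_two])

/-- The element `(a, b; 0, 1)` of `GL₂(F)`. -/
def mirabolic (a : Fˣ) (b : F) : GL (Fin 2) F :=
  Matrix.GeneralLinearGroup.mkOfDetNeZero !![(a : F), b; 0, 1] (by simp [Matrix.det_fin_two])

theorem swapGL_val (δ a : Fˣ) : (swapGL δ a).1 = !![0, -(a / δ : F); (δ : F), 0] := rfl

theorem mirabolic_val (a : Fˣ) (b : F) : (mirabolic a b).1 = !![(a : F), b; 0, 1] := rfl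

theorem swapGL_mul (δ a b : Fˣ) : swapGL δ (a * b) = mirabolic a 0 * swapGL δ b := by
  apply Units.ext
  rw [Units.val_mul, swapGL_val, swapGL_val, mirabolic_val]
  simp [Matrix.mul_fin_two, mul_div_assoc]

variable [ValuativeRel F] [TopologicalSpace F] [IsNonarchimedeanLocalField F] {δ ϖ : Fˣ}

theorem pglDegree_swapGL {a : Fˣ} {n : ℕ} (ha : absF (a : F) = ((resCard F : ℝ) ^ n)⁻¹) :
    pglDegree δ (mk (swapGL δ a)) = n := by
  have hq : 0 < (resCard F : ℝ) ^ n := pow_pos (zero_lt_one.trans (one_lt_resCard F)) n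
  have h1 : ((resCard F : ℝ) ^ n)⁻¹ ≤ 1 := inv_le_one_of_one_le₀ (one_le_pow₀ (one_lt_resCard F).le)
  have hδ := δ.ne_zero
  rw [pglDegree_eq_iff, swapGL_val]
  have : matSize (δ : F) !![0, -(a / δ : F); (δ : F), 0] = 1 := by
    simp [matSize, hδ, ha, h1]
  rw [this, Matrix.det_fin_two]
  simp [hδ, ha, hq.ne']

theorem pglDegree_mirabolic {a : Fˣ} {b : F} {n : ℕ} (ha : absF (a : F) = ((resCard F : ℝ) ^ n)⁻¹)
    (hb : absF (b * δ) ≤ 1) : pglDegree δ (mk (mirabolic a b)) = n := by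
  have hq : 0 < (resCard F : ℝ) ^ n := pow_pos (zero_lt_one.trans (one_lt_resCard F)) n
  have h1 : ((resCard F : ℝ) ^ n)⁻¹ ≤ 1 := inv_le_one_of_one_le₀ (one_le_pow₀ (one_lt_resCard F).le)
  have hδ := δ.ne_zero
  rw [pglDegree_eq_iff, mirabolic_val]
  have : matSize (δ : F) !![(a : F), b; 0, 1] = 1 := by
    rw [absF_mul] at hb
    simp [matSize, ha, h1, hb]
  rw [this, Matrix.det_fin_two]
  simp [ha, hq.ne']

theorem exists_dominant_GL (g : GL (Fin 2) F) : ∃ x y : GL (Fin 2) F, (x = 1 ∨ x = swapGL δ 1) ∧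
    (y = 1 ∨ y = swapGL δ 1) ∧ absF ((x * g * y).1 1 0 / δ) = matSize (δ : F) g.1 := by
  have hδ := δ.ne_zero
  have key : (matSize (δ : F) g.1 = absF (g.1 0 0) ∨ matSize (δ : F) g.1 = absF (g.1 0 1 * δ)) ∨
      matSize (δ : F) g.1 = absF (g.1 1 0 / δ) ∨ matSize (δ : F) g.1 = absF (g.1 1 1) := by
    unfold matSize
    rcases max_choice (max (absF (g.1 0 0)) (absF (g.1 0 1 * δ))) (max (absF (g.1 1 0 / δ)) (absF (g.1 1 1))) with h | h <;>
      rw [h]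
    · exact Or.inl (max_choice _ _)
    · exact Or.inr (max_choice _ _)
  rcases key with (h | h) | h | h
  · refine ⟨swapGL δ 1, 1, Or.inr rfl, Or.inl rfl, ?_⟩
    rw [h, mul_one, Units.val_mul, swapGL_val, Matrix.mul_apply, Fin.sum_univ_two]
    simp [hδ]
  · refine ⟨swapGL δ 1, swapGL δ 1, Or.inr rfl, Or.inr rfl, ?_⟩
    rw [h, Units.val_mul, Units.val_mul, swapGL_val, Matrix.mul_apply, Fin.sum_univ_two, Matrix.mul_apply,
      Matrix.mul_apply, Fin.sum_univ_two, Fin.sum_univ_two]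
    simp [hδ]
    ring
  · exact ⟨1, 1, Or.inl rfl, Or.inl rfl, by rw [h, one_mul, mul_one]⟩
  · refine ⟨1, swapGL δ 1, Or.inl rfl, Or.inr rfl, ?_⟩
    rw [h, one_mul, Units.val_mul, swapGL_val, Matrix.mul_apply, Fin.sum_univ_two]
    simp [hδ]

/-- A dominant lower left entry clears the diagonal entries by unipotent matrices in K' on both
sides. What remains is antidiagonal and is normalized by a scalar and a unit. -/
theorem exists_cartan_of_dominant (hϖ : absF (ϖ : F) = (resCard F : ℝ)⁻¹) {g : GL (Fin 2) F}
    (hg : absF (g.1 1 0 / δ) = matSize (δ : F) g.1) : ∃ k ∈ kPrimeGroup δ, ∃ k' ∈ kPrimeGroup δ,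
      mk g = k * mk (swapGL δ (ϖ ^ pglDegree δ (mk g))) * k' := by
  have hδ := δ.ne_zero
  have hp := matSize_pos (δ := δ) g
  have hc : g.1 1 0 ≠ 0 := by
    intro h
    rw [h, zero_div, absF_zero] at hg
    exact hp.ne hg
  obtain ⟨c, hc'⟩ : ∃ c : Fˣ, (c : F) = g.1 1 0 := ⟨Units.mk0 _ hc, rfl⟩
  rw [← hc'] at hg
  set m := pglDegree δ (mk g) with hm
  have hsq := matSize_sq (δ := δ) g
  rw [← hm] at hsq
  have hb := matSize_bounds (δ : F) g.1
  have key : ∀ x : F, absF x ≤ matSize (δ : F) g.1 → absF (x / c * δ) ≤ 1 := by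
    intro x hx
    rw [show x / c * δ = x / (c / δ) by field_simp, absF_div, hg]
    exact div_le_one_of_le₀ hx (matSize_nonneg _ _)
  -- Found by comparing determinants in g = (c/δ) · (ε, ∗; 0, 1) · swap(ϖ^m) · (1, ∗; 0, 1); the
  -- definition of the degree makes it a unit.
  let ε : Fˣ := g.det * δ ^ 2 / (c ^ 2 * ϖ ^ m)
  have hεval : (ε : F) = g.1.det * δ ^ 2 / (c ^ 2 * ϖ ^ m) := by simp [ε]
  have hε : absF (ε : F) = ((resCard F : ℝ) ^ 0)⁻¹ := by
    have hd := absF_ne_zero (x := g.1.det) g.det.ne_zero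
    have hq : (resCard F : ℝ) ^ m ≠ 0 := pow_ne_zero _ (zero_lt_one.trans (one_lt_resCard F)).ne'
    have hδ' := absF_ne_zero hδ
    have hc0 := absF_ne_zero c.ne_zero
    rw [hεval, absF_div, absF_mul, absF_mul, absF_pow, absF_pow, absF_pow, hϖ, inv_pow]
    rw [← hg, absF_div, div_pow] at hsq
    field_simp at hsq ⊢
    rw [hsq]
  have h1 : absF ((1 : Fˣ) : F) = ((resCard F : ℝ) ^ 0)⁻¹ := by simp
  refine ⟨_, mem_kPrimeGroup.2 (pglDegree_mirabolic hε (key _ hb.1.1)), _,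
    mem_kPrimeGroup.2 (pglDegree_mirabolic h1 (key _ hb.2.2)), ?_⟩
  rw [← map_mul, ← map_mul]
  refine (mk_eq_mk_iff.2 ⟨c / δ, Units.ext ?_⟩).symm
  rw [coe_mul_scalar, Units.val_mul, Units.val_mul, mirabolic_val, mirabolic_val, swapGL_val]
  have hdet := Matrix.det_fin_two g.1
  have hc0 := c.ne_zero
  have hϖ0 := ϖ.ne_zero
  ext i j
  fin_cases i <;> fin_cases j <;> simp [Matrix.mul_fin_two, hεval]
  · field_simp
  · field_simp
    rw [hdet, ← hc']
    ring
  · exact hc'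
  · field_simp

theorem exists_cartan (hϖ : absF (ϖ : F) = (resCard F : ℝ)⁻¹) (x : PGL(2, F)) :
    ∃ k ∈ kPrimeGroup δ, ∃ k' ∈ kPrimeGroup δ, x = k * mk (swapGL δ (ϖ ^ pglDegree δ x)) * k' := by
  obtain ⟨g, rfl⟩ := mk_surjective x
  obtain ⟨x, y, hx, hy, hxy⟩ := exists_dominant_GL (δ := δ) g
  have hmem : ∀ z : GL (Fin 2) F, (z = 1 ∨ z = swapGL δ 1) → mk z ∈ kPrimeGroup δ := by
    rintro z (rfl | rfl)
    · exact one_mem _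
    · exact mem_kPrimeGroup.2 (pglDegree_swapGL (by simp))
  have hdeg : pglDegree δ (mk (x * g * y)) = pglDegree δ (mk g) := by
    rw [map_mul, map_mul, pglDegree_mul_right (hmem y hy), pglDegree_mul_left (hmem x hx)]
  have hsz : matSize (δ : F) (x * g * y).1 = matSize (δ : F) g.1 := by
    have hdet : ∀ z : GL (Fin 2) F, (z = 1 ∨ z = swapGL δ 1) → absF z.1.det = 1 := by
      rintro z (rfl | rfl)
      · simp
      · rw [swapGL_val, Matrix.det_fin_two]; simp
    refine (pow_left_inj₀ (matSize_nonneg _ _) (matSize_nonneg _ _) two_ne_zero).1 ?_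
    rw [matSize_sq, matSize_sq, hdeg, Units.val_mul, Units.val_mul, Matrix.det_mul, Matrix.det_mul, absF_mul,
      absF_mul, hdet x hx, hdet y hy, one_mul, mul_one]
  obtain ⟨k, hk, k', hk', h⟩ := exists_cartan_of_dominant (δ := δ) hϖ (g := x * g * y) (by rw [hsz]; exact hxy)
  rw [hdeg] at h
  refine ⟨(mk x)⁻¹ * k, mul_mem (inv_mem (hmem x hx)) hk, k' * (mk y)⁻¹, mul_mem hk' (inv_mem (hmem y hy)), ?_⟩
  rw [map_mul, map_mul] at h
  rw [mul_assoc _ k, mul_assoc, ← mul_assoc (k * _), ← h]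
  group

/-- The characteristic function of the elements of degree `n`. -/
def degreeIndicator (δ : Fˣ) (n : ℕ) : PGL(2, F) → ℂ := Set.indicator {x | pglDegree δ x = n} 1

open Classical in
theorem degreeIndicator_apply (n : ℕ) (x : PGL(2, F)) :
    degreeIndicator δ n x = if pglDegree δ x = n then 1 else 0 := by
  simp [degreeIndicator, Set.indicator_apply]

variable {ν : Measure (PGL(2, F))}

theorem degreeIndicator_mem (hϖ : absF (ϖ : F) = (resCard F : ℝ)⁻¹) (h : IsHeckePair ν (kPrimeGroup δ) 1) (n : ℕ) :
    degreeIndicator δ n ∈ sphericalHecke (δ : F) := by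
  refine ⟨h.hasCompactSupport ?_, fun k hk k' hk' g => ?_⟩
  · obtain ⟨t, ht⟩ := h.exists_finset_doubleCoset (mk (swapGL δ (ϖ ^ n)))
    refine finiteCosetSupport_of_finset t fun x hx => ?_
    have hxn : pglDegree δ x = n := by
      by_contra hne
      exact hx (by rw [degreeIndicator_apply, if_neg hne])
    obtain ⟨k, hk, k', hk', hxk⟩ := exists_cartan (δ := δ) hϖ x
    rw [hxk, hxn]
    exact ht k hk k' hk'
  · have : pglDegree δ (k * g * k') = pglDegree δ g := by
      rw [pglDegree_mul_right hk', pglDegree_mul_left hk]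
    classical
    simp only [degreeIndicator, Set.indicator_apply, Set.mem_ofPred_eq, this, Pi.one_apply, one_mul]

/-- The generator is the characteristic function of the elements of degree 1. At a point of degree m
+ 1, its product with the characteristic function of degree m is the volume of an open set, and it
suffices that this set is not empty. -/
theorem exists_aeval_spherical_bijective [ν.IsMulLeftInvariant] [ν.IsOpenPosMeasure]
    (hϖ : absF (ϖ : F) = (resCard F : ℝ)⁻¹) (h : IsHeckePair ν (kPrimeGroup δ) 1)
    (hA : IsConvAlgebra ν (sphericalHecke (δ : F)) (sphericalUnit (δ : F))) :
    ∃ T : hA.Alg, Function.Bijective (Polynomial.aeval T : Polynomial ℂ →ₐ[ℂ] hA.Alg) := by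
  have hw : ∀ k, pglDegree δ (mk (swapGL δ (ϖ ^ k))) = k := fun k =>
    pglDegree_swapGL (by rw [Units.val_pow_eq_pow_val, absF_pow, hϖ, inv_pow])
  have hvan : ∀ n, VanishAbove (pglDegree δ) n (degreeIndicator δ n) := fun n g hg =>
    by rw [degreeIndicator_apply, if_neg hg.ne']
  have hunit : sphericalUnit (δ : F) = degreeIndicator δ 0 := by
    rw [sphericalUnit, degreeIndicator]
    congr 1
    ext x
    exact mem_KPrime
  refine ⟨hA.of _ (degreeIndicator_mem hϖ h 1), hA.aeval_bijective pglDegree_mul_le hw (fun a ha => ?_)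
    (fun a ha g h0 => ?_) ?_ ?_ _ (hvan 1) fun m => ⟨degreeIndicator δ m, degreeIndicator_mem hϖ h m, hvan m, ?_⟩⟩
  · exact h.exists_vanishAbove pglDegree_mul_le (fun k hk => mem_kPrimeGroup.1 hk) ha.1
  · obtain ⟨k, hk, k', hk', hg⟩ := exists_cartan (δ := δ) hϖ g
    rw [hg, ha.2 k hk k' hk', h0, mul_zero]
  · rw [hunit]; exact hvan 0
  · rw [hunit, degreeIndicator_apply, if_pos (hw 0)]
    exact one_ne_zero
  · set s := mk (swapGL δ (ϖ ^ (m + 1))) with hs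
    let U : Set (PGL(2, F)) := {x | pglDegree δ x = 1} ∩ {x | pglDegree δ (x⁻¹ * s) = m}
    have hint : (fun x => degreeIndicator δ 1 x * degreeIndicator δ m (x⁻¹ * s)) = U.indicator fun _ => (1 : ℂ) := by
      ext x
      classical
      simp only [degreeIndicator, U, Set.indicator_apply, Set.mem_inter_iff, Set.mem_ofPred_eq, Pi.one_apply]
      split_ifs <;> simp_all
    have hU : IsOpen U := (isOpen_pglDegree_eq δ 1).inter
      ((isOpen_pglDegree_eq δ m).preimage (continuous_inv.mul continuous_const))
    have hne : U.Nonempty := by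
      -- The point of degree m + 1 is diag(ϖ, 1) times the point of degree m.
      refine ⟨mk (mirabolic ϖ 0), pglDegree_mirabolic (by rw [hϖ, pow_one]) (by simp), ?_⟩
      rw [Set.mem_ofPred_eq, hs, pow_succ', swapGL_mul, map_mul, inv_mul_cancel_left, hw]
    have hfin : ν U < ⊤ := by
      have := h.conv_integrable (degreeIndicator_mem hϖ h 1) (degreeIndicator_mem hϖ h m) s
      rw [hint, integrable_indicator_iff hU.measurableSet, integrableOn_const_iff] at this
      simpa using this
    rw [IsConvAlgebra.toFun_of, conv, hint, integral_indicator_const _ hU.measurableSet]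
    simp only [Complex.real_smul, mul_one, ne_eq, Complex.ofReal_eq_zero]
    exact (ENNReal.toReal_pos (hU.measure_pos ν hne).ne' hfin.ne).ne'

end SphericalCartan

end KohnenHecke

end

/-! ### The main theorem. -/

open KohnenHecke in
theorem mainTheorem7
    {F : Type*} [Field F] [CharZero F] [ValuativeRel F] [TopologicalSpace F]
    [IsNonarchimedeanLocalField F] [MeasurableSpace F] [BorelSpace F]
    (hq : Odd (resCard F))
    (ϖ : Fˣ) (hϖ : absF (ϖ : F) = (resCard F : ℝ)⁻¹)
    (ψ : AddChar F Circle) (hψ : Continuous ψ) (hψ' : ψ ≠ 1)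
    (c : ℤ) (hc : IsIndex ψ c)
    (δ : Fˣ) (hδ : absF (δ : F) = (resCard F : ℝ) ^ (-c))
    (μ : Measure (Mp2 F)) [μ.IsMulLeftInvariant] [IsFiniteMeasureOnCompacts μ]
    [μ.IsOpenPosMeasure] (hμ : μ (GammaTilde (δ : F)) = 1)
    (ν : Measure (PGL(2, F))) [ν.IsHaarMeasure] (hν : ν (KPrime (δ : F)) = 1) :
    ∃ (h : IsConvAlgebra μ (genuineHecke ψ (δ : F)) (genuineUnit ψ (δ : F)))
      (h' : IsConvAlgebra ν (sphericalHecke (δ : F)) (sphericalUnit (δ : F)))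
      (T : ℕ → h.Alg),
      (∀ m, IsConvAlgebra.toFun (T m) = Ttilde ψ (δ : F) ϖ m) ∧
      T 1 ^ 2 = (resCard F : h.Alg) + 1 + T 2 ∧
      (∀ m, 2 ≤ m → T 1 * T m = (resCard F : h.Alg) * T (m - 1) + T (m + 1)) ∧
      Algebra.adjoin ℂ {T 1} = ⊤ ∧
      Nonempty (h.Alg ≃ₐ[ℂ] h'.Alg) := by
  haveI : Fact (Odd (resCard F)) := ⟨hq⟩
  have he := isUnramified_of_isIndex hc hδ
  have hΓ := isHeckePair_gammaGroup (δ := δ) he hμ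
  have hK := isHeckePair_kPrimeGroup (δ := δ) hν
  have h := isConvAlgebra_genuineHecke he hΓ
  have h' : IsConvAlgebra ν (sphericalHecke (δ : F)) (sphericalUnit (δ : F)) := hK.isConvAlgebra
  have hmem : ∀ m, Ttilde ψ (δ : F) ϖ m ∈ genuineHecke ψ (δ : F) := fun m => by
    rw [genuineHecke_eq he]
    exact Ttilde_mem he hϖ hΓ m
  have hT := aeval_Ttilde_bijective he hϖ hΓ h (h.of _ (hmem 1)) rfl
  obtain ⟨T', hT'⟩ := exists_aeval_spherical_bijective hϖ hK h'
  -- The isomorphism passes through the polynomial ring and sends T̃₁ to the generator T' of the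
  -- spherical algebra.
  refine ⟨h, h', fun m => h.of _ (hmem m), fun m => rfl, ?_, fun m hm => ?_, ?_,
    ⟨(AlgEquiv.ofBijective _ hT).symm.trans (AlgEquiv.ofBijective _ hT')⟩⟩
  · refine IsConvAlgebra.toFun_injective ?_
    rw [IsConvAlgebra.natCast_eq_smul, sq, IsConvAlgebra.toFun_mul, IsConvAlgebra.toFun_of,
      conv_Ttilde_one_one he hϖ hΓ, add_smul, one_smul]
    rfl
  · refine IsConvAlgebra.toFun_injective ?_
    rw [IsConvAlgebra.natCast_eq_smul, smul_one_mul, IsConvAlgebra.toFun_mul, IsConvAlgebra.toFun_of,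
      IsConvAlgebra.toFun_of, conv_Ttilde he hϖ hΓ hm]
    rfl
  · rw [Algebra.adjoin_singleton_eq_range_aeval]
    exact AlgHom.range_eq_top _ |>.2 hT.2
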